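/- Let $\alpha\colon G\to\operatorname{Aut}A$ be a (strongly) continuous action of a locally compact Hausdorff group $G$ by automorphisms of a $C^*$-algebra $A$, and let $N\subseteq H$ be closed subgroups of $G$ with $N$ normal in $G$. Fix left Haar measures on $G$, $G/N$ and $H/N$, and give product groups the product Haar measures; $\Delta$ denotes modular functions, with $\int f(sr)\,ds=\Delta(r)^{-1}\int f(s)\,ds$. Crossed products are full, $A\otimes C_0(X)$ is identified with $C_0(X,A)$, and $G/H$ with $(G/N)/(H/N)$. *The Green bimodule.* Let $\alpha\otimes\mathrm{lt}$ be the action $((\alpha\otimes\mathrm{lt})_s f)(rN)=\alpha_s(f(s^{-1}rN))$ of $G$ on $A\otimes C_0(G/N)$, let $B=(A\otimes C_0(G/N))\rtimes_{\alpha\otimes\mathrm{lt}}G$, and let $\beta$ be the action of $G/N$ on $B$ induced by the action $(\mathrm{id}\otimes\mathrm{rt})_{tN}f(rN)=f(rtN)$, which commutes with $\alpha\otimes\mathrm{lt}$. With $Q=G/N$ and $S=H/N$, the Green bimodule $X^{G/N}_{H/N}(\beta)$ is the $\big((B\otimes C_0(G/H))\rtimes_{\beta\otimes\mathrm{lt}}(G/N)\big)$–$\big(B\rtimes_{\beta|}(H/N)\big)$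 imprimitivity bimodule obtained by completing $C_c(Q,B)$ with respect to the operations $$(f\cdot x)(r)=\int_Q f(t,rS)\,\beta_t(x(t^{-1}r))\,\Delta_Q(t)^{1/2}\,dt,\qquad (x\cdot g)(r)=\int_S x(rh)\,\beta_{rh}(g(h^{-1}))\,\Delta_S(h)^{-1/2}\,dh,$$ $${}_*\langle x,y\rangle(t,rS)=\Delta_Q(t)^{-1/2}\int_S x(rh)\,\beta_t(y(t^{-1}rh)^*)\,dh,\qquad \langle x,y\rangle_*(h)=\Delta_S(h)^{-1/2}\int_Q\beta_t\big(x(t^{-1})^*y(t^{-1}h)\big)\,dt .$$ *The symmetric imprimitivity bimodule.* Let $P=G/N\times G\times G/N$, $K=G/N\times G$ and $L=H/N\times G$, with the commuting free and proper actions $$(tN,s)\cdot(rN,u,vN)=(trN,su,tvN),\qquad (rN,u,vN)\cdot(hN,y)=(ryN,uy,vhN)$$ of $K$ on the left and of $L$ on the right of $P$. Let $\sigma=\mathrm{id}\times\alpha$ be the action $\sigma_{(tN,s)}=\alpha_s$ of $K$ on $A$, and $\eta=\mathrm{id}$ the trivial action of $L$ on $A$. Then $\operatorname{Ind}_L^P\eta$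 is the $C^*$-algebra of bounded continuous $f\colon P\to A$ with $f(p\cdot l)=\eta_l^{-1}(f(p))$ for which $pL\mapsto\|f(p)\|$ vanishes at infinity on $P/L$; $K$ acts on it by $(\sigma\otimes\mathrm{lt})_kf(p)=\sigma_k(f(k^{-1}\cdot p))$. Similarly $\operatorname{Ind}_K^P\sigma$ is the $C^*$-algebra of bounded continuous $f\colon P\to A$ with $f(k\cdot p)=\sigma_k(f(p))$ for which $Kp\mapsto\|f(p)\|$ vanishes at infinity on $K\backslash P$; $L$ acts on it by $(\eta\otimes\mathrm{rt})_lf(p)=\eta_l(f(p\cdot l))$. The $(\operatorname{Ind}_L^P\eta\rtimes_{\sigma\otimes\mathrm{lt}}K)$–$(\operatorname{Ind}_K^P\sigma\rtimes_{\eta\otimes\mathrm{rt}}L)$ imprimitivity bimodule $W(P)$ is the completion of $C_c(P,A)$ with respect to the operations $$(c\cdot x)(p)=\int_K c(k,p)\,\sigma_k(x(k^{-1}\cdot p))\,\Delta_K(k)^{1/2}\,dk,\qquad (x\cdot b)(p)=\int_L\eta_l\big(x(p\cdot l)\,b(l^{-1},p\cdot l)\big)\Delta_L(l)^{-1/2}\,dl,$$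 $${}_*\langle x,y\rangle(k,p)=\Delta_K(k)^{-1/2}\int_L\eta_l\big(x(p\cdot l)\,\sigma_k(y(k^{-1}\cdot p\cdot l)^*)\big)\,dl,$$ $$\langle x,y\rangle_*(l,p)=\Delta_L(l)^{-1/2}\int_K\sigma_k\big(x(k^{-1}\cdot p)^*\,\eta_l(y(k^{-1}\cdot p\cdot l))\big)\,dk .$$ *The intermediate algebras.* Let $\gamma$ be the action $\gamma_{(hN,y)}(f)(rN)=\alpha_y(f(y^{-1}rhN))$ of $L$ on $A\otimes C_0(G/N)$, and let $\epsilon$ be the action $\epsilon_{(tN,s)}(f)(rN,uH)=\alpha_s(f(s^{-1}rtN,t^{-1}uH))$ of $K$ on $A\otimes C_0(G/N)\otimes C_0(G/H)$. **Proposition.** The identity map on $C_c(H/N\times G\times G/N,A)$ extends to an isomorphism $$i\colon B\rtimes_{\beta|}(H/N)\to(A\otimes C_0(G/N))\rtimes_\gamma L,$$ the map $\iota(g)(tN,s,rN,uH)=g(tN,uH,s,rN)$ from $C_c(G/N\times G/H\times G\times G/N,A)$ onto $C_c(G/N\times G\times G/N\times G/H,A)$ extends to an isomorphism $$\iota\colon(B\otimes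 C_0(G/H))\rtimes_{\beta\otimes\mathrm{lt}}(G/N)\to(A\otimes C_0(G/N)\otimes C_0(G/H))\rtimes_\epsilon K,$$ and the formulas $$\Gamma(f)(rN,u,vN)=f(ur^{-1}N,vH),\qquad \Upsilon(f)(rN,u,vN)=\alpha_u(f(r^{-1}vN))$$ define an $\epsilon$–$(\sigma\otimes\mathrm{lt})$ equivariant isomorphism $\Gamma\colon A\otimes C_0(G/N)\otimes C_0(G/H)\to\operatorname{Ind}_L^P\eta$ and a $\gamma$–$(\eta\otimes\mathrm{rt})$ equivariant isomorphism $\Upsilon\colon A\otimes C_0(G/N)\to\operatorname{Ind}_K^P\sigma$. Moreover the diagram of imprimitivity bimodules with horizontal arrows $X^{G/N}_{H/N}(\beta)$ and $W(P)$ and vertical isomorphisms $(\Gamma\rtimes K)\circ\iota$ and $(\Upsilon\rtimes L)\circ i$ commutes; that is, there is a linear bijection of $X^{G/N}_{H/N}(\beta)$ onto $W(P)$ which intertwines the left actions and the left inner products through $(\Gamma\rtimes K)\circ\iota$, and the right actions and the right inner products through $(\Upsilon\rtimes L)\circ i$. -/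

import Mathlib

open MeasureTheory Topology Filter Set UniformSpace
open scoped ZeroAtInfty CompactlySupported BoundedContinuousFunction NNReal Pointwise

set_option linter.unusedSectionVars false
set_option linter.style.haveILetI false

noncomputable section

namespace CrossedProd

/-! ### Actions -/

/-- A strongly continuous action of a topological group `G` by automorphisms of a C*-algebra. -/
structure CStarAction (G A : Type*) [Group G] [TopologicalSpace G] [NonUnitalCStarAlgebra A] where
  aut : G →* (A ≃⋆ₐ[ℂ] A)
  continuous_orbit : ∀ a : A, Continuous fun s => aut s a

namespace CStarAction

variable {G A : Type*} [Group G] [TopologicalSpace G] [NonUnitalCStarAlgebra A]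

instance : CoeFun (CStarAction G A) fun _ => G → (A ≃⋆ₐ[ℂ] A) := ⟨fun α => ⇑α.aut⟩

variable (α : CStarAction G A)

lemma one_apply (a : A) : α 1 a = a := by simp

lemma mul_apply (s t : G) (a : A) : α (s * t) a = α s (α t a) := by simp

lemma inv_apply_self (s : G) (a : A) : α s⁻¹ (α s a) = a := by rw [← α.mul_apply]; simp

lemma self_apply_inv (s : G) (a : A) : α s (α s⁻¹ a) = a := by rw [← α.mul_apply]; simp

lemma isometry_apply (s : G) : Isometry (α s) := StarAlgEquiv.isometry _

lemma norm_apply (s : G) (a : A) : ‖α s a‖ = ‖a‖ := StarAlgEquiv.norm_map _ _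

lemma continuous_uncurry : Continuous fun q : G × A => α q.1 q.2 := by
  rw [continuous_iff_continuousAt]
  rintro ⟨s, a⟩
  rw [ContinuousAt, tendsto_iff_norm_sub_tendsto_zero]
  have h1 : Tendsto (fun q : G × A => ‖q.2 - a‖ + ‖α q.1 a - α s a‖) (𝓝 (s, a)) (𝓝 0) := by
    have : Continuous fun q : G × A => ‖q.2 - a‖ + ‖α q.1 a - α s a‖ :=
      (continuous_snd.sub continuous_const).norm.add
        (((α.continuous_orbit a).comp continuous_fst).sub continuous_const).norm
    simpa using this.tendsto (s, a)
  refine squeeze_zero (fun _ => norm_nonneg _) (fun q => ?_) h1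
  calc ‖α q.1 q.2 - α s a‖ = ‖α q.1 (q.2 - a) + (α q.1 a - α s a)‖ := by rw [map_sub]; abel_nf
    _ ≤ _ := (norm_add_le _ _).trans (by rw [norm_apply])

lemma _root_.Continuous.cstarAction {X : Type*} [TopologicalSpace X] {f : X → G} {g : X → A}
    (hf : Continuous f) (hg : Continuous g) : Continuous fun x => α (f x) (g x) :=
  α.continuous_uncurry.comp (hf.prodMk hg)

/-- The trivial action. -/
def trivial (G A : Type*) [Group G] [TopologicalSpace G] [NonUnitalCStarAlgebra A] :
    CStarAction G A where
  aut := 1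
  continuous_orbit a := by simpa using continuous_const

/-- The action `(k, s) ↦ α_s` of a product group. -/
def ofSnd (K : Type*) [Group K] [TopologicalSpace K] (α : CStarAction G A) :
    CStarAction (K × G) A where
  aut := α.aut.comp (MonoidHom.snd K G)
  continuous_orbit a := (α.continuous_orbit a).comp continuous_snd

end CStarAction

/-- A jointly continuous left action of a topological group on a space. -/
structure SpaceAction (G X : Type*) [Group G] [TopologicalSpace G] [TopologicalSpace X] where
  toFun : G → X → X
  one_apply : ∀ x, toFun 1 x = x
  mul_apply : ∀ s t x, toFun (s * t) x = toFun s (toFun t x)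
  continuous_uncurry : Continuous fun q : G × X => toFun q.1 q.2

namespace SpaceAction

variable {G X : Type*} [Group G] [TopologicalSpace G] [TopologicalSpace X]

instance : CoeFun (SpaceAction G X) fun _ => G → X → X := ⟨SpaceAction.toFun⟩

/-- A right action `(x, t) ↦ x · t`, regarded as the left action `(t, x) ↦ x · t⁻¹`. -/
def ofRight [IsTopologicalGroup G] (r : X → G → X) (h1 : ∀ x, r x 1 = x)
    (hm : ∀ x s t, r x (s * t) = r (r x s) t) (hc : Continuous fun q : X × G => r q.1 q.2) :
    SpaceAction G X where
  toFun t x := r x t⁻¹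
  one_apply x := by simp [h1]
  mul_apply s t x := by rw [mul_inv_rev, hm]
  continuous_uncurry := hc.comp (continuous_snd.prodMk continuous_fst.inv)

variable (θ : SpaceAction G X)

lemma inv_apply_self (s : G) (x : X) : θ s⁻¹ (θ s x) = x := by
  rw [← θ.mul_apply, inv_mul_cancel, θ.one_apply]

lemma self_apply_inv (s : G) (x : X) : θ s (θ s⁻¹ x) = x := by
  rw [← θ.mul_apply, mul_inv_cancel, θ.one_apply]

lemma _root_.Continuous.spaceAction {Y : Type*} [TopologicalSpace Y] {f : Y → G} {g : Y → X}
    (hf : Continuous f) (hg : Continuous g) : Continuous fun y => θ (f y) (g y) :=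
  θ.continuous_uncurry.comp (hf.prodMk hg)

/-- The homeomorphism by which a group element acts. -/
def homeo (s : G) : X ≃ₜ X where
  toFun := θ s
  invFun := θ s⁻¹
  left_inv := θ.inv_apply_self s
  right_inv := θ.self_apply_inv s
  continuous_toFun := continuous_const.spaceAction θ continuous_id
  continuous_invFun := continuous_const.spaceAction θ continuous_id

/-- The orbit equivalence relation. -/
def orbitSetoid : Setoid X where
  r x y := ∃ s, θ s x = y
  iseqv :=
    { refl := fun x => ⟨1, θ.one_apply x⟩
      symm := by rintro x y ⟨s, rfl⟩; exact ⟨s⁻¹, θ.inv_apply_self s x⟩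
      trans := by rintro x y z ⟨s, rfl⟩ ⟨t, rfl⟩; exact ⟨t * s, θ.mul_apply t s x⟩ }

/-- The orbit space, with the quotient topology. -/
abbrev OrbitSpace : Type _ := Quotient θ.orbitSetoid

/-- The orbit map. -/
abbrev orbitMap (x : X) : θ.OrbitSpace := Quotient.mk _ x

lemma isOpenMap_orbitMap : IsOpenMap θ.orbitMap := by
  intro U hU
  rw [← isQuotientMap_quotient_mk'.isOpen_preimage]
  have : (θ.orbitMap ⁻¹' (θ.orbitMap '' U)) = ⋃ s : G, (θ.homeo s) ⁻¹' U := by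
    ext x
    simp only [mem_preimage, mem_image, mem_iUnion]
    constructor
    · rintro ⟨y, hy, hxy⟩
      obtain ⟨s, hs⟩ := Quotient.exact hxy.symm
      exact ⟨s, by simpa [homeo, hs] using hy⟩
    · rintro ⟨s, hs⟩
      exact ⟨_, hs, (Quotient.sound ⟨s, rfl⟩ : θ.orbitMap x = _).symm⟩
  exact this ▸ isOpen_iUnion fun s => hU.preimage (θ.homeo s).continuous

lemma exists_compact_lift [LocallyCompactSpace X] {C : Set θ.OrbitSpace} (hC : IsCompact C) :
    ∃ C' : Set X, IsCompact C' ∧ C ⊆ θ.orbitMap '' C' := by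
  choose k hk hkx using fun x : X => exists_compact_mem_nhds x
  obtain ⟨t, ht⟩ := hC.elim_finite_subcover (fun x : X => θ.orbitMap '' interior (k x))
    (fun x => θ.isOpenMap_orbitMap _ isOpen_interior) (by
      intro q _
      obtain ⟨x, rfl⟩ := Quotient.exists_rep q
      exact mem_iUnion.2 ⟨x, x, mem_interior_iff_mem_nhds.2 (hkx x), rfl⟩)
  refine ⟨⋃ x ∈ t, k x, t.isCompact_biUnion fun x _ => hk x, ht.trans ?_⟩
  rw [image_iUnion₂]
  exact iUnion₂_mono fun x _ => image_mono interior_subset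

end SpaceAction

/-! ### Haar measures -/

/-- A (left) Haar measure on the Borel sets of a topological group. -/
structure HaarMeasure (G : Type*) [Group G] [TopologicalSpace G] where
  measure : @Measure G (borel G)
  isHaar : @Measure.IsHaarMeasure G _ _ (borel G) measure

/-- The modular function, normalised by `∫ f(s r) ds = Δ(r)⁻¹ ∫ f(s) ds`. -/
def modular {G : Type*} [Group G] [TopologicalSpace G] [IsTopologicalGroup G]
    [LocallyCompactSpace G] (s : G) : ℝ :=
  ((Measure.modularCharacterFun s : ℝ≥0) : ℝ)⁻¹

namespace HaarMeasure

variable {G : Type*} [Group G] [TopologicalSpace G]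
variable {E : Type*} [NormedAddCommGroup E] [NormedSpace ℝ E]

/-- The (Bochner) integral against a Haar measure. -/
def int (μ : HaarMeasure G) (f : G → E) : E :=
  @integral G E _ _ (borel G) μ.measure f

lemma int_mul_left [IsTopologicalGroup G] (μ : HaarMeasure G) (f : G → E) (s : G) :
    μ.int (fun t => f (s * t)) = μ.int f := by
  let _ : MeasurableSpace G := borel G
  have _ : BorelSpace G := ⟨rfl⟩
  have := μ.isHaar
  exact integral_mul_left_eq_self f s

lemma int_congr (μ : HaarMeasure G) {f g : G → E} (h : ∀ t, f t = g t) : μ.int f = μ.int g :=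
  congrArg μ.int (funext h)

lemma integrable' (μ : HaarMeasure G) {f : G → E} (hf : Continuous f) (hc : HasCompactSupport f) :
    let _ : MeasurableSpace G := borel G
    Integrable f μ.measure := by
  let _ : MeasurableSpace G := borel G
  have _ : BorelSpace G := ⟨rfl⟩
  have := μ.isHaar
  exact hf.integrable_of_hasCompactSupport hc

lemma int_zero (μ : HaarMeasure G) : μ.int (fun _ => (0 : E)) = 0 := by
  let _ : MeasurableSpace G := borel G
  exact integral_zero _ _

lemma int_add (μ : HaarMeasure G) {f g : G → E} (hf : Continuous f) (hfc : HasCompactSupport f)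
    (hg : Continuous g) (hgc : HasCompactSupport g) :
    μ.int (fun t => f t + g t) = μ.int f + μ.int g := by
  let _ : MeasurableSpace G := borel G
  exact integral_add (μ.integrable' hf hfc) (μ.integrable' hg hgc)

lemma int_mono (μ : HaarMeasure G) {f g : G → ℝ} (hf : Continuous f) (hfc : HasCompactSupport f)
    (hg : Continuous g) (hgc : HasCompactSupport g) (h : ∀ t, f t ≤ g t) :
    μ.int f ≤ μ.int g := by
  let _ : MeasurableSpace G := borel G
  exact integral_mono (μ.integrable' hf hfc) (μ.integrable' hg hgc) h

lemma norm_int_le (μ : HaarMeasure G) (f : G → E) : ‖μ.int f‖ ≤ μ.int fun t => ‖f t‖ := by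
  let _ : MeasurableSpace G := borel G
  exact norm_integral_le_integral_norm _

lemma int_nonneg (μ : HaarMeasure G) {f : G → ℝ} (h : ∀ t, 0 ≤ f t) : 0 ≤ μ.int f := by
  let _ : MeasurableSpace G := borel G
  exact integral_nonneg h

lemma map_int {F : Type*} [NormedAddCommGroup F] [NormedSpace ℝ F] [CompleteSpace E]
    [CompleteSpace F] (μ : HaarMeasure G)
    (L : E →L[ℝ] F) {f : G → E} (hf : Continuous f) (hc : HasCompactSupport f) :
    L (μ.int f) = μ.int fun t => L (f t) := by
  let _ : MeasurableSpace G := borel G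
  exact (L.integral_comp_comm (μ.integrable' hf hc)).symm

lemma int_smul {𝕜 : Type*} [NormedField 𝕜] [NormedSpace 𝕜 E] [SMulCommClass ℝ 𝕜 E]
    (μ : HaarMeasure G) (c : 𝕜) (f : G → E) :
    μ.int (fun t => c • f t) = c • μ.int f := by
  let _ : MeasurableSpace G := borel G
  exact integral_smul c f

lemma int_swap {H : Type*} [Group H] [TopologicalSpace H]
    (μ : HaarMeasure G) (ν : HaarMeasure H) {f : G → H → E} (hf : Continuous f.uncurry)
    (hc : HasCompactSupport f.uncurry) :
    (μ.int fun s => ν.int fun t => f s t) = ν.int fun t => μ.int fun s => f s t := by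
  let _ : MeasurableSpace G := borel G
  have _ : BorelSpace G := ⟨rfl⟩
  let _ : MeasurableSpace H := borel H
  have _ : BorelSpace H := ⟨rfl⟩
  have := μ.isHaar
  have := ν.isHaar
  exact integral_integral_swap_of_hasCompactSupport hf hc

lemma continuous_int {X : Type*} [TopologicalSpace X] (μ : HaarMeasure G)
    {f : X → G → E} (hf : Continuous f.uncurry)
    (hs : ∀ x₀ : X, ∃ U ∈ 𝓝 x₀, ∃ k : Set G, IsCompact k ∧ ∀ x ∈ U, ∀ t ∉ k, f x t = 0) :
    Continuous fun x => μ.int (f x) := by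
  let _ : MeasurableSpace G := borel G
  have _ : BorelSpace G := ⟨rfl⟩
  have := μ.isHaar
  rw [continuous_iff_continuousAt]
  intro x₀
  obtain ⟨U, hU, k, hk, h⟩ := hs x₀
  have := continuousOn_integral_of_compact_support (μ := μ.measure) (f := f) (s := U) hk
    hf.continuousOn (fun p x hp hx => h p hp x hx)
  exact this.continuousAt hU

end HaarMeasure

section Modular

variable {G : Type*} [Group G] [TopologicalSpace G] [IsTopologicalGroup G] [LocallyCompactSpace G]

lemma modular_pos (s : G) : 0 < modular s :=
  inv_pos.2 (NNReal.coe_pos.2 (Measure.modularCharacterFun_pos s))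

lemma modular_mul (s t : G) : modular (s * t) = modular s * modular t := by
  simp [modular, Measure.modularCharacterFun_map_mul, mul_comm]

lemma modular_one : modular (1 : G) = 1 := by
  simp [modular, Measure.modularCharacterFun_map_one]

lemma modular_inv (s : G) : modular s⁻¹ = (modular s)⁻¹ := by
  refine eq_inv_of_mul_eq_one_left ?_
  rw [← modular_mul, inv_mul_cancel, modular_one]

lemma continuous_modular : Continuous (modular : G → ℝ) := by
  borelize G
  obtain ⟨⟨f, f_cont⟩, f_comp, f_nonneg, f_one⟩ :
    ∃ f : C(G, ℝ), HasCompactSupport f ∧ 0 ≤ f ∧ f 1 ≠ 0 := exists_continuous_nonneg_pos 1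
  let ν := MeasureTheory.Measure.haar (G := G)
  have hne : ∫ x, f x ∂ν ≠ 0 :=
    ne_of_gt (f_cont.integral_pos_of_hasCompactSupport_nonneg_nonzero f_comp f_nonneg f_one)
  have key : ∀ g : G, (Measure.modularCharacterFun g : ℝ) = (∫ x, f (x * g) ∂ν) / ∫ x, f x ∂ν := by
    intro g
    rw [Measure.modularCharacterFun_eq_haarScalarFactor ν g,
      Measure.haarScalarFactor_eq_integral_div _ _ f_cont f_comp hne,
      integral_map (AEMeasurable.mul_const aemeasurable_id' _)
        (Continuous.aestronglyMeasurable f_cont)]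
  have hc : Continuous fun g : G => (Measure.modularCharacterFun g : ℝ) := by
    simp_rw [key]
    refine Continuous.div_const ?_ _
    rw [continuous_iff_continuousAt]
    intro g₀
    obtain ⟨t, t_comp, ht⟩ := exists_compact_mem_nhds g₀
    have := continuousOn_integral_of_compact_support (μ := ν) (f := fun g x => f (x * g)) (s := t)
      (k := (tsupport f) * t⁻¹) (f_comp.mul t_comp.inv)
      (by exact (f_cont.comp (continuous_snd.mul continuous_fst)).continuousOn) (by
        intro g x hg hx
        by_contra h
        exact hx ⟨x * g, subset_tsupport _ h, g⁻¹, by simpa using hg, by simp⟩)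
    exact this.continuousAt ht
  exact hc.inv₀ fun g => (NNReal.coe_pos.2 (Measure.modularCharacterFun_pos g)).ne'

end Modular

section ProductHaar

variable {G H : Type*} [Group G] [TopologicalSpace G] [IsTopologicalGroup G]
  [LocallyCompactSpace G] [T2Space G] [Group H] [TopologicalSpace H] [IsTopologicalGroup H]
  [LocallyCompactSpace H] [T2Space H]

lemma hasCompactSupport_slice {E : Type*} [Zero E] {f : G × H → E}
    (hf : HasCompactSupport f) (s : G) : HasCompactSupport fun t => f (s, t) := by
  refine HasCompactSupport.intro (hf.image continuous_snd) fun t ht => ?_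
  by_contra h
  exact ht ⟨(s, t), subset_tsupport _ h, rfl⟩

lemma continuous_slice_int {E : Type*} [NormedAddCommGroup E] [NormedSpace ℝ E]
    (ν : HaarMeasure H) {f : G × H → E} (hf : Continuous f) (hc : HasCompactSupport f) :
    Continuous fun s => ν.int fun t => f (s, t) := by
  refine ν.continuous_int (f := fun s t => f (s, t)) hf fun s₀ => ⟨univ, univ_mem, _,
    hc.image continuous_snd, fun s _ t ht => ?_⟩
  by_contra h
  exact ht ⟨(s, t), subset_tsupport _ h, rfl⟩

lemma hasCompactSupport_slice_int {E : Type*} [NormedAddCommGroup E] [NormedSpace ℝ E]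
    (ν : HaarMeasure H) {f : G × H → E} (hc : HasCompactSupport f) :
    HasCompactSupport fun s => ν.int fun t => f (s, t) := by
  refine HasCompactSupport.intro (hc.image continuous_fst) fun s hs => ?_
  rw [← ν.int_zero]
  refine ν.int_congr fun t => ?_
  by_contra h
  exact hs ⟨(s, t), subset_tsupport _ h, rfl⟩

/-- The positive functional `f ↦ ∫∫ f(s, t) dt ds` on `C_c(G × H)`. -/
def iteratedIntegral (μ : HaarMeasure G) (ν : HaarMeasure H) : C_c(G × H, ℝ) →ₚ[ℝ] ℝ :=
  PositiveLinearMap.mk₀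
    { toFun := fun f => μ.int fun s => ν.int fun t => f (s, t)
      map_add' := fun f g => by
        rw [← μ.int_add (continuous_slice_int ν (map_continuous f) f.hasCompactSupport)
          (hasCompactSupport_slice_int ν f.hasCompactSupport)
          (continuous_slice_int ν (map_continuous g) g.hasCompactSupport)
          (hasCompactSupport_slice_int ν g.hasCompactSupport)]
        refine μ.int_congr fun s => ?_
        exact ν.int_add ((map_continuous f).comp (Continuous.prodMk_right s))
          (hasCompactSupport_slice f.hasCompactSupport s)
          ((map_continuous g).comp (Continuous.prodMk_right s))
          (hasCompactSupport_slice g.hasCompactSupport s)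
      map_smul' := fun c f => by
        simp only [CompactlySupportedContinuousMap.smul_apply, RingHom.id_apply]
        rw [← μ.int_smul]
        exact μ.int_congr fun s => ν.int_smul c _ }
    fun f hf => μ.int_nonneg fun s => ν.int_nonneg fun t => hf (s, t)

/-- The product of two Haar measures: the Radon measure on `G × H` which represents the iterated
integral on `C_c(G × H)`. -/
def HaarMeasure.prod (μ : HaarMeasure G) (ν : HaarMeasure H) : HaarMeasure (G × H) where
  measure :=
    letI : MeasurableSpace (G × H) := borel (G × H)
    haveI : BorelSpace (G × H) := ⟨rfl⟩
    RealRMK.rieszMeasure (iteratedIntegral μ ν)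
  isHaar := by
    let mGH : MeasurableSpace (G × H) := borel (G × H)
    have bGH : BorelSpace (G × H) := ⟨rfl⟩
    let Λ := iteratedIntegral μ ν
    let m := RealRMK.rieszMeasure Λ
    have hm : ∀ f : C_c(G × H, ℝ), ∫ x, f x ∂m = μ.int fun s => ν.int fun t => f (s, t) :=
      RealRMK.integral_rieszMeasure Λ
    have hinv : m.IsMulLeftInvariant := by
      refine ⟨fun g => ?_⟩
      have : (Measure.map (fun x => g * x) m).Regular :=
        Measure.Regular.map (μ := m) (Homeomorph.mulLeft g)
      refine Measure.ext_of_integral_eq_on_compactlySupported fun f => ?_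
      rw [integral_map (by fun_prop) (map_continuous f).aestronglyMeasurable, hm]
      let f' : C_c(G × H, ℝ) := ⟨⟨fun x => f (g * x), by fun_prop⟩,
        f.hasCompactSupport.comp_homeomorph (Homeomorph.mulLeft g)⟩
      refine (hm f').trans ?_
      refine Eq.trans (μ.int_congr fun s => ?_)
        (μ.int_mul_left (fun s => ν.int fun t => f (s, t)) g.1)
      exact ν.int_mul_left (fun t => f (g.1 * s, t)) g.2
    have hne : m ≠ 0 := by
      intro h0
      obtain ⟨⟨f, f_cont⟩, f_comp, f_nonneg, f_one⟩ :
        ∃ f : C(G × H, ℝ), HasCompactSupport f ∧ 0 ≤ f ∧ f 1 ≠ 0 := exists_continuous_nonneg_pos 1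
      have h1 := hm ⟨⟨f, f_cont⟩, f_comp⟩
      rw [h0, integral_zero_measure] at h1
      let mG : MeasurableSpace G := borel G
      have bG : BorelSpace G := ⟨rfl⟩
      let mH : MeasurableSpace H := borel H
      have bH : BorelSpace H := ⟨rfl⟩
      have := μ.isHaar
      have := ν.isHaar
      have h2 : 0 < ν.int fun t => f (1, t) :=
        (f_cont.comp (Continuous.prodMk_right 1)).integral_pos_of_hasCompactSupport_nonneg_nonzero
          (hasCompactSupport_slice f_comp 1) (fun t => f_nonneg (1, t)) (x := (1 : H)) f_one
      have h3 : 0 < μ.int fun s => ν.int fun t => f (s, t) :=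
        (continuous_slice_int ν f_cont f_comp).integral_pos_of_hasCompactSupport_nonneg_nonzero
          (hasCompactSupport_slice_int ν f_comp)
          (fun s => ν.int_nonneg fun t => f_nonneg (s, t)) (x := (1 : G)) h2.ne'
      exact h3.ne h1
    have hopen : m.IsOpenPosMeasure := have := NeZero.mk hne; isOpenPosMeasure_of_mulLeftInvariant_of_regular
    exact { }

end ProductHaar

/-! ### Completions of pre-C*-algebras -/

/-- A complex *-algebra with a C*-seminorm. -/
class PreCStarAlgebra (𝒜 : Type*) extends NonUnitalSeminormedRing 𝒜, StarRing 𝒜,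
    NormedSpace ℂ 𝒜, IsScalarTower ℂ 𝒜 𝒜, SMulCommClass ℂ 𝒜 𝒜, StarModule ℂ 𝒜 where
  norm_mul_self_le : ∀ x : 𝒜, ‖x‖ * ‖x‖ ≤ ‖star x * x‖

namespace PreCStarAlgebra

variable (𝒜 : Type*) [PreCStarAlgebra 𝒜]

lemma norm_star_le (x : 𝒜) : ‖star x‖ ≤ ‖x‖ := by
  by_cases hx : ‖star x‖ = 0
  · rw [hx]; exact norm_nonneg _
  · have hpos : 0 < ‖star x‖ := lt_of_le_of_ne (norm_nonneg _) (Ne.symm hx)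
    have h := (norm_mul_self_le (star x)).trans (norm_mul_le _ _)
    rw [star_star] at h
    exact le_of_mul_le_mul_right h hpos

instance : NormedStarGroup 𝒜 := ⟨norm_star_le 𝒜⟩

instance : Mul (Completion 𝒜) :=
  ⟨fun x y => (Completion.isDenseInducing_coe.prodMap Completion.isDenseInducing_coe).extend
    (fun p : 𝒜 × 𝒜 => ((p.1 * p.2 : 𝒜) : Completion 𝒜)) (x, y)⟩

instance : Star (Completion 𝒜) := ⟨Completion.map star⟩

lemma coe_mul (a b : 𝒜) : ((a * b : 𝒜) : Completion 𝒜) = a * b :=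
  ((Completion.isDenseInducing_coe.prodMap Completion.isDenseInducing_coe).extend_eq
    ((Completion.continuous_coe 𝒜).comp (@continuous_mul 𝒜 _ _ _)) (a, b)).symm

lemma coe_star (a : 𝒜) : ((star a : 𝒜) : Completion 𝒜) = star (a : Completion 𝒜) :=
  (Completion.map_coe star_isometry.uniformContinuous a).symm

instance : ContinuousMul (Completion 𝒜) where
  continuous_mul := by
    let m := (AddMonoidHom.mul : 𝒜 →+ 𝒜 →+ 𝒜).compr₂ Completion.toCompl
    have : Continuous fun p : 𝒜 × 𝒜 => m p.1 p.2 := (Completion.continuous_coe 𝒜).comp continuous_mul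
    have di : IsDenseInducing (Completion.toCompl : 𝒜 → Completion 𝒜) :=
      Completion.isDenseInducing_coe
    exact (di.extend_Z_bilin di this :)

instance : ContinuousStar (Completion 𝒜) where
  continuous_star := Completion.continuous_map

instance : NonUnitalNormedRing (Completion 𝒜) where
  __ : NormedAddCommGroup (Completion 𝒜) := inferInstance
  zero_mul a := Completion.induction_on a (isClosed_eq (by fun_prop) continuous_const)
    fun a => by rw [← Completion.coe_zero, ← coe_mul, zero_mul]
  mul_zero a := Completion.induction_on a (isClosed_eq (by fun_prop) continuous_const)
    fun a => by rw [← Completion.coe_zero, ← coe_mul, mul_zero]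
  mul_assoc a b c := Completion.induction_on₃ a b c (isClosed_eq (by fun_prop) (by fun_prop))
    fun a b c => by rw [← coe_mul, ← coe_mul, ← coe_mul, ← coe_mul, mul_assoc]
  left_distrib a b c := Completion.induction_on₃ a b c (isClosed_eq (by fun_prop) (by fun_prop))
    fun a b c => by
      rw [← Completion.coe_add, ← coe_mul, ← coe_mul, ← coe_mul, ← Completion.coe_add, mul_add]
  right_distrib a b c := Completion.induction_on₃ a b c (isClosed_eq (by fun_prop) (by fun_prop))
    fun a b c => by
      rw [← Completion.coe_add, ← coe_mul, ← coe_mul, ← coe_mul, ← Completion.coe_add, add_mul]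
  norm_mul_le a b := Completion.induction_on₂ a b (isClosed_le (by fun_prop) (by fun_prop))
    fun a b => by simpa only [← coe_mul, Completion.norm_coe] using norm_mul_le a b

instance : StarRing (Completion 𝒜) where
  star_involutive a := Completion.induction_on a (isClosed_eq (by fun_prop) continuous_id)
    fun a => by rw [← coe_star, ← coe_star, star_star]
  star_mul a b := Completion.induction_on₂ a b (isClosed_eq (by fun_prop) (by fun_prop))
    fun a b => by rw [← coe_mul, ← coe_star, ← coe_star, ← coe_star, star_mul, coe_mul]
  star_add a b := Completion.induction_on₂ a b (isClosed_eq (by fun_prop) (by fun_prop))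
    fun a b => by
      rw [← Completion.coe_add, ← coe_star, ← coe_star, ← coe_star, star_add, Completion.coe_add]

instance : CStarRing (Completion 𝒜) where
  norm_mul_self_le a := Completion.induction_on a (isClosed_le (by fun_prop) (by fun_prop))
    fun a => by simpa only [← coe_mul, ← coe_star, Completion.norm_coe] using norm_mul_self_le a

lemma continuous_smul_completion (c : ℂ) : Continuous fun x : Completion 𝒜 => c • x :=
  (uniformContinuous_const_smul (X := Completion 𝒜) c).continuous

instance : IsScalarTower ℂ (Completion 𝒜) (Completion 𝒜) where
  smul_assoc c a b := by
    have hc := continuous_smul_completion 𝒜 c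
    simp only [smul_eq_mul]
    induction a, b using Completion.induction_on₂ with
    | hp => exact isClosed_eq ((hc.comp continuous_fst).mul continuous_snd)
              (hc.comp (continuous_fst.mul continuous_snd))
    | ih a b =>
      rw [← Completion.coe_smul, ← coe_mul, ← coe_mul, ← Completion.coe_smul, smul_mul_assoc]

instance : SMulCommClass ℂ (Completion 𝒜) (Completion 𝒜) where
  smul_comm c a b := by
    have hc := continuous_smul_completion 𝒜 c
    simp only [smul_eq_mul]
    induction a, b using Completion.induction_on₂ with
    | hp => exact isClosed_eq (hc.comp (continuous_fst.mul continuous_snd))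
              (continuous_fst.mul (hc.comp continuous_snd))
    | ih a b =>
      rw [← Completion.coe_smul, ← coe_mul, ← coe_mul, ← Completion.coe_smul, mul_smul_comm]

instance : StarModule ℂ (Completion 𝒜) where
  star_smul c a := by
    induction a using Completion.induction_on with
    | hp => exact isClosed_eq (continuous_smul_completion 𝒜 c).star
              ((continuous_smul_completion 𝒜 (star c)).comp continuous_star)
    | ih a =>
      rw [← Completion.coe_smul, ← coe_star, ← coe_star, ← Completion.coe_smul, star_smul]

instance : NonUnitalCStarAlgebra (Completion 𝒜) where

end PreCStarAlgebra

/-! ### Full crossed products -/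

lemma HaarMeasure.map_int_add {G E F : Type*} [Group G] [TopologicalSpace G]
    [NormedAddCommGroup E] [NormedSpace ℝ E] [CompleteSpace E]
    [NormedAddCommGroup F] [NormedSpace ℝ F] [CompleteSpace F] (μ : HaarMeasure G)
    (L : E →+ F) (hL : Continuous L) {f : G → E} (hf : Continuous f) (hc : HasCompactSupport f) :
    L (μ.int f) = μ.int fun t => L (f t) :=
  μ.map_int (L.toRealLinearMap hL) hf hc

section ConvAlg

variable {G A : Type*} [Group G] [TopologicalSpace G] [IsTopologicalGroup G]
  [LocallyCompactSpace G] [T2Space G] [NonUnitalCStarAlgebra A]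

lemma HaarMeasure.act_int (μ : HaarMeasure G) {K : Type*} [Group K] [TopologicalSpace K]
    (α : CStarAction K A) (s : K) {f : G → A} (hf : Continuous f) (hc : HasCompactSupport f) :
    α s (μ.int f) = μ.int fun t => α s (f t) :=
  μ.map_int_add (AddMonoidHomClass.toAddMonoidHom (α s)) (α.isometry_apply s).continuous hf hc

lemma HaarMeasure.mul_int (μ : HaarMeasure G) (a : A) {f : G → A} (hf : Continuous f)
    (hc : HasCompactSupport f) : a * μ.int f = μ.int fun t => a * f t :=
  μ.map_int_add (AddMonoidHom.mulLeft a) (continuous_const.mul continuous_id) hf hc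

lemma HaarMeasure.int_mul (μ : HaarMeasure G) (a : A) {f : G → A} (hf : Continuous f)
    (hc : HasCompactSupport f) : μ.int f * a = μ.int fun t => f t * a :=
  μ.map_int_add (AddMonoidHom.mulRight a) (continuous_id.mul continuous_const) hf hc

lemma HaarMeasure.star_int (μ : HaarMeasure G) {f : G → A} (hf : Continuous f)
    (hc : HasCompactSupport f) : star (μ.int f) = μ.int fun t => star (f t) :=
  μ.map_int_add (starAddEquiv : A ≃+ A).toAddMonoidHom continuous_star hf hc

/-- The space `C_c(G, A)`, regarded as the convolution *-algebra of the system `(A, G, α)`. -/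
def ConvAlg (_α : CStarAction G A) (_μ : HaarMeasure G) : Type _ := C_c(G, A)

namespace ConvAlg

variable {α : CStarAction G A} {μ : HaarMeasure G}

instance : AddCommGroup (ConvAlg α μ) := inferInstanceAs (AddCommGroup C_c(G, A))
instance : Module ℂ (ConvAlg α μ) := inferInstanceAs (Module ℂ C_c(G, A))
instance : FunLike (ConvAlg α μ) G A := inferInstanceAs (FunLike C_c(G, A) G A)

@[ext] lemma ext {f g : ConvAlg α μ} (h : ∀ s, f s = g s) : f = g := DFunLike.ext _ _ h

lemma add_apply (f g : ConvAlg α μ) (s : G) : (f + g) s = f s + g s := rfl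
lemma zero_apply (s : G) : (0 : ConvAlg α μ) s = 0 := rfl
lemma smul_apply (c : ℂ) (f : ConvAlg α μ) (s : G) : (c • f) s = c • f s := rfl

lemma continuous (f : ConvAlg α μ) : Continuous f := map_continuous (F := C_c(G, A)) f
lemma hasCompactSupport (f : ConvAlg α μ) : HasCompactSupport f :=
  CompactlySupportedContinuousMap.hasCompactSupport (f : C_c(G, A))

lemma eq_zero (f : ConvAlg α μ) {s : G} (h : s ∉ tsupport f) : f s = 0 :=
  image_eq_zero_of_notMem_tsupport h

lemma continuous_convIntegrand (f g : ConvAlg α μ) :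
    Continuous fun q : G × G => f q.2 * α q.2 (g (q.2⁻¹ * q.1)) := by
  have hf := f.continuous
  have hg := g.continuous
  exact (hf.comp continuous_snd).mul
    (continuous_snd.cstarAction α (hg.comp (continuous_snd.inv.mul continuous_fst)))

lemma continuous_convIntegrand' (f g : ConvAlg α μ) (s : G) :
    Continuous fun t => f t * α t (g (t⁻¹ * s)) :=
  (continuous_convIntegrand f g).comp (Continuous.prodMk_right s)

lemma hasCompactSupport_convIntegrand (f g : ConvAlg α μ) (s : G) :
    HasCompactSupport fun t => f t * α t (g (t⁻¹ * s)) :=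
  f.hasCompactSupport.mul_right

/-- Convolution: `(f * g)(s) = ∫ f(t) α_t(g(t⁻¹ s)) dt`. -/
instance : Mul (ConvAlg α μ) where
  mul f g :=
    { toFun := fun s => μ.int fun t => f t * α t (g (t⁻¹ * s))
      continuous_toFun := by
        refine μ.continuous_int (f := fun s t => f t * α t (g (t⁻¹ * s)))
          (continuous_convIntegrand f g) fun s₀ => ⟨univ, univ_mem, tsupport f,
            f.hasCompactSupport, fun s _ t ht => ?_⟩
        rw [f.eq_zero ht, zero_mul]
      hasCompactSupport' := by
        refine HasCompactSupport.intro
          (IsCompact.mul f.hasCompactSupport g.hasCompactSupport) fun s hs => ?_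
        rw [← μ.int_zero]
        refine μ.int_congr fun t => ?_
        by_cases ht : t ∈ tsupport f
        · rw [g.eq_zero, map_zero, mul_zero]
          exact fun h => hs ⟨t, ht, t⁻¹ * s, h, by simp⟩
        · rw [f.eq_zero ht, zero_mul] }

lemma mul_apply (f g : ConvAlg α μ) (s : G) :
    (f * g) s = μ.int fun t => f t * α t (g (t⁻¹ * s)) := rfl

/-- Involution: `f*(s) = Δ(s)⁻¹ α_s(f(s⁻¹)*)`. -/
instance : Star (ConvAlg α μ) where
  star f :=
    { toFun := fun s => ((modular s)⁻¹ : ℝ) • α s (star (f s⁻¹))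
      continuous_toFun :=
        (continuous_modular.inv₀ fun s => (modular_pos s).ne').smul
          (continuous_id.cstarAction α (f.continuous.comp continuous_inv).star)
      hasCompactSupport' := by
        refine HasCompactSupport.intro (IsCompact.inv f.hasCompactSupport) fun s hs => ?_
        rw [f.eq_zero fun h => hs (by simpa using h), star_zero, map_zero, smul_zero] }

lemma star_apply (f : ConvAlg α μ) (s : G) :
    (star f) s = ((modular s)⁻¹ : ℝ) • α s (star (f s⁻¹)) := rfl

lemma act_smul {K : Type*} [Group K] [TopologicalSpace K] (α : CStarAction K A) (s : K) (c : ℝ)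
    (a : A) : α s (c • a) = c • α s a := by
  rw [← Complex.coe_smul, ← Complex.coe_smul, map_smul]

lemma mul_assoc' (f g h : ConvAlg α μ) : f * g * h = f * (g * h) := by
  ext s
  have hf := f.continuous
  have hg := g.continuous
  have hh := h.continuous
  let F : G → G → A := fun r t => f r * α r (g (r⁻¹ * t)) * α t (h (t⁻¹ * s))
  have hF : Continuous F.uncurry := by
    refine Continuous.mul (Continuous.mul (hf.comp continuous_fst) ?_) ?_
    · exact continuous_fst.cstarAction α (hg.comp (continuous_fst.inv.mul continuous_snd))
    · exact continuous_snd.cstarAction α (hh.comp (continuous_snd.inv.mul continuous_const))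
  have hFc : HasCompactSupport F.uncurry := by
    refine HasCompactSupport.intro (IsCompact.prod f.hasCompactSupport
      (IsCompact.mul f.hasCompactSupport g.hasCompactSupport)) ?_
    rintro ⟨r, t⟩ hrt
    change f r * α r (g (r⁻¹ * t)) * α t (h (t⁻¹ * s)) = 0
    by_cases hr : r ∈ tsupport f
    · rw [g.eq_zero, map_zero, mul_zero, zero_mul]
      exact fun h' => hrt ⟨hr, r, hr, r⁻¹ * t, h', by simp⟩
    · rw [f.eq_zero hr, zero_mul, zero_mul]
  have h1 : (f * g * h) s = μ.int fun t => μ.int fun r => F r t := by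
    rw [mul_apply]
    refine μ.int_congr fun t => ?_
    rw [mul_apply, μ.int_mul _ (continuous_convIntegrand' f g t)
      (hasCompactSupport_convIntegrand f g t)]
  have h2 : (f * (g * h)) s = μ.int fun r => μ.int fun t => F r t := by
    rw [mul_apply]
    refine μ.int_congr fun r => ?_
    rw [mul_apply]
    have c1 : Continuous fun t => g t * α t (h (t⁻¹ * (r⁻¹ * s))) :=
      (continuous_convIntegrand g h).comp (Continuous.prodMk_right _)
    have c2 := hasCompactSupport_convIntegrand g h (r⁻¹ * s)
    rw [μ.act_int α r c1 c2, μ.mul_int _ ((continuous_const (y := r)).cstarAction α c1)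
      (c2.comp_left (g := α r) (map_zero _)), ← μ.int_mul_left _ r⁻¹]
    refine μ.int_congr fun t => ?_
    simp only [F]
    rw [map_mul (α r), ← α.mul_apply, mul_assoc, mul_inv_cancel_left, mul_inv_rev, inv_inv,
      mul_assoc, mul_inv_cancel_left]
  rw [h1, h2, μ.int_swap μ hF hFc]

lemma mul_add' (f g h : ConvAlg α μ) : f * (g + h) = f * g + f * h := by
  ext s
  rw [add_apply, mul_apply, mul_apply, mul_apply, ← μ.int_add
    (continuous_convIntegrand' f g s)
    (hasCompactSupport_convIntegrand f g s)
    (continuous_convIntegrand' f h s)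
    (hasCompactSupport_convIntegrand f h s)]
  exact μ.int_congr fun t => by rw [add_apply, map_add, mul_add]

lemma add_mul' (f g h : ConvAlg α μ) : (f + g) * h = f * h + g * h := by
  ext s
  rw [add_apply, mul_apply, mul_apply, mul_apply, ← μ.int_add
    (continuous_convIntegrand' f h s)
    (hasCompactSupport_convIntegrand f h s)
    (continuous_convIntegrand' g h s)
    (hasCompactSupport_convIntegrand g h s)]
  exact μ.int_congr fun t => by rw [add_apply, add_mul]

lemma star_mul' (f g : ConvAlg α μ) : star (f * g) = star g * star f := by
  ext s
  rw [star_apply, mul_apply, mul_apply]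
  have c1 : Continuous fun t => f t * α t (g (t⁻¹ * s⁻¹)) :=
    (continuous_convIntegrand f g).comp (Continuous.prodMk_right _)
  have c2 := hasCompactSupport_convIntegrand f g s⁻¹
  rw [μ.star_int c1 c2, μ.act_int α s c1.star (c2.comp_left (g := star) (star_zero _)),
    ← μ.int_smul, ← μ.int_mul_left _ s⁻¹]
  refine μ.int_congr fun t => ?_
  rw [star_apply, star_apply, act_smul, smul_mul_smul_comm, ← α.mul_apply]
  have e1 : (modular s)⁻¹ = (modular t)⁻¹ * (modular (t⁻¹ * s))⁻¹ := by
    rw [← mul_inv, ← modular_mul]; simp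
  rw [e1]
  congr 1
  rw [star_mul, map_mul, ← map_star, ← α.mul_apply]
  simp

instance : NonUnitalRing (ConvAlg α μ) where
  __ : AddCommGroup (ConvAlg α μ) := inferInstance
  mul_assoc := mul_assoc'
  left_distrib := mul_add'
  right_distrib := add_mul'
  zero_mul f := by
    ext s
    rw [mul_apply, zero_apply, ← μ.int_zero]
    exact μ.int_congr fun t => by rw [zero_apply, zero_mul]
  mul_zero f := by
    ext s
    rw [mul_apply, zero_apply, ← μ.int_zero]
    exact μ.int_congr fun t => by rw [zero_apply, map_zero, mul_zero]

instance : StarRing (ConvAlg α μ) where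
  star_involutive f := by
    ext s
    rw [star_apply, star_apply, modular_inv, ← act_smul, inv_inv]
    simp only [star_smul, inv_inv, star_trivial, act_smul]
    rw [← map_star, star_star, α.self_apply_inv, smul_smul, inv_mul_cancel₀ (modular_pos s).ne',
      one_smul]
  star_mul := star_mul'
  star_add f g := by
    ext s
    simp only [star_apply, add_apply, star_add, map_add, smul_add]

instance : IsScalarTower ℂ (ConvAlg α μ) (ConvAlg α μ) where
  smul_assoc c f g := by
    ext s
    rw [smul_eq_mul, smul_eq_mul, smul_apply, mul_apply, mul_apply, ← μ.int_smul]
    exact μ.int_congr fun t => by rw [smul_apply, smul_mul_assoc]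

instance : SMulCommClass ℂ (ConvAlg α μ) (ConvAlg α μ) where
  smul_comm c f g := by
    ext s
    rw [smul_eq_mul, smul_eq_mul, smul_apply, mul_apply, mul_apply, ← μ.int_smul]
    exact μ.int_congr fun t => by rw [smul_apply, map_smul, mul_smul_comm]

instance : StarModule ℂ (ConvAlg α μ) where
  star_smul c f := by
    ext s
    simp only [star_apply, smul_apply, star_smul, map_smul]
    rw [smul_comm]

/-- The `L¹`-norm. -/
def l1Norm (f : ConvAlg α μ) : ℝ := μ.int fun t => ‖f t‖

/-- The C*-seminorms on `C_c(G, A)` which are dominated by the `L¹`-norm. -/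
def cstarSeminorms (α : CStarAction G A) (μ : HaarMeasure G) : Set (Seminorm ℂ (ConvAlg α μ)) :=
  {q | (∀ f, q f ≤ l1Norm f) ∧ (∀ f g, q (f * g) ≤ q f * q g) ∧ ∀ f, q (star f * f) = q f ^ 2}

/-- The universal norm of the full crossed product: the largest C*-seminorm on `C_c(G, A)` which
is dominated by the `L¹`-norm. -/
def universalNorm (α : CStarAction G A) (μ : HaarMeasure G) : Seminorm ℂ (ConvAlg α μ) :=
  sSup (cstarSeminorms α μ)

lemma bddAbove_cstarSeminorms : BddAbove (cstarSeminorms α μ) := by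
  rw [Seminorm.bddAbove_iff]
  refine ⟨fun f => l1Norm f, ?_⟩
  rintro _ ⟨q, hq, rfl⟩
  exact hq.1

lemma bot_mem_cstarSeminorms : (⊥ : Seminorm ℂ (ConvAlg α μ)) ∈ cstarSeminorms α μ := by
  refine ⟨fun f => ?_, fun f g => ?_, fun f => ?_⟩
  · exact μ.int_nonneg fun t => norm_nonneg _
  · simp
  · simp

instance : Nonempty (cstarSeminorms α μ) := ⟨⟨_, bot_mem_cstarSeminorms⟩⟩

lemma le_universalNorm {q : Seminorm ℂ (ConvAlg α μ)} (hq : q ∈ cstarSeminorms α μ)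
    (f : ConvAlg α μ) : q f ≤ universalNorm α μ f :=
  le_csSup bddAbove_cstarSeminorms hq f

lemma universalNorm_le {f : ConvAlg α μ} {C : ℝ}
    (h : ∀ q ∈ cstarSeminorms α μ, q f ≤ C) : universalNorm α μ f ≤ C := by
  rw [universalNorm, Seminorm.sSup_apply bddAbove_cstarSeminorms]
  exact ciSup_le fun q => h q.1 q.2

lemma universalNorm_le_l1Norm (f : ConvAlg α μ) : universalNorm α μ f ≤ l1Norm f :=
  universalNorm_le fun _ hq => hq.1 f

instance : NonUnitalSeminormedRing (ConvAlg α μ) where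
  __ : NonUnitalRing (ConvAlg α μ) := inferInstance
  __ := (universalNorm α μ).toAddGroupSeminorm.toSeminormedAddCommGroup
  norm_mul_le f g := universalNorm_le fun _ hq => (hq.2.1 f g).trans
    (mul_le_mul (le_universalNorm hq f) (le_universalNorm hq g) (apply_nonneg _ _)
      (apply_nonneg _ _))

lemma norm_def (f : ConvAlg α μ) : ‖f‖ = universalNorm α μ f := rfl

instance : NormedSpace ℂ (ConvAlg α μ) where
  norm_smul_le c f := (map_smul_eq_mul (universalNorm α μ) c f).le

instance : PreCStarAlgebra (ConvAlg α μ) where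
  norm_mul_self_le f := by
    rw [← sq, ← Real.le_sqrt (norm_nonneg _) (norm_nonneg _)]
    refine universalNorm_le fun q hq => Real.le_sqrt_of_sq_le ?_
    rw [← hq.2.2 f]
    exact le_universalNorm hq _

end ConvAlg

/-- The full crossed product `A ⋊_α G`. -/
def CrossedProduct (α : CStarAction G A) (μ : HaarMeasure G) : Type _ :=
  Completion (ConvAlg α μ)

namespace CrossedProduct

variable {α : CStarAction G A} {μ : HaarMeasure G}

instance : NonUnitalCStarAlgebra (CrossedProduct α μ) :=
  inferInstanceAs (NonUnitalCStarAlgebra (Completion (ConvAlg α μ)))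

/-- The canonical map `C_c(G, A) → A ⋊_α G`. -/
def of (f : ConvAlg α μ) : CrossedProduct α μ := (f : Completion (ConvAlg α μ))

lemma isDenseInducing_of : IsDenseInducing (of : ConvAlg α μ → CrossedProduct α μ) :=
  Completion.isDenseInducing_coe

end CrossedProduct

end ConvAlg

/-! ### Functoriality of crossed products -/

section Functoriality

variable {G A B : Type*} [Group G] [TopologicalSpace G] [IsTopologicalGroup G]
  [LocallyCompactSpace G] [T2Space G] [NonUnitalCStarAlgebra A] [NonUnitalCStarAlgebra B]

/-- `φ` intertwines the actions `α` and `β`. -/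
def Equivariant (φ : A ≃⋆ₐ[ℂ] B) (α : CStarAction G A) (β : CStarAction G B) : Prop :=
  ∀ s a, φ (α s a) = β s (φ a)

lemma Equivariant.symm {φ : A ≃⋆ₐ[ℂ] B} {α : CStarAction G A} {β : CStarAction G B}
    (h : Equivariant φ α β) : Equivariant φ.symm β α := fun s b => by
  refine EquivLike.injective φ ?_
  rw [h, φ.apply_symm_apply, φ.apply_symm_apply]

variable {α : CStarAction G A} {β : CStarAction G B} {μ : HaarMeasure G}

namespace ConvAlg

/-- The map `f ↦ φ ∘ f` of convolution algebras. -/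
def map (φ : A ≃⋆ₐ[ℂ] B) (f : ConvAlg α μ) : ConvAlg β μ :=
  CompactlySupportedContinuousMap.mk
    ⟨fun s => φ (f s), (StarAlgEquiv.isometry φ).continuous.comp f.continuous⟩
    (f.hasCompactSupport.comp_left (g := φ) (map_zero φ))

lemma map_apply (φ : A ≃⋆ₐ[ℂ] B) (f : ConvAlg α μ) (s : G) :
    (map φ f : ConvAlg β μ) s = φ (f s) := rfl

lemma map_conv_mul {φ : A ≃⋆ₐ[ℂ] B} (h : Equivariant φ α β) (f g : ConvAlg α μ) :
    (map φ (f * g) : ConvAlg β μ) = map φ f * map φ g := by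
  ext s
  rw [map_apply, mul_apply, mul_apply]
  refine (μ.map_int_add (AddMonoidHomClass.toAddMonoidHom φ) (StarAlgEquiv.isometry φ).continuous
    (continuous_convIntegrand' f g s) (hasCompactSupport_convIntegrand f g s)).trans ?_
  refine μ.int_congr fun t => ?_
  change φ (f t * α t (g (t⁻¹ * s))) = _
  rw [map_mul, h, map_apply, map_apply]

lemma map_conv_star {φ : A ≃⋆ₐ[ℂ] B} (h : Equivariant φ α β) (f : ConvAlg α μ) :
    (map φ (star f) : ConvAlg β μ) = star (map φ f) := by
  ext s
  rw [map_apply, star_apply, star_apply, map_apply, ← Complex.coe_smul, ← Complex.coe_smul,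
    map_smul, h, map_star]

/-- `map` as a linear map. -/
def mapₗ (φ : A ≃⋆ₐ[ℂ] B) : ConvAlg α μ →ₗ[ℂ] ConvAlg β μ where
  toFun := map φ
  map_add' f g := by ext s; simp only [map_apply, add_apply, map_add]
  map_smul' c f := by ext s; simp only [map_apply, smul_apply, map_smul, RingHom.id_apply]

lemma norm_map_le {φ : A ≃⋆ₐ[ℂ] B} (h : Equivariant φ α β) (f : ConvAlg α μ) :
    ‖(map φ f : ConvAlg β μ)‖ ≤ ‖f‖ := by
  refine universalNorm_le fun q hq => ?_
  refine le_universalNorm (q := q.comp (mapₗ φ)) ⟨fun f => ?_, fun f g => ?_, fun f => ?_⟩ f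
  · refine (hq.1 _).trans_eq (μ.int_congr fun t => ?_)
    exact StarAlgEquiv.norm_map φ (f t)
  · change q (map φ (f * g)) ≤ q (map φ f) * q (map φ g)
    rw [map_conv_mul h]
    exact hq.2.1 _ _
  · change q (map φ (star f * f)) = q (map φ f) ^ 2
    rw [map_conv_mul h, map_conv_star h]
    exact hq.2.2 _

lemma uniformContinuous_map {φ : A ≃⋆ₐ[ℂ] B} (h : Equivariant φ α β) :
    UniformContinuous (map φ : ConvAlg α μ → ConvAlg β μ) :=
  (AddMonoidHomClass.lipschitz_of_bound (mapₗ φ : ConvAlg α μ →ₗ[ℂ] ConvAlg β μ) 1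
    fun f => (norm_map_le h f).trans_eq (one_mul _).symm).uniformContinuous

end ConvAlg

namespace CrossedProduct

lemma of_mul (f g : ConvAlg α μ) : of (f * g) = of f * of g := PreCStarAlgebra.coe_mul _ f g
lemma of_star (f : ConvAlg α μ) : of (star f) = star (of f) := PreCStarAlgebra.coe_star _ f
lemma of_add (f g : ConvAlg α μ) : of (f + g) = of f + of g := Completion.coe_add f g
lemma of_sub (f g : ConvAlg α μ) : of (f - g) = of f - of g := Completion.coe_sub f g
lemma of_smul (c : ℂ) (f : ConvAlg α μ) : of (c • f) = c • of f := Completion.coe_smul c f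
lemma norm_of (f : ConvAlg α μ) : ‖of f‖ = ‖f‖ := Completion.norm_coe f
lemma denseRange_of : DenseRange (of : ConvAlg α μ → CrossedProduct α μ) :=
  isDenseInducing_of.dense
lemma continuous_of : Continuous (of : ConvAlg α μ → CrossedProduct α μ) :=
  isDenseInducing_of.continuous

/-- The extension of `ConvAlg.map` to the crossed products. -/
def mapFun (φ : A ≃⋆ₐ[ℂ] B) : CrossedProduct α μ → CrossedProduct β μ :=
  Completion.map (ConvAlg.map φ)

lemma continuous_mapFun (φ : A ≃⋆ₐ[ℂ] B) :
    Continuous (mapFun φ : CrossedProduct α μ → CrossedProduct β μ) := Completion.continuous_map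

lemma mapFun_of {φ : A ≃⋆ₐ[ℂ] B} (h : Equivariant φ α β) (f : ConvAlg α μ) :
    (mapFun φ (of f) : CrossedProduct β μ) = of (ConvAlg.map φ f) :=
  Completion.map_coe (ConvAlg.uniformContinuous_map h) f

lemma mapFun_mapFun {C : Type*} [NonUnitalCStarAlgebra C] {γ : CStarAction G C} {φ : A ≃⋆ₐ[ℂ] B}
    {ψ : B ≃⋆ₐ[ℂ] C} (h : Equivariant φ α β) (h' : Equivariant ψ β γ)
    (x : CrossedProduct α μ) :
    (mapFun ψ (mapFun φ x : CrossedProduct β μ) : CrossedProduct γ μ) =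
      mapFun (φ.trans ψ) x := by
  have h'' : Equivariant (φ.trans ψ) α γ := fun s a => by
    change ψ (φ (α s a)) = γ s (ψ (φ a))
    rw [h, h']
  refine denseRange_of.induction_on x (isClosed_eq
    ((continuous_mapFun _).comp (continuous_mapFun _)) (continuous_mapFun _)) fun f => ?_
  rw [mapFun_of h, mapFun_of h', mapFun_of h'']
  rfl

lemma mapFun_eq_self {φ : A ≃⋆ₐ[ℂ] A} (h : ∀ a, φ a = a) (x : CrossedProduct α μ) :
    (mapFun φ x : CrossedProduct α μ) = x := by
  have h' : Equivariant φ α α := fun s a => by rw [h, h]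
  refine denseRange_of.induction_on x (isClosed_eq (continuous_mapFun _) continuous_id) fun f => ?_
  rw [mapFun_of h']
  congr 1
  ext s
  exact h _

/-- The isomorphism `φ ⋊ G` of crossed products induced by an equivariant isomorphism `φ`; on
`C_c(G, A)` it is `f ↦ φ ∘ f`. -/
def mapEquiv (φ : A ≃⋆ₐ[ℂ] B) (h : Equivariant φ α β) :
    CrossedProduct α μ ≃⋆ₐ[ℂ] CrossedProduct β μ where
  toFun := mapFun φ
  invFun := mapFun φ.symm
  left_inv x := by
    rw [mapFun_mapFun h h.symm, mapFun_eq_self fun a => φ.symm_apply_apply a]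
  right_inv x := by
    rw [mapFun_mapFun h.symm h, mapFun_eq_self fun a => φ.apply_symm_apply a]
  map_mul' x y := by
    refine denseRange_of.induction_on₂ (isClosed_eq
      ((continuous_mapFun φ).comp (continuous_fst.mul continuous_snd))
      (((continuous_mapFun φ).comp continuous_fst).mul
        ((continuous_mapFun φ).comp continuous_snd))) (fun f g => ?_) x y
    rw [← of_mul, mapFun_of h, mapFun_of h, mapFun_of h, ConvAlg.map_conv_mul h, of_mul]
  map_add' x y := by
    refine denseRange_of.induction_on₂ (isClosed_eq
      ((continuous_mapFun φ).comp (continuous_fst.add continuous_snd))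
      (((continuous_mapFun φ).comp continuous_fst).add
        ((continuous_mapFun φ).comp continuous_snd))) (fun f g => ?_) x y
    rw [← of_add, mapFun_of h, mapFun_of h, mapFun_of h, ← of_add]
    exact congrArg of ((ConvAlg.mapₗ φ).map_add f g)
  map_star' x := by
    refine denseRange_of.induction_on x (isClosed_eq
      ((continuous_mapFun φ).comp continuous_star) (continuous_mapFun φ).star) fun f => ?_
    rw [← of_star, mapFun_of h, mapFun_of h, ConvAlg.map_conv_star h, of_star]
  map_smul' c x := by
    refine denseRange_of.induction_on x (isClosed_eq
      ((continuous_mapFun φ).comp (continuous_const_smul c))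
      ((continuous_mapFun φ).const_smul c)) fun f => ?_
    rw [← of_smul, mapFun_of h, mapFun_of h, ← of_smul]
    exact congrArg of ((ConvAlg.mapₗ φ).map_smul c f)

lemma mapEquiv_of (φ : A ≃⋆ₐ[ℂ] B) (h : Equivariant φ α β) (f : ConvAlg α μ) :
    mapEquiv φ h (of f) = of (ConvAlg.map φ f) := mapFun_of h f

end CrossedProduct

/-- The action on `A ⋊_α G` of a group `Q` which is induced by an action of `Q` on `A` commuting
with `α`. -/
def crossedAction {Q : Type*} [Group Q] [TopologicalSpace Q] (α : CStarAction G A)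
    (μ : HaarMeasure G) (ε : CStarAction Q A) (h : ∀ q, Equivariant (ε q) α α) :
    CStarAction Q (CrossedProduct α μ) where
  aut :=
    { toFun := fun q => CrossedProduct.mapEquiv (ε q) (h q)
      map_one' := StarAlgEquiv.ext fun x => CrossedProduct.mapFun_eq_self (fun a => by simp) x
      map_mul' := fun q r => StarAlgEquiv.ext fun x => by
        refine Eq.trans ?_ (CrossedProduct.mapFun_mapFun (h r) (h q) x).symm
        exact congrArg (fun φ => CrossedProduct.mapFun φ x) (ε.aut.map_mul q r) }
  continuous_orbit x := by
    have key : ∀ f : ConvAlg α μ, Continuous fun q =>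
        CrossedProduct.mapEquiv (ε q) (h q) (CrossedProduct.of f) := by
      intro f
      have hl : ∀ q₀ : Q, Continuous fun q => μ.int fun t => ‖ε q (f t) - ε q₀ (f t)‖ := by
        intro q₀
        refine μ.continuous_int (f := fun q t => ‖ε q (f t) - ε q₀ (f t)‖) ?_
          fun q => ⟨univ, univ_mem, tsupport f, f.hasCompactSupport, fun q _ t ht => ?_⟩
        · exact ((continuous_fst.cstarAction ε (f.continuous.comp continuous_snd)).sub
            (continuous_const.cstarAction ε (f.continuous.comp continuous_snd))).norm
        · simp [f.eq_zero ht]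
      rw [continuous_iff_continuousAt]
      intro q₀
      rw [ContinuousAt, tendsto_iff_norm_sub_tendsto_zero]
      refine squeeze_zero (fun _ => norm_nonneg _) (fun q => ?_)
        (g := fun q => μ.int fun t => ‖ε q (f t) - ε q₀ (f t)‖) ?_
      · rw [CrossedProduct.mapEquiv_of, CrossedProduct.mapEquiv_of, ← CrossedProduct.of_sub,
          CrossedProduct.norm_of]
        exact ConvAlg.universalNorm_le_l1Norm _
      · have h0 := (hl q₀).tendsto q₀
        simpa [μ.int_zero] using h0
    have hunif : ∀ q, Isometry (CrossedProduct.mapEquiv (μ := μ) (ε q) (h q)) :=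
      fun q => StarAlgEquiv.isometry _
    change Continuous fun q => CrossedProduct.mapEquiv (ε q) (h q) x
    rw [continuous_iff_continuousAt]
    intro q₀
    refine Metric.tendsto_nhds.2 fun e he => ?_
    obtain ⟨f, hf⟩ := CrossedProduct.denseRange_of.exists_dist_lt x (show 0 < e / 3 by linarith)
    filter_upwards [Metric.tendsto_nhds.1 ((key f).tendsto q₀) (e / 3) (by linarith)] with q hq
    have h1 := dist_triangle4 (CrossedProduct.mapEquiv (ε q) (h q) x)
      (CrossedProduct.mapEquiv (ε q) (h q) (CrossedProduct.of f))
      (CrossedProduct.mapEquiv (ε q₀) (h q₀) (CrossedProduct.of f))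
      (CrossedProduct.mapEquiv (ε q₀) (h q₀) x)
    rw [(hunif q).dist_eq, (hunif q₀).dist_eq, dist_comm (CrossedProduct.of f) x] at h1
    linarith

end Functoriality

/-! ### Function algebras and induced algebras -/

section FunctionAlgebras

/-- A criterion for uniform convergence `F s → F s₀`, where values outside a compact set are
uniformly small or repeat, up to isometry, values on the compact set. -/
lemma eventually_norm_sub_le {S P A : Type*} [TopologicalSpace S] [TopologicalSpace P]
    [NormedAddCommGroup A] {F : S → P → A} (hF : Continuous F.uncurry) {s₀ : S} {e : ℝ}
    (he : 0 < e) {V : Set S} (hV : V ∈ 𝓝 s₀) {C : Set P} (hC : IsCompact C)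
    (h : ∀ s ∈ V, ∀ p, (∃ p' ∈ C, ‖F s p - F s₀ p‖ = ‖F s p' - F s₀ p'‖) ∨
      (‖F s p‖ ≤ e / 2 ∧ ‖F s₀ p‖ ≤ e / 2)) :
    ∀ᶠ s in 𝓝 s₀, ∀ p, ‖F s p - F s₀ p‖ ≤ e := by
  have h1 : ∀ᶠ s in 𝓝 s₀, ∀ p ∈ C, ‖F s p - F s₀ p‖ < e := by
    refine hC.eventually_forall_of_forall_eventually fun p _ => ?_
    have hc : Continuous fun q : S × P => ‖F q.1 q.2 - F s₀ q.2‖ :=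
      (hF.sub (hF.comp (continuous_const.prodMk continuous_snd))).norm
    exact (hc.tendsto (s₀, p)).eventually_lt_const (by simpa using he)
  filter_upwards [h1, hV] with s hs hsV p
  rcases h s hsV p with ⟨p', hp', hpp⟩ | ⟨ha, hb⟩
  · exact hpp ▸ (hs p' hp').le
  · exact (norm_sub_le _ _).trans (by linarith)

section C0

variable {G X A : Type*} [Group G] [TopologicalSpace G] [IsTopologicalGroup G]
  [LocallyCompactSpace G] [TopologicalSpace X] [NonUnitalCStarAlgebra A]

/-- The function `x ↦ α_s(f(s⁻¹ · x))`. -/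
def c0Translate (α : CStarAction G A) (θ : SpaceAction G X) (s : G) (f : C₀(X, A)) : C₀(X, A) where
  toFun x := α s (f (θ s⁻¹ x))
  continuous_toFun := (α.isometry_apply s).continuous.comp
    (f.continuous.comp (θ.homeo s⁻¹).continuous)
  zero_at_infty' := by
    have h1 : Tendsto (fun x => f (θ.homeo s⁻¹ x)) (cocompact X) (𝓝 0) :=
      f.zero_at_infty'.comp (θ.homeo s⁻¹).isClosedEmbedding.tendsto_cocompact
    have h2 := ((α.isometry_apply s).continuous.tendsto 0).comp h1
    rw [map_zero] at h2
    exact h2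

/-- The diagonal action `α ⊗ lt` on `A ⊗ C₀(X) = C₀(X, A)`: `(s · f)(x) = α_s(f(s⁻¹ · x))`. -/
def c0Action (α : CStarAction G A) (θ : SpaceAction G X) : CStarAction G C₀(X, A) where
  aut :=
    { toFun := fun s =>
        { toFun := c0Translate α θ s
          invFun := c0Translate α θ s⁻¹
          left_inv := fun f => by
            ext x
            change α s⁻¹ (α s (f (θ s⁻¹ (θ s⁻¹⁻¹ x)))) = f x
            rw [α.inv_apply_self, θ.self_apply_inv]
          right_inv := fun f => by
            ext x
            change α s (α s⁻¹ (f (θ s⁻¹⁻¹ (θ s⁻¹ x)))) = f x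
            rw [α.self_apply_inv, θ.inv_apply_self]
          map_mul' := fun f g => ZeroAtInftyContinuousMap.ext fun x => map_mul (α s) _ _
          map_add' := fun f g => ZeroAtInftyContinuousMap.ext fun x => map_add (α s) _ _
          map_star' := fun f => ZeroAtInftyContinuousMap.ext fun x => map_star (α s) _
          map_smul' := fun c f => ZeroAtInftyContinuousMap.ext fun x => map_smul (α s) c _ }
      map_one' := StarAlgEquiv.ext fun f => ZeroAtInftyContinuousMap.ext fun x => by
        change α 1 (f (θ 1⁻¹ x)) = f x
        rw [inv_one, θ.one_apply, α.one_apply]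
      map_mul' := fun s t => StarAlgEquiv.ext fun f => ZeroAtInftyContinuousMap.ext fun x => by
        change α (s * t) (f (θ (s * t)⁻¹ x)) = α s (α t (f (θ t⁻¹ (θ s⁻¹ x))))
        rw [mul_inv_rev, θ.mul_apply, α.mul_apply] }
  continuous_orbit f := by
    change Continuous fun s => c0Translate α θ s f
    rw [continuous_iff_continuousAt]
    intro s₀
    refine Metric.tendsto_nhds.2 fun e he => ?_
    obtain ⟨V, hV, hVs⟩ := exists_compact_mem_nhds s₀
    obtain ⟨C, hC, hfC⟩ : ∃ C : Set X, IsCompact C ∧ ∀ x ∉ C, ‖f x‖ ≤ e / 4 := by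
      have := (tendsto_zero_iff_norm_tendsto_zero.1 f.zero_at_infty').eventually_le_const
        (show 0 < e / 4 by linarith)
      obtain ⟨C, hC, h⟩ := mem_cocompact.1 this
      exact ⟨C, hC, fun x hx => h hx⟩
    have hsmall : ∀ s ∈ V, ∀ x ∉ (fun q : G × X => θ q.1 q.2) '' (V ×ˢ C),
        ‖α s (f (θ s⁻¹ x))‖ ≤ e / 2 / 2 := by
      intro s hs x hx
      rw [α.norm_apply]
      refine (hfC _ fun hm => hx ⟨(s, θ s⁻¹ x), ⟨hs, hm⟩, θ.self_apply_inv s x⟩).trans ?_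
      linarith
    have key := eventually_norm_sub_le (F := fun s x => α s (f (θ s⁻¹ x))) (s₀ := s₀) (e := e / 2)
      (continuous_fst.cstarAction α (f.continuous.comp
        (continuous_fst.inv.spaceAction θ continuous_snd))) (by linarith) hVs
      ((hV.prod hC).image θ.continuous_uncurry) (fun s hs x => by
        by_cases hx : x ∈ (fun q : G × X => θ q.1 q.2) '' (V ×ˢ C)
        · exact Or.inl ⟨x, hx, rfl⟩
        · exact Or.inr ⟨hsmall s hs x hx, hsmall s₀ (mem_of_mem_nhds hVs) x hx⟩)
    filter_upwards [key] with s hs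
    rw [← ZeroAtInftyContinuousMap.dist_toBCF_eq_dist]
    refine lt_of_le_of_lt ((BoundedContinuousFunction.dist_le (by linarith)).2 fun x => ?_)
      (show e / 2 < e by linarith)
    rw [dist_eq_norm]
    exact hs x

lemma c0Action_apply (α : CStarAction G A) (θ : SpaceAction G X) (s : G) (f : C₀(X, A)) (x : X) :
    c0Action α θ s f x = α s (f (θ s⁻¹ x)) := rfl

/-- The element of `C_c(S, C₀(X, A))` given by a continuous function of two variables with compact
support. -/
def c0Cc {S : Type*} [TopologicalSpace S] [T2Space S] (F : S → X → A)
    (hF : Continuous F.uncurry) (CS : Set S) (hS : IsCompact CS) (CX : Set X) (hX : IsCompact CX)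
    (h : ∀ s x, F s x ≠ 0 → s ∈ CS ∧ x ∈ CX) : C_c(S, C₀(X, A)) where
  toFun s :=
    { toFun := F s
      continuous_toFun := hF.comp (Continuous.prodMk_right s)
      zero_at_infty' := by
        refine tendsto_const_nhds.congr' (mem_cocompact.2 ⟨CX, hX, fun x hx => ?_⟩)
        by_contra hne
        exact hx (h s x (Ne.symm hne)).2 }
  continuous_toFun := by
    rw [continuous_iff_continuousAt]
    intro s₀
    refine Metric.tendsto_nhds.2 fun e he => ?_
    have key := eventually_norm_sub_le (F := F) (s₀ := s₀) (e := e / 2) hF (by linarith) univ_mem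
      hX (fun s _ x => by
        by_cases hx : x ∈ CX
        · exact Or.inl ⟨x, hx, rfl⟩
        · have h0 : ∀ s, F s x = 0 := fun s => by
            by_contra hne
            exact hx (h s x hne).2
          exact Or.inr ⟨by rw [h0, norm_zero]; linarith, by rw [h0, norm_zero]; linarith⟩)
    filter_upwards [key] with s hs
    rw [← ZeroAtInftyContinuousMap.dist_toBCF_eq_dist]
    refine lt_of_le_of_lt ((BoundedContinuousFunction.dist_le (by linarith)).2 fun x => ?_)
      (show e / 2 < e by linarith)
    rw [dist_eq_norm]
    exact hs x
  hasCompactSupport' := by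
    refine HasCompactSupport.intro hS fun s hs => ZeroAtInftyContinuousMap.ext fun x => ?_
    by_contra hne
    exact hs (h s x hne).1

end C0

section Ind

variable {L P A : Type*} [Group L] [TopologicalSpace L] [IsTopologicalGroup L]
  [TopologicalSpace P] [NonUnitalCStarAlgebra A]

/-- The induced algebra of a left action `ρ` of `L` on `P` and an action `η` of `L` on `A`: the
bounded continuous `f : P → A` with `f(t · p) = η_t(f(p))` such that the function
`L · p ↦ ‖f(p)‖` vanishes at infinity on the orbit space. For the left action
`t · p = p t⁻¹` coming from a right action, the condition reads `f(p t) = η_t⁻¹(f(p))`. -/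
def Ind (ρ : SpaceAction L P) (η : CStarAction L A) : NonUnitalStarSubalgebra ℂ (P →ᵇ A) where
  carrier := {f | (∀ t p, f (ρ t p) = η t (f p)) ∧
    Tendsto (fun p => ‖f p‖) (comap ρ.orbitMap (cocompact ρ.OrbitSpace)) (𝓝 0)}
  add_mem' := by
    rintro f g ⟨hf, hf'⟩ ⟨hg, hg'⟩
    refine ⟨fun t p => by simp [hf, hg], ?_⟩
    refine squeeze_zero (fun _ => norm_nonneg _) (fun p => norm_add_le _ _) ?_
    simpa using hf'.add hg'
  zero_mem' := ⟨fun t p => by simp, by simpa using tendsto_const_nhds⟩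
  mul_mem' := by
    rintro f g ⟨hf, hf'⟩ ⟨hg, hg'⟩
    refine ⟨fun t p => by simp [hf, hg], ?_⟩
    refine squeeze_zero (fun _ => norm_nonneg _) (fun p => norm_mul_le _ _) ?_
    simpa using hf'.mul hg'
  smul_mem' := by
    rintro c f ⟨hf, hf'⟩
    refine ⟨fun t p => by simp [hf], ?_⟩
    simpa [norm_smul] using hf'.const_mul ‖c‖
  star_mem' := by
    rintro f ⟨hf, hf'⟩
    exact ⟨fun t p => by simp [hf, map_star], by simpa using hf'⟩

variable {ρ : SpaceAction L P} {η : CStarAction L A}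

instance : FunLike (Ind ρ η) P A where
  coe f := f.1
  coe_injective _ _ h := Subtype.ext (DFunLike.coe_injective h)

lemma Ind.equivariant (f : Ind ρ η) (t : L) (p : P) : f (ρ t p) = η t (f p) := f.2.1 t p

lemma Ind.continuous (f : Ind ρ η) : Continuous f := f.1.continuous

lemma Ind.ext' {f g : Ind ρ η} (h : ∀ p, f p = g p) : f = g := DFunLike.ext _ _ h

lemma Ind.dist_le' {f g : Ind ρ η} {e : ℝ} (he : 0 ≤ e) (h : ∀ p, ‖f p - g p‖ ≤ e) :
    dist f g ≤ e :=
  (BoundedContinuousFunction.dist_le he).2 fun p => by rw [dist_eq_norm]; exact h p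

instance : IsClosed (Ind ρ η : Set (P →ᵇ A)) := by
  have heval : ∀ p : P, Continuous fun f : P →ᵇ A => f p :=
    fun p => (BoundedContinuousFunction.lipschitz_eval_const p).continuous
  refine isClosed_of_closure_subset fun f hf => ⟨fun t p => ?_, ?_⟩
  · have hcl : IsClosed {g : P →ᵇ A | g (ρ t p) = η t (g p)} :=
      isClosed_eq (heval _) ((η.isometry_apply t).continuous.comp (heval p))
    exact closure_minimal (fun g hg => hg.1 t p) hcl hf
  · refine Metric.tendsto_nhds.2 fun e he => ?_
    obtain ⟨g, hg, hfg⟩ := Metric.mem_closure_iff.1 hf (e / 2) (by linarith)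
    filter_upwards [Metric.tendsto_nhds.1 hg.2 (e / 2) (by linarith)] with p hp
    have h1 := (BoundedContinuousFunction.dist_coe_le_dist (f := f) (g := g) p).trans_lt hfg
    rw [dist_eq_norm] at h1
    have h2 := norm_sub_norm_le (f p) (g p)
    simp only [dist_zero_right, norm_norm] at hp ⊢
    linarith

variable [LocallyCompactSpace P]

lemma ind_vanish_iff (f : P → A) :
    Tendsto (fun p => ‖f p‖) (comap ρ.orbitMap (cocompact ρ.OrbitSpace)) (𝓝 0) ↔
      ∀ e > 0, ∃ C : Set P, IsCompact C ∧ ∀ p, e ≤ ‖f p‖ → ∃ t, ρ t p ∈ C := by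
  rw [Metric.tendsto_nhds]
  refine forall₂_congr fun e he => ?_
  simp only [dist_zero_right, norm_norm]
  rw [Filter.eventually_comap]
  constructor
  · intro h
    obtain ⟨D, hD, hD'⟩ := mem_cocompact.1 h
    obtain ⟨C, hC, hDC⟩ := ρ.exists_compact_lift hD
    refine ⟨C, hC, fun p hp => ?_⟩
    have hpD : ρ.orbitMap p ∈ D := by
      by_contra hn
      exact (not_lt.2 hp) (hD' hn p rfl)
    obtain ⟨c, hc, hcp⟩ := hDC hpD
    obtain ⟨t, ht⟩ := Quotient.exact hcp.symm
    exact ⟨t, ht ▸ hc⟩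
  · rintro ⟨C, hC, h⟩
    refine mem_cocompact.2 ⟨ρ.orbitMap '' C, hC.image continuous_quotient_mk', ?_⟩
    rintro _ hq p rfl
    by_contra hn
    obtain ⟨t, ht⟩ := h p (not_lt.1 hn)
    exact hq ⟨_, ht, (Quotient.sound ⟨t, rfl⟩ : ρ.orbitMap p = _).symm⟩

section Action

variable {K : Type*} [Group K] [TopologicalSpace K] [IsTopologicalGroup K] [LocallyCompactSpace K]
variable (σ : CStarAction K A) (κ : SpaceAction K P)
  (hP : ∀ k t p, κ k (ρ t p) = ρ t (κ k p)) (hA : ∀ k t a, σ k (η t a) = η t (σ k a))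

/-- The function `p ↦ σ_k(f(k⁻¹ · p))`. -/
def indTranslate (k : K) (f : Ind ρ η) : Ind ρ η :=
  ⟨BoundedContinuousFunction.mkOfBound
      ⟨fun p => σ k (f (κ k⁻¹ p)), (σ.isometry_apply k).continuous.comp
        ((Ind.continuous f).comp (κ.homeo k⁻¹).continuous)⟩ (2 * ‖f.1‖) (fun p q => by
          change dist (σ k (f (κ k⁻¹ p))) (σ k (f (κ k⁻¹ q))) ≤ _
          rw [(σ.isometry_apply k).dist_eq]
          exact f.1.dist_le_two_norm _ _),
    fun t p => by
      change σ k (f (κ k⁻¹ (ρ t p))) = η t (σ k (f (κ k⁻¹ p)))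
      rw [hP, Ind.equivariant f, hA], by
      refine (ind_vanish_iff _).2 fun e he => ?_
      obtain ⟨C, hC, h⟩ := (ind_vanish_iff _).1 f.2.2 e he
      refine ⟨κ.homeo k '' C, hC.image (κ.homeo k).continuous, fun p hp => ?_⟩
      have hp' : e ≤ ‖σ k (f (κ k⁻¹ p))‖ := hp
      rw [σ.norm_apply] at hp'
      obtain ⟨t, ht⟩ := h _ hp'
      refine ⟨t, _, ht, ?_⟩
      change κ k (ρ t (κ k⁻¹ p)) = ρ t p
      rw [hP, κ.self_apply_inv]⟩

/-- The diagonal action `σ ⊗ lt` of `K` on an induced algebra: `(k · f)(p) = σ_k(f(k⁻¹ · p))`. -/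
def indAction : CStarAction K (Ind ρ η) where
  aut :=
    { toFun := fun k =>
        { toFun := indTranslate σ κ hP hA k
          invFun := indTranslate σ κ hP hA k⁻¹
          left_inv := fun f => Ind.ext' fun p => by
            change σ k⁻¹ (σ k (f (κ k⁻¹ (κ k⁻¹⁻¹ p)))) = f p
            rw [σ.inv_apply_self, κ.self_apply_inv]
          right_inv := fun f => Ind.ext' fun p => by
            change σ k (σ k⁻¹ (f (κ k⁻¹⁻¹ (κ k⁻¹ p)))) = f p
            rw [σ.self_apply_inv, κ.inv_apply_self]
          map_mul' := fun f g => Ind.ext' fun p => map_mul (σ k) _ _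
          map_add' := fun f g => Ind.ext' fun p => map_add (σ k) _ _
          map_star' := fun f => Ind.ext' fun p => map_star (σ k) _
          map_smul' := fun c f => Ind.ext' fun p => map_smul (σ k) c _ }
      map_one' := StarAlgEquiv.ext fun f => Ind.ext' fun p => by
        change σ 1 (f (κ 1⁻¹ p)) = f p
        rw [inv_one, κ.one_apply, σ.one_apply]
      map_mul' := fun k l => StarAlgEquiv.ext fun f => Ind.ext' fun p => by
        change σ (k * l) (f (κ (k * l)⁻¹ p)) = σ k (σ l (f (κ l⁻¹ (κ k⁻¹ p))))
        rw [mul_inv_rev, κ.mul_apply, σ.mul_apply] }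
  continuous_orbit f := by
    change Continuous fun k => indTranslate σ κ hP hA k f
    rw [continuous_iff_continuousAt]
    intro k₀
    refine Metric.tendsto_nhds.2 fun e he => ?_
    obtain ⟨V, hV, hVk⟩ := exists_compact_mem_nhds k₀
    obtain ⟨C, hC, hfC⟩ := (ind_vanish_iff _).1 f.2.2 (e / 4) (by linarith)
    let D : Set P := (fun q : K × P => κ q.1 q.2) '' (V ×ˢ C)
    have hsmall : ∀ k ∈ V, ∀ p, (∀ t, ρ t p ∉ D) → ‖σ k (f (κ k⁻¹ p))‖ ≤ e / 2 / 2 := by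
      intro k hk p hp
      rw [σ.norm_apply]
      by_contra hn
      obtain ⟨t, ht⟩ := hfC (κ k⁻¹ p) (by
        have : e / 2 / 2 < ‖f (κ k⁻¹ p)‖ := not_le.1 hn
        change e / 4 ≤ ‖f (κ k⁻¹ p)‖
        linarith)
      refine hp t ⟨(k, ρ t (κ k⁻¹ p)), ⟨hk, ht⟩, ?_⟩
      change κ k (ρ t (κ k⁻¹ p)) = ρ t p
      rw [hP, κ.self_apply_inv]
    have key := eventually_norm_sub_le (F := fun k p => σ k (f (κ k⁻¹ p))) (s₀ := k₀) (e := e / 2)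
      (continuous_fst.cstarAction σ ((Ind.continuous f).comp
        (continuous_fst.inv.spaceAction κ continuous_snd))) (by linarith) hVk
      ((hV.prod hC).image κ.continuous_uncurry) (fun k hk p => by
        by_cases hp : ∃ t, ρ t p ∈ D
        · obtain ⟨t, ht⟩ := hp
          refine Or.inl ⟨ρ t p, ht, ?_⟩
          rw [hP, hP, Ind.equivariant f, Ind.equivariant f, hA, hA, ← map_sub, η.norm_apply]
        · push Not at hp
          exact Or.inr ⟨hsmall k hk p hp, hsmall k₀ (mem_of_mem_nhds hVk) p hp⟩)
    filter_upwards [key] with k hk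
    exact lt_of_le_of_lt (Ind.dist_le' (by linarith) hk) (show e / 2 < e by linarith)

lemma indAction_apply (k : K) (f : Ind ρ η) (p : P) :
    indAction σ κ hP hA k f p = σ k (f (κ k⁻¹ p)) := rfl

end Action

/-- The element of `C_c(S, Ind ρ η)` given by a continuous function of two variables which is
equivariant in the second one and supported in a set that is compact modulo the action. -/
def indCc {S : Type*} [TopologicalSpace S] [T2Space S] (F : S → P → A)
    (hF : Continuous F.uncurry) (hη : ∀ s t p, F s (ρ t p) = η t (F s p))
    (CS : Set S) (hS : IsCompact CS) (CP : Set P) (hCP : IsCompact CP)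
    (h : ∀ s p, F s p ≠ 0 → s ∈ CS ∧ ∃ t, ρ t p ∈ CP) : C_c(S, Ind ρ η) where
  toFun s :=
    ⟨BoundedContinuousFunction.ofNormedAddCommGroup (F s) (hF.comp (Continuous.prodMk_right s))
        (max 0 (Classical.choose (hCP.exists_bound_of_continuousOn
          (hF.comp (Continuous.prodMk_right s)).continuousOn))) (fun p => by
        by_cases h0 : F s p = 0
        · rw [h0, norm_zero]; exact le_max_left _ _
        · obtain ⟨t, ht⟩ := (h s p h0).2
          have := Classical.choose_spec (hCP.exists_bound_of_continuousOn
            (hF.comp (Continuous.prodMk_right s)).continuousOn) _ ht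
          refine le_trans ?_ (this.trans (le_max_right _ _))
          change _ ≤ ‖F s (ρ t p)‖
          rw [hη, η.norm_apply]),
      hη s, by
      refine (ind_vanish_iff _).2 fun e he => ⟨CP, hCP, fun p hp => (h s p fun h0 => ?_).2⟩
      have hp' : e ≤ ‖F s p‖ := hp
      rw [h0, norm_zero] at hp'
      linarith⟩
  continuous_toFun := by
    rw [continuous_iff_continuousAt]
    intro s₀
    refine Metric.tendsto_nhds.2 fun e he => ?_
    have key := eventually_norm_sub_le (F := F) (s₀ := s₀) (e := e / 2) hF (by linarith) univ_mem
      hCP (fun s _ p => by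
        by_cases hp : ∃ t, ρ t p ∈ CP
        · obtain ⟨t, ht⟩ := hp
          refine Or.inl ⟨ρ t p, ht, ?_⟩
          rw [hη, hη, ← map_sub, η.norm_apply]
        · have h0 : ∀ s, F s p = 0 := fun s => by
            by_contra hne
            exact hp (h s p hne).2
          exact Or.inr ⟨by rw [h0, norm_zero]; linarith, by rw [h0, norm_zero]; linarith⟩)
    filter_upwards [key] with s hs
    exact lt_of_le_of_lt (Ind.dist_le' (by linarith) hs) (show e / 2 < e by linarith)
  hasCompactSupport' := by
    refine HasCompactSupport.intro hS fun s hs => Ind.ext' fun p => ?_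
    by_contra hne
    exact hs (h s p hne).1

end Ind

end FunctionAlgebras

/-! ### Bimodules over crossed products, as completions of spaces of functions -/

section Bimodules

variable {K L D E V : Type*} [Group K] [TopologicalSpace K] [IsTopologicalGroup K]
  [LocallyCompactSpace K] [T2Space K] [Group L] [TopologicalSpace L] [IsTopologicalGroup L]
  [LocallyCompactSpace L] [T2Space L] [NonUnitalCStarAlgebra D] [NonUnitalCStarAlgebra E]
  [AddCommGroup V] [Module ℂ V]

/-- The operations which make a vector space `V` into a pre-imprimitivity bimodule over the dense
subalgebras `C_c(K, D) ⊆ D ⋊_α K` and `C_c(L, E) ⊆ E ⋊_β L`: the two actions and the two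
algebra-valued inner products. -/
structure PreBimodule (α : CStarAction K D) (μ : HaarMeasure K) (β : CStarAction L E)
    (ν : HaarMeasure L) (V : Type*) where
  lact : ConvAlg α μ → V → V
  ract : V → ConvAlg β ν → V
  linner : V → V → ConvAlg α μ
  rinner : V → V → ConvAlg β ν

namespace PreBimodule

variable {α : CStarAction K D} {μ : HaarMeasure K} {β : CStarAction L E} {ν : HaarMeasure L}

/-- The seminorm `x ↦ ‖⟨x, x⟩‖^(1/2)` defined by the right inner product. It is written as the
largest seminorm below this function, so that the definition does not presuppose the positivity of
the inner product; where the inner product is positive, the function is itself a seminorm, and the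
two coincide. -/
def innerSeminorm (X : PreBimodule α μ β ν V) : Seminorm ℂ V :=
  sSup {q | ∀ x, q x ≤ √‖X.rinner x x‖}

/-- The vector space `V` with the seminorm of the right inner product. -/
def Space (_X : PreBimodule α μ β ν V) : Type _ := V

variable (X : PreBimodule α μ β ν V)

instance : AddCommGroup X.Space := inferInstanceAs (AddCommGroup V)
instance : Module ℂ X.Space := inferInstanceAs (Module ℂ V)

instance : SeminormedAddCommGroup X.Space :=
  { (show Seminorm ℂ X.Space from X.innerSeminorm).toAddGroupSeminorm.toSeminormedAddCommGroup with }

instance : NormedSpace ℂ X.Space where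
  norm_smul_le c x := (map_smul_eq_mul X.innerSeminorm c x).le

/-- The completed bimodule. -/
def Completed : Type _ := Completion X.Space

instance : NormedAddCommGroup X.Completed := inferInstanceAs (NormedAddCommGroup (Completion X.Space))
instance : NormedSpace ℂ X.Completed := inferInstanceAs (NormedSpace ℂ (Completion X.Space))
instance : CompleteSpace X.Completed := inferInstanceAs (CompleteSpace (Completion X.Space))

/-- The canonical map from `V` to the completed bimodule. -/
def of (x : X.Space) : X.Completed := (x : Completion X.Space)

lemma isDenseInducing_of : IsDenseInducing X.of := Completion.isDenseInducing_coe

/-- The left action of `D ⋊_α K`, extended by continuity. -/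
def left (a : CrossedProduct α μ) (x : X.Completed) : X.Completed :=
  (CrossedProduct.isDenseInducing_of.prodMap X.isDenseInducing_of).extend
    (fun p : ConvAlg α μ × X.Space => X.of (X.lact p.1 p.2)) (a, x)

/-- The right action of `E ⋊_β L`, extended by continuity. -/
def right (x : X.Completed) (b : CrossedProduct β ν) : X.Completed :=
  (X.isDenseInducing_of.prodMap CrossedProduct.isDenseInducing_of).extend
    (fun p : X.Space × ConvAlg β ν => X.of (X.ract p.1 p.2)) (x, b)

/-- The left inner product, extended by continuity. -/
def leftInner (x y : X.Completed) : CrossedProduct α μ :=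
  (X.isDenseInducing_of.prodMap X.isDenseInducing_of).extend
    (fun p : X.Space × X.Space => CrossedProduct.of (X.linner p.1 p.2)) (x, y)

/-- The right inner product, extended by continuity. -/
def rightInner (x y : X.Completed) : CrossedProduct β ν :=
  (X.isDenseInducing_of.prodMap X.isDenseInducing_of).extend
    (fun p : X.Space × X.Space => CrossedProduct.of (X.rinner p.1 p.2)) (x, y)

end PreBimodule

/-- An isomorphism of imprimitivity bimodules from the completion of `X` onto the completion of
`Y` whose coefficient maps are the isomorphisms `φ` and `ψ`. -/
structure BimoduleIso {K' L' D' E' V' : Type*} [Group K'] [TopologicalSpace K']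
    [IsTopologicalGroup K'] [LocallyCompactSpace K'] [T2Space K'] [Group L'] [TopologicalSpace L']
    [IsTopologicalGroup L'] [LocallyCompactSpace L'] [T2Space L'] [NonUnitalCStarAlgebra D']
    [NonUnitalCStarAlgebra E'] [AddCommGroup V'] [Module ℂ V']
    {α : CStarAction K D} {μ : HaarMeasure K} {β : CStarAction L E} {ν : HaarMeasure L}
    {α' : CStarAction K' D'} {μ' : HaarMeasure K'} {β' : CStarAction L' E'} {ν' : HaarMeasure L'}
    (X : PreBimodule α μ β ν V) (Y : PreBimodule α' μ' β' ν' V')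
    (φ : CrossedProduct α μ ≃⋆ₐ[ℂ] CrossedProduct α' μ')
    (ψ : CrossedProduct β ν ≃⋆ₐ[ℂ] CrossedProduct β' ν') where
  toEquiv : X.Completed ≃ₗᵢ[ℂ] Y.Completed
  map_left : ∀ a x, toEquiv (X.left a x) = Y.left (φ a) (toEquiv x)
  map_right : ∀ x b, toEquiv (X.right x b) = Y.right (toEquiv x) (ψ b)
  map_leftInner : ∀ x y, φ (X.leftInner x y) = Y.leftInner (toEquiv x) (toEquiv y)
  map_rightInner : ∀ x y, ψ (X.rightInner x y) = Y.rightInner (toEquiv x) (toEquiv y)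

end Bimodules

/-! ### The symmetric imprimitivity bimodule -/

section Auxiliary

lemma HaarMeasure.exists_ne_zero {G E : Type*} [Group G] [TopologicalSpace G]
    [NormedAddCommGroup E] [NormedSpace ℝ E] (μ : HaarMeasure G) {f : G → E} (h : μ.int f ≠ 0) :
    ∃ t, f t ≠ 0 := by
  by_contra hn
  push Not at hn
  exact h ((μ.int_congr hn).trans μ.int_zero)

lemma continuous_modular_rpow {G : Type*} [Group G] [TopologicalSpace G] [IsTopologicalGroup G]
    [LocallyCompactSpace G] (c : ℝ) : Continuous fun s : G => modular s ^ c :=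
  continuous_modular.rpow_const fun s => Or.inl (modular_pos s).ne'

lemma mem_tsupport_of_ne {X E : Type*} [TopologicalSpace X] [Zero E] {f : X → E} {x : X}
    (h : f x ≠ 0) : x ∈ tsupport f := subset_tsupport f h

lemma ne_zero_of_smul_ne {E : Type*} [AddCommGroup E] [Module ℝ E] {c : ℝ} {x : E}
    (h : c • x ≠ 0) : x ≠ 0 := fun h0 => h (by rw [h0, smul_zero])

lemma ne_zero_of_act_ne {G A : Type*} [Group G] [TopologicalSpace G] [NonUnitalCStarAlgebra A]
    {α : CStarAction G A} {s : G} {a : A} (h : α s a ≠ 0) : a ≠ 0 :=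
  fun h0 => h (by rw [h0, map_zero])

end Auxiliary

/-- Symmetric imprimitivity data: commuting free and proper actions of `K` on the left and of `L`
on the right of a locally compact space `P`, together with commuting actions `σ` of `K` and `η` of
`L` on `A`. The right action is recorded as the left action `t · p = p t⁻¹`. -/
structure SymmetricData (K L P A : Type*) [Group K] [TopologicalSpace K] [Group L]
    [TopologicalSpace L] [TopologicalSpace P] [NonUnitalCStarAlgebra A] where
  left : SpaceAction K P
  right : SpaceAction L P
  commute : ∀ s t p, left s (right t p) = right t (left s p)
  left_free : ∀ s p, left s p = p → s = 1
  right_free : ∀ t p, right t p = p → t = 1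
  left_proper : IsProperMap fun q : K × P => (left q.1 q.2, q.2)
  right_proper : IsProperMap fun q : L × P => (right q.1 q.2, q.2)
  σ : CStarAction K A
  η : CStarAction L A
  σ_commute : ∀ s t a, σ s (η t a) = η t (σ s a)

namespace SpaceAction

lemma isCompact_transporter {K P : Type*} [Group K] [TopologicalSpace K] [TopologicalSpace P]
    {θ : SpaceAction K P} (h : IsProperMap fun q : K × P => (θ q.1 q.2, q.2)) {B C : Set P}
    (hB : IsCompact B) (hC : IsCompact C) : IsCompact {s | ∃ p ∈ B, θ s p ∈ C} := by
  have h1 := (h.isCompact_preimage (hC.prod hB)).image continuous_fst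
  convert h1 using 1
  ext s
  constructor
  · rintro ⟨p, hp, hs⟩
    exact ⟨(s, p), ⟨hs, hp⟩, rfl⟩
  · rintro ⟨⟨s, p⟩, ⟨hs, hp⟩, rfl⟩
    exact ⟨p, hp, hs⟩

end SpaceAction

namespace SymmetricData

variable {K L P A : Type*} [Group K] [TopologicalSpace K] [IsTopologicalGroup K]
  [LocallyCompactSpace K] [T2Space K] [Group L] [TopologicalSpace L] [IsTopologicalGroup L]
  [LocallyCompactSpace L] [T2Space L] [TopologicalSpace P] [LocallyCompactSpace P] [T2Space P]
  [NonUnitalCStarAlgebra A] (d : SymmetricData K L P A)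

/-- The right action `p · t`. -/
def rmul (p : P) (t : L) : P := d.right t⁻¹ p

/-- The algebra `Ind_L^P η`. -/
abbrev IndL : NonUnitalStarSubalgebra ℂ (P →ᵇ A) := Ind d.right d.η

/-- The algebra `Ind_K^P σ`. -/
abbrev IndK : NonUnitalStarSubalgebra ℂ (P →ᵇ A) := Ind d.left d.σ

/-- The action `σ ⊗ lt` of `K` on `Ind_L^P η`. -/
def actL : CStarAction K d.IndL := indAction d.σ d.left d.commute d.σ_commute

/-- The action `η ⊗ rt` of `L` on `Ind_K^P σ`: `(t · f)(p) = η_t(f(p · t))`. -/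
def actK : CStarAction L d.IndK :=
  indAction d.η d.right (fun t s p => (d.commute s t p).symm) fun t s a => (d.σ_commute s t a).symm

lemma actL_apply (s : K) (f : d.IndL) (p : P) : d.actL s f p = d.σ s (f (d.left s⁻¹ p)) := rfl

lemma actK_apply (t : L) (f : d.IndK) (p : P) : d.actK t f p = d.η t (f (d.rmul p t)) := rfl

lemma continuous_rmul : Continuous fun q : P × L => d.rmul q.1 q.2 :=
  continuous_snd.inv.spaceAction d.right continuous_fst

lemma _root_.Continuous.rmul {Y : Type*} [TopologicalSpace Y] {f : Y → P} {g : Y → L}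
    (hf : Continuous f) (hg : Continuous g) : Continuous fun y => d.rmul (f y) (g y) :=
  d.continuous_rmul.comp (hf.prodMk hg)

lemma rmul_rmul_inv (p : P) (t : L) : d.rmul (d.rmul p t) t⁻¹ = p := by
  change d.right t⁻¹⁻¹ (d.right t⁻¹ p) = p
  rw [d.right.inv_apply_self]

lemma left_rmul (s : K) (p : P) (t : L) : d.left s (d.rmul p t) = d.rmul (d.left s p) t :=
  d.commute s t⁻¹ p

lemma isCompact_rtransporter {B C : Set P} (hB : IsCompact B) (hC : IsCompact C) :
    IsCompact {t : L | ∃ p ∈ B, d.rmul p t ∈ C} := by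
  have := (SpaceAction.isCompact_transporter d.right_proper hB hC).inv
  exact this

lemma isCompact_ltransporter {B C : Set P} (hB : IsCompact B) (hC : IsCompact C) :
    IsCompact {s : K | ∃ p ∈ B, d.left s⁻¹ p ∈ C} := by
  have := (SpaceAction.isCompact_transporter d.left_proper hB hC).inv
  exact this

lemma continuous_eval_ind {M : Type*} [Group M] [TopologicalSpace M] [IsTopologicalGroup M]
    {ρ : SpaceAction M P} {η : CStarAction M A} {Y : Type*} [TopologicalSpace Y]
    {c : Y → Ind ρ η} (hc : Continuous c) {g : Y → P} (hg : Continuous g) :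
    Continuous fun y => c y (g y) :=
  (continuous_eval (F := P →ᵇ A)).comp ((continuous_subtype_val.comp hc).prodMk hg)

variable (μ : HaarMeasure K) (ν : HaarMeasure L)

/-- `(c · x)(p) = ∫_K c(s, p) σ_s(x(s⁻¹ · p)) Δ_K(s)^(1/2) ds`. -/
def lact (c : ConvAlg d.actL μ) (x : C_c(P, A)) : C_c(P, A) where
  toFun p := μ.int fun s => modular s ^ (1 / 2 : ℝ) • (c s p * d.σ s (x (d.left s⁻¹ p)))
  continuous_toFun := by
    refine μ.continuous_int
      (f := fun p s => modular s ^ (1 / 2 : ℝ) • (c s p * d.σ s (x (d.left s⁻¹ p)))) ?_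
      fun p₀ => ⟨univ, univ_mem, tsupport c, c.hasCompactSupport, fun p _ s hs => ?_⟩
    · exact ((continuous_modular_rpow _).comp continuous_snd).smul
        ((continuous_eval_ind (c.continuous.comp continuous_snd) continuous_fst).mul
          (continuous_snd.cstarAction d.σ ((map_continuous x).comp
            (continuous_snd.inv.spaceAction d.left continuous_fst))))
    · rw [c.eq_zero hs]
      change _ • ((0 : A) * _) = 0
      rw [zero_mul, smul_zero]
  hasCompactSupport' := by
    refine HasCompactSupport.intro ((IsCompact.prod c.hasCompactSupport x.hasCompactSupport).image
      d.left.continuous_uncurry) fun p hp => ?_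
    by_contra hne
    obtain ⟨s, hs⟩ := μ.exists_ne_zero hne
    have h1 := ne_zero_of_smul_ne hs
    have h2 : c s ≠ 0 := fun h0 => left_ne_zero_of_mul h1 (by rw [h0]; rfl)
    exact hp ⟨(s, d.left s⁻¹ p), ⟨mem_tsupport_of_ne h2,
      mem_tsupport_of_ne (ne_zero_of_act_ne (right_ne_zero_of_mul h1))⟩, d.left.self_apply_inv s p⟩

/-- `(x · b)(p) = ∫_L η_t(x(p · t) b(t⁻¹, p · t)) Δ_L(t)^(-1/2) dt`. -/
def ract (x : C_c(P, A)) (b : ConvAlg d.actK ν) : C_c(P, A) where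
  toFun p := ν.int fun t => modular t ^ (-1 / 2 : ℝ) • d.η t (x (d.rmul p t) * b t⁻¹ (d.rmul p t))
  continuous_toFun := by
    refine ν.continuous_int
      (f := fun p t => modular t ^ (-1 / 2 : ℝ) • d.η t (x (d.rmul p t) * b t⁻¹ (d.rmul p t))) ?_
      fun p₀ => ⟨univ, univ_mem, (tsupport b)⁻¹, IsCompact.inv b.hasCompactSupport,
        fun p _ t ht => ?_⟩
    · have hr : Continuous fun q : P × L => d.rmul q.1 q.2 := d.continuous_rmul
      exact ((continuous_modular_rpow _).comp continuous_snd).smul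
        (continuous_snd.cstarAction d.η (((map_continuous x).comp hr).mul
          (continuous_eval_ind (b.continuous.comp continuous_snd.inv) hr)))
    · rw [b.eq_zero fun h => ht (by simpa using h)]
      change _ • d.η t (_ * (0 : A)) = 0
      rw [mul_zero, map_zero, smul_zero]
  hasCompactSupport' := by
    refine HasCompactSupport.intro ((IsCompact.prod x.hasCompactSupport b.hasCompactSupport).image
      d.continuous_rmul) fun p hp => ?_
    by_contra hne
    obtain ⟨t, ht⟩ := ν.exists_ne_zero hne
    have h1 := ne_zero_of_act_ne (ne_zero_of_smul_ne ht)
    have h2 : b t⁻¹ ≠ 0 := fun h0 => right_ne_zero_of_mul h1 (by rw [h0]; rfl)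
    exact hp ⟨(d.rmul p t, t⁻¹), ⟨mem_tsupport_of_ne (left_ne_zero_of_mul h1),
      mem_tsupport_of_ne h2⟩, d.rmul_rmul_inv p t⟩

lemma continuous_linner_integrand (x y : C_c(P, A)) : Continuous fun q : (K × P) × L =>
    d.η q.2 (x (d.rmul q.1.2 q.2) * d.σ q.1.1 (star (y (d.left q.1.1⁻¹ (d.rmul q.1.2 q.2))))) := by
  have hr : Continuous fun q : (K × P) × L => d.rmul q.1.2 q.2 :=
    (continuous_snd.comp continuous_fst).rmul d continuous_snd
  have hk : Continuous fun q : (K × P) × L => q.1.1 := continuous_fst.comp continuous_fst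
  exact continuous_snd.cstarAction d.η (((map_continuous x).comp hr).mul
    (hk.cstarAction d.σ ((map_continuous y).comp (hk.inv.spaceAction d.left hr)).star))

/-- `_*⟨x, y⟩(s, p) = Δ_K(s)^(-1/2) ∫_L η_t(x(p · t) σ_s(y(s⁻¹ · p · t)*)) dt`. -/
def linner (x y : C_c(P, A)) : ConvAlg d.actL μ :=
  indCc (fun s p => modular s ^ (-1 / 2 : ℝ) • ν.int fun t =>
      d.η t (x (d.rmul p t) * d.σ s (star (y (d.left s⁻¹ (d.rmul p t))))))
    (by
      refine ((continuous_modular_rpow _).comp continuous_fst).smul (ν.continuous_int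
        (f := fun (q : K × P) t =>
          d.η t (x (d.rmul q.2 t) * d.σ q.1 (star (y (d.left q.1⁻¹ (d.rmul q.2 t))))))
        (d.continuous_linner_integrand x y) ?_)
      rintro ⟨s₀, p₀⟩
      obtain ⟨U, hU, hUp⟩ := exists_compact_mem_nhds p₀
      refine ⟨univ ×ˢ U, prod_mem_nhds univ_mem hUp, _,
        d.isCompact_rtransporter hU x.hasCompactSupport, ?_⟩
      rintro ⟨s, p⟩ ⟨-, hp⟩ t ht
      by_contra hne
      exact ht ⟨p, hp, mem_tsupport_of_ne (left_ne_zero_of_mul (ne_zero_of_act_ne hne))⟩)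
    (by
      intro s r p
      have h1 : Continuous fun t =>
          d.η t (x (d.rmul p t) * d.σ s (star (y (d.left s⁻¹ (d.rmul p t))))) :=
        (d.continuous_linner_integrand x y).comp (Continuous.prodMk_right (s, p))
      have h2 : HasCompactSupport fun t =>
          d.η t (x (d.rmul p t) * d.σ s (star (y (d.left s⁻¹ (d.rmul p t))))) := by
        refine HasCompactSupport.intro
          (d.isCompact_rtransporter (isCompact_singleton (x := p)) x.hasCompactSupport)
          fun t ht => ?_
        by_contra hne
        exact ht ⟨p, rfl, mem_tsupport_of_ne (left_ne_zero_of_mul (ne_zero_of_act_ne hne))⟩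
      rw [ConvAlg.act_smul, ν.act_int d.η r h1 h2, ← ν.int_mul_left _ r]
      congr 1
      refine ν.int_congr fun t => ?_
      have e : d.rmul (d.right r p) (r * t) = d.rmul p t := by
        change d.right (r * t)⁻¹ (d.right r p) = d.right t⁻¹ p
        rw [← d.right.mul_apply]
        simp
      rw [e, d.η.mul_apply])
    _ (d.isCompact_ltransporter x.hasCompactSupport y.hasCompactSupport)
    _ x.hasCompactSupport
    (by
      intro s p hne
      obtain ⟨t, ht⟩ := ν.exists_ne_zero (ne_zero_of_smul_ne hne)
      have h1 := ne_zero_of_act_ne ht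
      have h2 := mem_tsupport_of_ne (left_ne_zero_of_mul h1)
      have h3 := ne_zero_of_act_ne (right_ne_zero_of_mul h1)
      exact ⟨⟨_, h2, mem_tsupport_of_ne fun h0 => h3 (by rw [h0, star_zero])⟩, t⁻¹, h2⟩)

lemma continuous_rinner_integrand (x y : C_c(P, A)) : Continuous fun q : (L × P) × K =>
    d.σ q.2 (star (x (d.left q.2⁻¹ q.1.2)) * d.η q.1.1 (y (d.rmul (d.left q.2⁻¹ q.1.2) q.1.1))) := by
  have hr : Continuous fun q : (L × P) × K => d.left q.2⁻¹ q.1.2 :=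
    continuous_snd.inv.spaceAction d.left (continuous_snd.comp continuous_fst)
  have hl : Continuous fun q : (L × P) × K => q.1.1 := continuous_fst.comp continuous_fst
  exact continuous_snd.cstarAction d.σ (((map_continuous x).comp hr).star.mul
    (hl.cstarAction d.η ((map_continuous y).comp (hr.rmul d hl))))

/-- `⟨x, y⟩_*(t, p) = Δ_L(t)^(-1/2) ∫_K σ_s(x(s⁻¹ · p)* η_t(y(s⁻¹ · p · t))) ds`. -/
def rinner (x y : C_c(P, A)) : ConvAlg d.actK ν :=
  indCc (fun t p => modular t ^ (-1 / 2 : ℝ) • μ.int fun s =>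
      d.σ s (star (x (d.left s⁻¹ p)) * d.η t (y (d.rmul (d.left s⁻¹ p) t))))
    (by
      refine ((continuous_modular_rpow _).comp continuous_fst).smul (μ.continuous_int
        (f := fun (q : L × P) s =>
          d.σ s (star (x (d.left s⁻¹ q.2)) * d.η q.1 (y (d.rmul (d.left s⁻¹ q.2) q.1))))
        (d.continuous_rinner_integrand x y) ?_)
      rintro ⟨t₀, p₀⟩
      obtain ⟨U, hU, hUp⟩ := exists_compact_mem_nhds p₀
      refine ⟨univ ×ˢ U, prod_mem_nhds univ_mem hUp, _,
        d.isCompact_ltransporter hU x.hasCompactSupport, ?_⟩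
      rintro ⟨t, p⟩ ⟨-, hp⟩ s hs
      by_contra hne
      have h1 := left_ne_zero_of_mul (ne_zero_of_act_ne hne)
      exact hs ⟨p, hp, mem_tsupport_of_ne fun h0 => h1 (by rw [h0, star_zero])⟩)
    (by
      intro t r p
      have h1 : Continuous fun s =>
          d.σ s (star (x (d.left s⁻¹ p)) * d.η t (y (d.rmul (d.left s⁻¹ p) t))) :=
        (d.continuous_rinner_integrand x y).comp (Continuous.prodMk_right (t, p))
      have h2 : HasCompactSupport fun s =>
          d.σ s (star (x (d.left s⁻¹ p)) * d.η t (y (d.rmul (d.left s⁻¹ p) t))) := by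
        refine HasCompactSupport.intro
          (d.isCompact_ltransporter (isCompact_singleton (x := p)) x.hasCompactSupport)
          fun s hs => ?_
        by_contra hne
        have h1 := left_ne_zero_of_mul (ne_zero_of_act_ne hne)
        exact hs ⟨p, rfl, mem_tsupport_of_ne fun h0 => h1 (by rw [h0, star_zero])⟩
      rw [ConvAlg.act_smul, μ.act_int d.σ r h1 h2, ← μ.int_mul_left _ r]
      congr 1
      refine μ.int_congr fun s => ?_
      have e : d.left (r * s)⁻¹ (d.left r p) = d.left s⁻¹ p := by
        rw [← d.left.mul_apply]
        simp
      rw [e, d.σ.mul_apply])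
    _ (d.isCompact_rtransporter x.hasCompactSupport y.hasCompactSupport)
    _ x.hasCompactSupport
    (by
      intro t p hne
      obtain ⟨s, hs⟩ := μ.exists_ne_zero (ne_zero_of_smul_ne hne)
      have h1 := ne_zero_of_act_ne hs
      have h2 := left_ne_zero_of_mul h1
      have h2' : d.left s⁻¹ p ∈ tsupport x :=
        mem_tsupport_of_ne fun h0 => h2 (by rw [h0, star_zero])
      exact ⟨⟨_, h2', mem_tsupport_of_ne (ne_zero_of_act_ne (right_ne_zero_of_mul h1))⟩,
        s⁻¹, h2'⟩)

/-- The symmetric imprimitivity bimodule `W(P)`, an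
`(Ind_L^P η ⋊ K)`-`(Ind_K^P σ ⋊ L)` bimodule: the completion of `C_c(P, A)`. -/
def bimodule : PreBimodule d.actL μ d.actK ν C_c(P, A) where
  lact := d.lact μ
  ract := d.ract ν
  linner := d.linner μ ν
  rinner := d.rinner μ ν

end SymmetricData

/-! ### The Green bimodule -/

/-- The restriction of an action to a subgroup. -/
def CStarAction.restrict {Q D : Type*} [Group Q] [TopologicalSpace Q] [NonUnitalCStarAlgebra D]
    (β : CStarAction Q D) (S : Subgroup Q) : CStarAction S D where
  aut := β.aut.comp S.subtype
  continuous_orbit a := (β.continuous_orbit a).comp continuous_subtype_val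

/-- The action of a group on a coset space by left translation. -/
def cosetAction {Q : Type*} [Group Q] [TopologicalSpace Q] [IsTopologicalGroup Q]
    (S : Subgroup Q) : SpaceAction Q (Q ⧸ S) where
  toFun t x := t • x
  one_apply x := one_smul _ x
  mul_apply s t x := mul_smul s t x
  continuous_uncurry := continuous_smul

instance locallyCompactSpace_of_isClosed {Q : Type*} [Group Q] [TopologicalSpace Q]
    [LocallyCompactSpace Q] (S : Subgroup Q) [h : IsClosed (S : Set Q)] : LocallyCompactSpace S :=
  h.isClosedEmbedding_subtypeVal.locallyCompactSpace

namespace Green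

variable {Q D : Type*} [Group Q] [TopologicalSpace Q] [IsTopologicalGroup Q]
  [LocallyCompactSpace Q] [T2Space Q] [NonUnitalCStarAlgebra D] (β : CStarAction Q D)
  (S : Subgroup Q) [IsClosed (S : Set Q)] (μ : HaarMeasure Q) (ν : HaarMeasure S)

/-- The action `β ⊗ lt` of `Q` on `D ⊗ C₀(Q/S) = C₀(Q/S, D)`. -/
abbrev leftAction : CStarAction Q C₀(Q ⧸ S, D) := c0Action β (cosetAction S)

lemma continuous_eval_c0 {X Y : Type*} [TopologicalSpace X] [TopologicalSpace Y]
    {c : Y → C₀(X, D)} (hc : Continuous c) {g : Y → X} (hg : Continuous g) :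
    Continuous fun y => c y (g y) := by
  have h1 : Continuous fun y => (c y).toBCF :=
    (ZeroAtInftyContinuousMap.isometry_toBCF).continuous.comp hc
  exact (continuous_eval (F := X →ᵇ D)).comp (h1.prodMk hg)

lemma isCompact_cosetTransporter {B C : Set Q} (hB : IsCompact B) (hC : IsCompact C) :
    IsCompact {h : S | ∃ r ∈ B, r * (h : Q) ∈ C} := by
  have h1 : IsCompact (((↑) : S → Q) ⁻¹' (B⁻¹ * C)) :=
    (‹IsClosed (S : Set Q)›.isClosedEmbedding_subtypeVal).isCompact_preimage (hB.inv.mul hC)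
  convert h1 using 1
  ext h
  constructor
  · rintro ⟨r, hr, hc⟩
    exact ⟨r⁻¹, Set.inv_mem_inv.2 hr, r * h, hc, by simp⟩
  · rintro ⟨a, ha, c, hc, e⟩
    refine ⟨a⁻¹, ha, ?_⟩
    have e' : a * c = (h : Q) := e
    rw [← e']
    simpa using hc

variable {β S μ ν}

/-- `(f · x)(r) = ∫_Q f(t, rS) β_t(x(t⁻¹ r)) Δ_Q(t)^(1/2) dt`. -/
def lact (f : ConvAlg (leftAction β S) μ) (x : C_c(Q, D)) : C_c(Q, D) where
  toFun r := μ.int fun t =>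
    modular t ^ (1 / 2 : ℝ) • (f t (r : Q ⧸ S) * β t (x (t⁻¹ * r)))
  continuous_toFun := by
    refine μ.continuous_int
      (f := fun (r : Q) (t : Q) => modular t ^ (1 / 2 : ℝ) • (f t (r : Q ⧸ S) * β t (x (t⁻¹ * r)))) ?_
      fun r₀ => ⟨univ, univ_mem, tsupport f, f.hasCompactSupport, fun r _ t ht => ?_⟩
    · exact ((continuous_modular_rpow _).comp continuous_snd).smul
        ((continuous_eval_c0 (f.continuous.comp continuous_snd)
          (QuotientGroup.continuous_mk.comp continuous_fst)).mul
          (continuous_snd.cstarAction β ((map_continuous x).comp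
            (continuous_snd.inv.mul continuous_fst))))
    · rw [f.eq_zero ht]
      change _ • ((0 : D) * _) = 0
      rw [zero_mul, smul_zero]
  hasCompactSupport' := by
    refine HasCompactSupport.intro (IsCompact.mul f.hasCompactSupport x.hasCompactSupport)
      fun r hr => ?_
    by_contra hne
    obtain ⟨t, ht⟩ := μ.exists_ne_zero hne
    have h1 := ne_zero_of_smul_ne ht
    have h2 : f t ≠ 0 := fun h0 => left_ne_zero_of_mul h1 (by rw [h0]; rfl)
    exact hr ⟨t, mem_tsupport_of_ne h2, t⁻¹ * r,
      mem_tsupport_of_ne (ne_zero_of_act_ne (right_ne_zero_of_mul h1)), by simp⟩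

/-- `(x · g)(r) = ∫_S x(r h) β_{r h}(g(h⁻¹)) Δ_S(h)^(-1/2) dh`. -/
def ract (x : C_c(Q, D)) (g : ConvAlg (β.restrict S) ν) : C_c(Q, D) where
  toFun r := ν.int fun h =>
    modular h ^ (-1 / 2 : ℝ) • (x (r * (h : Q)) * β (r * (h : Q)) (g h⁻¹))
  continuous_toFun := by
    refine ν.continuous_int
      (f := fun r h => modular h ^ (-1 / 2 : ℝ) • (x (r * (h : Q)) * β (r * (h : Q)) (g h⁻¹))) ?_
      fun r₀ => ⟨univ, univ_mem, (tsupport g)⁻¹, IsCompact.inv g.hasCompactSupport,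
        fun r _ h hh => ?_⟩
    · have hm : Continuous fun q : Q × S => q.1 * (q.2 : Q) :=
        continuous_fst.mul (continuous_subtype_val.comp continuous_snd)
      exact ((continuous_modular_rpow _).comp continuous_snd).smul
        (((map_continuous x).comp hm).mul (hm.cstarAction β (g.continuous.comp continuous_snd.inv)))
    · rw [g.eq_zero fun h' => hh (by simpa using h'), map_zero, mul_zero, smul_zero]
  hasCompactSupport' := by
    refine HasCompactSupport.intro (IsCompact.mul x.hasCompactSupport
      (IsCompact.image g.hasCompactSupport continuous_subtype_val)) fun r hr => ?_
    by_contra hne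
    obtain ⟨h, hh⟩ := ν.exists_ne_zero hne
    have h1 := ne_zero_of_smul_ne hh
    exact hr ⟨r * (h : Q), mem_tsupport_of_ne (left_ne_zero_of_mul h1), _,
      ⟨h⁻¹, mem_tsupport_of_ne (ne_zero_of_act_ne (right_ne_zero_of_mul h1)), rfl⟩, by simp⟩

lemma continuous_linner_integrand (x y : C_c(Q, D)) : Continuous fun q : (Q × Q) × S =>
    x (q.1.2 * (q.2 : Q)) * β q.1.1 (star (y (q.1.1⁻¹ * (q.1.2 * (q.2 : Q))))) := by
  have hr : Continuous fun q : (Q × Q) × S => q.1.2 * (q.2 : Q) :=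
    (continuous_snd.comp continuous_fst).mul (continuous_subtype_val.comp continuous_snd)
  have ht : Continuous fun q : (Q × Q) × S => q.1.1 := continuous_fst.comp continuous_fst
  exact ((map_continuous x).comp hr).mul
    (ht.cstarAction β ((map_continuous y).comp (ht.inv.mul hr)).star)

/-- The function `(t, rS) ↦ Δ_Q(t)^(-1/2) ∫_S x(r h) β_t(y(t⁻¹ r h)*) dh` on `Q × Q/S`. -/
def linnerFun (ν : HaarMeasure S) (β : CStarAction Q D) (x y : C_c(Q, D)) (t : Q) : Q ⧸ S → D :=
  Quotient.lift (fun r : Q => modular t ^ (-1 / 2 : ℝ) • ν.int fun h =>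
      x (r * (h : Q)) * β t (star (y (t⁻¹ * (r * (h : Q))))))
    (by
      intro r r' hr
      have hr := QuotientGroup.leftRel_apply.1 hr
      change _ • _ = _ • _
      rw [← ν.int_mul_left
        (fun h : S => x (r * (h : Q)) * β t (star (y (t⁻¹ * (r * (h : Q)))))) ⟨_, hr⟩]
      congr 1
      refine ν.int_congr fun h => ?_
      have e : r * (((⟨r⁻¹ * r', hr⟩ : S) * h : S) : Q) = r' * (h : Q) := by
        rw [Subgroup.coe_mul]
        group
      rw [e])

lemma linnerFun_mk (x y : C_c(Q, D)) (t r : Q) : linnerFun ν β x y t (r : Q ⧸ S) =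
    modular t ^ (-1 / 2 : ℝ) • ν.int fun h : S =>
      x (r * (h : Q)) * β t (star (y (t⁻¹ * (r * (h : Q))))) := rfl

/-- `_*⟨x, y⟩(t, rS) = Δ_Q(t)^(-1/2) ∫_S x(r h) β_t(y(t⁻¹ r h)*) dh`. -/
def linner (ν : HaarMeasure S) (x y : C_c(Q, D)) : ConvAlg (leftAction β S) μ :=
  c0Cc (linnerFun ν β x y)
    (by
      have hq : IsOpenQuotientMap fun q : Q × Q => (q.1, (q.2 : Q ⧸ S)) :=
        IsOpenQuotientMap.id.prodMap QuotientGroup.isOpenQuotientMap_mk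
      rw [← hq.continuous_comp_iff]
      refine ((continuous_modular_rpow _).comp continuous_fst).smul (ν.continuous_int
        (f := fun (q : Q × Q) h =>
          x (q.2 * (h : Q)) * β q.1 (star (y (q.1⁻¹ * (q.2 * (h : Q))))))
        (continuous_linner_integrand x y) ?_)
      rintro ⟨t₀, r₀⟩
      obtain ⟨U, hU, hUr⟩ := exists_compact_mem_nhds r₀
      refine ⟨univ ×ˢ U, prod_mem_nhds univ_mem hUr, _,
        isCompact_cosetTransporter S hU x.hasCompactSupport, ?_⟩
      rintro ⟨t, r⟩ ⟨-, hr⟩ h hh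
      by_contra hne
      exact hh ⟨r, hr, mem_tsupport_of_ne (left_ne_zero_of_mul hne)⟩)
    (tsupport x * (tsupport y)⁻¹)
    (IsCompact.mul x.hasCompactSupport (IsCompact.inv y.hasCompactSupport))
    (((↑) : Q → Q ⧸ S) '' tsupport x)
    (IsCompact.image x.hasCompactSupport QuotientGroup.continuous_mk)
    (by
      intro t q
      induction q using QuotientGroup.induction_on with
      | H r =>
        intro hne
        rw [linnerFun_mk] at hne
        obtain ⟨h, hh⟩ := ν.exists_ne_zero (ne_zero_of_smul_ne hne)
        have h1 := mem_tsupport_of_ne (left_ne_zero_of_mul hh)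
        have h2 := ne_zero_of_act_ne (right_ne_zero_of_mul hh)
        have h3 := mem_tsupport_of_ne (f := y) fun h0 => h2 (by rw [h0, star_zero])
        refine ⟨⟨_, h1, _, Set.inv_mem_inv.2 h3, by group⟩, _, h1, ?_⟩
        exact QuotientGroup.mk_mul_of_mem r h.2)

/-- `⟨x, y⟩_*(h) = Δ_S(h)^(-1/2) ∫_Q β_t(x(t⁻¹)* y(t⁻¹ h)) dt`. -/
def rinner (μ : HaarMeasure Q) (x y : C_c(Q, D)) : ConvAlg (β.restrict S) ν :=
  CompactlySupportedContinuousMap.mk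
    ⟨fun h => modular h ^ (-1 / 2 : ℝ) • μ.int fun t =>
        β t (star (x t⁻¹) * y (t⁻¹ * (h : Q))), by
      refine (continuous_modular_rpow _).smul (μ.continuous_int
        (f := fun (h : S) t => β t (star (x t⁻¹) * y (t⁻¹ * (h : Q)))) ?_ ?_)
      · exact continuous_snd.cstarAction β (((map_continuous x).comp continuous_snd.inv).star.mul
          ((map_continuous y).comp (continuous_snd.inv.mul
            (continuous_subtype_val.comp continuous_fst))))
      · refine fun h₀ => ⟨univ, univ_mem, (tsupport x)⁻¹, IsCompact.inv x.hasCompactSupport,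
          fun h _ t ht => ?_⟩
        by_contra hne
        have h1 := left_ne_zero_of_mul (ne_zero_of_act_ne hne)
        exact ht (by
          rw [Set.mem_inv]
          exact mem_tsupport_of_ne fun h0 => h1 (by rw [h0, star_zero]))⟩
    (by
      refine HasCompactSupport.intro
        (isCompact_cosetTransporter S x.hasCompactSupport y.hasCompactSupport)
        fun h hh => ?_
      by_contra hne
      obtain ⟨t, ht⟩ := μ.exists_ne_zero (ne_zero_of_smul_ne hne)
      have h1 := ne_zero_of_act_ne ht
      have h2 := left_ne_zero_of_mul h1
      exact hh ⟨t⁻¹, mem_tsupport_of_ne fun h0 => h2 (by rw [h0, star_zero]),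
        mem_tsupport_of_ne (right_ne_zero_of_mul h1)⟩)

/-- The Green bimodule `X_S^Q(β)`, a `((D ⊗ C₀(Q/S)) ⋊_{β ⊗ lt} Q)`-`(D ⋊_{β|} S)` bimodule: the
completion of `C_c(Q, D)`. -/
def bimodule (β : CStarAction Q D) (S : Subgroup Q) [IsClosed (S : Set Q)] (μ : HaarMeasure Q)
    (ν : HaarMeasure S) : PreBimodule (leftAction β S) μ (β.restrict S) ν C_c(Q, D) where
  lact := lact
  ract := ract
  linner := linner ν
  rinner := rinner μ

end Green

/-! ### The set-up for closed subgroups `N ⊆ H` of `G` with `N` normal -/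

section Setup

variable {G A : Type*} [Group G] [TopologicalSpace G] [IsTopologicalGroup G]
  [LocallyCompactSpace G] [T2Space G] [NonUnitalCStarAlgebra A]

/-- The subgroup `H/N` of `G/N`. -/
abbrev quotSubgroup (N H : Subgroup G) [N.Normal] : Subgroup (G ⧸ N) :=
  H.map (QuotientGroup.mk' N)

lemma mk_mem_quotSubgroup {N H : Subgroup G} [N.Normal] (h : N ≤ H) (u : G) :
    (u : G ⧸ N) ∈ quotSubgroup N H ↔ u ∈ H := by
  constructor
  · rintro ⟨v, hv, e⟩
    have h1 : v⁻¹ * u ∈ N := QuotientGroup.eq.1 e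
    simpa using H.mul_mem hv (h h1)
  · exact fun hu => ⟨u, hu, rfl⟩

instance isClosed_quotSubgroup (N H : Subgroup G) [N.Normal] [hH : IsClosed (H : Set G)]
    [h : Fact (N ≤ H)] : IsClosed (quotSubgroup N H : Set (G ⧸ N)) := by
  have hq : IsQuotientMap ((↑) : G → G ⧸ N) := QuotientGroup.isOpenQuotientMap_mk.isQuotientMap
  rw [← hq.isClosed_preimage]
  convert hH using 1
  ext u
  exact mk_mem_quotSubgroup h.out u

/-- The action `tN · uH = tuH` of `G/N` on `G/H`. -/
def quotCosetAction (N H : Subgroup G) [N.Normal] [h : Fact (N ≤ H)] :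
    SpaceAction (G ⧸ N) (G ⧸ H) where
  toFun := Quotient.map₂ (fun t u : G => t * u) (by
    intro t t' ht u u' hu
    have ht := QuotientGroup.leftRel_apply.1 ht
    have hu := QuotientGroup.leftRel_apply.1 hu
    refine QuotientGroup.leftRel_apply.2 ?_
    have h1 : u⁻¹ * (t⁻¹ * t') * u⁻¹⁻¹ ∈ H := h.out (Subgroup.Normal.conj_mem ‹_› _ ht _)
    have h2 := H.mul_mem h1 hu
    convert h2 using 1
    group)
  one_apply x := by
    induction x using QuotientGroup.induction_on with
    | H u => exact congrArg ((↑) : G → G ⧸ H) (one_mul u)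
  mul_apply s t x := by
    induction s using QuotientGroup.induction_on with
    | H s =>
    induction t using QuotientGroup.induction_on with
    | H t =>
    induction x using QuotientGroup.induction_on with
    | H u => exact congrArg ((↑) : G → G ⧸ H) (mul_assoc s t u)
  continuous_uncurry := by
    have hq : IsOpenQuotientMap fun q : G × G => ((q.1 : G ⧸ N), (q.2 : G ⧸ H)) :=
      QuotientGroup.isOpenQuotientMap_mk.prodMap QuotientGroup.isOpenQuotientMap_mk
    rw [← hq.continuous_comp_iff]
    exact QuotientGroup.continuous_mk.comp continuous_mul

lemma quotCosetAction_mk (N H : Subgroup G) [N.Normal] [Fact (N ≤ H)] (t u : G) :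
    quotCosetAction N H (t : G ⧸ N) (u : G ⧸ H) = ((t * u : G) : G ⧸ H) := rfl

variable (α : CStarAction G A) (N H : Subgroup G) [N.Normal]

/-- The action `α ⊗ lt` of `G` on `A ⊗ C₀(G/N) = C₀(G/N, A)`: `(s · f)(rN) = α_s(f(s⁻¹rN))`. -/
abbrev ltAction : CStarAction G C₀(G ⧸ N, A) := c0Action α (cosetAction N)

/-- The action `id ⊗ rt` of `G/N` on `A ⊗ C₀(G/N)`: `(tN · f)(rN) = f(rtN)`. -/
abbrev rtAction (A : Type*) [NonUnitalCStarAlgebra A] : CStarAction (G ⧸ N) C₀(G ⧸ N, A) :=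
  c0Action (CStarAction.trivial (G ⧸ N) A) (SpaceAction.ofRight (fun r t : G ⧸ N => r * t) mul_one
    (fun r s t => (mul_assoc r s t).symm) continuous_mul)

lemma rtAction_apply (t : G ⧸ N) (f : C₀(G ⧸ N, A)) (r : G ⧸ N) :
    rtAction N A t f r = f (r * t) :=
  congrArg (fun q => f (r * q)) (inv_inv t)

lemma ltAction_apply (s : G) (f : C₀(G ⧸ N, A)) (r : G ⧸ N) :
    ltAction α N s f r = α s (f (((s⁻¹ : G) : G ⧸ N) * r)) := by
  induction r using QuotientGroup.induction_on with
  | H r => rfl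

lemma rtAction_equivariant (t : G ⧸ N) :
    Equivariant (rtAction N A t) (ltAction α N) (ltAction α N) := fun s f => by
  ext r
  rw [rtAction_apply, ltAction_apply, ltAction_apply, rtAction_apply, mul_assoc]

/-- The action `β` of `G/N` on `(A ⊗ C₀(G/N)) ⋊_{α ⊗ lt} G` induced by `id ⊗ rt`. -/
def betaAction [IsClosed (N : Set G)] (μG : HaarMeasure G) :
    CStarAction (G ⧸ N) (CrossedProduct (ltAction α N) μG) :=
  crossedAction (ltAction α N) μG (rtAction N A) (rtAction_equivariant α N)

/-- The action `γ` of `H/N × G` on `A ⊗ C₀(G/N)`: `((hN, y) · f)(rN) = α_y(f(y⁻¹rhN))`. -/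
def gammaAction [IsClosed (H : Set G)] [Fact (N ≤ H)] :
    CStarAction (quotSubgroup N H × G) C₀(G ⧸ N, A) :=
  c0Action (α.ofSnd (quotSubgroup N H))
    { toFun := fun l r => (l.2 : G ⧸ N) * r * (l.1 : G ⧸ N)⁻¹
      one_apply := fun r => by simp
      mul_apply := fun l m r => by
        simp only [Prod.snd_mul, Prod.fst_mul, QuotientGroup.mk_mul, Subgroup.coe_mul]
        group
      continuous_uncurry := by
        have h1 : Continuous fun q : (quotSubgroup N H × G) × (G ⧸ N) => (q.1.2 : G ⧸ N) :=
          QuotientGroup.continuous_mk.comp (continuous_snd.comp continuous_fst)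
        have h2 : Continuous fun q : (quotSubgroup N H × G) × (G ⧸ N) => (q.1.1 : G ⧸ N) :=
          continuous_subtype_val.comp (continuous_fst.comp continuous_fst)
        exact (h1.mul continuous_snd).mul h2.inv }

/-- The action `(id ⊗ rt ⊗ lt) × (α ⊗ lt ⊗ id)` of `G/N × G` on
`A ⊗ C₀(G/N) ⊗ C₀(G/H) = C₀(G/N × G/H, A)`:
`((tN, s) · f)(rN, uH) = α_s(f(s⁻¹rtN, t⁻¹uH))`. -/
def etaAction [IsClosed (N : Set G)] [Fact (N ≤ H)] :
    CStarAction ((G ⧸ N) × G) C₀((G ⧸ N) × (G ⧸ H), A) :=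
  c0Action (α.ofSnd (G ⧸ N))
    { toFun := fun k x => ((k.2 : G ⧸ N) * x.1 * k.1⁻¹, quotCosetAction N H k.1 x.2)
      one_apply := fun x => by simp [(quotCosetAction N H).one_apply]
      mul_apply := fun k l x => by
        refine Prod.ext ?_ ((quotCosetAction N H).mul_apply _ _ _)
        simp only [Prod.snd_mul, Prod.fst_mul, QuotientGroup.mk_mul]
        group
      continuous_uncurry := by
        have h1 : Continuous fun q : ((G ⧸ N) × G) × ((G ⧸ N) × (G ⧸ H)) => (q.1.2 : G ⧸ N) :=
          QuotientGroup.continuous_mk.comp (continuous_snd.comp continuous_fst)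
        have h2 : Continuous fun q : ((G ⧸ N) × G) × ((G ⧸ N) × (G ⧸ H)) => q.1.1 :=
          continuous_fst.comp continuous_fst
        have h3 : Continuous fun q : ((G ⧸ N) × G) × ((G ⧸ N) × (G ⧸ H)) => q.2 :=
          continuous_snd
        exact ((h1.mul h3.fst).mul h2.inv).prodMk (h2.spaceAction _ h3.snd) }

/-- The symmetric imprimitivity data with `P = G/N × G × G/N`, the left action
`(tN, s) · (rN, u, vN) = (trN, su, tvN)` of `K = G/N × G`, the right action
`(rN, u, vN) · (hN, y) = (ryN, uy, vhN)` of `L = H/N × G`, `σ = id × α` and `η = id`. -/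
def greenData [IsClosed (N : Set G)] [IsClosed (H : Set G)] [Fact (N ≤ H)] :
    SymmetricData ((G ⧸ N) × G) (quotSubgroup N H × G) ((G ⧸ N) × G × (G ⧸ N)) A where
  left :=
    { toFun := fun k p => (k.1 * p.1, k.2 * p.2.1, k.1 * p.2.2)
      one_apply := fun p => by simp
      mul_apply := fun k l p => by simp [mul_assoc]
      continuous_uncurry := by fun_prop }
  right := SpaceAction.ofRight
    (fun p l => (p.1 * (l.2 : G ⧸ N), p.2.1 * l.2, p.2.2 * (l.1 : G ⧸ N)))
    (fun p => by simp) (fun p l m => by simp [mul_assoc]) (by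
      have h1 : Continuous fun q : ((G ⧸ N) × G × (G ⧸ N)) × (quotSubgroup N H × G) =>
          (q.2.2 : G ⧸ N) := QuotientGroup.continuous_mk.comp (continuous_snd.comp continuous_snd)
      fun_prop)
  commute s t p := by simp [SpaceAction.ofRight, mul_assoc]
  left_free s p h := by
    have h1 := congrArg Prod.fst h
    have h2 := congrArg (fun q => q.2.1) h
    exact Prod.ext (mul_eq_right.1 h1) (mul_eq_right.1 h2)
  right_free t p h := by
    have h1 := congrArg (fun q => q.2.1) h
    have h2 := congrArg (fun q => q.2.2) h
    have h3 : t⁻¹ = 1 :=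
      Prod.ext (Subtype.ext (mul_eq_left.1 h2)) (mul_eq_left.1 h1)
    exact inv_eq_one.1 h3
  left_proper := by
    refine (Function.LeftInverse.isClosedEmbedding
      (f := fun q : ((G ⧸ N) × G × (G ⧸ N)) × ((G ⧸ N) × G × (G ⧸ N)) =>
        ((q.1.1 * q.2.1⁻¹, q.1.2.1 * q.2.2.1⁻¹), q.2)) ?_ (by fun_prop) ?_).isProperMap
    · rintro ⟨⟨t, s⟩, r, u, v⟩
      simp
    · exact Continuous.prodMk (by fun_prop) continuous_snd
  right_proper := by
    have h1 : IsClosedEmbedding fun q : (quotSubgroup N H × G) × ((G ⧸ N) × G × (G ⧸ N)) =>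
        (((q.1.1 : G ⧸ N), q.1.2), q.2) :=
      (((isClosed_quotSubgroup N H).isClosedEmbedding_subtypeVal.prodMap
        IsClosedEmbedding.id).prodMap IsClosedEmbedding.id)
    have h2 : IsClosedEmbedding fun q : ((G ⧸ N) × G) × ((G ⧸ N) × G × (G ⧸ N)) =>
        ((q.2.1 * ((q.1.2⁻¹ : G) : G ⧸ N), q.2.2.1 * q.1.2⁻¹, q.2.2.2 * q.1.1⁻¹), q.2) := by
      have hc : Continuous fun q : ((G ⧸ N) × G) × ((G ⧸ N) × G × (G ⧸ N)) =>
          ((q.1.2⁻¹ : G) : G ⧸ N) :=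
        QuotientGroup.continuous_mk.comp (continuous_snd.comp continuous_fst).inv
      refine Function.LeftInverse.isClosedEmbedding
        (f := fun q : ((G ⧸ N) × G × (G ⧸ N)) × ((G ⧸ N) × G × (G ⧸ N)) =>
          ((q.1.2.2⁻¹ * q.2.2.2, q.1.2.1⁻¹ * q.2.2.1), q.2)) ?_ (by fun_prop) (by fun_prop)
      rintro ⟨⟨t, s⟩, r, u, v⟩
      simp
    exact (h2.comp h1).isProperMap
  σ := α.ofSnd (G ⧸ N)
  η := CStarAction.trivial _ A
  σ_commute s t a := by simp [CStarAction.trivial]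

variable {N H}

/-- The isomorphism `i` is the canonical one: for `f ∈ C_c(H/N × G, C₀(G/N, A))`, the function
`hN ↦ f(hN, ·)` belongs to `C_c(H/N, (A ⊗ C₀(G/N)) ⋊ G)`, and `i` carries it to `f`. -/
def IsCanonicalRight [IsClosed (N : Set G)] [IsClosed (H : Set G)] [Fact (N ≤ H)]
    {α : CStarAction G A} {μG : HaarMeasure G} {μHN : HaarMeasure (quotSubgroup N H)}
    (i : CrossedProduct ((betaAction α N μG).restrict (quotSubgroup N H)) μHN ≃⋆ₐ[ℂ]
      CrossedProduct (gammaAction α N H) (μHN.prod μG)) : Prop :=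
  ∀ f : ConvAlg (gammaAction α N H) (μHN.prod μG),
    ∃ (f₁ : ConvAlg ((betaAction α N μG).restrict (quotSubgroup N H)) μHN)
      (g : quotSubgroup N H → ConvAlg (ltAction α N) μG),
      (∀ h s, g h s = f (h, s)) ∧ (∀ h, f₁ h = CrossedProduct.of (g h)) ∧
        i (CrossedProduct.of f₁) = CrossedProduct.of f

/-- The isomorphism `ι` is the canonical one: for `f ∈ C_c(G/N × G, C₀(G/N × G/H, A))`, the
function `(tN, uH) ↦ (s ↦ f(tN, s)(·, uH))` belongs to
`C_c(G/N, ((A ⊗ C₀(G/N)) ⋊ G) ⊗ C₀(G/H))`, and `ι` carries it to `f`. The coset `uH` is regarded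
as a point of the coset space of `H/N` in `G/N`. -/
def IsCanonicalLeft [IsClosed (N : Set G)] [IsClosed (H : Set G)] [Fact (N ≤ H)]
    {α : CStarAction G A} {μG : HaarMeasure G} {μGN : HaarMeasure (G ⧸ N)}
    (ι : CrossedProduct (Green.leftAction (betaAction α N μG) (quotSubgroup N H)) μGN ≃⋆ₐ[ℂ]
      CrossedProduct (etaAction α N H) (μGN.prod μG)) : Prop :=
  ∀ f : ConvAlg (etaAction α N H) (μGN.prod μG),
    ∃ (f₁ : ConvAlg (Green.leftAction (betaAction α N μG) (quotSubgroup N H)) μGN)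
      (g : G ⧸ N → G → ConvAlg (ltAction α N) μG),
      (∀ t u s r, g t u s r = f (t, s) (r, (u : G ⧸ H))) ∧
        (∀ t (u : G), f₁ t ((u : G ⧸ N) : (G ⧸ N) ⧸ quotSubgroup N H) =
          CrossedProduct.of (g t u)) ∧
        ι (CrossedProduct.of f₁) = CrossedProduct.of f

end Setup

end CrossedProd

end

open CrossedProd

set_option linter.unusedSimpArgs false

noncomputable section

namespace CrossedProd

/-! ### Haar integrals: right translation, inversion and product groups. -/

namespace HaarMeasure

section Basic

variable {G : Type*} [Group G] [TopologicalSpace G]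
variable {E : Type*} [NormedAddCommGroup E] [NormedSpace ℝ E]

/-! Write `Q = G/N`, `S = H/N` and `B = (A ⊗ C₀(G/N)) ⋊ G`. All the isomorphisms come from reading a
function on a product as a function of one variable whose values are functions of the others; the
work is to show that this is compatible with the universal norms.

The isomorphism `i` says that an iterated crossed product is a crossed product by the product group
(`CrossedProduct.exists_iterated_equiv`). For `ι` one also needs `(C₀(X, A)) ⋊ G ≅ C₀(X, A ⋊ G)`
when `G` acts trivially on `X` (`CrossedProduct.exists_c0_equiv`), together with `(G/N)/(H/N) =
G/H`. The maps `Γ` and `Υ` exist because the orbit maps of `L` and `K` on `P` are explicit, `(r, u,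
v) ↦ (ur⁻¹, vH)` and `(r, u, v) ↦ r⁻¹v`, and the coordinate `u` untwists the coefficient action
(`exists_ind_equiv`).

For the bimodules, `greenEmb` sends `z ∈ C_c(P, A)` to the function on `Q` whose value at `v` is the
element `(u, q) ↦ Δ(u)^(-1/2) z(q⁻¹u, u, v)` of `B`. The substitution `r = q⁻¹u` undoes `Γ`, since
then `ur⁻¹ = q`. The power of `Δ` absorbs the difference between the symmetric normalisation of
`W(P)` and the plain convolution of `B`. With it the four operations of `W(P)` correspond exactly to
those of the Green bimodule (`greenEmb_lact`, `greenEmb_ract`, `linner_greenEmb`,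
`rinner_greenEmb`), and the range is dense (`exists_innerSeminorm_sub_greenEmb_lt`). By
`nonempty_bimoduleIso_of_dense` this suffices once the Green bimodule is known to have bounded
operations; for `W(P)` nothing has to be proved separately, because its seminorm and its operations
are transported.

The analytic core is therefore `Green.isBounded_bimodule`. The right inner product is positive
because `⟨x, x⟩` is an integral of elements `y* y` with weights from a Bruhat function
(`Green.of_rinner_self`), the left one because `⟨x, x⟩` is an `L¹`-limit of elements `w w*`
(`Green.exists_l1Norm_linner_sub_le`). Positivity gives Cauchy–Schwarz inequalities and two
seminorms. Each action is an integral of isometric translations and of adjointable multiplications,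
hence is bounded by the `L¹`-norm, and then by the universal norm. The imprimitivity relation
finally bounds the left seminorm by the right one (`Green.lnorm_le_rnorm`).

Two principles are used throughout. A submultiplicative seminorm `q` below the `L¹`-norm with `q(f)²
≤ q(f* f)` lies below the universal norm (`ConvAlg.le_norm_of_sq_le`). An action satisfying a
Cauchy–Schwarz inequality is automatically contractive as soon as each orbit is bounded by some
constant (`action_le_of_orbit_bound`). -/

lemma int_smul_const [CompleteSpace E] (μ : HaarMeasure G) (f : G → ℝ) (x : E) :
    μ.int (fun t => f t • x) = μ.int f • x := by
  let _ : MeasurableSpace G := borel G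
  exact integral_smul_const f x

lemma int_sub (μ : HaarMeasure G) {f g : G → E} (hf : Continuous f) (hfc : HasCompactSupport f)
    (hg : Continuous g) (hgc : HasCompactSupport g) :
    μ.int (fun t => f t - g t) = μ.int f - μ.int g := by
  let _ : MeasurableSpace G := borel G
  exact integral_sub (μ.integrable' hf hfc) (μ.integrable' hg hgc)

/-- Two elements of a Banach space are equal if all functionals agree on them. -/
lemma eq_of_dual {x y : E} (h : ∀ L : E →L[ℝ] ℝ, L x = L y) : x = y :=
  SeparatingDual.eq_iff_forall_dual_eq.2 h

variable [IsTopologicalGroup G] [LocallyCompactSpace G]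

lemma exists_nonneg_int_pos (μ : HaarMeasure G) {U : Set G} (hU : U ∈ 𝓝 (1 : G)) :
    ∃ b : G → ℝ, Continuous b ∧ HasCompactSupport b ∧ (∀ s, 0 ≤ b s) ∧ (∀ s, b s ≠ 0 → s ∈ U) ∧
      0 < μ.int b := by
  let _ : MeasurableSpace G := borel G
  have _ : BorelSpace G := ⟨rfl⟩
  have := μ.isHaar
  obtain ⟨f, h1, h2, h3, h4⟩ := exists_continuous_one_zero_of_isCompact (X := G)
    (isCompact_singleton (x := (1 : G))) (isOpen_interior (s := U)).isClosed_compl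
    (by simpa [mem_interior_iff_mem_nhds] using hU)
  refine ⟨f, f.continuous, h3, fun s => (h4 s).1, fun s hs => ?_, ?_⟩
  · by_contra hn
    exact hs (h2 fun hi => hn (interior_subset hi))
  · refine f.continuous.integral_pos_of_hasCompactSupport_nonneg_nonzero h3 (fun s => (h4 s).1)
      (x := 1) ?_
    rw [h1 rfl]
    simp

/-- The constant is the integral of a cutoff function equal to 1 on `K`, so it depends on `K` alone.
This converts uniform estimates with a common compact support into `L¹`-estimates. -/
lemma exists_int_le_mul (μ : HaarMeasure G) {K : Set G} (hK : IsCompact K) :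
    ∃ c : ℝ, 0 ≤ c ∧ ∀ (f : G → ℝ) (M : ℝ), Continuous f → (∀ t, f t ≠ 0 → t ∈ K) →
      (∀ t, f t ≤ M) → 0 ≤ M → μ.int f ≤ c * M := by
  obtain ⟨g, h1, -, h3, h4⟩ := exists_continuous_one_zero_of_isCompact (X := G) hK isClosed_empty
    (disjoint_empty K)
  refine ⟨μ.int g, μ.int_nonneg fun t => (h4 t).1, fun f M hf hfK hfM hM => ?_⟩
  have hfc : HasCompactSupport f :=
    HasCompactSupport.intro' hK.closure isClosed_closure
      fun t ht => by_contra fun hn => ht (subset_closure (hfK t hn))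
  have : μ.int f ≤ μ.int fun t => M * g t := by
    refine μ.int_mono hf hfc (continuous_const.mul g.continuous) (h3.mul_left) fun t => ?_
    by_cases ht : t ∈ K
    · rw [h1 ht]
      simpa using hfM t
    · have h0 : f t = 0 := by_contra fun hn => ht (hfK t hn)
      rw [h0]
      exact mul_nonneg hM (h4 t).1
  refine this.trans_eq ?_
  rw [mul_comm]
  exact μ.int_smul M g

/-- The right translate of `μ` is again left invariant, hence a multiple of `μ` on compactly
supported functions; the factor is the modular character. -/
lemma int_mul_right_real (μ : HaarMeasure G) {f : G → ℝ} (hf : Continuous f)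
    (hc : HasCompactSupport f) (r : G) :
    μ.int (fun s => f (s * r)) = (modular r)⁻¹ * μ.int f := by
  let _ : MeasurableSpace G := borel G
  have _ : BorelSpace G := ⟨rfl⟩
  have := μ.isHaar
  have h := Measure.integral_isMulLeftInvariant_eq_smul_of_hasCompactSupport
    (Measure.map (· * r) μ.measure) μ.measure hf hc
  rw [integral_map (AEMeasurable.mul_const aemeasurable_id' _) hf.aestronglyMeasurable,
    ← Measure.modularCharacterFun_eq_haarScalarFactor, integral_smul_nnreal_measure] at h
  refine h.trans ?_
  rw [modular, inv_inv]
  rfl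

variable [CompleteSpace E]

lemma int_mul_right (μ : HaarMeasure G) {f : G → E} (hf : Continuous f)
    (hc : HasCompactSupport f) (r : G) :
    μ.int (fun s => f (s * r)) = (modular r)⁻¹ • μ.int f := by
  refine eq_of_dual fun L => ?_
  rw [map_smul, μ.map_int L hf hc, μ.map_int L (f := fun s => f (s * r)) (hf.comp (continuous_mul_const r))
    (hc.comp_homeomorph (Homeomorph.mulRight r)), smul_eq_mul]
  exact μ.int_mul_right_real (L.continuous.comp hf) (hc.comp_left (g := L) (map_zero L)) r

/-- Integrate `g(ts) f(s)` over `G × G` in both orders, where `g` is a bump function. Integrating in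
`t` first gives `∫ g` times `∫ Δ(s)⁻¹ f(s) ds` by right translation. Integrating in `s` first, left
invariance turns the kernel into `g(s) f(t⁻¹s)`, and a second exchange gives `∫ g` times `∫ f(t⁻¹)
dt`. Cancel `∫ g > 0`. -/
lemma int_inv (μ : HaarMeasure G) {f : G → E} (hf : Continuous f) (hc : HasCompactSupport f) :
    μ.int (fun s => f s⁻¹) = μ.int fun s => (modular s)⁻¹ • f s := by
  obtain ⟨g, hg, hgc, -, -, hpos⟩ := μ.exists_nonneg_int_pos (univ_mem : univ ∈ 𝓝 (1 : G))
  have hmod : Continuous fun s : G => (modular s)⁻¹ :=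
    continuous_modular.inv₀ fun s => (modular_pos s).ne'
  let F : G → G → E := fun s t => g (t * s) • f s
  have hF : Continuous F.uncurry :=
    (hg.comp (continuous_snd.mul continuous_fst)).smul (hf.comp continuous_fst)
  have hFc : HasCompactSupport F.uncurry := by
    -- `G` need not be Hausdorff here, so the compact set must be shown to be closed separately.
    refine HasCompactSupport.intro' (K := tsupport f ×ˢ (tsupport g * (tsupport f)⁻¹))
      (IsCompact.prod hc (IsCompact.mul hgc (IsCompact.inv hc))) ?_ ?_
    · exact (isClosed_tsupport f).prod
        (IsClosed.mul_right_of_isCompact (isClosed_tsupport g) (IsCompact.inv hc))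
    · rintro ⟨s, t⟩ h
      by_contra hne
      have h1 : g (t * s) ≠ 0 := left_ne_zero_of_smul hne
      have h2 : f s ≠ 0 := right_ne_zero_of_smul hne
      exact h ⟨subset_tsupport _ h2, t * s, subset_tsupport _ h1, s⁻¹,
        Set.inv_mem_inv.2 (subset_tsupport _ h2), by simp⟩
  have hswap := μ.int_swap μ hF hFc
  have h1 : (μ.int fun s => μ.int fun t => F s t) =
      μ.int g • μ.int fun s => (modular s)⁻¹ • f s := by
    rw [← μ.int_smul]
    refine μ.int_congr fun s => ?_
    rw [μ.int_smul_const, μ.int_mul_right hg hgc, smul_smul, smul_eq_mul, mul_comm]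
  have h2 : (μ.int fun t => μ.int fun s => F s t) = μ.int g • μ.int fun s => f s⁻¹ := by
    have e1 : ∀ t, (μ.int fun s => F s t) = μ.int fun s => g s • f (t⁻¹ * s) := fun t => by
      rw [← μ.int_mul_left (fun s => g s • f (t⁻¹ * s)) t]
      exact μ.int_congr fun s => by simp [F]
    rw [μ.int_congr e1]
    let F' : G → G → E := fun t s => g s • f (t⁻¹ * s)
    have hF' : Continuous F'.uncurry :=
      (hg.comp continuous_snd).smul (hf.comp (continuous_fst.inv.mul continuous_snd))
    have hFc' : HasCompactSupport F'.uncurry := by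
      refine HasCompactSupport.intro' (K := (tsupport g * (tsupport f)⁻¹) ×ˢ tsupport g)
        (IsCompact.prod (IsCompact.mul hgc (IsCompact.inv hc)) hgc) ?_ ?_
      · exact (IsClosed.mul_right_of_isCompact (isClosed_tsupport g) (IsCompact.inv hc)).prod
          (isClosed_tsupport g)
      · rintro ⟨t, s⟩ h
        by_contra hne
        have h1 : g s ≠ 0 := left_ne_zero_of_smul hne
        have h2 : f (t⁻¹ * s) ≠ 0 := right_ne_zero_of_smul hne
        exact h ⟨⟨s, subset_tsupport _ h1, (t⁻¹ * s)⁻¹,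
          Set.inv_mem_inv.2 (subset_tsupport _ h2), by simp⟩, subset_tsupport _ h1⟩
    refine (μ.int_swap μ hF' hFc').trans ?_
    rw [← μ.int_smul_const]
    refine μ.int_congr fun s => ?_
    change (μ.int fun t => g s • f (t⁻¹ * s)) = _
    rw [μ.int_smul, ← μ.int_mul_left _ s]
    congr 1
    exact μ.int_congr fun t => by simp
  rw [h1, h2] at hswap
  exact (smul_right_injective E hpos.ne' hswap).symm

/-- The substitution `s ↦ s⁻¹`. -/
lemma int_inv' (μ : HaarMeasure G) {f : G → E} (hf : Continuous f) (hc : HasCompactSupport f) :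
    μ.int (fun s => (modular s)⁻¹ • f s⁻¹) = μ.int f := by
  have h := μ.int_inv (f := fun s => modular s • f s) (continuous_modular.smul hf) hc.smul_left
  simp only [modular_inv] at h
  rw [h]
  exact μ.int_congr fun s => by rw [smul_smul, inv_mul_cancel₀ (modular_pos s).ne', one_smul]

end Basic

section Product

variable {G H : Type*} [Group G] [TopologicalSpace G] [IsTopologicalGroup G]
  [LocallyCompactSpace G] [T2Space G] [Group H] [TopologicalSpace H] [IsTopologicalGroup H]
  [LocallyCompactSpace H] [T2Space H]
variable {E : Type*} [NormedAddCommGroup E] [NormedSpace ℝ E] [CompleteSpace E]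

/-- For real functions this is the defining property of the Riesz measure; vector-valued functions
are reduced to it by continuous functionals. -/
lemma int_prod (μ : HaarMeasure G) (ν : HaarMeasure H) {f : G × H → E} (hf : Continuous f)
    (hc : HasCompactSupport f) :
    (μ.prod ν).int f = μ.int fun s => ν.int fun t => f (s, t) := by
  refine eq_of_dual fun L => ?_
  rw [HaarMeasure.map_int _ L hf hc, μ.map_int L (continuous_slice_int ν hf hc)
    (hasCompactSupport_slice_int ν hc)]
  have h1 : ∀ s, L (ν.int fun t => f (s, t)) = ν.int fun t => L (f (s, t)) := fun s =>
    ν.map_int L (hf.comp (Continuous.prodMk_right s)) (hasCompactSupport_slice hc s)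
  rw [μ.int_congr h1]
  let _ : MeasurableSpace (G × H) := borel (G × H)
  have _ : BorelSpace (G × H) := ⟨rfl⟩
  exact RealRMK.integral_rieszMeasure (iteratedIntegral μ ν)
    ⟨⟨fun q => L (f q), L.continuous.comp hf⟩, hc.comp_left (g := L) (map_zero L)⟩

/-- Right translation of a function with nonzero integral determines the modular function, and the
iterated integral can be translated one variable at a time. -/
lemma _root_.CrossedProd.modular_prod (μ : HaarMeasure G) (ν : HaarMeasure H) (s : G) (t : H) :
    modular (s, t) = modular s * modular t := by
  obtain ⟨b, hb, hbc, h0, -, hpos⟩ :=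
    (μ.prod ν).exists_nonneg_int_pos (univ_mem : univ ∈ 𝓝 (1 : G × H))
  have h1 := (μ.prod ν).int_mul_right hb hbc (s, t)
  have h2 : ((μ.prod ν).int fun q => b (q * (s, t))) =
      (modular s)⁻¹ • (modular t)⁻¹ • (μ.prod ν).int b := by
    rw [int_prod μ ν (f := fun q => b (q * (s, t))) (hb.comp (continuous_mul_const (s, t)))
      (hbc.comp_homeomorph (Homeomorph.mulRight (s, t))), int_prod μ ν hb hbc, ← μ.int_smul,
      ← μ.int_mul_right (f := fun s' => (modular t)⁻¹ • ν.int fun t' => b (s', t'))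
        (by have := continuous_slice_int ν hb hbc; fun_prop)
        ((hasCompactSupport_slice_int ν hbc).smul_left (f := fun _ => (modular t)⁻¹))]
    refine μ.int_congr fun s' => ?_
    exact ν.int_mul_right (f := fun t' => b (s' * s, t'))
      (hb.comp (Continuous.prodMk_right _)) (hasCompactSupport_slice hbc _) t
  rw [h1, smul_smul] at h2
  have h3 := smul_left_injective ℝ hpos.ne' h2
  rw [← inv_inj, h3, mul_inv]

end Product

end HaarMeasure

end CrossedProd

end

noncomputable section

namespace CrossedProd

/-! ### Automatic boundedness -/

/-- Iterating the first inequality gives `(u 0 / k)^(2^n) ≤ u n / k`, which is at most `(C / k)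
M^(2^n)`; taking `2^n`-th roots, the constant `C` disappears in the limit. -/
lemma le_mul_of_forall_sq_le {u : ℕ → ℝ} {k C M : ℝ} (hu : ∀ n, 0 ≤ u n) (hk : 0 ≤ k)
    (hM : 0 ≤ M) (h : ∀ n, u n ^ 2 ≤ k * u (n + 1)) (hb : ∀ n, u n ≤ C * M ^ 2 ^ n) :
    u 0 ≤ k * M := by
  rcases hk.eq_or_lt with rfl | hk
  · have := h 0
    rw [zero_mul] at this ⊢
    nlinarith [hu 0]
  have h1 : ∀ n, (u 0 / k) ^ 2 ^ n ≤ u n / k := by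
    intro n
    induction n with
    | zero => simp
    | succ n ih =>
      rw [pow_succ, pow_mul]
      refine (pow_le_pow_left₀ (pow_nonneg (div_nonneg (hu 0) hk.le) _) ih 2).trans ?_
      rw [div_pow, div_le_div_iff₀ (by positivity) hk]
      nlinarith [h n, mul_le_mul_of_nonneg_right (h n) hk.le]
  by_contra hlt
  rw [not_le, ← lt_div_iff₀' hk] at hlt
  set v := u 0 / k
  have hv : 0 < v := hM.trans_lt hlt
  -- The midpoint replaces `M` because `M` may vanish; the quotient is well defined and still
  -- exceeds 1.
  have h2 : ∀ n, (v / ((M + v) / 2)) ^ 2 ^ n ≤ C / k := by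
    intro n
    have hm : 0 < (M + v) / 2 := by linarith
    rw [div_pow, div_le_iff₀ (by positivity)]
    refine (h1 n).trans ?_
    rw [div_mul_eq_mul_div]
    refine div_le_div_of_nonneg_right ((hb n).trans ?_) hk.le
    by_cases hC : 0 ≤ C
    · exact mul_le_mul_of_nonneg_left (pow_le_pow_left₀ hM (by linarith) _) hC
    · exfalso
      have h0 := hb 0
      have h3 : u 0 ≤ 0 := h0.trans (by
        simp only [pow_zero, pow_one]
        nlinarith)
      have : v ≤ 0 := div_nonpos_of_nonpos_of_nonneg h3 hk.le
      linarith
  have h3 : Tendsto (fun n : ℕ => (v / ((M + v) / 2)) ^ 2 ^ n) atTop atTop :=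
    (tendsto_pow_atTop_atTop_of_one_lt (by rw [one_lt_div (by linarith)]; linarith)).comp
      (tendsto_pow_atTop_atTop_of_one_lt one_lt_two)
  obtain ⟨n, hn⟩ := (h3.eventually_gt_atTop (C / k)).exists
  linarith [h2 n]

/-- An action of a normed *-algebra which satisfies a Cauchy–Schwarz inequality and is bounded on
each orbit is contractive. -/
lemma action_le_of_orbit_bound {𝓑 V : Type*} [NonUnitalRing 𝓑] [StarRing 𝓑] {N : 𝓑 → ℝ}
    (hN0 : ∀ a, 0 ≤ N a) (hNmul : ∀ a b, N (a * b) ≤ N a * N b) (hNstar : ∀ a, N (star a) = N a)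
    {nV : V → ℝ} (hV : ∀ x, 0 ≤ nV x) {T : 𝓑 → V → V}
    (h : ∀ a x, nV (T a x) ^ 2 ≤ nV x * nV (T (star a * a) x))
    (hC : ∀ x, ∃ C, ∀ a, nV (T a x) ≤ C * N a) (a : 𝓑) (x : V) : nV (T a x) ≤ N a * nV x := by
  obtain ⟨C, hC⟩ := hC x
  -- `b n` is `(a* a)^(2^n)`. It is self-adjoint, so the hypothesis applied to it reads `u n ^ 2 ≤
  -- nV x * u (n + 1)` for `u n = nV (T (b n) x)`, as `le_mul_of_forall_sq_le` requires. The orbit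
  -- constant `C` plays no role in the conclusion.
  let b : ℕ → 𝓑 := fun n => Nat.rec (star a * a) (fun _ c => c * c) n
  have hb0 : b 0 = star a * a := rfl
  have hbs : ∀ n, b (n + 1) = b n * b n := fun n => rfl
  have hbstar : ∀ n, star (b n) = b n := by
    intro n
    induction n with
    | zero => rw [hb0, star_mul, star_star]
    | succ n ih => rw [hbs, star_mul, ih]
  have hbN : ∀ n, N (b n) ≤ N (b 0) ^ 2 ^ n := by
    intro n
    induction n with
    | zero => simp
    | succ n ih =>
      rw [hbs, pow_succ, pow_mul, sq]
      exact (hNmul _ _).trans (mul_le_mul ih ih (hN0 _) (pow_nonneg (hN0 _) _))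
  have hC0 : ∀ n, nV (T (b n) x) ≤ max C 0 * N (b 0) ^ 2 ^ n := fun n =>
    ((hC (b n)).trans (mul_le_mul_of_nonneg_right (le_max_left _ _) (hN0 _))).trans
      (mul_le_mul_of_nonneg_left (hbN n) (le_max_right _ _))
  have key := le_mul_of_forall_sq_le (u := fun n => nV (T (b n) x)) (fun n => hV _) (hV x)
    (hN0 (b 0)) (fun n => by
      have := h (b n) x
      rwa [hbstar, ← hbs] at this) hC0
  have h2 : nV (T a x) ^ 2 ≤ (N a * nV x) ^ 2 := by
    refine (h a x).trans ((mul_le_mul_of_nonneg_left key (hV x)).trans ?_)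
    have : N (b 0) ≤ N a * N a := (hNmul _ _).trans_eq (by rw [hNstar])
    nlinarith [mul_le_mul_of_nonneg_left this (mul_nonneg (hV x) (hV x))]
  exact (sq_le_sq₀ (hV _) (mul_nonneg (hN0 a) (hV x))).1 h2

namespace ConvAlg

variable {G A : Type*} [Group G] [TopologicalSpace G] [IsTopologicalGroup G]
  [LocallyCompactSpace G] [T2Space G] [NonUnitalCStarAlgebra A]
  {α : CStarAction G A} {μ : HaarMeasure G}

/-- The element of the convolution algebra given by a function. -/
def mk (f : G → A) (hf : Continuous f) (hc : HasCompactSupport f) : ConvAlg α μ :=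
  CompactlySupportedContinuousMap.mk ⟨f, hf⟩ hc

lemma sub_apply (f g : ConvAlg α μ) (s : G) : (f - g) s = f s - g s := rfl

lemma sum_apply {ι : Type*} (I : Finset ι) (f : ι → ConvAlg α μ) (s : G) :
    (∑ i ∈ I, f i) s = ∑ i ∈ I, f i s := by
  classical
  induction I using Finset.induction_on with
  | empty => simp [zero_apply]
  | insert i I hi ih => rw [Finset.sum_insert hi, Finset.sum_insert hi, add_apply, ih]

lemma hasCompactSupport_norm (f : ConvAlg α μ) : HasCompactSupport fun s => ‖f s‖ :=
  f.hasCompactSupport.norm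

lemma continuous_norm (f : ConvAlg α μ) : Continuous fun s => ‖f s‖ := f.continuous.norm

lemma l1Norm_nonneg (f : ConvAlg α μ) : 0 ≤ l1Norm f := μ.int_nonneg fun _ => norm_nonneg _

lemma norm_le_l1Norm (f : ConvAlg α μ) : ‖f‖ ≤ l1Norm f := universalNorm_le_l1Norm f

/-- The `L¹`-norm as a seminorm. -/
def l1Seminorm (α : CStarAction G A) (μ : HaarMeasure G) : Seminorm ℂ (ConvAlg α μ) :=
  Seminorm.of l1Norm (fun f g => by
    rw [l1Norm, l1Norm, l1Norm, ← μ.int_add f.continuous_norm f.hasCompactSupport_norm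
      g.continuous_norm g.hasCompactSupport_norm]
    exact μ.int_mono (f + g).continuous_norm (f + g).hasCompactSupport_norm
      (f.continuous_norm.add g.continuous_norm)
      (f.hasCompactSupport_norm.add g.hasCompactSupport_norm) fun t => norm_add_le _ _)
    fun c f => by
      rw [l1Norm, l1Norm, ← smul_eq_mul, ← μ.int_smul]
      exact μ.int_congr fun t => by rw [smul_apply, norm_smul, smul_eq_mul]

lemma l1Seminorm_apply (f : ConvAlg α μ) : l1Seminorm α μ f = l1Norm f := rfl

lemma l1Norm_star (f : ConvAlg α μ) : l1Norm (star f) = l1Norm f := by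
  rw [l1Norm, l1Norm, ← μ.int_inv' f.continuous_norm f.hasCompactSupport_norm]
  refine μ.int_congr fun s => ?_
  rw [star_apply, norm_smul, α.norm_apply, norm_star, smul_eq_mul, Real.norm_of_nonneg]
  exact (inv_pos.2 (modular_pos s)).le

lemma norm_mul_apply_le (f g : ConvAlg α μ) (s : G) :
    ‖(f * g) s‖ ≤ μ.int fun t => ‖f t‖ * ‖g (t⁻¹ * s)‖ := by
  have hc : Continuous fun t => ‖f t‖ * ‖g (t⁻¹ * s)‖ := f.continuous_norm.mul
    (g.continuous_norm.comp (continuous_inv.mul continuous_const))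
  have hcc : HasCompactSupport fun t => ‖f t‖ * ‖g (t⁻¹ * s)‖ :=
    f.hasCompactSupport_norm.mul_right
  rw [mul_apply]
  refine (μ.norm_int_le _).trans (μ.int_mono (continuous_convIntegrand' f g s).norm
    (hasCompactSupport_convIntegrand f g s).norm hc hcc fun t => ?_)
  refine (norm_mul_le _ _).trans_eq ?_
  rw [α.norm_apply]

lemma l1Norm_mul_le (f g : ConvAlg α μ) : l1Norm (f * g) ≤ l1Norm f * l1Norm g := by
  obtain ⟨F, hFdef⟩ : ∃ F : G × G → ℝ, ∀ s t, F (s, t) = ‖f t‖ * ‖g (t⁻¹ * s)‖ :=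
    ⟨fun q => ‖f q.2‖ * ‖g (q.2⁻¹ * q.1)‖, fun _ _ => rfl⟩
  have hF : Continuous F := ((f.continuous_norm.comp continuous_snd).mul
    (g.continuous_norm.comp (continuous_snd.inv.mul continuous_fst))).congr
      fun q => (hFdef q.1 q.2).symm
  have hFc : HasCompactSupport F := by
    refine HasCompactSupport.intro ((IsCompact.mul f.hasCompactSupport g.hasCompactSupport).prod
      f.hasCompactSupport) ?_
    rintro ⟨s, t⟩ h
    by_contra hne
    rw [hFdef] at hne
    have h1 : f t ≠ 0 := norm_ne_zero_iff.1 (left_ne_zero_of_mul hne)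
    have h2 : g (t⁻¹ * s) ≠ 0 := norm_ne_zero_iff.1 (right_ne_zero_of_mul hne)
    exact h ⟨⟨t, subset_tsupport _ h1, _, subset_tsupport _ h2, by simp⟩, subset_tsupport _ h1⟩
  have hle : ∀ s, ‖(f * g) s‖ ≤ μ.int fun t => F (s, t) := fun s => by
    simp only [hFdef]
    exact norm_mul_apply_le f g s
  have hr : ∀ t, (μ.int fun s => F (s, t)) = ‖f t‖ • l1Norm g := fun t => by
    rw [l1Norm, ← μ.int_smul, ← μ.int_mul_left (fun s => F (s, t)) t]
    exact μ.int_congr fun s => by rw [hFdef, inv_mul_cancel_left, smul_eq_mul]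
  calc l1Norm (f * g) ≤ μ.int fun s => μ.int fun t => F (s, t) :=
        μ.int_mono (continuous_norm _) (hasCompactSupport_norm _)
          (continuous_slice_int μ hF hFc) (hasCompactSupport_slice_int μ hFc) hle
    _ = μ.int fun t => μ.int fun s => F (s, t) :=
        μ.int_swap (f := fun s t => F (s, t)) μ hF hFc
    _ = μ.int fun t => ‖f t‖ • l1Norm g := μ.int_congr hr
    _ = l1Norm f * l1Norm g := by rw [μ.int_smul_const]; rfl

lemma exists_l1Norm_le_mul (α : CStarAction G A) (μ : HaarMeasure G) {K : Set G}
    (hK : IsCompact K) : ∃ c : ℝ, 0 ≤ c ∧ ∀ (f : ConvAlg α μ) (M : ℝ), (∀ t, f t ≠ 0 → t ∈ K) →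
      (∀ t, ‖f t‖ ≤ M) → 0 ≤ M → l1Norm f ≤ c * M := by
  obtain ⟨c, hc, h⟩ := μ.exists_int_le_mul hK
  exact ⟨c, hc, fun f M hf hM h0 => h _ M f.continuous_norm
    (fun t ht => hf t (norm_ne_zero_iff.1 ht)) hM h0⟩

/-- A submultiplicative seminorm below the `L¹`-norm which satisfies `q(f)² ≤ q(f* f)` is
dominated by the universal norm. -/
lemma le_norm_of_sq_le (q : Seminorm ℂ (ConvAlg α μ)) (h1 : ∀ f, q f ≤ l1Norm f)
    (h2 : ∀ f g, q (f * g) ≤ q f * q g) (h3 : ∀ f, q f ^ 2 ≤ q (star f * f)) (f : ConvAlg α μ) :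
    q f ≤ ‖f‖ := by
  -- From `q(f)² ≤ q(f* f) ≤ q(f*) q(f)`. Hence `q` is invariant under the involution and satisfies
  -- the C*-identity, so it takes part in the supremum defining the universal norm.
  have h4 : ∀ f, q f ≤ q (star f) := fun f => by
    rcases (apply_nonneg q f).eq_or_lt with h0 | h0
    · rw [← h0]; exact apply_nonneg q _
    · have := (h3 f).trans (h2 _ _)
      nlinarith
  refine le_universalNorm ⟨h1, h2, fun f => le_antisymm ?_ (h3 f)⟩ f
  refine (h2 _ _).trans ?_
  have h5 := h4 (star f)
  rw [star_star] at h5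
  nlinarith [apply_nonneg q f]

/-- Here too the inequality forces `q` to be invariant under the involution, so it can be applied to
`f*`. Right actions lead to this form. -/
lemma le_norm_of_sq_le' (q : Seminorm ℂ (ConvAlg α μ)) (h1 : ∀ f, q f ≤ l1Norm f)
    (h2 : ∀ f g, q (f * g) ≤ q f * q g) (h3 : ∀ f, q f ^ 2 ≤ q (f * star f)) (f : ConvAlg α μ) :
    q f ≤ ‖f‖ := by
  refine le_norm_of_sq_le q h1 h2 (fun f => ?_) f
  have h4 : q f ≤ q (star f) := by
    rcases (apply_nonneg q f).eq_or_lt with h0 | h0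
    · rw [← h0]; exact apply_nonneg q _
    · have := (h3 f).trans (h2 _ _)
      nlinarith
  have h5 := h3 (star f)
  rw [star_star] at h5
  nlinarith [apply_nonneg q f]

section Operators

variable {V : Type*} [SeminormedAddCommGroup V] [NormedSpace ℂ V]

/-- An action of `C_c(G, A)` on a normed space by operators which is bounded by the `L¹`-norm and
satisfies a Cauchy–Schwarz inequality is bounded by the universal norm. -/
lemma action_le_norm (T : ConvAlg α μ →ₗ[ℂ] V →ₗ[ℂ] V) (hm : ∀ a b x, T (a * b) x = T a (T b x))
    (hcs : ∀ a x, ‖T a x‖ ^ 2 ≤ ‖x‖ * ‖T (star a * a) x‖)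
    (hl : ∀ a x, ‖T a x‖ ≤ l1Norm a * ‖x‖) (a : ConvAlg α μ) (x : V) : ‖T a x‖ ≤ ‖a‖ * ‖x‖ := by
  -- The `L¹`-bound makes every `T a` a bounded operator. The operator norm is then a seminorm in
  -- `a` to which `le_norm_of_sq_le` applies, the Cauchy–Schwarz hypothesis giving `‖S a‖² ≤ ‖S (a*
  -- a)‖`.
  let S : ConvAlg α μ →ₗ[ℂ] (V →L[ℂ] V) :=
    { toFun := fun a => (T a).mkContinuous (l1Norm a) (hl a)
      map_add' := fun a b => by ext x; simp
      map_smul' := fun c a => by ext x; simp }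
  have hS : ∀ a x, S a x = T a x := fun a x => rfl
  have key := le_norm_of_sq_le ((normSeminorm ℂ (V →L[ℂ] V)).comp S)
    (fun a => LinearMap.mkContinuous_norm_le _ (l1Norm_nonneg a) (hl a)) (fun a b => ?_) (fun a => ?_) a
  · exact ((S a).le_opNorm x).trans (mul_le_mul_of_nonneg_right key (norm_nonneg x))
  · have : S (a * b) = (S a).comp (S b) := by
      ext x
      exact hm a b x
    change ‖S (a * b)‖ ≤ _
    rw [this]
    exact ContinuousLinearMap.opNorm_comp_le _ _
  · change ‖S a‖ ^ 2 ≤ ‖S (star a * a)‖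
    rw [← Real.le_sqrt (norm_nonneg _) (norm_nonneg _)]
    refine ContinuousLinearMap.opNorm_le_bound _ (Real.sqrt_nonneg _) fun x => ?_
    refine (sq_le_sq₀ (norm_nonneg _) (by positivity)).1 ?_
    rw [mul_pow, Real.sq_sqrt (norm_nonneg _)]
    refine (hcs a x).trans ?_
    have := (S (star a * a)).le_opNorm x
    rw [hS] at this
    nlinarith [norm_nonneg x]

/-- The analogue of `action_le_norm` for right actions. -/
lemma action_le_norm' (T : ConvAlg α μ →ₗ[ℂ] V →ₗ[ℂ] V) (hm : ∀ a b x, T (a * b) x = T b (T a x))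
    (hcs : ∀ a x, ‖T a x‖ ^ 2 ≤ ‖x‖ * ‖T (a * star a) x‖)
    (hl : ∀ a x, ‖T a x‖ ≤ l1Norm a * ‖x‖) (a : ConvAlg α μ) (x : V) : ‖T a x‖ ≤ ‖a‖ * ‖x‖ := by
  let S : ConvAlg α μ →ₗ[ℂ] (V →L[ℂ] V) :=
    { toFun := fun a => (T a).mkContinuous (l1Norm a) (hl a)
      map_add' := fun a b => by ext x; simp
      map_smul' := fun c a => by ext x; simp }
  have hS : ∀ a x, S a x = T a x := fun a x => rfl
  have key := le_norm_of_sq_le' ((normSeminorm ℂ (V →L[ℂ] V)).comp S)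
    (fun a => LinearMap.mkContinuous_norm_le _ (l1Norm_nonneg a) (hl a)) (fun a b => ?_) (fun a => ?_) a
  · exact ((S a).le_opNorm x).trans (mul_le_mul_of_nonneg_right key (norm_nonneg x))
  · have : S (a * b) = (S b).comp (S a) := by
      ext x
      exact hm a b x
    change ‖S (a * b)‖ ≤ ‖S a‖ * ‖S b‖
    rw [this, mul_comm]
    exact ContinuousLinearMap.opNorm_comp_le _ _
  · change ‖S a‖ ^ 2 ≤ ‖S (a * star a)‖
    rw [← Real.le_sqrt (norm_nonneg _) (norm_nonneg _)]
    refine ContinuousLinearMap.opNorm_le_bound _ (Real.sqrt_nonneg _) fun x => ?_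
    refine (sq_le_sq₀ (norm_nonneg _) (by positivity)).1 ?_
    rw [mul_pow, Real.sq_sqrt (norm_nonneg _)]
    refine (hcs a x).trans ?_
    have := (S (a * star a)).le_opNorm x
    rw [hS] at this
    nlinarith [norm_nonneg x]

end Operators

section Dense

variable {𝒜 : Type*} [NonUnitalRing 𝒜] [StarRing 𝒜] [Module ℂ 𝒜]

/-- A C*-seminorm on an `L¹`-dense *-subalgebra which is dominated by the `L¹`-norm is dominated
by the universal norm. -/
lemma le_norm_of_l1_dense (j : 𝒜 →ₗ[ℂ] ConvAlg α μ) (jmul : ∀ a b, j (a * b) = j a * j b)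
    (jstar : ∀ a, j (star a) = star (j a))
    (hd : ∀ (f : ConvAlg α μ) (e : ℝ), 0 < e → ∃ a, l1Norm (f - j a) < e)
    (q : Seminorm ℂ 𝒜) (hq1 : ∀ a, q a ≤ l1Norm (j a)) (hq2 : ∀ a b, q (a * b) ≤ q a * q b)
    (hq3 : ∀ a, q a ^ 2 ≤ q (star a * a)) (a : 𝒜) : q a ≤ ‖j a‖ := by
  have hbdd : ∀ f : ConvAlg α μ, BddBelow (range fun z : 𝒜 => q z + l1Seminorm α μ (f - j z)) :=
    fun f => ⟨0, by rintro _ ⟨z, rfl⟩; positivity⟩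
  have hl : ∀ f g, l1Seminorm α μ (f * g) ≤ l1Seminorm α μ f * l1Seminorm α μ g := l1Norm_mul_le
  -- The largest seminorm on the whole convolution algebra which is at most `q` on `𝒜` and at most
  -- the `L¹`-norm. Since `q` is itself dominated by the `L¹`-norm, it restricts to `q`.
  let Q : Seminorm ℂ (ConvAlg α μ) := Seminorm.ofSMulLE
    (fun f => ⨅ z : 𝒜, (q z + l1Seminorm α μ (f - j z)))
    (le_antisymm ((ciInf_le (hbdd 0) 0).trans_eq (by simp)) (le_ciInf fun z => by positivity))
    (fun f g => le_ciInf_add_ciInf fun z w => (ciInf_le (hbdd _) (z + w)).trans (by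
      have h1 := map_add_le_add q z w
      have h2 := map_add_le_add (l1Seminorm α μ) (f - j z) (g - j w)
      have h3 : f - j z + (g - j w) = f + g - j (z + w) := by rw [map_add]; abel
      rw [h3] at h2
      linarith))
    (fun c f => by
      rw [Real.mul_iInf_of_nonneg (norm_nonneg c)]
      refine le_ciInf fun z => (ciInf_le (hbdd _) (c • z)).trans_eq ?_
      rw [j.map_smul, ← smul_sub, map_smul_eq_mul, map_smul_eq_mul, mul_add])
  have hQ : ∀ f, Q f = ⨅ z : 𝒜, (q z + l1Seminorm α μ (f - j z)) := fun f => rfl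
  have hQ1 : ∀ f, Q f ≤ l1Seminorm α μ f := fun f => by
    rw [hQ]
    exact (ciInf_le (hbdd f) 0).trans_eq (by simp)
  have hQj : ∀ a, Q (j a) = q a := fun a => by
    refine le_antisymm ((ciInf_le (hbdd _) a).trans_eq (by simp)) (le_ciInf fun z => ?_)
    have h1 := hq1 (a - z)
    have h2 := map_add_le_add q (a - z) z
    rw [sub_add_cancel] at h2
    rw [j.map_sub] at h1
    change q a ≤ q z + l1Norm (j a - j z)
    linarith
  have happ : ∀ f : ConvAlg α μ, ∃ z : ℕ → 𝒜,
      Tendsto (fun n => l1Seminorm α μ (f - j (z n))) atTop (𝓝 0) := fun f => by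
    choose z hz using fun n : ℕ => hd f (1 / (n + 1)) (by positivity)
    exact ⟨z, squeeze_zero (fun n => apply_nonneg _ _) (fun n => (hz n).le)
      tendsto_one_div_add_atTop_nhds_zero_nat⟩
  -- `Q` is 1-Lipschitz for the `L¹`-norm, so inequalities between values of `q` pass to `Q` along
  -- `L¹`-approximating sequences.
  have hlim : ∀ (f : ConvAlg α μ) (z : ℕ → 𝒜),
      Tendsto (fun n => l1Seminorm α μ (f - j (z n))) atTop (𝓝 0) →
      Tendsto (fun n => q (z n)) atTop (𝓝 (Q f)) := fun f z hz => by
    rw [tendsto_iff_dist_tendsto_zero]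
    refine squeeze_zero (fun _ => dist_nonneg) (fun n => ?_) hz
    rw [← hQj, dist_comm]
    have h1 := (abs_sub_map_le_sub Q f (j (z n)))
    exact h1.trans (hQ1 _)
  have hmulz : ∀ (f g : ConvAlg α μ) (z w : ℕ → 𝒜),
      Tendsto (fun n => l1Seminorm α μ (f - j (z n))) atTop (𝓝 0) →
      Tendsto (fun n => l1Seminorm α μ (g - j (w n))) atTop (𝓝 0) →
      Tendsto (fun n => l1Seminorm α μ (f * g - j (z n * w n))) atTop (𝓝 0) := by
    intro f g z w hz hw
    refine squeeze_zero (fun n => apply_nonneg _ _) (fun n => ?_) (g := fun n =>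
      l1Seminorm α μ (f - j (z n)) * l1Seminorm α μ g +
        (l1Seminorm α μ f + l1Seminorm α μ (f - j (z n))) * l1Seminorm α μ (g - j (w n))) ?_
    · have e : f * g - j (z n * w n) = (f - j (z n)) * g + j (z n) * (g - j (w n)) := by
        rw [jmul, sub_mul, mul_sub]; abel
      rw [e]
      refine (map_add_le_add _ _ _).trans (add_le_add (hl _ _) ((hl _ _).trans
        (mul_le_mul_of_nonneg_right ?_ (apply_nonneg _ _))))
      have h1 := map_sub_le_add (l1Seminorm α μ) f (f - j (z n))
      rwa [sub_sub_cancel] at h1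
    · simpa using (hz.mul_const (l1Seminorm α μ g)).add ((tendsto_const_nhds.add hz).mul hw)
  have hstarz : ∀ (f : ConvAlg α μ) (z : ℕ → 𝒜),
      Tendsto (fun n => l1Seminorm α μ (f - j (z n))) atTop (𝓝 0) →
      Tendsto (fun n => l1Seminorm α μ (star f - j (star (z n)))) atTop (𝓝 0) := by
    intro f z hz
    refine hz.congr fun n => ?_
    rw [jstar, ← star_sub, l1Seminorm_apply, l1Seminorm_apply, l1Norm_star]
  rw [← hQj]
  refine le_norm_of_sq_le Q hQ1 (fun f g => ?_) (fun f => ?_) (j a)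
  · obtain ⟨z, hz⟩ := happ f
    obtain ⟨w, hw⟩ := happ g
    exact le_of_tendsto_of_tendsto' (hlim _ _ (hmulz f g z w hz hw))
      ((hlim f z hz).mul (hlim g w hw)) fun n => hq2 _ _
  · obtain ⟨z, hz⟩ := happ f
    exact le_of_tendsto_of_tendsto' ((hlim f z hz).pow 2)
      (hlim _ _ (hmulz _ _ _ _ (hstarz f z hz) hz)) fun n => hq3 _

end Dense

end ConvAlg

end CrossedProd

end

noncomputable section

namespace CrossedProd

/-! ### Families of elements of a convolution algebra -/

section Families

variable {G A T : Type*} [Group G] [TopologicalSpace G] [IsTopologicalGroup G]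
  [LocallyCompactSpace G] [T2Space G] [NonUnitalCStarAlgebra A]
  {α : CStarAction G A} {μ : HaarMeasure G} [TopologicalSpace T]

/-- The bounded continuous functions which vanish outside a set. -/
def supportedFunctions (A : Type*) [NonUnitalCStarAlgebra A] (K : Set G) :
    Submodule ℝ (G →ᵇ A) where
  carrier := {f | ∀ s ∉ K, f s = 0}
  add_mem' hf hg s hs := by simp [hf s hs, hg s hs]
  zero_mem' s _ := rfl
  smul_mem' c f hf s hs := by simp [hf s hs]

lemma isClosed_supportedFunctions (K : Set G) :
    IsClosed (supportedFunctions A K : Set (G →ᵇ A)) := by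
  have : (supportedFunctions A K : Set (G →ᵇ A)) = ⋂ s ∈ Kᶜ, {f | f s = 0} := by
    ext f
    simp only [mem_iInter, mem_ofPred_eq, mem_compl_iff]
    rfl
  rw [this]
  exact isClosed_biInter fun s _ => isClosed_eq
    (BoundedContinuousFunction.lipschitz_eval_const s).continuous continuous_const

instance (K : Set G) [h : Fact (IsClosed (supportedFunctions A K : Set (G →ᵇ A)))] :
    CompleteSpace (supportedFunctions A K) := h.out.completeSpace_coe

/-- The map from functions supported in a compact set to the crossed product. -/
def supportedToCrossed (α : CStarAction G A) (μ : HaarMeasure G) {K : Set G} (hK : IsCompact K) :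
    supportedFunctions A K →L[ℝ] CrossedProduct α μ :=
  LinearMap.mkContinuousOfExistsBound
    { toFun := fun f => CrossedProduct.of
        (ConvAlg.mk f.1 f.1.continuous (HasCompactSupport.intro hK f.2))
      map_add' := fun f g => by rw [← CrossedProduct.of_add]; rfl
      map_smul' := fun c f => by
        rw [RingHom.id_apply, ← Complex.coe_smul, ← CrossedProduct.of_smul]
        congr 1 }
    (by
      obtain ⟨c, -, h⟩ := ConvAlg.exists_l1Norm_le_mul α μ hK
      refine ⟨c, fun f => ?_⟩
      change ‖CrossedProduct.of _‖ ≤ _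
      rw [CrossedProduct.norm_of]
      refine (ConvAlg.norm_le_l1Norm _).trans (h _ ‖f.1‖ (fun t ht => ?_)
        (fun t => f.1.norm_coe_le_norm t) (norm_nonneg _))
      by_contra hn
      exact ht (f.2 t hn))

/-- A family of functions supported in a common compact set, as a family of bounded functions. -/
def supportedFamily (F : T → ConvAlg α μ) {K : Set G} (h : ∀ t s, F t s ≠ 0 → s ∈ K) (t : T) :
    supportedFunctions A K :=
  ⟨BoundedContinuousFunction.ofNormedAddCommGroup (F t) (F t).continuous
    (Classical.choose (((F t).hasCompactSupport).exists_bound_of_continuousOn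
      (F t).continuous.continuousOn) ⊔ 0) (fun s => by
      by_cases hs : s ∈ tsupport (F t)
      · exact (Classical.choose_spec (((F t).hasCompactSupport).exists_bound_of_continuousOn
          (F t).continuous.continuousOn) s hs).trans le_sup_left
      · rw [(F t).eq_zero hs, norm_zero]
        exact le_sup_right),
    fun s hs => by_contra fun hne => hs (h t s hne)⟩

lemma continuous_supportedFamily {F : T → ConvAlg α μ}
    (hF : Continuous fun q : T × G => F q.1 q.2) {K : Set G} (hK : IsCompact K)
    (h : ∀ t s, F t s ≠ 0 → s ∈ K) : Continuous (supportedFamily F h) := by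
  rw [continuous_iff_continuousAt]
  intro t₀
  refine Metric.tendsto_nhds.2 fun e he => ?_
  have key := eventually_norm_sub_le (F := fun t s => F t s) (s₀ := t₀) (e := e / 2) hF
    (by linarith) univ_mem hK (fun t _ s => by
      by_cases hs : s ∈ K
      · exact Or.inl ⟨s, hs, rfl⟩
      · have h0 : ∀ t, F t s = 0 := fun t => by_contra fun hne => hs (h t s hne)
        exact Or.inr ⟨by rw [h0, norm_zero]; linarith, by rw [h0, norm_zero]; linarith⟩)
  filter_upwards [key] with t ht
  refine lt_of_le_of_lt ((BoundedContinuousFunction.dist_le (by linarith)).2 fun s => ?_)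
    (show e / 2 < e by linarith)
  rw [dist_eq_norm]
  exact ht s

lemma continuous_of_family {F : T → ConvAlg α μ} (hF : Continuous fun q : T × G => F q.1 q.2)
    {K : Set G} (hK : IsCompact K) (h : ∀ t s, F t s ≠ 0 → s ∈ K) :
    Continuous fun t => CrossedProduct.of (F t) :=
  (supportedToCrossed α μ hK).continuous.comp (continuous_supportedFamily hF hK h)

variable [Group T] [T2Space T]

/-- The integral of a family of elements of `C_c(G, A)` in the crossed product is the pointwise
integral. -/
lemma int_of_family (ν : HaarMeasure T) {F : T → ConvAlg α μ}
    (hF : Continuous fun q : T × G => F q.1 q.2) {K : Set G} (hK : IsCompact K) {C : Set T}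
    (hC : IsCompact C) (h : ∀ t s, F t s ≠ 0 → t ∈ C ∧ s ∈ K) {g : ConvAlg α μ}
    (hg : ∀ s, g s = ν.int fun t => F t s) :
    CrossedProduct.of g = ν.int fun t => CrossedProduct.of (F t) := by
  have : Fact (IsClosed (supportedFunctions A K : Set (G →ᵇ A))) :=
    ⟨isClosed_supportedFunctions K⟩
  have hc := continuous_supportedFamily hF hK fun t s hne => (h t s hne).2
  have hcc : HasCompactSupport (supportedFamily F fun t s hne => (h t s hne).2) := by
    refine HasCompactSupport.intro hC fun t ht => Subtype.ext ?_
    ext s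
    by_contra hne
    exact ht (h t s hne).1
  -- The integral is taken once, in the Banach space of bounded functions supported in `K`. Both the
  -- passage to the crossed product and the evaluation at a point are continuous and linear on that
  -- space, so they commute with it.
  refine Eq.trans ?_ (ν.map_int (supportedToCrossed α μ hK) hc hcc)
  change CrossedProduct.of g = CrossedProduct.of _
  congr 1
  ext s
  rw [hg]
  exact (ν.map_int (((BoundedContinuousFunction.evalCLM ℝ s)).comp
    (supportedFunctions A K).subtypeL) hc hcc).symm

lemma hasCompactSupport_of_family {F : T → ConvAlg α μ} {C : Set T} (hC : IsCompact C)
    (h : ∀ t s, F t s ≠ 0 → t ∈ C) : HasCompactSupport fun t => CrossedProduct.of (F t) := by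
  refine HasCompactSupport.intro hC fun t ht => ?_
  have : F t = 0 := by
    ext s
    exact by_contra fun hne => ht (h t s hne)
  rw [this]
  exact Completion.coe_zero

end Families

/-! ### Inner products with values in a C*-algebra -/

section SemiInner

attribute [local instance] CStarAlgebra.spectralOrder CStarAlgebra.spectralOrderedRing

/-- Since `c p c* ≤ ‖p‖ c c*`, the choice `a = 1/‖p‖` gives `‖p‖⁻¹ c c* ≤ r`, and norms of positive
elements are monotone. To allow `p = 0` one uses `a = (‖p‖ + e)⁻¹` and lets `e` tend to 0. -/
lemma norm_sq_le_of_forall_nonneg {C : Type*} [NonUnitalCStarAlgebra C] {p c r : C} (hp : 0 ≤ p)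
    (h : ∀ a : ℝ, 0 ≤ a ^ 2 • (c * p * star c) - (2 * a) • (c * star c) + r) :
    ‖c‖ ^ 2 ≤ ‖p‖ * ‖r‖ := by
  have h1 : ∀ e > 0, ‖c‖ ^ 2 ≤ (‖p‖ + e) * ‖r‖ := by
    intro e he
    have hd : 0 < ‖p‖ + e := by positivity
    have h2 := h (‖p‖ + e)⁻¹
    have h3 : c * p * star c ≤ ‖p‖ • (c * star c) :=
      CStarAlgebra.star_right_conjugate_le_norm_smul hp.isSelfAdjoint
    have hcc : 0 ≤ c * star c := mul_star_self_nonneg c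
    have h4 : (‖p‖ + e)⁻¹ ^ 2 • (c * p * star c) ≤ (‖p‖ + e)⁻¹ • (c * star c) := by
      refine (smul_le_smul_of_nonneg_left h3 (by positivity)).trans ?_
      rw [smul_smul]
      refine smul_le_smul_of_nonneg_right ?_ hcc
      rw [sq, mul_assoc]
      refine mul_le_of_le_one_right (by positivity) ?_
      rw [inv_mul_le_one₀ hd]
      linarith
    have h5 : (‖p‖ + e)⁻¹ • (c * star c) ≤ r := by
      have h6 : 0 ≤ (‖p‖ + e)⁻¹ • (c * star c) - (2 * (‖p‖ + e)⁻¹) • (c * star c) + r := by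
        refine h2.trans (add_le_add_left (sub_le_sub_right h4 _) _)
      rw [← sub_smul] at h6
      have e1 : (‖p‖ + e)⁻¹ - 2 * (‖p‖ + e)⁻¹ = -(‖p‖ + e)⁻¹ := by ring
      rw [e1, neg_smul, neg_add_eq_sub] at h6
      exact sub_nonneg.1 h6
    have h7 := CStarAlgebra.norm_le_norm_of_nonneg_of_le (smul_nonneg (by positivity) hcc) h5
    rw [norm_smul, CStarRing.norm_self_mul_star, Real.norm_of_nonneg (by positivity),
      inv_mul_le_iff₀ hd] at h7
    rw [sq]
    exact h7
  refine le_of_forall_pos_le_add fun e he => ?_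
  refine (h1 (e / (‖r‖ + 1)) (by positivity)).trans ?_
  rw [add_mul]
  gcongr
  rw [div_mul_eq_mul_div, div_le_iff₀ (by positivity)]
  nlinarith [norm_nonneg r]

/-- A positive semidefinite inner product with values in a C*-algebra, of which only the properties
needed for the Cauchy–Schwarz inequality are recorded; it covers both left and right inner
products. -/
structure SemiInner (V C : Type*) [AddCommGroup V] [Module ℂ V] [NonUnitalCStarAlgebra C] where
  ip : V → V → C
  add_left : ∀ x x' y, ip (x + x') y = ip x y + ip x' y
  star_ip : ∀ x y, star (ip x y) = ip y x
  real_smul_left : ∀ (a : ℝ) x y, ip (a • x) y = a • ip x y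
  norm_smul_self : ∀ (c : ℂ) x, ‖ip (c • x) (c • x)‖ = ‖c‖ ^ 2 * ‖ip x x‖
  nonneg : ∀ x, 0 ≤ ip x x
  exists_module : ∀ x y, ∃ (z : V) (c : C), ‖c‖ = ‖ip x y‖ ∧ ip z z = c * ip x x * star c ∧
    ip z y = c * star c

namespace SemiInner

variable {V C : Type*} [AddCommGroup V] [Module ℂ V] [NonUnitalCStarAlgebra C] (I : SemiInner V C)

lemma add_right (x y y' : V) : I.ip x (y + y') = I.ip x y + I.ip x y' := by
  rw [← I.star_ip, I.add_left, star_add, I.star_ip, I.star_ip]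

lemma real_smul_right (a : ℝ) (x y : V) : I.ip x (a • y) = a • I.ip x y := by
  rw [← I.star_ip, I.real_smul_left, star_smul, I.star_ip, star_trivial]

lemma norm_ip_comm (x y : V) : ‖I.ip x y‖ = ‖I.ip y x‖ := by rw [← I.star_ip, norm_star]

/-- Expand `⟨a z - y, a z - y⟩ ≥ 0` for the `z` of `exists_module`. For a right inner product `z = x
· ⟨x, y⟩` and `c = ⟨x, y⟩*`; for a left one `z = ⟨y, x⟩ · x` and `c = ⟨y, x⟩`. -/
lemma norm_ip_sq_le (x y : V) : ‖I.ip x y‖ ^ 2 ≤ ‖I.ip x x‖ * ‖I.ip y y‖ := by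
  obtain ⟨z, c, hc, hzz, hzy⟩ := I.exists_module x y
  rw [← hc]
  refine norm_sq_le_of_forall_nonneg (I.nonneg x) fun a => ?_
  have h := I.nonneg (a • z + (-1 : ℝ) • y)
  have hyz : I.ip y z = c * star c := by rw [← I.star_ip, hzy, star_mul, star_star]
  simp only [I.add_left, I.add_right, I.real_smul_left, I.real_smul_right, hzz, hzy, hyz] at h
  convert h using 1
  module

/-- The seminorm `x ↦ ‖⟨x, x⟩‖^(1/2)`. -/
def seminorm : Seminorm ℂ V :=
  Seminorm.of (fun x => √‖I.ip x x‖) (fun x y => by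
    refine Real.sqrt_le_iff.2 ⟨by positivity, ?_⟩
    have h1 : ‖I.ip x y‖ ≤ √‖I.ip x x‖ * √‖I.ip y y‖ := by
      rw [← Real.sqrt_mul (norm_nonneg _)]
      exact Real.le_sqrt_of_sq_le (I.norm_ip_sq_le x y)
    have h2 := Real.sq_sqrt (norm_nonneg (I.ip x x))
    have h3 := Real.sq_sqrt (norm_nonneg (I.ip y y))
    rw [I.add_left, I.add_right, I.add_right]
    have h4 := norm_add_le (I.ip x x + I.ip x y) (I.ip y x + I.ip y y)
    have h5 := norm_add_le (I.ip x x) (I.ip x y)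
    have h6 := norm_add_le (I.ip y x) (I.ip y y)
    rw [I.norm_ip_comm y x] at h6
    nlinarith)
    fun c x => by
      rw [I.norm_smul_self, Real.sqrt_mul (by positivity), Real.sqrt_sq (norm_nonneg c)]

lemma seminorm_apply (x : V) : I.seminorm x = √‖I.ip x x‖ := rfl

lemma seminorm_sq (x : V) : I.seminorm x ^ 2 = ‖I.ip x x‖ := Real.sq_sqrt (norm_nonneg _)

lemma norm_ip_le (x y : V) : ‖I.ip x y‖ ≤ I.seminorm x * I.seminorm y := by
  rw [seminorm_apply, seminorm_apply, ← Real.sqrt_mul (norm_nonneg _)]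
  exact Real.le_sqrt_of_sq_le (I.norm_ip_sq_le x y)

lemma seminorm_le_of_forall {x : V} {M : ℝ} (h : ‖I.ip x x‖ ≤ M * I.seminorm x) :
    I.seminorm x ≤ max M 0 := by
  rw [← I.seminorm_sq] at h
  rcases (apply_nonneg I.seminorm x).eq_or_lt with h0 | h0
  · rw [← h0]; exact le_max_right _ _
  · exact le_max_of_le_left (by nlinarith)

end SemiInner

end SemiInner

/-! ### Bounded bimodules -/

/-- A biadditive map bounded by the product of the norms is jointly continuous, and continuous
biadditive maps into a complete group extend to completions. Only additivity is used, so
conjugate-linear variables are covered. -/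
lemma continuous_extend_of_norm_le {M N M' N' W : Type*} [SeminormedAddCommGroup M]
    [SeminormedAddCommGroup N] [NormedAddCommGroup M'] [NormedAddCommGroup N']
    [NormedAddCommGroup W] [CompleteSpace W] {e : M →+ M'} (de : IsDenseInducing e)
    {e' : N →+ N'} (de' : IsDenseInducing e') {f : M → N → W}
    (hl : ∀ x x' y, f (x + x') y = f x y + f x' y) (hr : ∀ x y y', f x (y + y') = f x y + f x y')
    (hb : ∀ x y, ‖f x y‖ ≤ ‖x‖ * ‖y‖) :
    Continuous ((de.prodMap de').extend fun p : M × N => f p.1 p.2) ∧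
      ∀ x y, (de.prodMap de').extend (fun p : M × N => f p.1 p.2) (e x, e' y) = f x y := by
  let φ : M →+ N →+ W := AddMonoidHom.mk' (fun x => AddMonoidHom.mk' (f x) (hr x)) fun x x' => by
    ext y
    exact hl x x' y
  have hφ : ∀ x y, φ x y = f x y := fun x y => rfl
  have hc : Continuous fun p : M × N => φ p.1 p.2 := by
    rw [continuous_iff_continuousAt]
    rintro ⟨x₀, y₀⟩
    rw [ContinuousAt, tendsto_iff_norm_sub_tendsto_zero]
    have h1 : Tendsto (fun p : M × N => ‖p.1 - x₀‖ * ‖p.2‖ + ‖x₀‖ * ‖p.2 - y₀‖) (𝓝 (x₀, y₀))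
        (𝓝 0) := by
      have : Continuous fun p : M × N => ‖p.1 - x₀‖ * ‖p.2‖ + ‖x₀‖ * ‖p.2 - y₀‖ := by fun_prop
      simpa using this.tendsto (x₀, y₀)
    refine squeeze_zero (fun _ => norm_nonneg _) (fun p => ?_) h1
    have e1 : φ p.1 p.2 - φ x₀ y₀ = φ (p.1 - x₀) p.2 + φ x₀ (p.2 - y₀) := by
      rw [map_sub, map_sub, AddMonoidHom.sub_apply]
      abel
    rw [e1]
    exact (norm_add_le _ _).trans (add_le_add (hb _ _) (hb _ _))
  exact ⟨IsDenseInducing.extend_Z_bilin de de' hc,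
    fun x y => (de.prodMap de').extend_eq hc (x, y)⟩

section Bimodules

variable {K L D E V : Type*} [Group K] [TopologicalSpace K] [IsTopologicalGroup K]
  [LocallyCompactSpace K] [T2Space K] [Group L] [TopologicalSpace L] [IsTopologicalGroup L]
  [LocallyCompactSpace L] [T2Space L] [NonUnitalCStarAlgebra D] [NonUnitalCStarAlgebra E]
  [AddCommGroup V] [Module ℂ V]
  {α : CStarAction K D} {μ : HaarMeasure K} {β : CStarAction L E} {ν : HaarMeasure L}

namespace PreBimodule

/-- The supremum of the seminorms below a function is that function when it is itself a seminorm. -/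
lemma innerSeminorm_eq (X : PreBimodule α μ β ν V) {q : Seminorm ℂ V}
    (hq : ∀ x, q x = √‖X.rinner x x‖) : X.innerSeminorm = q := by
  refine le_antisymm ?_ ?_
  · refine csSup_le ⟨q, fun x => (hq x).le⟩ fun p hp x => ?_
    rw [hq]
    exact hp x
  · refine le_csSup ⟨q, fun p hp x => ?_⟩ fun x => (hq x).le
    rw [hq]
    exact hp x

/-- The operations of `X` are additive in each variable and bounded. -/
structure IsBounded (X : PreBimodule α μ β ν V) : Prop where
  norm_eq : ∀ x, X.innerSeminorm x = √‖X.rinner x x‖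
  lact_add_left : ∀ a b x, X.lact (a + b) x = X.lact a x + X.lact b x
  lact_add_right : ∀ a x y, X.lact a (x + y) = X.lact a x + X.lact a y
  ract_add_left : ∀ x y b, X.ract (x + y) b = X.ract x b + X.ract y b
  ract_add_right : ∀ x b c, X.ract x (b + c) = X.ract x b + X.ract x c
  linner_add_left : ∀ x x' y, X.linner (x + x') y = X.linner x y + X.linner x' y
  linner_add_right : ∀ x y y', X.linner x (y + y') = X.linner x y + X.linner x y'
  rinner_add_left : ∀ x x' y, X.rinner (x + x') y = X.rinner x y + X.rinner x' y
  rinner_add_right : ∀ x y y', X.rinner x (y + y') = X.rinner x y + X.rinner x y'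
  lact_le : ∀ a x, X.innerSeminorm (X.lact a x) ≤ ‖a‖ * X.innerSeminorm x
  ract_le : ∀ x b, X.innerSeminorm (X.ract x b) ≤ X.innerSeminorm x * ‖b‖
  linner_le : ∀ x y, ‖X.linner x y‖ ≤ X.innerSeminorm x * X.innerSeminorm y
  rinner_le : ∀ x y, ‖X.rinner x y‖ ≤ X.innerSeminorm x * X.innerSeminorm y

variable (X : PreBimodule α μ β ν V)

/-- The canonical map from `V` to the completed bimodule. -/
def emb (x : V) : X.Completed := X.of x

lemma norm_emb (x : V) : ‖X.emb x‖ = X.innerSeminorm x := Completion.norm_coe (E := X.Space) x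

lemma emb_add (x y : V) : X.emb (x + y) = X.emb x + X.emb y :=
  Completion.coe_add (α := X.Space) x y

lemma emb_sub (x y : V) : X.emb (x - y) = X.emb x - X.emb y :=
  Completion.coe_sub (α := X.Space) x y

lemma denseRange_emb : DenseRange X.emb := X.isDenseInducing_of.dense

/-- The canonical map to the completed bimodule, as a linear isometry. -/
def ofₗᵢ : X.Space →ₗᵢ[ℂ] X.Completed := Completion.toComplₗᵢ

/-- The canonical map to the crossed product, as an additive map. -/
def _root_.CrossedProd.CrossedProduct.ofAddHom (α : CStarAction K D) (μ : HaarMeasure K) :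
    ConvAlg α μ →+ CrossedProduct α μ := AddMonoidHom.mk' CrossedProduct.of CrossedProduct.of_add

/-- The canonical map to the completed bimodule, as an additive map. -/
def ofAddHom : X.Space →+ X.Completed := AddMonoidHom.mk' X.of X.emb_add

variable {X}

lemma IsBounded.left (hX : X.IsBounded) :
    (Continuous fun p : CrossedProduct α μ × X.Completed => X.left p.1 p.2) ∧
      ∀ a x, X.left (CrossedProduct.of a) (X.emb x) = X.emb (X.lact a x) :=
  continuous_extend_of_norm_le (e := CrossedProduct.ofAddHom α μ) (e' := X.ofAddHom)
    CrossedProduct.isDenseInducing_of X.isDenseInducing_of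
    (f := fun a x => X.emb (X.lact a x))
    (fun a b x => (congrArg X.emb (hX.lact_add_left a b x)).trans (X.emb_add _ _))
    (fun a x y => (congrArg X.emb (hX.lact_add_right a x y)).trans (X.emb_add _ _))
    fun a x => (X.norm_emb _).trans_le (hX.lact_le a x)

lemma IsBounded.right (hX : X.IsBounded) :
    (Continuous fun p : X.Completed × CrossedProduct β ν => X.right p.1 p.2) ∧
      ∀ x b, X.right (X.emb x) (CrossedProduct.of b) = X.emb (X.ract x b) :=
  continuous_extend_of_norm_le (e := X.ofAddHom) (e' := CrossedProduct.ofAddHom β ν)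
    X.isDenseInducing_of CrossedProduct.isDenseInducing_of
    (f := fun x b => X.emb (X.ract x b))
    (fun x y b => (congrArg X.emb (hX.ract_add_left x y b)).trans (X.emb_add _ _))
    (fun x b c => (congrArg X.emb (hX.ract_add_right x b c)).trans (X.emb_add _ _))
    fun x b => (X.norm_emb _).trans_le (hX.ract_le x b)

lemma IsBounded.leftInner (hX : X.IsBounded) :
    (Continuous fun p : X.Completed × X.Completed => X.leftInner p.1 p.2) ∧
      ∀ x y, X.leftInner (X.emb x) (X.emb y) = CrossedProduct.of (X.linner x y) :=
  continuous_extend_of_norm_le (e := X.ofAddHom) (e' := X.ofAddHom)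
    X.isDenseInducing_of X.isDenseInducing_of
    (f := fun x y => CrossedProduct.of (X.linner x y))
    (fun x y z => (congrArg _ (hX.linner_add_left x y z)).trans (CrossedProduct.of_add _ _))
    (fun x y z => (congrArg _ (hX.linner_add_right x y z)).trans (CrossedProduct.of_add _ _))
    fun x y => (CrossedProduct.norm_of _).trans_le (hX.linner_le x y)

lemma IsBounded.rightInner (hX : X.IsBounded) :
    (Continuous fun p : X.Completed × X.Completed => X.rightInner p.1 p.2) ∧
      ∀ x y, X.rightInner (X.emb x) (X.emb y) = CrossedProduct.of (X.rinner x y) :=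
  continuous_extend_of_norm_le (e := X.ofAddHom) (e' := X.ofAddHom)
    X.isDenseInducing_of X.isDenseInducing_of
    (f := fun x y => CrossedProduct.of (X.rinner x y))
    (fun x y z => (congrArg _ (hX.rinner_add_left x y z)).trans (CrossedProduct.of_add _ _))
    (fun x y z => (congrArg _ (hX.rinner_add_right x y z)).trans (CrossedProduct.of_add _ _))
    fun x y => (CrossedProduct.norm_of _).trans_le (hX.rinner_le x y)

end PreBimodule

variable {K' L' D' E' V' : Type*} [Group K'] [TopologicalSpace K']
    [IsTopologicalGroup K'] [LocallyCompactSpace K'] [T2Space K'] [Group L'] [TopologicalSpace L']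
    [IsTopologicalGroup L'] [LocallyCompactSpace L'] [T2Space L'] [NonUnitalCStarAlgebra D']
    [NonUnitalCStarAlgebra E'] [AddCommGroup V'] [Module ℂ V']
    {α' : CStarAction K' D'} {μ' : HaarMeasure K'} {β' : CStarAction L' E'} {ν' : HaarMeasure L'}

/-- The extension of `j` to the completions is isometric, so its range is closed; it is also dense.
-/
lemma PreBimodule.exists_linearIsometryEquiv (X : PreBimodule α μ β ν V)
    (Y : PreBimodule α' μ' β' ν' V') (j : V' →ₗ[ℂ] V)
    (hnorm : ∀ z, Y.innerSeminorm z = X.innerSeminorm (j z))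
    (hj : ∀ (x : V) (e : ℝ), 0 < e → ∃ z, X.innerSeminorm (x - j z) < e) :
    ∃ e : Y.Completed ≃ₗᵢ[ℂ] X.Completed, ∀ z : V', e (Y.emb z) = X.emb (j z) := by
  let J : Y.Space →ₗᵢ[ℂ] X.Space := ⟨j, fun z => (hnorm z).symm⟩
  let f : Y.Space →L[ℂ] X.Completed := (X.ofₗᵢ.comp J).toContinuousLinearMap
  let e₀ : Y.Completed →L[ℂ] X.Completed := f.extend Y.ofₗᵢ.toContinuousLinearMap
  have he₀ : ∀ z : V', e₀ (Y.emb z) = X.emb (j z) := fun z =>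
    ContinuousLinearMap.extend_eq f Y.isDenseInducing_of.dense
      Y.ofₗᵢ.isometry.isUniformInducing (show Y.Space from z)
  have hnorm₀ : ∀ y, ‖e₀ y‖ = ‖y‖ := fun y =>
    Y.denseRange_emb.induction_on y
      (isClosed_eq e₀.continuous.norm continuous_norm) fun z => by
        rw [he₀, X.norm_emb, Y.norm_emb, hnorm]
  let e₁ : Y.Completed →ₗᵢ[ℂ] X.Completed := ⟨e₀.toLinearMap, hnorm₀⟩
  have hsurj : Function.Surjective e₁ := by
    have hcl : IsClosed (range e₁) := e₁.isometry.isClosedEmbedding.isClosed_range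
    have hdense : DenseRange e₁ := by
      refine Metric.denseRange_iff.2 fun x r hr => ?_
      obtain ⟨x', hx'⟩ := X.denseRange_emb.exists_dist_lt x (half_pos hr)
      obtain ⟨z, hz⟩ := hj x' (r / 2) (half_pos hr)
      refine ⟨Y.emb z, (dist_triangle _ (X.emb x') _).trans_lt ?_⟩
      have h1 : dist (X.emb x') (e₁ (Y.emb z)) < r / 2 := by
        change dist (X.emb x') (e₀ (Y.emb z)) < _
        rw [he₀, dist_eq_norm]
        rw [← X.emb_sub, X.norm_emb]
        exact hz
      linarith
    intro x
    have := hdense.closure_range ▸ mem_univ x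
    rwa [hcl.closure_eq] at this
  exact ⟨LinearIsometryEquiv.ofSurjective e₁ hsurj, he₀⟩

/-- A bounded bimodule is isomorphic to any bimodule which is densely embedded in it. -/
theorem nonempty_bimoduleIso_of_dense {X : PreBimodule α μ β ν V} {Y : PreBimodule α' μ' β' ν' V'}
    {φ : CrossedProduct α μ ≃⋆ₐ[ℂ] CrossedProduct α' μ'}
    {ψ : CrossedProduct β ν ≃⋆ₐ[ℂ] CrossedProduct β' ν'} (hX : X.IsBounded)
    (j : V' →ₗ[ℂ] V) (hj : ∀ (x : V) (e : ℝ), 0 < e → ∃ z, X.innerSeminorm (x - j z) < e)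
    (a : ConvAlg α' μ' → ConvAlg α μ)
    (ha : ∀ c, φ (CrossedProduct.of (a c)) = CrossedProduct.of c)
    (b : ConvAlg β' ν' → ConvAlg β ν)
    (hb : ∀ c, ψ (CrossedProduct.of (b c)) = CrossedProduct.of c)
    (hl : ∀ c z, j (Y.lact c z) = X.lact (a c) (j z))
    (hr : ∀ z c, j (Y.ract z c) = X.ract (j z) (b c))
    (hli : ∀ x y, X.linner (j x) (j y) = a (Y.linner x y))
    (hri : ∀ x y, X.rinner (j x) (j y) = b (Y.rinner x y)) : Nonempty (BimoduleIso X Y φ ψ) := by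
  -- `ψ` is isometric and matches the right inner products, so `√‖⟨z, z⟩‖` on `Y` is the pullback
  -- along `j` of the seminorm of `X`. It is therefore a seminorm, and positivity of the inner
  -- product of `Y` never has to be proved.
  have hnorm : ∀ z, Y.innerSeminorm z = X.innerSeminorm (j z) := by
    have : Y.innerSeminorm = X.innerSeminorm.comp j := by
      refine Y.innerSeminorm_eq fun z => ?_
      change X.innerSeminorm (j z) = _
      rw [hX.norm_eq, hri, ← CrossedProduct.norm_of, ← CrossedProduct.norm_of,
        ← StarAlgEquiv.norm_map ψ, hb]
    intro z
    rw [this]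
    rfl
  obtain ⟨e, he⟩ := X.exists_linearIsometryEquiv Y j hnorm hj
  have hes : ∀ z, e.symm (X.emb (j z)) = Y.emb z := fun z => by rw [← he, e.symm_apply_apply]
  have hφ : ∀ c, φ.symm (CrossedProduct.of c) = CrossedProduct.of (a c) := fun c => by
    rw [← ha, φ.symm_apply_apply]
  have hψ : ∀ c, ψ.symm (CrossedProduct.of c) = CrossedProduct.of (b c) := fun c => by
    rw [← hb, ψ.symm_apply_apply]
  have cφ : Continuous φ := (StarAlgEquiv.isometry φ).continuous
  have cψ : Continuous ψ := (StarAlgEquiv.isometry ψ).continuous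
  have cφ' : Continuous φ.symm := (StarAlgEquiv.isometry φ.symm).continuous
  have cψ' : Continuous ψ.symm := (StarAlgEquiv.isometry ψ.symm).continuous
  have hLk : ∀ (c : ConvAlg α' μ') (z : V'),
      e.symm (X.left (φ.symm (CrossedProduct.of c)) (e (Y.emb z))) = Y.emb (Y.lact c z) :=
    fun c z => by rw [hφ, he, hX.left.2, ← hl, hes]
  have hRk : ∀ (z : V') (c : ConvAlg β' ν'),
      e.symm (X.right (e (Y.emb z)) (ψ.symm (CrossedProduct.of c))) = Y.emb (Y.ract z c) :=
    fun z c => by rw [hψ, he, hX.right.2, ← hr, hes]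
  have hLIk : ∀ x y : V', φ (X.leftInner (e (Y.emb x)) (e (Y.emb y))) =
      CrossedProduct.of (Y.linner x y) := fun x y => by rw [he, he, hX.leftInner.2, hli, ha]
  have hRIk : ∀ x y : V', ψ (X.rightInner (e (Y.emb x)) (e (Y.emb y))) =
      CrossedProduct.of (Y.rinner x y) := fun x y => by rw [he, he, hX.rightInner.2, hri, hb]
  -- The operations of `Y` are extensions from a dense subset, and no bound for them is known
  -- beforehand. The transported operation of `X` is continuous and agrees with that of `Y` on the
  -- dense subset, so uniqueness of extensions identifies the two. The same argument serves the
  -- other three operations.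
  have hL : ∀ c y, Y.left c y = e.symm (X.left (φ.symm c) (e y)) := fun c y => by
    refine congrFun (IsDenseInducing.extend_unique
      (CrossedProduct.isDenseInducing_of.prodMap Y.isDenseInducing_of)
      (g := fun p : CrossedProduct α' μ' × Y.Completed =>
        e.symm (X.left (φ.symm p.1) (e p.2))) ?_ ?_) (c, y)
    · rintro ⟨c, z⟩
      exact hLk c z
    · exact e.symm.continuous.comp (hX.left.1.comp
        ((cφ'.comp continuous_fst).prodMk (e.continuous.comp continuous_snd)))
  have hR : ∀ y c, Y.right y c = e.symm (X.right (e y) (ψ.symm c)) := fun y c => by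
    refine congrFun (IsDenseInducing.extend_unique
      (Y.isDenseInducing_of.prodMap CrossedProduct.isDenseInducing_of)
      (g := fun p : Y.Completed × CrossedProduct β' ν' =>
        e.symm (X.right (e p.1) (ψ.symm p.2))) ?_ ?_) (y, c)
    · rintro ⟨z, c⟩
      exact hRk z c
    · exact e.symm.continuous.comp (hX.right.1.comp
        ((e.continuous.comp continuous_fst).prodMk (cψ'.comp continuous_snd)))
  have hLI : ∀ x y, Y.leftInner x y = φ (X.leftInner (e x) (e y)) := fun x y => by
    refine congrFun (IsDenseInducing.extend_unique
      (Y.isDenseInducing_of.prodMap Y.isDenseInducing_of)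
      (g := fun p : Y.Completed × Y.Completed => φ (X.leftInner (e p.1) (e p.2))) ?_ ?_) (x, y)
    · rintro ⟨x, y⟩
      exact hLIk x y
    · exact cφ.comp (hX.leftInner.1.comp
        ((e.continuous.comp continuous_fst).prodMk (e.continuous.comp continuous_snd)))
  have hRI : ∀ x y, Y.rightInner x y = ψ (X.rightInner (e x) (e y)) := fun x y => by
    refine congrFun (IsDenseInducing.extend_unique
      (Y.isDenseInducing_of.prodMap Y.isDenseInducing_of)
      (g := fun p : Y.Completed × Y.Completed => ψ (X.rightInner (e p.1) (e p.2))) ?_ ?_) (x, y)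
    · rintro ⟨x, y⟩
      exact hRIk x y
    · exact cψ.comp (hX.rightInner.1.comp
        ((e.continuous.comp continuous_fst).prodMk (e.continuous.comp continuous_snd)))
  refine ⟨⟨e.symm, fun c x => ?_, fun x c => ?_, fun x y => ?_, fun x y => ?_⟩⟩
  · rw [hL, φ.symm_apply_apply, e.apply_symm_apply]
  · rw [hR, ψ.symm_apply_apply, e.apply_symm_apply]
  · rw [hLI, e.apply_symm_apply, e.apply_symm_apply]
  · rw [hRI, e.apply_symm_apply, e.apply_symm_apply]

end Bimodules

end CrossedProd

end

noncomputable section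

namespace CrossedProd

/-! ### Powers of the modular function, and maps commuting with integrals. -/

section Tools

variable {G : Type*} [Group G] [TopologicalSpace G]

/-- The power `Δ(s)^c` of the modular function. -/
def dmod [IsTopologicalGroup G] [LocallyCompactSpace G] (c : ℝ) (s : G) : ℝ := modular s ^ c

section Modular

variable [IsTopologicalGroup G] [LocallyCompactSpace G]

@[fun_prop] lemma continuous_dmod (c : ℝ) : Continuous (dmod c : G → ℝ) := continuous_modular_rpow c

lemma dmod_pos (c : ℝ) (s : G) : 0 < dmod c s := Real.rpow_pos_of_pos (modular_pos s) c

lemma dmod_add (c d : ℝ) (s : G) : dmod c s * dmod d s = dmod (c + d) s :=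
  (Real.rpow_add (modular_pos s) c d).symm

lemma dmod_mul (c : ℝ) (s t : G) : dmod c (s * t) = dmod c s * dmod c t := by
  rw [dmod, modular_mul, Real.mul_rpow (modular_pos s).le (modular_pos t).le]; rfl

lemma dmod_inv (c : ℝ) (s : G) : dmod c s⁻¹ = dmod (-c) s := by
  rw [dmod, modular_inv, Real.inv_rpow (modular_pos s).le, ← Real.rpow_neg (modular_pos s).le]; rfl

@[simp] lemma dmod_zero (s : G) : dmod 0 s = 1 := Real.rpow_zero _

lemma inv_modular (s : G) : (modular s)⁻¹ = dmod (-1) s := (Real.rpow_neg_one _).symm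

end Modular

attribute [fun_prop] Continuous.cstarAction ConvAlg.continuous Green.continuous_eval_c0

@[fun_prop] lemma continuous_cc {X E : Type*} [TopologicalSpace X] [TopologicalSpace E] [Zero E]
    (x : C_c(X, E)) : Continuous x := map_continuous x

lemma cc_eq_zero {X E : Type*} [TopologicalSpace X] [TopologicalSpace E] [Zero E]
    (x : C_c(X, E)) {s : X} (h : s ∉ tsupport x) : x s = 0 := image_eq_zero_of_notMem_tsupport h

lemma isCompact_tsupport_cc {X E : Type*} [TopologicalSpace X] [TopologicalSpace E] [Zero E]
    (x : C_c(X, E)) : IsCompact (tsupport x) := x.hasCompactSupport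

lemma ConvAlg.isCompact_tsupport {A : Type*} [NonUnitalCStarAlgebra A] [IsTopologicalGroup G]
    [LocallyCompactSpace G] [T2Space G] {α : CStarAction G A} {μ : HaarMeasure G}
    (a : ConvAlg α μ) : IsCompact (tsupport a) := a.hasCompactSupport

lemma CStarAction.act_mul {A : Type*} [NonUnitalCStarAlgebra A] (α : CStarAction G A) (s : G)
    (a b : A) : α s (a * b) = α s a * α s b := map_mul (α s) a b

lemma CStarAction.act_star {A : Type*} [NonUnitalCStarAlgebra A] (α : CStarAction G A) (s : G)
    (a : A) : α s (star a) = star (α s a) := map_star (α s) a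

lemma CStarAction.act_zero {A : Type*} [NonUnitalCStarAlgebra A] (α : CStarAction G A) (s : G) :
    α s 0 = 0 := map_zero (α s)

namespace HaarMeasure

variable {E : Type*} [NormedAddCommGroup E] [NormedSpace ℝ E]

/-- A linear isometry between Banach spaces commutes with the Bochner integral even when the
integrand is not integrable, so no continuity or support condition is needed. -/
lemma act_int' {A : Type*} [NonUnitalCStarAlgebra A] (μ : HaarMeasure G) {K : Type*} [Group K]
    [TopologicalSpace K] (α : CStarAction K A) (s : K) (f : G → A) :
    α s (μ.int f) = μ.int fun t => α s (f t) := by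
  let _ : MeasurableSpace G := borel G
  let L : A →ₗᵢ[ℝ] A :=
    { toFun := α s
      map_add' := map_add _
      map_smul' := fun c a => ConvAlg.act_smul α s c a
      norm_map' := α.norm_apply s }
  exact (L.integral_comp_comm f).symm

lemma star_int' {A : Type*} [NonUnitalCStarAlgebra A] (μ : HaarMeasure G) (f : G → A) :
    star (μ.int f) = μ.int fun t => star (f t) := by
  let _ : MeasurableSpace G := borel G
  let L : A →ₗᵢ[ℝ] A :=
    { toFun := star
      map_add' := star_add
      map_smul' := fun c a => by simp
      norm_map' := norm_star }
  exact (L.integral_comp_comm f).symm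

lemma mul_int_of {A : Type*} [NonUnitalCStarAlgebra A] (μ : HaarMeasure G) (a : A) {f : G → A}
    [T2Space G] {K : Set G} (hK : IsCompact K) (hf : Continuous f) (h : ∀ t, t ∉ K → f t = 0) :
    a * μ.int f = μ.int fun t => a * f t :=
  μ.map_int_add (AddMonoidHom.mulLeft a) (continuous_const.mul continuous_id) hf
    (HasCompactSupport.intro hK h)

lemma int_mul_of {A : Type*} [NonUnitalCStarAlgebra A] (μ : HaarMeasure G) (a : A) {f : G → A}
    [T2Space G] {K : Set G} (hK : IsCompact K) (hf : Continuous f) (h : ∀ t, t ∉ K → f t = 0) :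
    μ.int f * a = μ.int fun t => f t * a :=
  μ.map_int_add (AddMonoidHom.mulRight a) (continuous_id.mul continuous_const) hf
    (HasCompactSupport.intro hK h)

lemma int_swap_of {H : Type*} [Group H] [TopologicalSpace H] [T2Space G] [T2Space H]
    (μ : HaarMeasure G) (ν : HaarMeasure H) {F : G → H → E} {K : Set G} {L : Set H}
    (hK : IsCompact K) (hL : IsCompact L) (hF : Continuous fun q : G × H => F q.1 q.2)
    (h1 : ∀ s t, s ∉ K → F s t = 0) (h2 : ∀ s t, s ∈ K → t ∉ L → F s t = 0) :
    (μ.int fun s => ν.int fun t => F s t) = ν.int fun t => μ.int fun s => F s t := by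
  refine μ.int_swap ν hF (HasCompactSupport.intro (hK.prod hL) ?_)
  rintro ⟨s, t⟩ hst
  by_cases hs : s ∈ K
  · exact h2 s t hs fun ht => hst ⟨hs, ht⟩
  · exact h1 s t hs

lemma int_translate [IsTopologicalGroup G] (μ : HaarMeasure G) (s : G) (f : G → E) :
    μ.int f = μ.int fun t => f (s * t) := (μ.int_mul_left f s).symm

lemma int_apply_c0 {X A : Type*} [TopologicalSpace X] [NonUnitalCStarAlgebra A] [T2Space G]
    (μ : HaarMeasure G) {f : G → C₀(X, A)} {K : Set G} (hK : IsCompact K) (hf : Continuous f)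
    (h : ∀ t, t ∉ K → f t = 0) (x : X) : μ.int f x = μ.int fun t => f t x := by
  let L : C₀(X, A) →+ A :=
    { toFun := fun f => f x
      map_zero' := rfl
      map_add' := fun _ _ => rfl }
  exact μ.map_int_add L (Green.continuous_eval_c0 continuous_id continuous_const) hf
    (HasCompactSupport.intro hK h)

end HaarMeasure

end Tools

/-! ### Convolution with coefficients in `C₀(X, A)`, evaluated at points. -/

section C0Conv

variable {G X A : Type*} [Group G] [TopologicalSpace G] [IsTopologicalGroup G]
  [LocallyCompactSpace G] [T2Space G] [TopologicalSpace X] [NonUnitalCStarAlgebra A]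
  {α : CStarAction G A} {θ : SpaceAction G X} {μ : HaarMeasure G}

lemma ConvAlg.mul_apply_apply (a b : ConvAlg (c0Action α θ) μ) (t : G) (x : X) :
    (a * b) t x = μ.int fun s => a s x * α s (b (s⁻¹ * t) (θ s⁻¹ x)) :=
  μ.int_apply_c0 a.hasCompactSupport (ConvAlg.continuous_convIntegrand' a b t)
    (fun s hs => by rw [a.eq_zero hs, zero_mul]) x

lemma ConvAlg.star_apply_apply (a : ConvAlg (c0Action α θ) μ) (t : G) (x : X) :
    (star a) t x = dmod (-1) t • α t (star (a t⁻¹ (θ t⁻¹ x))) := by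
  rw [← inv_modular]; rfl

end C0Conv

/-! ### The algebraic identities of the Green bimodule on `C_c(Q, D)`. -/

namespace Green

variable {Q D : Type*} [Group Q] [TopologicalSpace Q] [IsTopologicalGroup Q]
  [LocallyCompactSpace Q] [T2Space Q] [NonUnitalCStarAlgebra D] {β : CStarAction Q D}
  {S : Subgroup Q} [IsClosed (S : Set Q)] {μ : HaarMeasure Q} {ν : HaarMeasure S}

lemma lact_apply (a : ConvAlg (leftAction β S) μ) (x : C_c(Q, D)) (r : Q) :
    lact a x r = μ.int fun t => dmod (1 / 2) t • (a t (r : Q ⧸ S) * β t (x (t⁻¹ * r))) := rfl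

lemma ract_apply (x : C_c(Q, D)) (b : ConvAlg (β.restrict S) ν) (r : Q) :
    ract x b r = ν.int fun h =>
      dmod (-1 / 2) h • (x (r * (h : Q)) * β (r * (h : Q)) (b h⁻¹)) := rfl

lemma linner_apply (x y : C_c(Q, D)) (t r : Q) :
    (linner ν x y : ConvAlg (leftAction β S) μ) t (r : Q ⧸ S) = dmod (-1 / 2) t • ν.int fun h : S =>
      x (r * (h : Q)) * β t (star (y (t⁻¹ * (r * (h : Q))))) := rfl

lemma rinner_apply (x y : C_c(Q, D)) (h : S) :
    (rinner μ x y : ConvAlg (β.restrict S) ν) h = dmod (-1 / 2) h • μ.int fun t =>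
      β t (star (x t⁻¹) * y (t⁻¹ * (h : Q))) := rfl

lemma restrict_apply (h : S) (d : D) : β.restrict S h d = β (h : Q) d := rfl

lemma cosetAction_mk (t r : Q) : cosetAction S t (r : Q ⧸ S) = ((t * r : Q) : Q ⧸ S) := rfl

lemma mk_mul_coe (r : Q) (h : S) : ((r * (h : Q) : Q) : Q ⧸ S) = (r : Q ⧸ S) :=
  QuotientGroup.mk_mul_of_mem r h.2

lemma conv_ext {a b : ConvAlg (leftAction β S) μ}
    (h : ∀ t r : Q, a t (r : Q ⧸ S) = b t (r : Q ⧸ S)) : a = b := by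
  ext t r
  induction r using QuotientGroup.induction_on with
  | H r => exact h t r

lemma apply_eq_zero (a : ConvAlg (leftAction β S) μ) {t : Q} (ht : t ∉ tsupport a) (r : Q ⧸ S) :
    a t r = 0 := by rw [a.eq_zero ht]; rfl

/-- The pattern of most identities below: `e1` and `e2` bring the two sides to iterated integrals of
one kernel, by left translation of a variable and by multiplicativity of the modular powers, and
`int_swap_of` exchanges the order. -/
lemma lact_mul (a b : ConvAlg (leftAction β S) μ) (x : C_c(Q, D)) :
    lact (a * b) x = lact a (lact b x) := by
  ext r
  rw [lact_apply, lact_apply]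
  have e1 : ∀ t, dmod (1 / 2) t • ((a * b) t (r : Q ⧸ S) * β t (x (t⁻¹ * r))) =
      μ.int fun s => dmod (1 / 2) t • (a s (r : Q ⧸ S) *
        (β s (b (s⁻¹ * t) ((s⁻¹ * r : Q) : Q ⧸ S)) * β t (x (t⁻¹ * r)))) := fun t => by
    rw [ConvAlg.mul_apply_apply, μ.int_mul_of _ a.isCompact_tsupport (by fun_prop)
      fun s hs => by rw [apply_eq_zero _ hs, zero_mul], ← μ.int_smul]
    exact μ.int_congr fun s => by rw [mul_assoc, cosetAction_mk]
  have e2 : ∀ s, dmod (1 / 2) s • (a s (r : Q ⧸ S) * β s (lact b x (s⁻¹ * r))) =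
      μ.int fun t => dmod (1 / 2) t • (a s (r : Q ⧸ S) *
        (β s (b (s⁻¹ * t) ((s⁻¹ * r : Q) : Q ⧸ S)) * β t (x (t⁻¹ * r)))) := fun s => by
    rw [lact_apply, μ.act_int', μ.mul_int_of _ b.isCompact_tsupport (by fun_prop)
      fun t ht => by rw [apply_eq_zero _ ht, zero_mul, smul_zero, map_zero], ← μ.int_smul,
      μ.int_translate s⁻¹]
    refine μ.int_congr fun t => ?_
    rw [ConvAlg.act_smul, mul_smul_comm, smul_smul, ← dmod_mul, mul_inv_cancel_left, map_mul,
      ← β.mul_apply, mul_inv_cancel_left, mul_inv_rev, inv_inv, mul_assoc, mul_inv_cancel_left]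
  rw [μ.int_congr e1, μ.int_congr e2]
  refine μ.int_swap_of μ (a.isCompact_tsupport.mul b.isCompact_tsupport) a.isCompact_tsupport
    (by fun_prop) (fun t s ht => ?_) (fun t s _ hs => ?_)
  · by_cases hs : s ∈ tsupport a
    · rw [apply_eq_zero b fun h => ht ⟨s, hs, _, h, mul_inv_cancel_left s t⟩]
      simp
    · rw [apply_eq_zero _ hs, zero_mul, smul_zero]
  · rw [apply_eq_zero _ hs, zero_mul, smul_zero]

end Green
end CrossedProd
end

noncomputable section

namespace CrossedProd

namespace Green

variable {Q D : Type*} [Group Q] [TopologicalSpace Q] [IsTopologicalGroup Q]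
  [LocallyCompactSpace Q] [T2Space Q] [NonUnitalCStarAlgebra D] {β : CStarAction Q D}
  {S : Subgroup Q} [IsClosed (S : Set Q)] {μ : HaarMeasure Q} {ν : HaarMeasure S}

lemma isCompact_preimage_coe {C : Set Q} (hC : IsCompact C) (r : Q) :
    IsCompact {h : S | r * (h : Q) ∈ C} := by
  simpa using isCompact_cosetTransporter S (isCompact_singleton (x := r)) hC

lemma linner_lact (a : ConvAlg (leftAction β S) μ) (x y : C_c(Q, D)) :
    (linner ν (lact a x) y : ConvAlg (leftAction β S) μ) = a * linner ν x y := by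
  refine conv_ext fun t r => ?_
  rw [linner_apply, ConvAlg.mul_apply_apply, ← ν.int_smul]
  have e1 : ∀ h : S, dmod (-1 / 2) t • (lact a x (r * h) * β t (star (y (t⁻¹ * (r * h))))) =
      μ.int fun s => (dmod (-1 / 2) t * dmod (1 / 2) s) • (a s (r : Q ⧸ S) *
        (β s (x (s⁻¹ * (r * h))) * β t (star (y (t⁻¹ * (r * h)))))) := fun h => by
    rw [lact_apply, μ.int_mul_of _ a.isCompact_tsupport (by fun_prop)
      fun s hs => by rw [apply_eq_zero _ hs, zero_mul, smul_zero], ← μ.int_smul]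
    exact μ.int_congr fun s => by rw [smul_mul_assoc, smul_smul, mk_mul_coe, mul_assoc]
  have e2 : ∀ s, a s (r : Q ⧸ S) * β s ((linner ν x y : ConvAlg (leftAction β S) μ) (s⁻¹ * t)
        (cosetAction S s⁻¹ (r : Q ⧸ S))) =
      ν.int fun h => (dmod (-1 / 2) t * dmod (1 / 2) s) • (a s (r : Q ⧸ S) *
        (β s (x (s⁻¹ * (r * h))) * β t (star (y (t⁻¹ * (r * h)))))) := fun s => by
    rw [cosetAction_mk, linner_apply, ← ν.int_smul, ν.act_int', ν.mul_int_of _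
      (isCompact_preimage_coe (isCompact_tsupport_cc x) (s⁻¹ * r)) (by fun_prop)
      fun h hh => by rw [cc_eq_zero _ hh, zero_mul, smul_zero, map_zero]]
    refine ν.int_congr fun h => ?_
    rw [ConvAlg.act_smul, mul_smul_comm, dmod_mul, dmod_inv, mul_comm, β.act_mul, ← β.mul_apply,
      mul_inv_cancel_left, mul_inv_rev, inv_inv, mul_assoc s⁻¹, mul_assoc, mul_inv_cancel_left]
    norm_num
  rw [ν.int_congr e1, μ.int_congr e2]
  refine (μ.int_swap_of ν a.isCompact_tsupport (isCompact_cosetTransporter S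
    (a.isCompact_tsupport.inv.mul (isCompact_singleton (x := r))) (isCompact_tsupport_cc x))
    (by fun_prop) (fun s h hs => ?_) (fun s h hs hh => ?_)).symm
  · rw [apply_eq_zero _ hs, zero_mul, smul_zero]
  · rw [cc_eq_zero x fun hx => hh ⟨s⁻¹ * r, ⟨s⁻¹, by simpa using hs, r, rfl, rfl⟩, by
      simpa [mul_assoc] using hx⟩]
    simp

lemma rinner_ract (x y : C_c(Q, D)) (b : ConvAlg (β.restrict S) ν) :
    (rinner μ x (ract y b) : ConvAlg (β.restrict S) ν) = rinner μ x y * b := by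
  ext h
  rw [rinner_apply, ConvAlg.mul_apply, ← μ.int_smul]
  have e1 : ∀ t : Q, dmod (-1 / 2) h • β t (star (x t⁻¹) * ract y b (t⁻¹ * (h : Q))) =
      ν.int fun k => dmod (-1 / 2) k • (β t (star (x t⁻¹) * y (t⁻¹ * (k : Q))) *
        β (k : Q) (b (k⁻¹ * h))) := fun t => by
    rw [ract_apply, ν.mul_int_of _ b.isCompact_tsupport.inv (by fun_prop) fun k hk => by
      rw [b.eq_zero fun h => hk (by simpa using h), map_zero, mul_zero, smul_zero], ν.act_int',
      ← ν.int_smul, ν.int_translate h⁻¹]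
    refine ν.int_congr fun k => ?_
    rw [mul_smul_comm, ConvAlg.act_smul, smul_smul, ← dmod_mul, mul_inv_cancel_left, ← mul_assoc,
      β.act_mul, ← β.mul_apply]
    simp only [mul_assoc, mul_inv_rev, inv_inv, inv_mul_cancel_left, mul_inv_cancel_left,
      mul_inv_cancel, inv_mul_cancel, mul_one, one_mul, Subgroup.coe_mul, Subgroup.coe_inv]
  have e2 : ∀ k : S, (rinner μ x y : ConvAlg (β.restrict S) ν) k * β.restrict S k (b (k⁻¹ * h)) =
      μ.int fun t => dmod (-1 / 2) k • (β t (star (x t⁻¹) * y (t⁻¹ * (k : Q))) *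
        β (k : Q) (b (k⁻¹ * h))) := fun k => by
    rw [rinner_apply, ← μ.int_smul, μ.int_mul_of _ (isCompact_tsupport_cc x).inv (by fun_prop)
      fun t ht => by rw [cc_eq_zero x fun h => ht (by simpa using h)]; simp]
    exact μ.int_congr fun t => by rw [smul_mul_assoc, restrict_apply]
  rw [μ.int_congr e1, ν.int_congr e2]
  refine μ.int_swap_of ν (isCompact_tsupport_cc x).inv ((isCompact_singleton (x := h)).mul
    b.isCompact_tsupport.inv) (by fun_prop) (fun t k ht => ?_) (fun t k _ hk => ?_)
  · rw [cc_eq_zero x fun h => ht (by simpa using h)]; simp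
  · rw [b.eq_zero fun hb => hk ⟨h, rfl, h⁻¹ * k, by simpa using hb, by simp⟩]; simp

lemma ract_mul (x : C_c(Q, D)) (b c : ConvAlg (β.restrict S) ν) :
    ract x (b * c) = ract (ract x b) c := by
  ext r
  rw [ract_apply, ract_apply]
  have e1 : ∀ k : S, dmod (-1 / 2) k • (x (r * (k : Q)) * β (r * (k : Q)) ((b * c) k⁻¹)) =
      ν.int fun h => dmod (-1 / 2) k • (x (r * (k : Q)) * (β (r * (k : Q)) (b (k⁻¹ * h)) *
        β (r * h) (c h⁻¹))) := fun k => by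
    rw [ConvAlg.mul_apply, ν.act_int', ν.mul_int_of _ b.isCompact_tsupport (by
      simp only [restrict_apply]; fun_prop) fun h hh => by rw [b.eq_zero hh]; simp, ← ν.int_smul,
      ν.int_translate k⁻¹]
    refine ν.int_congr fun h => ?_
    rw [β.act_mul, restrict_apply, ← β.mul_apply]
    simp only [mul_assoc, mul_inv_rev, inv_inv, inv_mul_cancel_left, mul_inv_cancel_left,
      mul_inv_cancel, inv_mul_cancel, mul_one, one_mul, Subgroup.coe_mul, Subgroup.coe_inv]
  have e2 : ∀ h : S, dmod (-1 / 2) h • (ract x b (r * (h : Q)) * β (r * (h : Q)) (c h⁻¹)) =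
      ν.int fun k => dmod (-1 / 2) k • (x (r * (k : Q)) * (β (r * (k : Q)) (b (k⁻¹ * h)) *
        β (r * h) (c h⁻¹))) := fun h => by
    rw [ract_apply, ν.int_mul_of _ b.isCompact_tsupport.inv (by fun_prop) fun k hk => by
      rw [b.eq_zero fun h => hk (by simpa using h), map_zero, mul_zero, smul_zero], ← ν.int_smul,
      ν.int_translate h⁻¹]
    refine ν.int_congr fun k => ?_
    rw [smul_mul_assoc, smul_smul, ← dmod_mul]
    simp only [mul_assoc, mul_inv_rev, inv_inv, inv_mul_cancel_left, mul_inv_cancel_left,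
      mul_inv_cancel, inv_mul_cancel, mul_one, one_mul, Subgroup.coe_mul, Subgroup.coe_inv]
  rw [ν.int_congr e1, ν.int_congr e2]
  refine (ν.int_swap_of ν c.isCompact_tsupport.inv (c.isCompact_tsupport.inv.mul
    b.isCompact_tsupport.inv) (by fun_prop) (fun h k hh => ?_) (fun h k hh hk => ?_)).symm
  · rw [c.eq_zero fun hc => hh (by simpa using hc)]; simp
  · rw [b.eq_zero fun hb => hk ⟨h, hh, h⁻¹ * k, by simpa using hb, by simp⟩]; simp

/-- The imprimitivity relation. The powers of `Δ_Q` cancel on the left and those of `Δ_S` on the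
right; what remains is one kernel on `S × Q`. -/
lemma lact_linner (x y z : C_c(Q, D)) :
    lact (linner ν x y : ConvAlg (leftAction β S) μ) z =
      ract x (rinner μ y z : ConvAlg (β.restrict S) ν) := by
  ext r
  rw [lact_apply, ract_apply]
  have e1 : ∀ t : Q, dmod (1 / 2) t • ((linner ν x y : ConvAlg (leftAction β S) μ) t (r : Q ⧸ S) *
        β t (z (t⁻¹ * r))) =
      ν.int fun h => x (r * (h : Q)) * β t (star (y (t⁻¹ * (r * (h : Q)))) * z (t⁻¹ * r)) :=
    fun t => by
    rw [linner_apply, smul_mul_assoc, smul_smul, dmod_add, ν.int_mul_of _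
      (isCompact_preimage_coe (isCompact_tsupport_cc x) r) (by fun_prop)
      fun h hh => by rw [cc_eq_zero _ hh, zero_mul]]
    norm_num
    exact ν.int_congr fun h => by rw [mul_assoc]
  have e2 : ∀ h : S, dmod (-1 / 2) h • (x (r * (h : Q)) * β (r * (h : Q))
        ((rinner μ y z : ConvAlg (β.restrict S) ν) h⁻¹)) =
      μ.int fun t => x (r * (h : Q)) * β t (star (y (t⁻¹ * (r * (h : Q)))) * z (t⁻¹ * r)) :=
    fun h => by
    rw [rinner_apply, ConvAlg.act_smul, mul_smul_comm, smul_smul, dmod_inv, dmod_add, μ.act_int',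
      μ.mul_int_of _ (isCompact_tsupport_cc y).inv (by fun_prop)
      fun t ht => by rw [cc_eq_zero y fun h => ht (by simpa using h)]; simp,
      μ.int_translate (r * (h : Q))⁻¹]
    rw [show -1 / 2 + -(-1 / 2) = (0 : ℝ) by norm_num, dmod_zero, one_smul]
    refine μ.int_congr fun t => ?_
    rw [← β.mul_apply]
    simp only [mul_assoc, mul_inv_rev, inv_inv, inv_mul_cancel_left, mul_inv_cancel_left,
      mul_inv_cancel, inv_mul_cancel, mul_one, one_mul, Subgroup.coe_mul, Subgroup.coe_inv]
  rw [μ.int_congr e1, ν.int_congr e2]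
  refine (ν.int_swap_of μ (isCompact_preimage_coe (isCompact_tsupport_cc x) r)
    ((isCompact_tsupport_cc x).mul (isCompact_tsupport_cc y).inv) (by fun_prop)
    (fun h t hh => ?_) (fun h t hh ht => ?_)).symm
  · rw [cc_eq_zero _ hh, zero_mul]
  · rw [cc_eq_zero y fun hy => ht ⟨_, hh, _, Set.inv_mem_inv.2 hy, by group⟩]
    simp

lemma star_rinner (x y : C_c(Q, D)) :
    star (rinner μ x y : ConvAlg (β.restrict S) ν) = rinner μ y x := by
  ext h
  rw [ConvAlg.star_apply, inv_modular, rinner_apply, rinner_apply, star_smul, μ.star_int',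
    ConvAlg.act_smul, smul_smul, μ.act_int', dmod_inv, star_trivial, dmod_add,
    μ.int_translate (h⁻¹ : Q), show (-1 : ℝ) + -(-1 / 2) = -1 / 2 by norm_num]
  congr 1
  refine μ.int_congr fun t => ?_
  rw [restrict_apply, ← β.act_star, ← β.mul_apply, star_mul, star_star]
  simp only [mul_assoc, mul_inv_rev, inv_inv, inv_mul_cancel_left, mul_inv_cancel_left,
      mul_inv_cancel, inv_mul_cancel, mul_one, one_mul, Subgroup.coe_mul, Subgroup.coe_inv]

lemma star_linner (x y : C_c(Q, D)) :
    star (linner ν x y : ConvAlg (leftAction β S) μ) = linner ν y x := by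
  refine conv_ext fun t r => ?_
  rw [ConvAlg.star_apply_apply, cosetAction_mk, linner_apply, linner_apply, star_smul, ν.star_int',
    ConvAlg.act_smul, smul_smul, ν.act_int', dmod_inv, star_trivial, dmod_add,
    show (-1 : ℝ) + -(-1 / 2) = -1 / 2 by norm_num]
  congr 1
  refine ν.int_congr fun h => ?_
  rw [star_mul, ← β.act_star, star_star, β.act_mul, ← β.mul_apply, mul_inv_cancel, β.one_apply]
  simp only [mul_assoc, mul_inv_rev, inv_inv, inv_mul_cancel_left, mul_inv_cancel_left,
      mul_inv_cancel, inv_mul_cancel, mul_one, one_mul, Subgroup.coe_mul, Subgroup.coe_inv]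

/-- Both sides equal `∫∫ Δ(s)⁻¹ g(t, s)`: the left one by right translation in `t`, the right one by
inversion in `s`. -/
lemma int_int_mul_right (μ : HaarMeasure Q) {g : Q → Q → D}
    (hg : Continuous fun q : Q × Q => g q.1 q.2) {K L : Set Q} (hK : IsCompact K)
    (hL : IsCompact L) (h1 : ∀ t s, t ∉ K → g t s = 0) (h2 : ∀ t s, s ∉ L → g t s = 0) :
    (μ.int fun t => μ.int fun s => g (t * s) s) = μ.int fun t => μ.int fun s => g t s⁻¹ := by
  have e2 : ∀ t, (μ.int fun s => g t s⁻¹) = μ.int fun s => (modular s)⁻¹ • g t s := fun t =>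
    μ.int_inv (hg.comp (continuous_const.prodMk continuous_id))
      (HasCompactSupport.intro hL fun s hs => h2 t s hs)
  have e3 : ∀ s, (μ.int fun t => g (t * s) s) = μ.int fun t => (modular s)⁻¹ • g t s := fun s => by
    rw [μ.int_smul]
    exact μ.int_mul_right (f := fun t => g t s) (hg.comp (continuous_id.prodMk continuous_const))
      (HasCompactSupport.intro hK fun t ht => h1 t s ht) s
  rw [μ.int_congr e2, μ.int_swap_of μ (F := fun t s => g (t * s) s) (hK.mul hL.inv) hL
    (hg.comp ((continuous_fst.mul continuous_snd).prodMk continuous_snd)) (fun t s ht => ?_) (fun t s _ hs => h2 _ _ hs), μ.int_congr e3]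
  · refine μ.int_swap_of μ hL hK ?_ (fun s t hs => by rw [h2 _ _ hs, smul_zero])
      (fun s t _ ht => by rw [h1 _ _ ht, smul_zero])
    simp_rw [inv_modular]
    exact ((continuous_dmod (-1)).comp continuous_fst).smul
      (hg.comp (continuous_snd.prodMk continuous_fst))
  · by_cases hs : s ∈ L
    · exact h1 _ _ fun h => ht ⟨t * s, h, s⁻¹, by simpa using hs, by simp⟩
    · exact h2 _ _ hs

/-- Elements of the left algebra act by adjointable operators for the right inner product. The
involution brings in a modular factor, which `int_int_mul_right` accounts for. -/
lemma rinner_lact (a : ConvAlg (leftAction β S) μ) (x y : C_c(Q, D)) :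
    (rinner μ (lact a x) y : ConvAlg (β.restrict S) ν) = rinner μ x (lact (star a) y) := by
  ext h
  rw [rinner_apply, rinner_apply]
  congr 1
  obtain ⟨g, hgd⟩ : ∃ g : Q → Q → D, ∀ t s, g t s = dmod (1 / 2) s • (β t (star (x t⁻¹)) *
    β (t * s⁻¹) (star (a s ((s * t⁻¹ : Q) : Q ⧸ S)) * y (s * t⁻¹ * h))) := ⟨_, fun _ _ => rfl⟩
  have hg : Continuous fun q : Q × Q => g q.1 q.2 := by simp only [hgd]; fun_prop
  have e1 : ∀ t : Q, β t (star (lact a x t⁻¹) * y (t⁻¹ * h)) = μ.int fun s => g (t * s) s :=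
    fun t => by
    rw [lact_apply, μ.star_int', μ.int_mul_of _ a.isCompact_tsupport (by fun_prop)
      fun s hs => by rw [apply_eq_zero _ hs]; simp, μ.act_int']
    refine μ.int_congr fun s => ?_
    rw [hgd, star_smul, star_trivial, smul_mul_assoc, ConvAlg.act_smul, star_mul, mul_assoc,
      β.act_mul, ← β.act_star, ← β.mul_apply]
    simp only [mul_assoc, mul_inv_rev, mul_inv_cancel_left, mul_inv_cancel, mul_one]
  have e2 : ∀ t : Q, β t (star (x t⁻¹) * lact (star a) y (t⁻¹ * h)) =
      μ.int fun s => g t s⁻¹ := fun t => by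
    rw [lact_apply, μ.mul_int_of _ (star a).isCompact_tsupport (by fun_prop)
      fun s hs => by rw [apply_eq_zero _ hs]; simp, μ.act_int']
    refine μ.int_congr fun s => ?_
    rw [hgd, ConvAlg.star_apply_apply, smul_mul_assoc, smul_smul, dmod_add, dmod_inv,
      mul_smul_comm, ConvAlg.act_smul, ← β.act_mul, β.act_mul, ← β.mul_apply, cosetAction_mk,
      ← mul_assoc s⁻¹ t⁻¹, mk_mul_coe, inv_inv, show (1 : ℝ) / 2 + -1 = -(1 / 2) by norm_num]
  rw [μ.int_congr e1, μ.int_congr e2]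
  refine int_int_mul_right μ hg (isCompact_tsupport_cc x).inv a.isCompact_tsupport
    (fun t s ht => ?_) (fun t s hs => ?_)
  · rw [hgd, cc_eq_zero x fun h => ht (by simpa using h), star_zero, β.act_zero, zero_mul,
      smul_zero]
  · rw [hgd, apply_eq_zero _ hs, star_zero, zero_mul, β.act_zero, mul_zero, smul_zero]

/-- The mirror image of `rinner_lact`: the right algebra acts by adjointable operators for the left
inner product. Here both sides are already integrals of one kernel on `S × S`. -/
lemma linner_ract (x y : C_c(Q, D)) (b : ConvAlg (β.restrict S) ν) :
    (linner ν (ract x b) y : ConvAlg (leftAction β S) μ) = linner ν x (ract y (star b)) := by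
  refine conv_ext fun t r => ?_
  rw [linner_apply, linner_apply]
  congr 1
  have e1 : ∀ h : S, ract x b (r * h) * β t (star (y (t⁻¹ * (r * h)))) =
      ν.int fun k => dmod (-1 / 2) (h⁻¹ * k) • (x (r * k) * (β (r * k) (b (k⁻¹ * h)) *
        β t (star (y (t⁻¹ * (r * h)))))) := fun h => by
    rw [ract_apply, ν.int_mul_of _ b.isCompact_tsupport.inv (by fun_prop) fun k hk => by
      rw [b.eq_zero fun h => hk (by simpa using h), map_zero, mul_zero, smul_zero],
      ν.int_translate h⁻¹]
    refine ν.int_congr fun k => ?_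
    rw [smul_mul_assoc]
    simp only [mul_assoc, mul_inv_rev, inv_inv, inv_mul_cancel_left, mul_inv_cancel_left,
      mul_inv_cancel, inv_mul_cancel, mul_one, one_mul, Subgroup.coe_mul, Subgroup.coe_inv]
  have e2 : ∀ k : S, x (r * k) * β t (star (ract y (star b) (t⁻¹ * (r * k)))) =
      ν.int fun h => dmod (-1 / 2) (h⁻¹ * k) • (x (r * k) * (β (r * k) (b (k⁻¹ * h)) *
        β t (star (y (t⁻¹ * (r * h)))))) := fun k => by
    rw [ract_apply, ν.star_int', ν.act_int', ν.mul_int_of _ (star b).isCompact_tsupport.inv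
      (by fun_prop) fun h hh => by
        rw [(star b).eq_zero fun h' => hh (by simpa using h')]; simp, ν.int_translate k⁻¹]
    refine ν.int_congr fun h => ?_
    rw [ConvAlg.star_apply, inv_modular, ConvAlg.act_smul, mul_smul_comm, star_smul, star_smul,
      star_mul, ConvAlg.act_smul, ConvAlg.act_smul, β.act_mul, smul_smul, mul_smul_comm,
      star_trivial, star_trivial, dmod_inv, dmod_add, ← β.act_star, restrict_apply, ← β.act_star,
      star_star, ← β.mul_apply, ← β.mul_apply, show h⁻¹ * k = (k⁻¹ * h)⁻¹ by group, dmod_inv,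
      show -1 / 2 + - -1 = -(-1 / 2 : ℝ) by norm_num, inv_inv]
    simp only [mul_assoc, mul_inv_rev, inv_inv, inv_mul_cancel_left, mul_inv_cancel_left,
      mul_inv_cancel, inv_mul_cancel, mul_one, one_mul, Subgroup.coe_mul, Subgroup.coe_inv]
  rw [ν.int_congr e1, ν.int_congr e2]
  have hx := isCompact_preimage_coe (S := S) (isCompact_tsupport_cc x) r
  refine (ν.int_swap_of ν hx (hx.mul b.isCompact_tsupport)
    (by fun_prop) (fun k h hk => ?_) (fun k h hk hh => ?_)).symm
  · rw [cc_eq_zero _ hk]; simp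
  · rw [b.eq_zero fun hb => hh ⟨k, hk, k⁻¹ * h, hb, by simp⟩]; simp

end Green
end CrossedProd
end

noncomputable section

namespace CrossedProd

/-! ### Linearity of the actions and sesquilinearity of the inner products. -/

section Linear

variable {X E : Type*} [TopologicalSpace X] [NormedAddCommGroup E] [NormedSpace ℂ E]

lemma cc_add_apply (x y : C_c(X, E)) (s : X) : (x + y) s = x s + y s := rfl

lemma cc_smul_apply (c : ℂ) (x : C_c(X, E)) (s : X) : (c • x) s = c • x s := rfl

lemma HaarMeasure.int_add_of {G E : Type*} [Group G] [TopologicalSpace G] [T2Space G]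
    [NormedAddCommGroup E] [NormedSpace ℝ E] (μ : HaarMeasure G) {f g : G → E}
    {K L : Set G} (hK : IsCompact K) (hL : IsCompact L) (hf : Continuous f) (hg : Continuous g)
    (h : ∀ t, t ∉ K → f t = 0) (h' : ∀ t, t ∉ L → g t = 0) :
    μ.int (fun t => f t + g t) = μ.int f + μ.int g :=
  μ.int_add hf (HasCompactSupport.intro hK h) hg (HasCompactSupport.intro hL h')

end Linear

namespace Green

variable {Q D : Type*} [Group Q] [TopologicalSpace Q] [IsTopologicalGroup Q]
  [LocallyCompactSpace Q] [T2Space Q] [NonUnitalCStarAlgebra D] {β : CStarAction Q D}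
  {S : Subgroup Q} [IsClosed (S : Set Q)] {μ : HaarMeasure Q} {ν : HaarMeasure S}

/-- The left action as a bilinear map. -/
def lactₗ (β : CStarAction Q D) (S : Subgroup Q) [IsClosed (S : Set Q)] (μ : HaarMeasure Q) :
    ConvAlg (leftAction β S) μ →ₗ[ℂ] C_c(Q, D) →ₗ[ℂ] C_c(Q, D) :=
  LinearMap.mk₂ ℂ lact
    (fun a b x => by
      ext r
      rw [cc_add_apply, lact_apply, lact_apply, lact_apply, ← μ.int_add_of a.isCompact_tsupport
        b.isCompact_tsupport (by fun_prop) (by fun_prop)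
        (fun t ht => by rw [apply_eq_zero _ ht, zero_mul, smul_zero])
        (fun t ht => by rw [apply_eq_zero _ ht, zero_mul, smul_zero])]
      exact μ.int_congr fun t => by
        rw [ConvAlg.add_apply, ZeroAtInftyContinuousMap.add_apply, add_mul, smul_add])
    (fun c a x => by
      ext r
      rw [cc_smul_apply, lact_apply, lact_apply, ← μ.int_smul]
      exact μ.int_congr fun t => by
        rw [ConvAlg.smul_apply, ZeroAtInftyContinuousMap.smul_apply, smul_mul_assoc, smul_comm])
    (fun a x y => by
      ext r
      rw [cc_add_apply, lact_apply, lact_apply, lact_apply, ← μ.int_add_of a.isCompact_tsupport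
        a.isCompact_tsupport (by fun_prop) (by fun_prop)
        (fun t ht => by rw [apply_eq_zero _ ht, zero_mul, smul_zero])
        (fun t ht => by rw [apply_eq_zero _ ht, zero_mul, smul_zero])]
      exact μ.int_congr fun t => by rw [cc_add_apply, map_add, mul_add, smul_add])
    (fun c a x => by
      ext r
      rw [cc_smul_apply, lact_apply, lact_apply, ← μ.int_smul]
      exact μ.int_congr fun t => by rw [cc_smul_apply, map_smul, mul_smul_comm, smul_comm])

lemma lactₗ_apply (a : ConvAlg (leftAction β S) μ) (x : C_c(Q, D)) :
    lactₗ β S μ a x = lact a x := rfl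

/-- The right action as a bilinear map. -/
def ractₗ (β : CStarAction Q D) (S : Subgroup Q) [IsClosed (S : Set Q)] (ν : HaarMeasure S) :
    ConvAlg (β.restrict S) ν →ₗ[ℂ] C_c(Q, D) →ₗ[ℂ] C_c(Q, D) :=
  LinearMap.mk₂ ℂ (fun b x => ract x b)
    (fun b c x => by
      ext r
      rw [cc_add_apply, ract_apply, ract_apply, ract_apply, ← ν.int_add_of b.isCompact_tsupport.inv
        c.isCompact_tsupport.inv (by fun_prop) (by fun_prop)
        (fun t ht => by rw [b.eq_zero fun h => ht (by simpa using h), map_zero, mul_zero, smul_zero])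
        (fun t ht => by
          rw [c.eq_zero fun h => ht (by simpa using h), map_zero, mul_zero, smul_zero])]
      exact ν.int_congr fun t => by
        rw [ConvAlg.add_apply, map_add, mul_add, smul_add])
    (fun c b x => by
      ext r
      rw [cc_smul_apply, ract_apply, ract_apply, ← ν.int_smul]
      exact ν.int_congr fun t => by
        rw [ConvAlg.smul_apply, map_smul, mul_smul_comm, smul_comm])
    (fun b x y => by
      ext r
      rw [cc_add_apply, ract_apply, ract_apply, ract_apply, ← ν.int_add_of b.isCompact_tsupport.inv
        b.isCompact_tsupport.inv (by fun_prop) (by fun_prop)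
        (fun t ht => by rw [b.eq_zero fun h => ht (by simpa using h), map_zero, mul_zero, smul_zero])
        (fun t ht => by
          rw [b.eq_zero fun h => ht (by simpa using h), map_zero, mul_zero, smul_zero])]
      exact ν.int_congr fun t => by rw [cc_add_apply, add_mul, smul_add])
    (fun c b x => by
      ext r
      rw [cc_smul_apply, ract_apply, ract_apply, ← ν.int_smul]
      exact ν.int_congr fun t => by rw [cc_smul_apply, smul_mul_assoc, smul_comm])

lemma ractₗ_apply (b : ConvAlg (β.restrict S) ν) (x : C_c(Q, D)) :
    ractₗ β S ν b x = ract x b := rfl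

lemma linner_add_left (x x' y : C_c(Q, D)) : (linner ν (x + x') y : ConvAlg (leftAction β S) μ) =
    linner ν x y + linner ν x' y := by
  refine conv_ext fun t r => ?_
  rw [ConvAlg.add_apply, ZeroAtInftyContinuousMap.add_apply, linner_apply, linner_apply,
    linner_apply, ← smul_add, ← ν.int_add_of (isCompact_preimage_coe (isCompact_tsupport_cc x) r)
    (isCompact_preimage_coe (isCompact_tsupport_cc x') r) (by fun_prop) (by fun_prop)
    (fun h hh => by rw [cc_eq_zero _ hh, zero_mul]) (fun h hh => by rw [cc_eq_zero _ hh, zero_mul])]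
  congr 1
  exact ν.int_congr fun h => by rw [cc_add_apply, add_mul]

lemma linner_smul_left (c : ℂ) (x y : C_c(Q, D)) :
    (linner ν (c • x) y : ConvAlg (leftAction β S) μ) = c • linner ν x y := by
  refine conv_ext fun t r => ?_
  rw [ConvAlg.smul_apply, ZeroAtInftyContinuousMap.smul_apply, linner_apply, linner_apply,
    smul_comm c, ← ν.int_smul c]
  congr 1
  exact ν.int_congr fun h => by rw [cc_smul_apply, smul_mul_assoc]

lemma linner_add_right (x y y' : C_c(Q, D)) :
    (linner ν x (y + y') : ConvAlg (leftAction β S) μ) = linner ν x y + linner ν x y' := by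
  rw [← star_linner, linner_add_left, star_add, star_linner, star_linner]

lemma linner_smul_right (c : ℂ) (x y : C_c(Q, D)) :
    (linner ν x (c • y) : ConvAlg (leftAction β S) μ) = star c • linner ν x y := by
  rw [← star_linner, linner_smul_left, star_smul, star_linner]

lemma rinner_add_right (x y y' : C_c(Q, D)) :
    (rinner μ x (y + y') : ConvAlg (β.restrict S) ν) = rinner μ x y + rinner μ x y' := by
  ext h
  have hx : ∀ t z, t ∉ (tsupport x)⁻¹ → β t (star (x t⁻¹) * z) = 0 := fun t z ht => by
    rw [cc_eq_zero x fun h => ht (by simpa using h), star_zero, zero_mul, map_zero]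
  rw [ConvAlg.add_apply, rinner_apply, rinner_apply, rinner_apply, ← smul_add, ← μ.int_add_of
    (isCompact_tsupport_cc x).inv (isCompact_tsupport_cc x).inv (by fun_prop) (by fun_prop)
    (fun t ht => hx t _ ht) (fun t ht => hx t _ ht)]
  congr 1
  exact μ.int_congr fun t => by rw [cc_add_apply, mul_add, map_add]

lemma rinner_smul_right (c : ℂ) (x y : C_c(Q, D)) :
    (rinner μ x (c • y) : ConvAlg (β.restrict S) ν) = c • rinner μ x y := by
  ext h
  rw [ConvAlg.smul_apply, rinner_apply, rinner_apply, smul_comm c, ← μ.int_smul c]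
  congr 1
  exact μ.int_congr fun t => by rw [cc_smul_apply, mul_smul_comm, map_smul]

lemma rinner_add_left (x x' y : C_c(Q, D)) :
    (rinner μ (x + x') y : ConvAlg (β.restrict S) ν) = rinner μ x y + rinner μ x' y := by
  rw [← star_rinner, rinner_add_right, star_add, star_rinner, star_rinner]

lemma rinner_smul_left (c : ℂ) (x y : C_c(Q, D)) :
    (rinner μ (c • x) y : ConvAlg (β.restrict S) ν) = star c • rinner μ x y := by
  rw [← star_rinner, rinner_smul_right, star_smul, star_rinner]

lemma ract_rinner_left (x y : C_c(Q, D)) (b : ConvAlg (β.restrict S) ν) :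
    (rinner μ (ract x b) y : ConvAlg (β.restrict S) ν) = star b * rinner μ x y := by
  rw [← star_rinner, rinner_ract, star_mul, star_rinner]

lemma linner_lact_right (a : ConvAlg (leftAction β S) μ) (x y : C_c(Q, D)) :
    (linner ν x (lact a y) : ConvAlg (leftAction β S) μ) = linner ν x y * star a := by
  rw [← star_linner, linner_lact, star_mul, star_linner]

/-! ### Bruhat functions and positivity -/

/-- `r ↦ ∫_S φ(r h) dh`. -/
lemma continuous_int_coset (ν : HaarMeasure S) {φ : Q → ℝ} (hφ : Continuous φ) {C : Set Q}
    (hC : IsCompact C) (h : ∀ r, φ r ≠ 0 → r ∈ C) :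
    Continuous fun r : Q => ν.int fun k : S => φ (r * (k : Q)) := by
  refine ν.continuous_int (f := fun (r : Q) (k : S) => φ (r * (k : Q))) (by fun_prop) fun r₀ => ?_
  obtain ⟨U, hU, hUr⟩ := exists_compact_mem_nhds r₀
  refine ⟨U, hUr, _, isCompact_cosetTransporter S hU hC, fun r hr k hk => ?_⟩
  by_contra hne
  exact hk ⟨r, hr, h _ hne⟩

/-- The integral depends only on the coset `rS`, and every coset on which it is nonzero meets `C`,
so its bound on the compact set `C` is global. -/
lemma exists_int_coset_le (ν : HaarMeasure S) {φ : Q → ℝ} (hφ : Continuous φ) {C : Set Q}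
    (hC : IsCompact C) (h : ∀ r, φ r ≠ 0 → r ∈ C) :
    ∃ M : ℝ, ∀ r : Q, (ν.int fun k : S => φ (r * (k : Q))) ≤ M := by
  obtain ⟨M, hM⟩ := (hC.image (continuous_int_coset ν hφ hC h)).bddAbove
  refine ⟨max M 0, fun r => ?_⟩
  by_cases h0 : (ν.int fun k : S => φ (r * (k : Q))) = 0
  · rw [h0]; exact le_max_right _ _
  · obtain ⟨k, hk⟩ := ν.exists_ne_zero h0
    refine le_trans (le_of_eq ?_) ((hM ⟨_, h _ hk, rfl⟩).trans (le_max_left _ _))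
    rw [ν.int_translate k]
    exact ν.int_congr fun l => by rw [Subgroup.coe_mul, mul_assoc]

/-- Divide a cutoff function by its own average over the cosets of `S`. -/
lemma exists_bruhat (ν : HaarMeasure S) {C : Set Q} (hC : IsCompact C) :
    ∃ b : Q → ℝ, Continuous b ∧ HasCompactSupport b ∧ (∀ t, 0 ≤ b t) ∧
      ∀ t ∈ C, (ν.int fun k : S => b (t * (k : Q))) = 1 := by
  obtain ⟨b₀, hb1, -, hbc, hb01⟩ := exists_continuous_one_zero_of_isCompact hC isClosed_empty
    (disjoint_empty C)
  have hb₀ := b₀.continuous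
  let B : Q → ℝ := fun t => ν.int fun k : S => b₀ (t * (k : Q))
  have hB : Continuous B := continuous_int_coset ν hb₀ hbc fun r hr => mem_tsupport_of_ne hr
  have hpos : ∀ t ∈ C, 0 < B t := fun t ht => by
    let _ : MeasurableSpace S := borel S
    have _ : BorelSpace S := ⟨rfl⟩
    have := ν.isHaar
    refine Continuous.integral_pos_of_hasCompactSupport_nonneg_nonzero (x := (1 : S))
      (f := fun k : S => b₀ (t * (k : Q))) (by fun_prop) ?_ (fun k => (hb01 _).1) ?_
    · exact HasCompactSupport.intro (isCompact_preimage_coe hbc t) fun k hk =>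
        image_eq_zero_of_notMem_tsupport hk
    · simp [hb1 ht]
  obtain ⟨e, he, heC⟩ : ∃ e > 0, ∀ t ∈ C, e ≤ B t := by
    rcases C.eq_empty_or_nonempty with rfl | hne
    · exact ⟨1, one_pos, by simp⟩
    · obtain ⟨t, ht, hmin⟩ := hC.exists_isMinOn hne hB.continuousOn
      exact ⟨B t, hpos t ht, fun s hs => hmin hs⟩
  have hm : ∀ t, 0 < max (B t) e := fun t => lt_max_of_lt_right he
  -- The average `B` may vanish away from `C`. Replacing it by its maximum with a lower bound `e` on
  -- `C` keeps the quotient continuous and changes nothing over `C`.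
  refine ⟨fun t => b₀ t / max (B t) e, hb₀.div (hB.max continuous_const) fun t => (hm t).ne', ?_,
    fun t => div_nonneg (hb01 t).1 (hm t).le, fun t ht => ?_⟩
  · exact HasCompactSupport.intro hbc fun t ht => by
      rw [image_eq_zero_of_notMem_tsupport ht, zero_div]
  · have e1 : ∀ k : S, b₀ (t * (k : Q)) / max (B (t * (k : Q))) e = (B t)⁻¹ • b₀ (t * (k : Q)) := by
      intro k
      have : B (t * (k : Q)) = B t := by
        simp only [B]
        rw [ν.int_translate k (fun l : S => b₀ (t * (l : Q)))]
        exact ν.int_congr fun l => by rw [Subgroup.coe_mul, mul_assoc]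
      rw [this, max_eq_left (heC t ht), smul_eq_mul, div_eq_inv_mul]
    rw [ν.int_congr e1, ν.int_smul]
    exact inv_mul_cancel₀ (hpos t ht).ne'

end Green
end CrossedProd
end

noncomputable section

namespace CrossedProd

section Order

attribute [local instance] CStarAlgebra.spectralOrder CStarAlgebra.spectralOrderedRing

lemma HaarMeasure.int_nonneg_cstar {T C : Type*} [Group T] [TopologicalSpace T]
    [NonUnitalCStarAlgebra C] (μ : HaarMeasure T) {f : T → C} (h : ∀ t, 0 ≤ f t) : 0 ≤ μ.int f := by
  let _ : MeasurableSpace T := borel T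
  exact integral_nonneg h

end Order

namespace Green

variable {Q D : Type*} [Group Q] [TopologicalSpace Q] [IsTopologicalGroup Q]
  [LocallyCompactSpace Q] [T2Space Q] [NonUnitalCStarAlgebra D] {β : CStarAction Q D}
  {S : Subgroup Q} [IsClosed (S : Set Q)] {μ : HaarMeasure Q} {ν : HaarMeasure S}

/-- The function `k ↦ Δ_S(k)^(-1/2) β_t(x(t⁻¹k))` on `S`. -/
def slice (x : C_c(Q, D)) (t : Q) : ConvAlg (β.restrict S) ν :=
  ConvAlg.mk (fun k => dmod (-1 / 2) k • β t (x (t⁻¹ * (k : Q)))) (by fun_prop)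
    (HasCompactSupport.intro (isCompact_preimage_coe (isCompact_tsupport_cc x) t⁻¹)
      fun k hk => by rw [cc_eq_zero _ hk, map_zero, smul_zero])

lemma slice_apply (x : C_c(Q, D)) (t : Q) (k : S) : (slice x t : ConvAlg (β.restrict S) ν) k =
    dmod (-1 / 2) k • β t (x (t⁻¹ * (k : Q))) := rfl

lemma star_slice_mul_slice (x : C_c(Q, D)) (t : Q) (h : S) :
    (star (slice x t) * slice x t : ConvAlg (β.restrict S) ν) h = dmod (-1 / 2) h • ν.int fun k : S =>
      β ((k : Q) * t) (star (x ((k : Q) * t)⁻¹) * x (((k : Q) * t)⁻¹ * (h : Q))) := by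
  rw [ConvAlg.mul_apply, ← ν.int_smul]
  refine ν.int_congr fun k => ?_
  rw [ConvAlg.star_apply, slice_apply, slice_apply, inv_modular, star_smul, ConvAlg.act_smul,
    ConvAlg.act_smul, restrict_apply, restrict_apply, ← β.act_star, ← β.mul_apply,
    ← β.mul_apply, smul_mul_assoc, smul_mul_assoc, mul_smul_comm, smul_smul, smul_smul,
    ← β.act_mul, star_trivial, dmod_inv, dmod_mul, dmod_inv, ← mul_assoc, dmod_add,
    dmod_add, show -1 + -(-1 / 2) + -(-1 / 2) = (0 : ℝ) by norm_num, dmod_zero, one_mul]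
  simp only [mul_inv_rev, mul_assoc, Subgroup.coe_mul, Subgroup.coe_inv]

/-- Let `G_h(t) = β_t(x(t⁻¹)* x(t⁻¹h))`, so that `⟨x, x⟩(h)` is `Δ(h)^(-1/2) ∫_Q G_h`. The value at
`h` of `star (slice x t) * slice x t` is `Δ(h)^(-1/2)` times the average of `G_h` over the coset
`St`. Integrating these averages against `b(t⁻¹)` and moving the translation by `k ∈ S` onto `b`
gives `∫_Q G_h(t) (∫_S b(t⁻¹k) dk) dt`. The inner integral is 1 wherever `G_h(t) ≠ 0`, because then
`t⁻¹` lies in the support of `x`. -/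
lemma of_rinner_self (x : C_c(Q, D)) : ∃ b : Q → ℝ, (∀ t, 0 ≤ b t) ∧
    CrossedProduct.of (rinner μ x x : ConvAlg (β.restrict S) ν) =
      μ.int fun t => b t • CrossedProduct.of (star (slice x t) * slice x t :
        ConvAlg (β.restrict S) ν) := by
  obtain ⟨b, hb, hbc, hb0, hb1⟩ := exists_bruhat ν (isCompact_tsupport_cc x)
  refine ⟨fun t => b t⁻¹, fun t => hb0 _, ?_⟩
  let F : Q → ConvAlg (β.restrict S) ν := fun t => ((b t⁻¹ : ℝ) : ℂ) • (star (slice x t) * slice x t)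
  have hFd : ∀ t h, F t h = b t⁻¹ • dmod (-1 / 2) h • ν.int fun k : S =>
      β ((k : Q) * t) (star (x ((k : Q) * t)⁻¹) * x (((k : Q) * t)⁻¹ * (h : Q))) := fun t h => by
    simp only [F]
    rw [ConvAlg.smul_apply, star_slice_mul_slice, Complex.coe_smul]
  have hx : ∀ (t : Q) (k h : S), t⁻¹ * (k : Q)⁻¹ ∉ tsupport x →
      β ((k : Q) * t) (star (x ((k : Q) * t)⁻¹) * x (((k : Q) * t)⁻¹ * (h : Q))) = 0 := by
    intro t k h hk
    rw [mul_inv_rev, cc_eq_zero x hk, star_zero, zero_mul, map_zero]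
  have hFc : Continuous fun q : Q × S => F q.1 q.2 := by
    simp only [hFd]
    have : Continuous fun q : Q × S => ν.int fun k : S => β ((k : Q) * q.1)
        (star (x ((k : Q) * q.1)⁻¹) * x (((k : Q) * q.1)⁻¹ * (q.2 : Q))) := by
      refine ν.continuous_int (f := fun (q : Q × S) (k : S) => β ((k : Q) * q.1)
        (star (x ((k : Q) * q.1)⁻¹) * x (((k : Q) * q.1)⁻¹ * (q.2 : Q)))) (by fun_prop) ?_
      rintro ⟨t₀, h₀⟩
      obtain ⟨U, hU, hUt⟩ := exists_compact_mem_nhds t₀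
      refine ⟨U ×ˢ univ, prod_mem_nhds hUt univ_mem, _,
        (isCompact_cosetTransporter S hU.inv (isCompact_tsupport_cc x)).inv, ?_⟩
      rintro ⟨t, h⟩ ⟨ht, -⟩ k hk
      refine hx t k h fun hm => hk ?_
      exact ⟨t⁻¹, Set.inv_mem_inv.2 ht, by simpa using hm⟩
    fun_prop
  have e1 : (μ.int fun t => b t⁻¹ • CrossedProduct.of (star (slice x t) * slice x t :
      ConvAlg (β.restrict S) ν)) = μ.int fun t => CrossedProduct.of (F t) :=
    μ.int_congr fun t => by rw [CrossedProduct.of_smul, Complex.coe_smul]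
  rw [e1]
  refine int_of_family μ hFc (isCompact_cosetTransporter S (isCompact_tsupport_cc x)
    (isCompact_tsupport_cc x)) hbc.inv (fun t h hne => ?_) fun h => ?_
  · rw [hFd] at hne
    refine ⟨by simpa using mem_tsupport_of_ne fun h0 => hne (by rw [h0, zero_smul]), ?_⟩
    obtain ⟨k, hk⟩ := ν.exists_ne_zero (ne_zero_of_smul_ne (ne_zero_of_smul_ne hne))
    have h1 := ne_zero_of_act_ne hk
    exact ⟨_, mem_tsupport_of_ne fun h0 => left_ne_zero_of_mul h1 (by rw [h0, star_zero]),
      mem_tsupport_of_ne (right_ne_zero_of_mul h1)⟩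
  · simp only [hFd]
    simp_rw [smul_comm (b _)]
    rw [rinner_apply, μ.int_smul]
    congr 1
    obtain ⟨g, hg⟩ : ∃ g : Q → D, ∀ t, g t = β t (star (x t⁻¹) * x (t⁻¹ * h)) := ⟨_, fun _ => rfl⟩
    have hgc : Continuous g := by rw [funext hg]; fun_prop
    simp_rw [← hg, ← ν.int_smul]
    rw [μ.int_swap_of ν hbc.inv (L := {k : S | ∃ r ∈ tsupport b, r * (k : Q) ∈ tsupport x}⁻¹)
      (isCompact_cosetTransporter S hbc (isCompact_tsupport_cc x)).inv
      (by fun_prop) (fun t k ht => ?_) (fun t k ht hk => ?_)]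
    · have e2 : ∀ k : S, (μ.int fun t => b t⁻¹ • g ((k : Q) * t)) =
          μ.int fun t => b (t⁻¹ * (k : Q)) • g t := fun k => by
        rw [μ.int_translate ((k : Q)⁻¹)]
        exact μ.int_congr fun t => by simp
      rw [ν.int_congr e2, ← μ.int_swap_of ν (isCompact_tsupport_cc x).inv (isCompact_cosetTransporter S
        (isCompact_tsupport_cc x) hbc) (by fun_prop) (fun t k ht => ?_) (fun t k ht hk => ?_)]
      · refine μ.int_congr fun t => ?_
        rw [ν.int_smul_const]
        by_cases ht : t⁻¹ ∈ tsupport x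
        · rw [hb1 _ ht, one_smul]
        · rw [hg, cc_eq_zero x ht, star_zero, zero_mul, map_zero, smul_zero]
      · rw [hg, cc_eq_zero x fun h => ht (by simpa using h), star_zero, zero_mul, map_zero, smul_zero]
      · rw [image_eq_zero_of_notMem_tsupport (f := b), zero_smul]
        exact fun hm => hk ⟨t⁻¹, by simpa using ht, hm⟩
    · rw [image_eq_zero_of_notMem_tsupport (f := b) fun h => ht (by simpa using h), zero_smul]
    · rw [hg, mul_inv_rev, cc_eq_zero x fun hm => hk ⟨t⁻¹, by simpa using ht, by simpa using hm⟩,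
        star_zero, zero_mul, map_zero, smul_zero]

section Order

attribute [local instance] CStarAlgebra.spectralOrder CStarAlgebra.spectralOrderedRing

lemma of_rinner_self_nonneg (x : C_c(Q, D)) :
    0 ≤ CrossedProduct.of (rinner μ x x : ConvAlg (β.restrict S) ν) := by
  obtain ⟨b, hb, h⟩ := of_rinner_self (β := β) (μ := μ) (ν := ν) x
  rw [h]
  refine μ.int_nonneg_cstar fun t => smul_nonneg (hb t) ?_
  rw [CrossedProduct.of_mul, CrossedProduct.of_star]
  exact star_mul_self_nonneg _

end Order

end Green
end CrossedProd
end

noncomputable section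

namespace CrossedProd

/-! ### Positivity of the left inner product by approximate square roots. -/

namespace Green

variable {Q D : Type*} [Group Q] [TopologicalSpace Q] [IsTopologicalGroup Q]
  [LocallyCompactSpace Q] [T2Space Q] [NonUnitalCStarAlgebra D] {β : CStarAction Q D}
  {S : Subgroup Q} [IsClosed (S : Set Q)] {μ : HaarMeasure Q} {ν : HaarMeasure S}

/-- The function `rS ↦ (∫_S b(r h) dh)^(1/2)`. -/
def rootAverage (ν : HaarMeasure S) (b : Q → ℝ) : Q ⧸ S → ℝ :=
  Quotient.lift (fun r : Q => √(ν.int fun h : S => b (r * (h : Q)))) (by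
    intro r r' hr
    have hr := QuotientGroup.leftRel_apply.1 hr
    change √_ = √_
    rw [ν.int_translate ⟨_, hr⟩ (fun h : S => b (r * (h : Q)))]
    congr 1
    exact ν.int_congr fun h => by rw [Subgroup.coe_mul, ← mul_assoc, mul_inv_cancel_left])

lemma rootAverage_mk (b : Q → ℝ) (r : Q) :
    rootAverage ν b (r : Q ⧸ S) = √(ν.int fun h : S => b (r * (h : Q))) := rfl

lemma rootAverage_mul_self {b : Q → ℝ} (hb0 : ∀ t, 0 ≤ b t) (r : Q) :
    rootAverage ν b (r : Q ⧸ S) * rootAverage ν b (r : Q ⧸ S) =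
      ν.int fun h : S => b (r * (h : Q)) :=
  Real.mul_self_sqrt (ν.int_nonneg fun _ => hb0 _)

lemma continuous_rootAverage {b : Q → ℝ} (hb : Continuous b) (hbc : HasCompactSupport b) :
    Continuous (rootAverage ν b) :=
  QuotientGroup.isOpenQuotientMap_mk.continuous_comp_iff.1
    (continuous_int_coset ν hb hbc fun _ => mem_tsupport_of_ne).sqrt

lemma mem_image_of_rootAverage_ne_zero {b : Q → ℝ} {q : Q ⧸ S} (h : rootAverage ν b q ≠ 0) :
    q ∈ ((↑) : Q → Q ⧸ S) '' tsupport b := by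
  induction q using QuotientGroup.induction_on with
  | H r =>
    rw [rootAverage_mk] at h
    obtain ⟨k, hk⟩ := ν.exists_ne_zero fun h0 => h (by rw [h0, Real.sqrt_zero])
    exact ⟨_, mem_tsupport_of_ne hk, mk_mul_coe r k⟩

/-- The function `(s, rS) ↦ Δ(s)^(-1/2) (∫_S b(s⁻¹ r h) dh)^(1/2) x(s)`. -/
def approxRoot (ν : HaarMeasure S) (b : Q → ℝ) (hb : Continuous b) (hbc : HasCompactSupport b)
    (x : C_c(Q, D)) : ConvAlg (leftAction β S) μ :=
  c0Cc (fun s q => dmod (-1 / 2) s • rootAverage ν b (s⁻¹ • q) • x s)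
    (by
      have := continuous_rootAverage (ν := ν) hb hbc
      simp only [Function.uncurry_def]
      fun_prop)
    (tsupport x) (isCompact_tsupport_cc x)
    ((fun q : Q × (Q ⧸ S) => q.1 • q.2) '' (tsupport x ×ˢ (((↑) : Q → Q ⧸ S) '' tsupport b)))
    (((isCompact_tsupport_cc x).prod (hbc.image QuotientGroup.continuous_mk)).image
      continuous_smul) (by
    intro s q hne
    have h1 := ne_zero_of_smul_ne hne
    have h2 := mem_tsupport_of_ne (ne_zero_of_smul_ne h1)
    refine ⟨h2, (s, s⁻¹ • q), ⟨h2, mem_image_of_rootAverage_ne_zero (ν := ν) fun h0 => h1 ?_⟩, by simp⟩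
    rw [h0, zero_smul])

lemma approxRoot_apply (b : Q → ℝ) (hb : Continuous b) (hbc : HasCompactSupport b)
    (x : C_c(Q, D)) (s r : Q) :
    (approxRoot ν b hb hbc x : ConvAlg (leftAction β S) μ) s (r : Q ⧸ S) =
      dmod (-1 / 2) s • rootAverage ν b ((s⁻¹ * r : Q) : Q ⧸ S) • x s := rfl

/-- With `g_t(s) = x(s) β_t(x(t⁻¹s)*)`, the product `w w*` is `⟨x, x⟩` in which `g_t(rh)` is
replaced by its average over right translates `g_t(rhs)` with weight `b(s⁻¹)`. The square root in
`w` is chosen so that the two factors, evaluated at the same coset, multiply to the coset average of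
`b`. -/
lemma approxRoot_mul_star (b : Q → ℝ) (hb : Continuous b) (hbc : HasCompactSupport b)
    (hb0 : ∀ t, 0 ≤ b t) (x : C_c(Q, D)) (t r : Q) :
    (approxRoot ν b hb hbc x * star (approxRoot ν b hb hbc x) : ConvAlg (leftAction β S) μ) t
      (r : Q ⧸ S) = dmod (-1 / 2) t • ν.int fun h : S => μ.int fun s =>
        b s⁻¹ • (x (r * h * s) * β t (star (x (t⁻¹ * (r * h * s))))) := by
  obtain ⟨g, hg⟩ : ∃ g : Q → D, ∀ s, g s = x s * β t (star (x (t⁻¹ * s))) := ⟨_, fun _ => rfl⟩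
  have hgc : Continuous g := by rw [funext hg]; fun_prop
  rw [ConvAlg.mul_apply_apply]
  have e1 : ∀ s, (approxRoot ν b hb hbc x : ConvAlg (leftAction β S) μ) s (r : Q ⧸ S) *
      β s ((star (approxRoot ν b hb hbc x) : ConvAlg (leftAction β S) μ) (s⁻¹ * t)
        (cosetAction S s⁻¹ (r : Q ⧸ S))) =
      dmod (-1 / 2) t • ν.int fun h : S => b (s⁻¹ * (r * h)) • g s := fun s => by
    rw [cosetAction_mk, ConvAlg.star_apply_apply, cosetAction_mk, approxRoot_apply,
      approxRoot_apply, ν.int_smul_const, hg]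
    simp_rw [← mul_assoc s⁻¹ r]
    have hc : dmod (-1 / 2) s * (dmod (-1) (s⁻¹ * t) * dmod (-1 / 2) (t⁻¹ * s)) =
        dmod (-1 / 2) t := by
      rw [show t⁻¹ * s = (s⁻¹ * t)⁻¹ by group, dmod_inv, dmod_add,
        show (-1 : ℝ) + -(-1 / 2) = -1 / 2 by norm_num, ← dmod_mul, mul_inv_cancel_left]
    rw [← rootAverage_mul_self hb0, star_smul, star_smul, star_trivial, star_trivial,
      ConvAlg.act_smul, ConvAlg.act_smul, ConvAlg.act_smul, ConvAlg.act_smul, ConvAlg.act_smul,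
      ← β.mul_apply, ← mul_assoc (s⁻¹ * t)⁻¹⁻¹, inv_mul_cancel, one_mul, mul_inv_cancel_left,
      show (s⁻¹ * t)⁻¹ = t⁻¹ * s by group, ← hc]
    simp only [smul_mul_assoc, mul_smul_comm, smul_smul]
    congr 1
    ring
  have hgK : ∀ s, s ∉ tsupport x → g s = 0 := fun s hs => by rw [hg, cc_eq_zero x hs, zero_mul]
  simp_rw [← hg]
  rw [μ.int_congr e1, μ.int_smul, μ.int_swap_of ν (isCompact_tsupport_cc x)
    (isCompact_cosetTransporter S ((isCompact_tsupport_cc x).inv.mul (isCompact_singleton (x := r)))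
      hbc) (by fun_prop) (fun s h hs => by rw [hgK s hs, smul_zero]) (fun s h hs hh => ?_)]
  · congr 1
    refine ν.int_congr fun h => ?_
    rw [μ.int_translate (r * (h : Q))]
    exact μ.int_congr fun s => by simp [mul_assoc]
  · rw [image_eq_zero_of_notMem_tsupport (f := b), zero_smul]
    exact fun hm => hh ⟨s⁻¹ * r, ⟨s⁻¹, by simpa using hs, r, rfl, rfl⟩, by
      simpa [mul_assoc] using hm⟩

end Green
end CrossedProd
end

noncomputable section

namespace CrossedProd

lemma c0_norm_le {X A : Type*} [TopologicalSpace X] [NonUnitalCStarAlgebra A] {f : C₀(X, A)}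
    {M : ℝ} (hM : 0 ≤ M) (h : ∀ x, ‖f x‖ ≤ M) : ‖f‖ ≤ M := by
  rw [← ZeroAtInftyContinuousMap.norm_toBCF_eq_norm]
  exact (BoundedContinuousFunction.norm_le hM).2 h

lemma c0_norm_apply_le {X A : Type*} [TopologicalSpace X] [NonUnitalCStarAlgebra A] (f : C₀(X, A))
    (x : X) : ‖f x‖ ≤ ‖f‖ := by
  rw [← ZeroAtInftyContinuousMap.norm_toBCF_eq_norm]
  exact BoundedContinuousFunction.norm_coe_le_norm f.toBCF x

namespace Green

variable {Q D : Type*} [Group Q] [TopologicalSpace Q] [IsTopologicalGroup Q]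
  [LocallyCompactSpace Q] [T2Space Q] [NonUnitalCStarAlgebra D] {β : CStarAction Q D}
  {S : Subgroup Q} [IsClosed (S : Set Q)] {μ : HaarMeasure Q} {ν : HaarMeasure S}

lemma norm_sub_average_le {b : Q → ℝ} (hb : Continuous b) (hbc : HasCompactSupport b)
    (hb0 : ∀ t, 0 ≤ b t) (hb1 : (μ.int fun s => b s⁻¹) = 1) {g : Q → D} (hg : Continuous g) {q : Q}
    {η : ℝ} (h : ∀ s, b s⁻¹ ≠ 0 → ‖g q - g (q * s)‖ ≤ η) :
    ‖g q - μ.int fun s => b s⁻¹ • g (q * s)‖ ≤ η := by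
  have hc : HasCompactSupport fun s => b s⁻¹ := hbc.comp_homeomorph (Homeomorph.inv Q)
  have e1 : (g q - μ.int fun s => b s⁻¹ • g (q * s)) =
      μ.int fun s => b s⁻¹ • (g q - g (q * s)) := by
    simp_rw [smul_sub]
    rw [μ.int_sub (f := fun s => b s⁻¹ • g q) (g := fun s => b s⁻¹ • g (q * s)) (by fun_prop)
      hc.smul_right (by fun_prop) hc.smul_right, μ.int_smul_const, hb1,
      one_smul]
  rw [e1]
  refine (μ.norm_int_le _).trans ?_
  have e2 : η = μ.int fun s => b s⁻¹ * η := by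
    have := μ.int_smul_const (fun s => b s⁻¹) η
    simp only [smul_eq_mul] at this
    rw [this, hb1, one_mul]
  rw [e2]
  refine μ.int_mono (by fun_prop) (hc.smul_right).norm (by fun_prop) hc.mul_right fun s => ?_
  rw [norm_smul, Real.norm_of_nonneg (hb0 _)]
  by_cases hs : b s⁻¹ = 0
  · rw [hs, zero_mul, zero_mul]
  · exact mul_le_mul_of_nonneg_left (h s hs) (hb0 _)

lemma exists_approximate_unit (μ : HaarMeasure Q) {U : Set Q} (hU : U ∈ 𝓝 (1 : Q)) :
    ∃ b : Q → ℝ, Continuous b ∧ HasCompactSupport b ∧ (∀ t, 0 ≤ b t) ∧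
      (∀ s, b s⁻¹ ≠ 0 → s ∈ U) ∧ (μ.int fun s => b s⁻¹) = 1 := by
  obtain ⟨b, hb, hbc, hb0, hbU, hbi⟩ := μ.exists_nonneg_int_pos hU
  refine ⟨fun s => (μ.int b)⁻¹ * b s⁻¹, by fun_prop,
    (hbc.comp_homeomorph (Homeomorph.inv Q)).mul_left,
    fun s => mul_nonneg (inv_nonneg.2 hbi.le) (hb0 _), fun s hs => ?_, ?_⟩
  · simp only [inv_inv] at hs
    exact hbU s (right_ne_zero_of_mul hs)
  · simp only [inv_inv]
    exact (μ.int_smul (μ.int b)⁻¹ b).trans (inv_mul_cancel₀ hbi.ne')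

/-- The pointwise error is at most `η` and is supported in `K'`. The cutoff `φ`, equal to 1 there,
dominates its indicator function and has continuous coset integrals, which can be bounded uniformly
in `r`. -/
lemma norm_int_sub_average_le {b : Q → ℝ} (hb : Continuous b) (hbc : HasCompactSupport b)
    (hb0 : ∀ t, 0 ≤ b t) (hb1 : (μ.int fun s => b s⁻¹) = 1) {g : Q → D} (hg : Continuous g)
    {K K' : Set Q} (hK' : IsCompact K') (hKK' : K ⊆ K')
    (hgK : ∀ s, s ∉ K → g s = 0)
    (hbK : ∀ q s, b s⁻¹ ≠ 0 → q * s ∈ K → q ∈ K') {φ : Q → ℝ} (hφ : Continuous φ)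
    (hφc : HasCompactSupport φ) (hφ0 : ∀ q, 0 ≤ φ q) (hφ1 : ∀ q ∈ K', φ q = 1) {η : ℝ} (hη : 0 ≤ η)
    (h : ∀ q ∈ K', ∀ s, b s⁻¹ ≠ 0 → ‖g q - g (q * s)‖ ≤ η) (r : Q) :
    ‖(ν.int fun h : S => g (r * (h : Q))) -
      ν.int fun h : S => μ.int fun s => b s⁻¹ • g (r * (h : Q) * s)‖ ≤
        η * ν.int fun h : S => φ (r * (h : Q)) := by
  have hz : ∀ q, q ∉ K' → (μ.int fun s => b s⁻¹ • g (q * s)) = 0 := fun q hq => by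
    by_contra hne
    obtain ⟨s, hs⟩ := μ.exists_ne_zero hne
    refine hq (hbK q s (fun h0 => hs (by rw [h0, zero_smul])) ?_)
    by_contra hn
    exact hs (by rw [hgK _ hn, smul_zero])
  have hA : Continuous fun q => μ.int fun s => b s⁻¹ • g (q * s) := by
    refine μ.continuous_int (f := fun q s => b s⁻¹ • g (q * s)) (by fun_prop) fun q =>
      ⟨univ, univ_mem, _, hbc.inv, fun q' _ s hs => ?_⟩
    rw [image_eq_zero_of_notMem_tsupport (f := b) fun h => hs (by simpa using h), zero_smul]
  have hcmp := isCompact_preimage_coe (S := S) hK' r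
  have hφr : Continuous fun h : S => φ (r * (h : Q)) := by fun_prop
  have hgr : Continuous fun h : S => g (r * (h : Q)) := by fun_prop
  have hAr : Continuous fun h : S => μ.int fun s => b s⁻¹ • g (r * (h : Q) * s) :=
    hA.comp (continuous_const.mul continuous_subtype_val)
  have hgs : HasCompactSupport fun h : S => g (r * (h : Q)) :=
    HasCompactSupport.intro hcmp fun h hh => hgK _ fun hm => hh (hKK' hm)
  have hAs : HasCompactSupport fun h : S => μ.int fun s => b s⁻¹ • g (r * (h : Q) * s) :=
    HasCompactSupport.intro hcmp fun h hh => hz _ hh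
  rw [← ν.int_sub hgr hgs hAr hAs]
  refine (ν.norm_int_le _).trans ?_
  have e2 : (η * ν.int fun h : S => φ (r * (h : Q))) = ν.int fun h : S => η * φ (r * (h : Q)) :=
    (ν.int_smul η fun h : S => φ (r * (h : Q))).symm
  rw [e2]
  have hφs : HasCompactSupport fun h : S => φ (r * (h : Q)) :=
    HasCompactSupport.intro (isCompact_preimage_coe hφc r) fun h hh =>
      image_eq_zero_of_notMem_tsupport hh
  refine ν.int_mono (hgr.sub hAr).norm ?_ (hφr.const_mul η) hφs.mul_left fun k => ?_
  · exact HasCompactSupport.intro hcmp fun k hk => by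
      rw [hz _ hk, hgK _ fun hm => hk (hKK' hm), sub_zero, norm_zero]
  · by_cases hk : r * (k : Q) ∈ K'
    · rw [hφ1 _ hk, mul_one]
      exact norm_sub_average_le hb hbc hb0 hb1 hg (h _ hk)
    · rw [hz _ hk, hgK _ fun hm => hk (hKK' hm), sub_zero, norm_zero]
      exact mul_nonneg hη (hφ0 _)

/-- Take `b` with integral 1 (after inversion) concentrated near the identity: by uniform continuity
the averages in `approxRoot_mul_star` converge uniformly, within a fixed compact set. -/
lemma exists_l1Norm_linner_sub_le (x : C_c(Q, D)) {e : ℝ} (he : 0 < e) :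
    ∃ w : ConvAlg (leftAction β S) μ, ConvAlg.l1Norm (linner ν x x - w * star w) ≤ e := by
  have hK := isCompact_tsupport_cc x
  obtain ⟨U, hUc, hU⟩ := exists_compact_mem_nhds (1 : Q)
  have hK' := hK.mul hUc.inv
  have hC := hK.mul hK.inv
  obtain ⟨φ, hφ1, -, hφc, hφ01⟩ := exists_continuous_one_zero_of_isCompact hK' isClosed_empty
    (disjoint_empty _)
  obtain ⟨M, hM⟩ := exists_int_coset_le ν φ.continuous hφc fun r hr => mem_tsupport_of_ne hr
  have hM0 : 0 ≤ M := (ν.int_nonneg fun _ => (hφ01 _).1).trans (hM 1)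
  obtain ⟨c, hc0, hc⟩ := ConvAlg.exists_l1Norm_le_mul (leftAction β S) μ hC
  obtain ⟨m, hm⟩ := (hC.image (continuous_dmod (-1 / 2))).bddAbove
  have hm' : ∀ t ∈ tsupport x * (tsupport x)⁻¹, dmod (-1 / 2) t ≤ |m| := fun t ht =>
    (hm ⟨t, ht, rfl⟩).trans (le_abs_self m)
  -- The error is at most `c |m| η M`, where `c` turns a uniform bound into an `L¹`-bound, `m`
  -- bounds `Δ^(-1/2)` on the support, and `M` bounds the coset integrals of `φ`. The added 1
  -- prevents a zero denominator.
  obtain ⟨η, hη, hηe⟩ : ∃ η > 0, c * (|m| * (η * M)) ≤ e := by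
    refine ⟨e / (c * (|m| * M) + 1), by positivity, ?_⟩
    have h1 : 0 ≤ c * (|m| * M) := by positivity
    rw [show c * (|m| * (e / (c * (|m| * M) + 1) * M)) = e * (c * (|m| * M)) / (c * (|m| * M) + 1) by
      ring, div_le_iff₀ (by positivity)]
    nlinarith
  obtain ⟨g, hg⟩ : ∃ g : Q → Q → D, ∀ t s, g t s = x s * β t (star (x (t⁻¹ * s))) :=
    ⟨_, fun _ _ => rfl⟩
  have hgc : Continuous fun q : Q × Q => g q.1 q.2 := by simp only [hg]; fun_prop
  have hgC : ∀ t s, t ∉ tsupport x * (tsupport x)⁻¹ → g t s = 0 := fun t s ht => by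
    rw [hg]
    by_cases hs : s ∈ tsupport x
    · rw [cc_eq_zero x (s := t⁻¹ * s), star_zero, map_zero, mul_zero]
      exact fun hm => ht ⟨s, hs, _, Set.inv_mem_inv.2 hm, by group⟩
    · rw [cc_eq_zero x hs, zero_mul]
  -- Compactness gives one neighbourhood of the identity for all `t` and all base points at once.
  have hV : ∀ᶠ s in 𝓝 (1 : Q), ∀ p ∈ (tsupport x * (tsupport x)⁻¹) ×ˢ (tsupport x * U⁻¹),
      ‖g p.1 p.2 - g p.1 (p.2 * s)‖ < η := by
    refine (hC.prod hK').eventually_forall_of_forall_eventually fun p _ => ?_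
    have hcont : Continuous fun q : Q × (Q × Q) => ‖g q.2.1 q.2.2 - g q.2.1 (q.2.2 * q.1)‖ :=
      ((hgc.comp continuous_snd).sub (hgc.comp (f := fun q : Q × (Q × Q) => (q.2.1, q.2.2 * q.1))
        (by fun_prop))).norm
    exact (hcont.tendsto (1, p)).eventually_lt_const (by simpa using hη)
  obtain ⟨b, hb, hbc, hb0, hbU, hb1⟩ := exists_approximate_unit μ (inter_mem hV hU)
  have key : ∀ t ∈ tsupport x * (tsupport x)⁻¹, ∀ r : Q, ‖(linner ν x x - approxRoot ν b hb hbc x *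
      star (approxRoot ν b hb hbc x) : ConvAlg (leftAction β S) μ) t (r : Q ⧸ S)‖ ≤
        |m| * (η * M) := by
    intro t ht r
    rw [ConvAlg.sub_apply, ZeroAtInftyContinuousMap.sub_apply, linner_apply,
      approxRoot_mul_star b hb hbc hb0, ← smul_sub, norm_smul, Real.norm_of_nonneg (dmod_pos _ _).le]
    refine mul_le_mul (hm' t ht) ?_ (norm_nonneg _) (abs_nonneg m)
    simp_rw [← hg]
    have h1U : (1 : Q) ∈ U⁻¹ := by simpa using mem_of_mem_nhds hU
    refine (norm_int_sub_average_le hb hbc hb0 hb1 (hgc.comp (Continuous.prodMk_right t)) hK'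
      (fun s hs => ⟨s, hs, 1, h1U, mul_one s⟩)
      (fun s hs => by change g t s = 0; rw [hg, cc_eq_zero x hs, zero_mul]) (fun q s hs hq => ?_)
      φ.continuous hφc (fun q => (hφ01 q).1) (fun q hq => hφ1 hq) hη.le (fun q hq s hs => ?_)
      r).trans (mul_le_mul_of_nonneg_left (hM r) hη.le)
    · exact ⟨_, hq, s⁻¹, Set.inv_mem_inv.2 (hbU s hs).2, by simp⟩
    · exact ((hbU s hs).1 (t, q) ⟨ht, hq⟩).le
  have key0 : ∀ t, t ∉ tsupport x * (tsupport x)⁻¹ → ∀ r : Q, (linner ν x x -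
      approxRoot ν b hb hbc x * star (approxRoot ν b hb hbc x) : ConvAlg (leftAction β S) μ) t
        (r : Q ⧸ S) = 0 := by
    intro t ht r
    rw [ConvAlg.sub_apply, ZeroAtInftyContinuousMap.sub_apply, linner_apply,
      approxRoot_mul_star b hb hbc hb0]
    simp_rw [← hg, hgC _ _ ht, smul_zero, HaarMeasure.int_zero, smul_zero, sub_zero]
  refine ⟨approxRoot ν b hb hbc x, (hc _ (|m| * (η * M)) (fun t hne => ?_) (fun t => ?_)
    (by positivity)).trans hηe⟩
  · by_contra ht
    refine hne (ZeroAtInftyContinuousMap.ext fun q => ?_)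
    induction q using QuotientGroup.induction_on with
    | H r => exact key0 t ht r
  · refine c0_norm_le (by positivity) fun q => ?_
    induction q using QuotientGroup.induction_on with
    | H r =>
      by_cases ht : t ∈ tsupport x * (tsupport x)⁻¹
      · exact key t ht r
      · rw [key0 t ht r, norm_zero]
        positivity

section Order

attribute [local instance] CStarAlgebra.spectralOrder CStarAlgebra.spectralOrderedRing

lemma of_linner_self_nonneg (x : C_c(Q, D)) :
    0 ≤ CrossedProduct.of (linner ν x x : ConvAlg (leftAction β S) μ) := by
  have hcl : IsClosed {a : CrossedProduct (leftAction β S) μ | 0 ≤ a} := CStarAlgebra.isClosed_nonneg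
  refine hcl.closure_subset (Metric.mem_closure_iff.2 fun e he => ?_)
  obtain ⟨w, hw⟩ := exists_l1Norm_linner_sub_le (β := β) (μ := μ) (ν := ν) x (half_pos he)
  refine ⟨CrossedProduct.of (w * star w), ?_, ?_⟩
  · rw [CrossedProduct.of_mul, CrossedProduct.of_star]
    exact (mul_star_self_nonneg (CrossedProduct.of w) : (0 : CrossedProduct (leftAction β S) μ) ≤ _)
  · rw [dist_eq_norm, ← CrossedProduct.of_sub, CrossedProduct.norm_of]
    exact ((ConvAlg.norm_le_l1Norm _).trans hw).trans_lt (half_lt_self he)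

end Order

end Green
end CrossedProd
end

noncomputable section

namespace CrossedProd

lemma HaarMeasure.norm_int_le_of_le {G E : Type*} [Group G] [TopologicalSpace G]
    [NormedAddCommGroup E] [NormedSpace ℝ E] (μ : HaarMeasure G) {f : G → E} {g : G → ℝ}
    (hg : Continuous g) (hc : HasCompactSupport g) (h : ∀ t, ‖f t‖ ≤ g t) :
    ‖μ.int f‖ ≤ μ.int g := by
  let _ : MeasurableSpace G := borel G
  exact norm_integral_le_of_norm_le (μ.integrable' hg hc) (Eventually.of_forall h)

/-! ### The two seminorms on `C_c(Q, D)` and their Cauchy–Schwarz inequalities. -/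

section Seminorms

variable {G A V : Type*} [Group G] [TopologicalSpace G] [IsTopologicalGroup G]
  [LocallyCompactSpace G] [T2Space G] [NonUnitalCStarAlgebra A]
  {α : CStarAction G A} {μ : HaarMeasure G} [AddCommGroup V] [Module ℂ V]

/-- Stated for a bare seminorm, because the same space `C_c(Q, D)` carries two competing ones. -/
lemma ConvAlg.action_le_norm_of_seminorm (p : Seminorm ℂ V) (T : ConvAlg α μ →ₗ[ℂ] V →ₗ[ℂ] V)
    (hm : ∀ a b x, T (a * b) x = T a (T b x))
    (hcs : ∀ a x, p (T a x) ^ 2 ≤ p x * p (T (star a * a) x))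
    (hl : ∀ a x, p (T a x) ≤ l1Norm a * p x) (a : ConvAlg α μ) (x : V) : p (T a x) ≤ ‖a‖ * p x :=
  let _ : SeminormedAddCommGroup V :=
    { p.toAddGroupSeminorm.toSeminormedAddCommGroup with }
  let _ : NormedSpace ℂ V := ⟨fun c x => (map_smul_eq_mul p c x).le⟩
  ConvAlg.action_le_norm T hm hcs hl a x

lemma ConvAlg.action_le_norm_of_seminorm' (p : Seminorm ℂ V) (T : ConvAlg α μ →ₗ[ℂ] V →ₗ[ℂ] V)
    (hm : ∀ a b x, T (a * b) x = T b (T a x))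
    (hcs : ∀ a x, p (T a x) ^ 2 ≤ p x * p (T (a * star a) x))
    (hl : ∀ a x, p (T a x) ≤ l1Norm a * p x) (a : ConvAlg α μ) (x : V) : p (T a x) ≤ ‖a‖ * p x :=
  let _ : SeminormedAddCommGroup V :=
    { p.toAddGroupSeminorm.toSeminormedAddCommGroup with }
  let _ : NormedSpace ℂ V := ⟨fun c x => (map_smul_eq_mul p c x).le⟩
  ConvAlg.action_le_norm' T hm hcs hl a x

end Seminorms

namespace Green

variable {Q D : Type*} [Group Q] [TopologicalSpace Q] [IsTopologicalGroup Q]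
  [LocallyCompactSpace Q] [T2Space Q] [NonUnitalCStarAlgebra D] {β : CStarAction Q D}
  {S : Subgroup Q} [IsClosed (S : Set Q)] {μ : HaarMeasure Q} {ν : HaarMeasure S}

section Order

attribute [local instance] CStarAlgebra.spectralOrder CStarAlgebra.spectralOrderedRing

/-- The right inner product as a positive inner product. -/
def rightSemiInner (β : CStarAction Q D) (μ : HaarMeasure Q) (ν : HaarMeasure S) :
    SemiInner C_c(Q, D) (CrossedProduct (β.restrict S) ν) where
  ip x y := CrossedProduct.of (rinner μ x y)
  add_left x x' y := by rw [rinner_add_left, CrossedProduct.of_add]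
  star_ip x y := by rw [← CrossedProduct.of_star, star_rinner]
  real_smul_left a x y := by
    rw [← Complex.coe_smul, rinner_smul_left, CrossedProduct.of_smul, ← Complex.coe_smul]
    simp
  norm_smul_self c x := by
    rw [rinner_smul_left, rinner_smul_right, CrossedProduct.of_smul, CrossedProduct.of_smul,
      norm_smul, norm_smul, norm_star, ← mul_assoc, sq]
  nonneg := of_rinner_self_nonneg
  exists_module x y := by
    refine ⟨ract x (rinner μ x y : ConvAlg (β.restrict S) ν), star (CrossedProduct.of (rinner μ x y)), norm_star _, ?_, ?_⟩
    · rw [rinner_ract, ract_rinner_left, CrossedProduct.of_mul, CrossedProduct.of_mul,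
        CrossedProduct.of_star, star_star]
    · rw [ract_rinner_left, CrossedProduct.of_mul, CrossedProduct.of_star, star_star]

/-- The left inner product as a positive inner product. -/
def leftSemiInner (β : CStarAction Q D) (μ : HaarMeasure Q) (ν : HaarMeasure S) :
    SemiInner C_c(Q, D) (CrossedProduct (leftAction β S) μ) where
  ip x y := CrossedProduct.of (linner ν x y)
  add_left x x' y := by rw [linner_add_left, CrossedProduct.of_add]
  star_ip x y := by rw [← CrossedProduct.of_star, star_linner]
  real_smul_left a x y := by
    rw [← Complex.coe_smul, linner_smul_left, CrossedProduct.of_smul, ← Complex.coe_smul]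
  norm_smul_self c x := by
    rw [linner_smul_left, linner_smul_right, CrossedProduct.of_smul, CrossedProduct.of_smul,
      norm_smul, norm_smul, norm_star, ← mul_assoc, sq]
  nonneg := of_linner_self_nonneg
  exists_module x y := by
    refine ⟨lact (linner ν y x : ConvAlg (leftAction β S) μ) x, CrossedProduct.of (linner ν y x), ?_, ?_, ?_⟩
    · rw [← star_linner, CrossedProduct.of_star, norm_star]
    · rw [linner_lact, linner_lact_right, CrossedProduct.of_mul, CrossedProduct.of_mul,
        CrossedProduct.of_star, mul_assoc]
    · rw [linner_lact, CrossedProduct.of_mul, ← star_linner, CrossedProduct.of_star, star_star]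

end Order

/-- The seminorm of the right inner product. -/
def rnorm (β : CStarAction Q D) (μ : HaarMeasure Q) (ν : HaarMeasure S) : Seminorm ℂ C_c(Q, D) :=
  (rightSemiInner β μ ν).seminorm

/-- The seminorm of the left inner product. -/
def lnorm (β : CStarAction Q D) (μ : HaarMeasure Q) (ν : HaarMeasure S) : Seminorm ℂ C_c(Q, D) :=
  (leftSemiInner β μ ν).seminorm

lemma rnorm_apply (x : C_c(Q, D)) :
    rnorm β μ ν x = √‖(rinner μ x x : ConvAlg (β.restrict S) ν)‖ := by
  rw [← CrossedProduct.norm_of]; rfl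

lemma rnorm_sq (x : C_c(Q, D)) :
    rnorm β μ ν x ^ 2 = ‖(rinner μ x x : ConvAlg (β.restrict S) ν)‖ := by
  rw [rnorm_apply, Real.sq_sqrt (norm_nonneg _)]

lemma lnorm_apply (x : C_c(Q, D)) :
    lnorm β μ ν x = √‖(linner ν x x : ConvAlg (leftAction β S) μ)‖ := by
  rw [← CrossedProduct.norm_of]; rfl

lemma lnorm_sq (x : C_c(Q, D)) :
    lnorm β μ ν x ^ 2 = ‖(linner ν x x : ConvAlg (leftAction β S) μ)‖ := by
  rw [lnorm_apply, Real.sq_sqrt (norm_nonneg _)]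

lemma norm_rinner_le (x y : C_c(Q, D)) :
    ‖(rinner μ x y : ConvAlg (β.restrict S) ν)‖ ≤ rnorm β μ ν x * rnorm β μ ν y := by
  rw [← CrossedProduct.norm_of]
  exact (rightSemiInner β μ ν).norm_ip_le x y

lemma norm_linner_le (x y : C_c(Q, D)) :
    ‖(linner ν x y : ConvAlg (leftAction β S) μ)‖ ≤ lnorm β μ ν x * lnorm β μ ν y := by
  rw [← CrossedProduct.norm_of]
  exact (leftSemiInner β μ ν).norm_ip_le x y

lemma rnorm_le_of_forall {x : C_c(Q, D)} {M : ℝ} (hM : 0 ≤ M)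
    (h : ‖(rinner μ x x : ConvAlg (β.restrict S) ν)‖ ≤ M * rnorm β μ ν x) : rnorm β μ ν x ≤ M := by
  have := (rightSemiInner β μ ν).seminorm_le_of_forall (x := x) (M := M) (by
    rw [← CrossedProduct.norm_of] at h
    exact h)
  rwa [max_eq_left hM] at this

lemma lnorm_le_of_forall {x : C_c(Q, D)} {M : ℝ} (hM : 0 ≤ M)
    (h : ‖(linner ν x x : ConvAlg (leftAction β S) μ)‖ ≤ M * lnorm β μ ν x) :
    lnorm β μ ν x ≤ M := by
  have := (leftSemiInner β μ ν).seminorm_le_of_forall (x := x) (M := M) (by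
    rw [← CrossedProduct.norm_of] at h
    exact h)
  rwa [max_eq_left hM] at this

/-! ### Crude bounds for the two seminorms -/

lemma exists_norm_le_cc (x : C_c(Q, D)) : ∃ C : ℝ, 0 ≤ C ∧ ∀ r, ‖x r‖ ≤ C := by
  obtain ⟨C, hC⟩ := (continuous_cc x).bounded_above_of_compact_support x.hasCompactSupport
  exact ⟨C, (norm_nonneg _).trans (hC 1), hC⟩

/-- If `y` is dominated by `M φ`, then `⟨y, y⟩` is supported in a compact set depending on `φ` and
is uniformly at most a constant times `M²`; compare with the `L¹`-norm. The constant is far from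
sharp, but it depends only on `φ`. It provides the orbit bound for multiplication operators and the
density of the embedding of `C_c(P, A)`. -/
lemma exists_rnorm_le (β : CStarAction Q D) (μ : HaarMeasure Q) (ν : HaarMeasure S)
    {φ : Q → ℝ} (hφ : Continuous φ) (hφc : HasCompactSupport φ) (hφ0 : ∀ r, 0 ≤ φ r) : ∃ C : ℝ, ∀ (y : C_c(Q, D)) (M : ℝ), 0 ≤ M →
      (∀ r, ‖y r‖ ≤ M * φ r) → rnorm β μ ν y ≤ C * M := by
  have hK : IsCompact (tsupport φ) := hφc
  have hT := isCompact_cosetTransporter S hK hK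
  obtain ⟨c, hc0, hc⟩ := ConvAlg.exists_l1Norm_le_mul (β.restrict S) ν hT
  obtain ⟨m, hm⟩ := (hT.image (continuous_dmod (-1 / 2))).bddAbove
  obtain ⟨X, hX'⟩ := hφ.bounded_above_of_compact_support hφc
  have hX : ∀ r, φ r ≤ X := fun r => (le_abs_self _).trans (hX' r)
  have hX0 : 0 ≤ X := (hφ0 1).trans (hX 1)
  have hxi : HasCompactSupport fun t => φ t⁻¹ * X :=
    HasCompactSupport.intro hK.inv fun t ht => by
      rw [image_eq_zero_of_notMem_tsupport (f := φ) fun h => ht (by simpa using h), zero_mul]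
  refine ⟨√(c * (|m| * μ.int fun t => φ t⁻¹ * X)), fun y M hM h => ?_⟩
  have hI : 0 ≤ μ.int fun t => φ t⁻¹ * X := μ.int_nonneg fun t => mul_nonneg (hφ0 _) hX0
  have hy : ∀ {r}, y r ≠ 0 → r ∈ tsupport φ := fun {r} hr => by
    refine mem_tsupport_of_ne fun h0 => hr ?_
    have := h r
    rw [h0, mul_zero] at this
    exact norm_le_zero_iff.1 this
  have hsupp : ∀ k : S, (rinner μ y y : ConvAlg (β.restrict S) ν) k ≠ 0 →
      k ∈ {h : S | ∃ r ∈ tsupport φ, r * (h : Q) ∈ tsupport φ} := fun k hk => by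
    rw [rinner_apply] at hk
    obtain ⟨t, ht⟩ := μ.exists_ne_zero (ne_zero_of_smul_ne hk)
    have h1 := ne_zero_of_act_ne ht
    exact ⟨t⁻¹, hy fun h0 => left_ne_zero_of_mul h1 (by rw [h0, star_zero]),
      hy (right_ne_zero_of_mul h1)⟩
  rw [rnorm_apply, ← Real.sqrt_sq hM, ← Real.sqrt_mul (by positivity)]
  refine Real.sqrt_le_sqrt ((ConvAlg.norm_le_l1Norm _).trans ((hc _ (|m| * ((μ.int fun t =>
    φ t⁻¹ * X) * M ^ 2)) hsupp (fun k => ?_) (by positivity)).trans_eq (by ring)))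
  by_cases hk : (rinner μ y y : ConvAlg (β.restrict S) ν) k = 0
  · rw [hk, norm_zero]; positivity
  rw [rinner_apply, norm_smul, Real.norm_of_nonneg (dmod_pos _ _).le]
  refine mul_le_mul ((hm ⟨k, hsupp k hk, rfl⟩).trans (le_abs_self m)) ?_ (norm_nonneg _)
    (abs_nonneg m)
  refine (μ.norm_int_le _).trans ?_
  have e : (μ.int fun t => φ t⁻¹ * X) * M ^ 2 = μ.int fun t => M ^ 2 * (φ t⁻¹ * X) := by
    rw [mul_comm]
    exact (μ.int_smul (M ^ 2) fun t => φ t⁻¹ * X).symm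
  rw [e]
  refine μ.int_mono (by fun_prop) ?_ (by fun_prop) hxi.mul_left fun t => ?_
  · exact HasCompactSupport.intro hK.inv fun t ht => by
      rw [by_contra fun h0 => ht (Set.mem_inv.2 (hy h0)), star_zero, zero_mul, map_zero, norm_zero]
  · rw [β.norm_apply]
    refine (norm_mul_le _ _).trans ?_
    rw [norm_star]
    calc ‖y t⁻¹‖ * ‖y (t⁻¹ * k)‖ ≤ (M * φ t⁻¹) * (M * X) :=
          mul_le_mul (h _) ((h _).trans (mul_le_mul_of_nonneg_left (hX _) hM)) (norm_nonneg _)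
            (mul_nonneg hM (hφ0 _))
      _ = _ := by ring

/-- The analogue of `exists_rnorm_le`, with `‖x‖` as the dominating function; it provides orbit
bounds for right multiplication. -/
lemma exists_lnorm_le (β : CStarAction Q D) (μ : HaarMeasure Q) (ν : HaarMeasure S)
    (x : C_c(Q, D)) : ∃ C : ℝ, ∀ (y : C_c(Q, D)) (M : ℝ), 0 ≤ M →
      (∀ r, ‖y r‖ ≤ M * ‖x r‖) → lnorm β μ ν y ≤ C * M := by
  have hK := isCompact_tsupport_cc x
  have hT := hK.mul hK.inv
  obtain ⟨c, hc0, hc⟩ := ConvAlg.exists_l1Norm_le_mul (leftAction β S) μ hT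
  obtain ⟨m, hm⟩ := (hT.image (continuous_dmod (-1 / 2))).bddAbove
  obtain ⟨X, hX0, hX⟩ := exists_norm_le_cc x
  obtain ⟨I, hI⟩ := exists_int_coset_le ν (φ := fun r => ‖x r‖) (by fun_prop) hK
    fun r hr => mem_tsupport_of_ne (norm_ne_zero_iff.1 hr)
  have hI0 : 0 ≤ I := (ν.int_nonneg fun _ => norm_nonneg _).trans (hI 1)
  refine ⟨√(c * (|m| * (X * I))), fun y M hM h => ?_⟩
  have hy : ∀ {r}, y r ≠ 0 → r ∈ tsupport x := fun {r} hr => by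
    refine mem_tsupport_of_ne fun h0 => hr ?_
    have := h r
    rw [h0, norm_zero, mul_zero] at this
    exact norm_le_zero_iff.1 this
  have hsupp : ∀ t r : Q, (linner ν y y : ConvAlg (leftAction β S) μ) t (r : Q ⧸ S) ≠ 0 →
      t ∈ tsupport x * (tsupport x)⁻¹ := fun t r hk => by
    rw [linner_apply] at hk
    obtain ⟨k, hk⟩ := ν.exists_ne_zero (ne_zero_of_smul_ne hk)
    have h2 := ne_zero_of_act_ne (right_ne_zero_of_mul hk)
    exact ⟨_, hy (left_ne_zero_of_mul hk), _,
      Set.inv_mem_inv.2 (hy fun h0 => h2 (by rw [h0, star_zero])), by group⟩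
  rw [lnorm_apply, ← Real.sqrt_sq hM, ← Real.sqrt_mul (by positivity)]
  refine Real.sqrt_le_sqrt ((ConvAlg.norm_le_l1Norm _).trans ((hc _ (|m| * ((X * I) * M ^ 2))
    (fun t ht => ?_) (fun t => c0_norm_le (by positivity) fun q => ?_) (by positivity)).trans_eq
    (by ring)))
  · by_contra hn
    refine ht (ZeroAtInftyContinuousMap.ext fun q => ?_)
    induction q using QuotientGroup.induction_on with
    | H r => exact by_contra fun hne => hn (hsupp t r hne)
  induction q using QuotientGroup.induction_on with
  | H r =>
  by_cases hk : (linner ν y y : ConvAlg (leftAction β S) μ) t (r : Q ⧸ S) = 0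
  · rw [hk, norm_zero]; positivity
  rw [linner_apply, norm_smul, Real.norm_of_nonneg (dmod_pos _ _).le]
  refine mul_le_mul ((hm ⟨t, hsupp t r hk, rfl⟩).trans (le_abs_self m)) ?_ (norm_nonneg _)
    (abs_nonneg m)
  refine (ν.norm_int_le _).trans ?_
  have hc := isCompact_preimage_coe (S := S) hK r
  have e : (ν.int fun k : S => (X * M ^ 2) * ‖x (r * k)‖) ≤ X * I * M ^ 2 := by
    rw [show X * I * M ^ 2 = (X * M ^ 2) * I by ring]
    exact (ν.int_smul (X * M ^ 2) fun k : S => ‖x (r * k)‖).trans_le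
      (mul_le_mul_of_nonneg_left (hI r) (by positivity))
  refine le_trans (ν.int_mono (by fun_prop) ?_ (by fun_prop) ?_ fun k => ?_) e
  · exact HasCompactSupport.intro hc fun k hk => by
      rw [by_contra fun h0 => hk (hy h0), zero_mul, norm_zero]
  · exact HasCompactSupport.intro hc fun k hk => by rw [cc_eq_zero x hk, norm_zero, mul_zero]
  · refine (norm_mul_le _ _).trans ?_
    rw [β.norm_apply, norm_star]
    calc ‖y (r * k)‖ * ‖y (t⁻¹ * (r * k))‖ ≤ (M * ‖x (r * k)‖) * (M * X) :=
          mul_le_mul (h _) ((h _).trans (mul_le_mul_of_nonneg_left (hX _) hM)) (norm_nonneg _)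
            (by positivity)
      _ = _ := by ring

end Green
end CrossedProd
end

noncomputable section

namespace CrossedProd

namespace Green

variable {Q D : Type*} [Group Q] [TopologicalSpace Q] [IsTopologicalGroup Q]
  [LocallyCompactSpace Q] [T2Space Q] [NonUnitalCStarAlgebra D] {β : CStarAction Q D}
  {S : Subgroup Q} [IsClosed (S : Set Q)] {μ : HaarMeasure Q} {ν : HaarMeasure S}

/-! ### The left action is bounded for the seminorm of the right inner product -/

/-- The function `r ↦ Δ(s)^(1/2) β_s(x(s⁻¹r))`. -/
def translate (β : CStarAction Q D) (s : Q) (x : C_c(Q, D)) : C_c(Q, D) where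
  toFun r := dmod (1 / 2) s • β s (x (s⁻¹ * r))
  continuous_toFun := by fun_prop
  hasCompactSupport' := HasCompactSupport.intro
    ((isCompact_singleton (x := s)).mul (isCompact_tsupport_cc x)) fun r hr => by
      rw [cc_eq_zero x fun h => hr ⟨s, rfl, _, h, by simp⟩, map_zero, smul_zero]

lemma translate_apply (s : Q) (x : C_c(Q, D)) (r : Q) :
    translate β s x r = dmod (1 / 2) s • β s (x (s⁻¹ * r)) := rfl

/-- The factor `Δ(s)^(1/2)` in `translate` compensates the right translation by `s` under the
integral over `Q`. -/
lemma rinner_translate (s : Q) (x y : C_c(Q, D)) :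
    (rinner μ (translate β s x) (translate β s y) : ConvAlg (β.restrict S) ν) = rinner μ x y := by
  ext h
  rw [rinner_apply, rinner_apply]
  congr 1
  have hc := μ.int_mul_right (f := fun t => β t (star (x t⁻¹) * y (t⁻¹ * h))) (by fun_prop)
    (HasCompactSupport.intro (isCompact_tsupport_cc x).inv fun t ht => by
      rw [cc_eq_zero x fun h => ht (by simpa using h), star_zero, zero_mul, map_zero]) s
  rw [inv_modular] at hc
  have e : ∀ t, β t (star (translate β s x t⁻¹) * translate β s y (t⁻¹ * h)) =
      dmod 1 s • β (t * s) (star (x (t * s)⁻¹) * y ((t * s)⁻¹ * h)) := fun t => by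
    rw [translate_apply, translate_apply, star_smul, star_trivial, smul_mul_smul_comm, dmod_add,
      ← β.act_star, ← β.act_mul, ConvAlg.act_smul, ← β.mul_apply, mul_inv_rev, mul_assoc s⁻¹]
    norm_num
  rw [μ.int_congr e, μ.int_smul, hc, smul_smul, dmod_add]
  norm_num

lemma rnorm_translate (s : Q) (x : C_c(Q, D)) :
    rnorm β μ ν (translate β s x) = rnorm β μ ν x := by
  rw [rnorm_apply, rnorm_apply, rinner_translate]

/-- The pointwise product `r ↦ m(rS) x(r)`. -/
def cmul (m : C₀(Q ⧸ S, D)) (x : C_c(Q, D)) : C_c(Q, D) where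
  toFun r := m (r : Q ⧸ S) * x r
  continuous_toFun := by fun_prop
  hasCompactSupport' := x.hasCompactSupport.mul_left

lemma cmul_apply (m : C₀(Q ⧸ S, D)) (x : C_c(Q, D)) (r : Q) :
    cmul m x r = m (r : Q ⧸ S) * x r := rfl

lemma rinner_cmul (m : C₀(Q ⧸ S, D)) (x y : C_c(Q, D)) :
    (rinner μ (cmul m x) y : ConvAlg (β.restrict S) ν) = rinner μ x (cmul (star m) y) := by
  ext h
  rw [rinner_apply, rinner_apply]
  congr 1
  refine μ.int_congr fun t => ?_
  rw [cmul_apply, cmul_apply, star_mul, mk_mul_coe, mul_assoc]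
  rfl

/-- Multiplication by `m` is adjointable with adjoint multiplication by `m*`, so
`action_le_of_orbit_bound` upgrades the crude bound on each orbit to the sharp constant `‖m‖`. -/
lemma rnorm_cmul_le (m : C₀(Q ⧸ S, D)) (x : C_c(Q, D)) :
    rnorm β μ ν (cmul m x) ≤ ‖m‖ * rnorm β μ ν x := by
  refine action_le_of_orbit_bound (N := fun m : C₀(Q ⧸ S, D) => ‖m‖) (nV := rnorm β μ ν) norm_nonneg
    norm_mul_le norm_star (fun x => apply_nonneg _ x) (T := cmul) (fun m x => ?_) (fun x => ?_) m x
  · have : cmul (star m * m) x = cmul (star m) (cmul m x) := by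
      ext r
      exact mul_assoc _ _ _
    rw [rnorm_sq, rinner_cmul, ← this]
    exact norm_rinner_le _ _
  · obtain ⟨C, hC⟩ := exists_rnorm_le β μ ν (continuous_cc x).norm x.hasCompactSupport.norm
      fun _ => norm_nonneg _
    refine ⟨C, fun m => hC _ _ (norm_nonneg m) fun r => ?_⟩
    exact (norm_mul_le _ _).trans
      (mul_le_mul_of_nonneg_right (c0_norm_apply_le m _) (norm_nonneg _))

/-- The left action is the integral over `s` of a translation followed by a multiplication by
`a(s)`. The formula is paired with `y` so that the integral lives in a crossed product, not in the
incomplete space `C_c(Q, D)`. -/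
lemma of_rinner_lact (a : ConvAlg (leftAction β S) μ) (x y : C_c(Q, D)) :
    CrossedProduct.of (rinner μ y (lact a x) : ConvAlg (β.restrict S) ν) =
      μ.int fun s => CrossedProduct.of (rinner μ y (cmul (a s) (translate β s x)) :
        ConvAlg (β.restrict S) ν) := by
  have hF : ∀ (s : Q) (h : S), (rinner μ y (cmul (a s) (translate β s x)) :
      ConvAlg (β.restrict S) ν) h = dmod (-1 / 2) h • μ.int fun t => β t (star (y t⁻¹) *
        (dmod (1 / 2) s • (a s ((t⁻¹ * h : Q) : Q ⧸ S) * β s (x (s⁻¹ * (t⁻¹ * h)))))) :=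
    fun s h => by
      rw [rinner_apply]
      congr 1
      refine μ.int_congr fun t => ?_
      rw [cmul_apply, translate_apply, mul_smul_comm (dmod (1 / 2) s) (a s _)]
  have hy : ∀ t d, t ∉ (tsupport y)⁻¹ → β t (star (y t⁻¹) * d) = 0 := fun t d ht => by
    rw [cc_eq_zero y fun h => ht (by simpa using h), star_zero, zero_mul, map_zero]
  have hi : Continuous fun q : Q × S => μ.int fun t => β t (star (y t⁻¹) *
      (dmod (1 / 2) q.1 • (a q.1 ((t⁻¹ * q.2 : Q) : Q ⧸ S) *
        β q.1 (x (q.1⁻¹ * (t⁻¹ * q.2)))))) :=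
    μ.continuous_int (f := fun (q : Q × S) t => β t (star (y t⁻¹) *
      (dmod (1 / 2) q.1 • (a q.1 ((t⁻¹ * q.2 : Q) : Q ⧸ S) *
        β q.1 (x (q.1⁻¹ * (t⁻¹ * q.2))))))) (by fun_prop) fun q =>
      ⟨univ, univ_mem, _, (isCompact_tsupport_cc y).inv, fun _ _ t ht => hy t _ ht⟩
  refine int_of_family μ (by simp only [hF]; fun_prop) (isCompact_cosetTransporter S
    (isCompact_tsupport_cc y) (a.isCompact_tsupport.mul (isCompact_tsupport_cc x)))
    a.isCompact_tsupport (fun s h hne => ?_) fun h => ?_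
  · rw [hF] at hne
    obtain ⟨t, ht⟩ := μ.exists_ne_zero (ne_zero_of_smul_ne hne)
    have h1 := ne_zero_of_act_ne ht
    have h2 := ne_zero_of_smul_ne (right_ne_zero_of_mul h1)
    have hs : s ∈ tsupport a := by_contra fun hs => left_ne_zero_of_mul h2 (apply_eq_zero a hs _)
    exact ⟨hs, t⁻¹, mem_tsupport_of_ne fun h0 => left_ne_zero_of_mul h1 (by rw [h0, star_zero]),
      s, hs, _, mem_tsupport_of_ne (ne_zero_of_act_ne (right_ne_zero_of_mul h2)), by simp⟩
  · simp_rw [hF]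
    rw [rinner_apply, μ.int_smul]
    congr 1
    have e : ∀ t, β t (star (y t⁻¹) * lact a x (t⁻¹ * h)) = μ.int fun s => β t (star (y t⁻¹) *
        (dmod (1 / 2) s • (a s ((t⁻¹ * h : Q) : Q ⧸ S) * β s (x (s⁻¹ * (t⁻¹ * h)))))) := fun t => by
      rw [lact_apply, μ.mul_int_of _ a.isCompact_tsupport (by fun_prop)
        fun s hs => by rw [apply_eq_zero _ hs, zero_mul, smul_zero], μ.act_int']
    rw [μ.int_congr e]
    exact μ.int_swap_of μ (isCompact_tsupport_cc y).inv a.isCompact_tsupport (by fun_prop)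
      (fun t s ht => hy t _ ht) fun t s _ hs => by
        rw [apply_eq_zero _ hs, zero_mul, smul_zero, mul_zero, map_zero]

lemma norm_rinner_lact_le (a : ConvAlg (leftAction β S) μ) (x y : C_c(Q, D)) :
    ‖(rinner μ y (lact a x) : ConvAlg (β.restrict S) ν)‖ ≤
      ConvAlg.l1Norm a * rnorm β μ ν x * rnorm β μ ν y := by
  rw [← CrossedProduct.norm_of, of_rinner_lact]
  have e : ConvAlg.l1Norm a * rnorm β μ ν x * rnorm β μ ν y =
      μ.int fun s => (rnorm β μ ν x * rnorm β μ ν y) * ‖a s‖ := by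
    rw [mul_assoc, mul_comm]
    exact (μ.int_smul (rnorm β μ ν x * rnorm β μ ν y) fun s => ‖a s‖).symm
  rw [e]
  refine μ.norm_int_le_of_le (by fun_prop) a.hasCompactSupport_norm.mul_left fun s => ?_
  rw [CrossedProduct.norm_of]
  refine (norm_rinner_le _ _).trans ?_
  have h1 := rnorm_cmul_le (β := β) (μ := μ) (ν := ν) (a s) (translate β s x)
  rw [rnorm_translate] at h1
  refine (mul_le_mul_of_nonneg_left h1 (apply_nonneg _ _)).trans_eq ?_
  ring

/-- Taking `y = lact a x` in `norm_rinner_lact_le` gives the bound by the `L¹`-norm. Adjointability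
gives the Cauchy–Schwarz inequality, and `ConvAlg.action_le_norm_of_seminorm` passes to the
universal norm. -/
lemma rnorm_lact_le (a : ConvAlg (leftAction β S) μ) (x : C_c(Q, D)) :
    rnorm β μ ν (lact a x) ≤ ‖a‖ * rnorm β μ ν x := by
  refine ConvAlg.action_le_norm_of_seminorm (rnorm β μ ν) (lactₗ β S μ) lact_mul (fun a x => ?_)
    (fun a x => ?_) a x
  · rw [rnorm_sq]
    simp only [lactₗ_apply]
    rw [rinner_lact, ← lact_mul]
    exact norm_rinner_le _ _
  · exact rnorm_le_of_forall (mul_nonneg (ConvAlg.l1Norm_nonneg a) (apply_nonneg _ _))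
      (norm_rinner_lact_le a x _)

/-- Immediate from `⟨x b, x b⟩ = b* ⟨x, x⟩ b`; no `L¹`-estimate is involved on this side. -/
lemma rnorm_ract_le (x : C_c(Q, D)) (b : ConvAlg (β.restrict S) ν) :
    rnorm β μ ν (ract x b) ≤ rnorm β μ ν x * ‖b‖ := by
  refine (sq_le_sq₀ (apply_nonneg _ _) (mul_nonneg (apply_nonneg _ _) (norm_nonneg _))).1 ?_
  rw [mul_pow, rnorm_sq, rnorm_sq, rinner_ract, ract_rinner_left]
  refine (norm_mul_le _ _).trans ((mul_le_mul_of_nonneg_right (norm_mul_le _ _)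
    (norm_nonneg _)).trans_eq ?_)
  rw [norm_star]
  ring

end Green
end CrossedProd
end

noncomputable section

namespace CrossedProd

namespace Green

variable {Q D : Type*} [Group Q] [TopologicalSpace Q] [IsTopologicalGroup Q]
  [LocallyCompactSpace Q] [T2Space Q] [NonUnitalCStarAlgebra D] {β : CStarAction Q D}
  {S : Subgroup Q} [IsClosed (S : Set Q)] {μ : HaarMeasure Q} {ν : HaarMeasure S}

/-! ### The right action is bounded for the seminorm of the left inner product -/

/-- The function `r ↦ Δ_S(k)^(1/2) x(r k)`. -/
def rtranslate (k : S) (x : C_c(Q, D)) : C_c(Q, D) where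
  toFun r := dmod (1 / 2) k • x (r * (k : Q))
  continuous_toFun := by fun_prop
  hasCompactSupport' := HasCompactSupport.intro
    ((isCompact_tsupport_cc x).mul (isCompact_singleton (x := (k : Q)⁻¹))) fun r hr => by
      rw [cc_eq_zero x fun h => hr ⟨_, h, _, rfl, by simp⟩, smul_zero]

lemma rtranslate_apply (k : S) (x : C_c(Q, D)) (r : Q) :
    rtranslate k x r = dmod (1 / 2) k • x (r * (k : Q)) := rfl

/-- The factor `Δ_S(k)^(1/2)` compensates the right translation by `k` under the integral over `S`.
-/
lemma linner_rtranslate (k : S) (x y : C_c(Q, D)) :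
    (linner ν (rtranslate k x) (rtranslate k y) : ConvAlg (leftAction β S) μ) = linner ν x y := by
  refine conv_ext fun t r => ?_
  rw [linner_apply, linner_apply]
  congr 1
  have hc := ν.int_mul_right (f := fun h : S => x (r * (h : Q)) *
    β t (star (y (t⁻¹ * (r * (h : Q)))))) (by fun_prop) (HasCompactSupport.intro
      (isCompact_preimage_coe (isCompact_tsupport_cc x) r) fun t ht => by
      rw [cc_eq_zero x ht, zero_mul]) k
  rw [inv_modular] at hc
  have e : ∀ h : S, rtranslate k x (r * h) * β t (star (rtranslate k y (t⁻¹ * (r * h)))) =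
      dmod 1 k • (x (r * ((h * k : S) : Q)) * β t (star (y (t⁻¹ * (r * ((h * k : S) : Q)))))) :=
    fun h => by
    rw [rtranslate_apply, rtranslate_apply, star_smul, star_trivial, ConvAlg.act_smul,
      smul_mul_smul_comm, dmod_add, Subgroup.coe_mul]
    simp only [mul_assoc]
    norm_num
  rw [ν.int_congr e, ν.int_smul, hc, smul_smul, dmod_add]
  norm_num

lemma lnorm_rtranslate (k : S) (x : C_c(Q, D)) :
    lnorm β μ ν (rtranslate k x) = lnorm β μ ν x := by
  rw [lnorm_apply, lnorm_apply, linner_rtranslate]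

/-- The pointwise product `r ↦ x(r) β_r(d)`. -/
def rcmul (β : CStarAction Q D) (d : D) (x : C_c(Q, D)) : C_c(Q, D) where
  toFun r := x r * β r d
  continuous_toFun := by fun_prop
  hasCompactSupport' := x.hasCompactSupport.mul_right

lemma rcmul_apply (d : D) (x : C_c(Q, D)) (r : Q) : rcmul β d x r = x r * β r d := rfl

lemma linner_rcmul (d : D) (x y : C_c(Q, D)) :
    (linner ν (rcmul β d x) y : ConvAlg (leftAction β S) μ) =
      linner ν x (rcmul β (star d) y) := by
  refine conv_ext fun t r => ?_
  rw [linner_apply, linner_apply]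
  congr 1
  refine ν.int_congr fun h => ?_
  rw [rcmul_apply, rcmul_apply, star_mul, ← β.act_star, star_star, β.act_mul, ← β.mul_apply,
    mul_inv_cancel_left, mul_assoc]

lemma lnorm_rcmul_le (d : D) (x : C_c(Q, D)) :
    lnorm β μ ν (rcmul β d x) ≤ ‖d‖ * lnorm β μ ν x := by
  -- Right multiplication reverses products, so the left action to which the principle applies is
  -- multiplication by `d*`.
  have key := action_le_of_orbit_bound (N := fun d : D => ‖d‖) (nV := lnorm β μ ν) norm_nonneg
    norm_mul_le norm_star (fun x => apply_nonneg _ x) (T := fun d x => rcmul β (star d) x)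
    (fun m x => ?_) (fun x => ?_) (star d) x
  · simpa only [star_star, norm_star] using key
  · have : rcmul β (star (star m * m)) x = rcmul β (star (star m)) (rcmul β (star m) x) := by
      ext r
      rw [star_mul, star_star, rcmul_apply, rcmul_apply, rcmul_apply, β.act_mul, mul_assoc]
    rw [lnorm_sq, linner_rcmul, this]
    exact norm_linner_le _ _
  · obtain ⟨C, hC⟩ := exists_lnorm_le β μ ν x
    refine ⟨C, fun m => hC _ _ (norm_nonneg m) fun r => (norm_mul_le _ _).trans_eq ?_⟩
    rw [β.norm_apply, norm_star, mul_comm]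

lemma ract_linner_kernel_continuous (b : ConvAlg (β.restrict S) ν) (x y : C_c(Q, D)) :
    Continuous fun q : (S × Q) × Q => ν.int fun k : S =>
      x (q.2 * k * (q.1.1 : Q)) * β (q.2 * k * q.1.1) (b q.1.1⁻¹) *
        β q.1.2 (star (y (q.1.2⁻¹ * (q.2 * k)))) := by
  refine ν.continuous_int (f := fun (q : (S × Q) × Q) (k : S) =>
    x (q.2 * k * (q.1.1 : Q)) * β (q.2 * k * q.1.1) (b q.1.1⁻¹) *
        β q.1.2 (star (y (q.1.2⁻¹ * (q.2 * k))))) (by fun_prop) ?_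
  rintro ⟨⟨h₀, t₀⟩, r₀⟩
  obtain ⟨U, hU, hUt⟩ := exists_compact_mem_nhds t₀
  obtain ⟨W, hW, hWr⟩ := exists_compact_mem_nhds r₀
  refine ⟨(univ ×ˢ U) ×ˢ W, prod_mem_nhds (prod_mem_nhds univ_mem hUt) hWr, _,
    isCompact_cosetTransporter S (hU.inv.mul hW) (isCompact_tsupport_cc y), ?_⟩
  rintro ⟨⟨h, t⟩, r⟩ ⟨⟨-, ht⟩, hr⟩ k hk
  dsimp only
  rw [cc_eq_zero y fun hm => hk ⟨_, ⟨t⁻¹, Set.inv_mem_inv.2 ht, r, hr, rfl⟩, by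
    simpa [mul_assoc] using hm⟩, star_zero, map_zero, mul_zero]

/-- The kernel of the integral formula for the left inner product of `x · b` and `y`. -/
def ractFamily (b : ConvAlg (β.restrict S) ν) (x y : C_c(Q, D)) (h : S) :
    ConvAlg (leftAction β S) μ :=
  ((dmod (-1) h : ℝ) : ℂ) • linner ν (rtranslate h (rcmul β (b h⁻¹) x)) y

lemma ractFamily_apply (b : ConvAlg (β.restrict S) ν) (x y : C_c(Q, D)) (h : S) (t r : Q) :
    (ractFamily b x y h : ConvAlg (leftAction β S) μ) t (r : Q ⧸ S) = dmod (-1 / 2) h •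
      dmod (-1 / 2) t • ν.int fun k : S => x (r * k * (h : Q)) * β (r * k * h) (b h⁻¹) *
        β t (star (y (t⁻¹ * (r * k)))) := by
  rw [ractFamily, ConvAlg.smul_apply, ZeroAtInftyContinuousMap.smul_apply, linner_apply,
    Complex.coe_smul]
  simp_rw [rtranslate_apply, rcmul_apply, smul_mul_assoc]
  rw [ν.int_smul, smul_comm (dmod (-1 / 2) t), smul_smul, dmod_add]
  norm_num

lemma ractFamily_support (b : ConvAlg (β.restrict S) ν) (x y : C_c(Q, D)) (h : S) (t r : Q)
    (hne : (ractFamily b x y h : ConvAlg (leftAction β S) μ) t (r : Q ⧸ S) ≠ 0) :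
    h ∈ (tsupport b)⁻¹ ∧ t ∈ (tsupport x * ((↑) '' tsupport b)) * (tsupport y)⁻¹ ∧
      (r : Q ⧸ S) ∈ ((↑) : Q → Q ⧸ S) '' tsupport x := by
  rw [ractFamily_apply] at hne
  obtain ⟨k, hk⟩ := ν.exists_ne_zero (ne_zero_of_smul_ne (ne_zero_of_smul_ne hne))
  have h1 := left_ne_zero_of_mul hk
  have hx := mem_tsupport_of_ne (left_ne_zero_of_mul h1)
  have hb := mem_tsupport_of_ne (ne_zero_of_act_ne (right_ne_zero_of_mul h1))
  have h2 := ne_zero_of_act_ne (right_ne_zero_of_mul hk)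
  have hy := mem_tsupport_of_ne (f := y) fun h0 => h2 (by rw [h0, star_zero])
  refine ⟨by simpa using hb, ⟨_, ⟨_, hx, _, ⟨_, hb, rfl⟩, rfl⟩, _, Set.inv_mem_inv.2 hy, ?_⟩, _, hx, ?_⟩
  · simp [mul_assoc]
  · rw [mk_mul_coe, mk_mul_coe]

lemma continuous_ractFamily (b : ConvAlg (β.restrict S) ν) (x y : C_c(Q, D)) :
    Continuous fun q : S × Q => (ractFamily b x y q.1 : ConvAlg (leftAction β S) μ) q.2 := by
  have hq : IsOpenQuotientMap fun q : (S × Q) × Q => (q.1, (q.2 : Q ⧸ S)) :=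
    IsOpenQuotientMap.id.prodMap QuotientGroup.isOpenQuotientMap_mk
  have hc : Continuous (Function.uncurry fun (q : S × Q) (r : Q ⧸ S) =>
      (ractFamily b x y q.1 : ConvAlg (leftAction β S) μ) q.2 r) := by
    rw [← hq.continuous_comp_iff]
    have := ract_linner_kernel_continuous b x y
    have e : (Function.uncurry fun (q : S × Q) (r : Q ⧸ S) =>
        (ractFamily b x y q.1 : ConvAlg (leftAction β S) μ) q.2 r) ∘
        (fun q : (S × Q) × Q => (q.1, (q.2 : Q ⧸ S))) = fun q => dmod (-1 / 2) q.1.1 •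
      dmod (-1 / 2) q.1.2 • ν.int fun k : S => x (q.2 * k * (q.1.1 : Q)) *
        β (q.2 * k * q.1.1) (b q.1.1⁻¹) * β q.1.2 (star (y (q.1.2⁻¹ * (q.2 * k)))) :=
      funext fun q => ractFamily_apply b x y q.1.1 q.1.2 q.2
    rw [e]
    fun_prop
  exact continuous_cc (c0Cc _ hc ((tsupport b)⁻¹ ×ˢ ((tsupport x * ((↑) '' tsupport b)) *
    (tsupport y)⁻¹)) (b.isCompact_tsupport.inv.prod (((isCompact_tsupport_cc x).mul
      (b.isCompact_tsupport.image continuous_subtype_val)).mul (isCompact_tsupport_cc y).inv))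
    (((↑) : Q → Q ⧸ S) '' tsupport x)
    ((isCompact_tsupport_cc x).image QuotientGroup.continuous_mk) (by
      rintro ⟨h, t⟩ q
      induction q using QuotientGroup.induction_on with
      | H r =>
        intro hne
        obtain ⟨h1, h2, h3⟩ := ractFamily_support b x y h t r hne
        exact ⟨⟨h1, h2⟩, h3⟩))

/-- The right action is an integral over `h ∈ S` of multiplications by `b(h⁻¹)` followed by right
translations; the density `Δ_S(h)⁻¹` is what is left after `rtranslate` has taken its factor
`Δ_S(h)^(1/2)`. It is also the density that turns `∫ ‖b(h⁻¹)‖` into the `L¹`-norm of `b`. -/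
lemma of_linner_ract (b : ConvAlg (β.restrict S) ν) (x y : C_c(Q, D)) :
    CrossedProduct.of (linner ν (ract x b) y : ConvAlg (leftAction β S) μ) =
      ν.int fun h => CrossedProduct.of (ractFamily b x y h : ConvAlg (leftAction β S) μ) := by
  refine int_of_family ν (continuous_ractFamily b x y) (((isCompact_tsupport_cc x).mul
      (b.isCompact_tsupport.image continuous_subtype_val)).mul (isCompact_tsupport_cc y).inv)
    b.isCompact_tsupport.inv (fun h t hne => ?_) fun t => ?_
  · obtain ⟨q, hq⟩ := DFunLike.ne_iff.1 hne
    induction q using QuotientGroup.induction_on with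
    | H r => exact ⟨(ractFamily_support b x y h t r hq).1, (ractFamily_support b x y h t r hq).2.1⟩
  · ext q
    have hz : ∀ h : S, h ∉ (tsupport b)⁻¹ →
        (ractFamily b x y h : ConvAlg (leftAction β S) μ) t = 0 := fun h hh => by
      by_contra hne
      obtain ⟨q, hq⟩ := DFunLike.ne_iff.1 hne
      induction q using QuotientGroup.induction_on with
      | H r => exact hh (ractFamily_support b x y h t r hq).1
    have hp : Continuous fun h : S => (h, t) := by fun_prop
    have hct := (continuous_ractFamily (μ := μ) b x y).comp hp
    refine Eq.trans ?_ (ν.int_apply_c0 b.isCompact_tsupport.inv hct hz q).symm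
    simp only [Function.comp_apply]
    induction q using QuotientGroup.induction_on with
    | H r =>
      simp_rw [ractFamily_apply]
      have e : ∀ k : S, ract x b (r * k) * β t (star (y (t⁻¹ * (r * k)))) = ν.int fun h : S =>
          dmod (-1 / 2) h • (x (r * k * (h : Q)) * β (r * k * h) (b h⁻¹) *
            β t (star (y (t⁻¹ * (r * k))))) := fun k => by
        rw [ract_apply, ν.int_mul_of _ b.isCompact_tsupport.inv (by fun_prop) fun h hh => by
          rw [b.eq_zero fun hm => hh (by simpa using hm), map_zero, mul_zero, smul_zero]]
        exact ν.int_congr fun h => by rw [smul_mul_assoc]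
      rw [linner_apply, ν.int_congr e]
      simp_rw [smul_comm (dmod (-1 / 2) (_ : S))]
      rw [ν.int_smul]
      congr 1
      simp_rw [← ν.int_smul]
      refine (ν.int_swap_of ν b.isCompact_tsupport.inv (isCompact_cosetTransporter S
        ((isCompact_singleton (x := t⁻¹ * r))) (isCompact_tsupport_cc y)) (by fun_prop)
        (fun h k hh => ?_) fun h k _ hk => ?_).symm
      · rw [b.eq_zero fun hm => hh (by simpa using hm), map_zero, mul_zero, zero_mul, smul_zero]
      · rw [cc_eq_zero y fun hm => hk ⟨_, rfl, by simpa [mul_assoc] using hm⟩, star_zero, map_zero,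
          mul_zero, smul_zero]

lemma norm_linner_ract_le (b : ConvAlg (β.restrict S) ν) (x y : C_c(Q, D)) :
    ‖(linner ν (ract x b) y : ConvAlg (leftAction β S) μ)‖ ≤
      ConvAlg.l1Norm b * lnorm β μ ν x * lnorm β μ ν y := by
  rw [← CrossedProduct.norm_of, of_linner_ract]
  have e : ConvAlg.l1Norm b * lnorm β μ ν x * lnorm β μ ν y =
      ν.int fun h => (lnorm β μ ν x * lnorm β μ ν y) * (dmod (-1) h * ‖b h⁻¹‖) := by
    have h1 := ν.int_inv' b.continuous_norm b.hasCompactSupport_norm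
    simp_rw [inv_modular, smul_eq_mul] at h1
    rw [mul_assoc, mul_comm, ConvAlg.l1Norm, ← h1]
    exact (ν.int_smul (lnorm β μ ν x * lnorm β μ ν y) fun s => dmod (-1) s * ‖b s⁻¹‖).symm
  rw [e]
  refine ν.norm_int_le_of_le (by fun_prop) (HasCompactSupport.intro b.isCompact_tsupport.inv
    fun h hh => ?_) fun h => ?_
  · rw [b.eq_zero fun hm => hh (by simpa using hm), norm_zero, mul_zero, mul_zero]
  rw [CrossedProduct.norm_of, ractFamily, norm_smul, Complex.norm_real,
    Real.norm_of_nonneg (dmod_pos _ _).le]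
  have h1 := lnorm_rcmul_le (β := β) (μ := μ) (ν := ν) (b h⁻¹) x
  have h2 := norm_linner_le (β := β) (μ := μ) (ν := ν) (rtranslate h (rcmul β (b h⁻¹) x)) y
  rw [lnorm_rtranslate] at h2
  have h3 := h2.trans (mul_le_mul_of_nonneg_right h1 (apply_nonneg (lnorm β μ ν) y))
  refine (mul_le_mul_of_nonneg_left h3 (dmod_pos _ _).le).trans_eq ?_
  ring

/-- The counterpart of `rnorm_lact_le` with the two sides exchanged. -/
lemma lnorm_ract_le (x : C_c(Q, D)) (b : ConvAlg (β.restrict S) ν) :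
    lnorm β μ ν (ract x b) ≤ ‖b‖ * lnorm β μ ν x := by
  refine ConvAlg.action_le_norm_of_seminorm' (lnorm β μ ν) (ractₗ β S ν) (fun a b x => ract_mul x a b)
    (fun a x => ?_) (fun a x => ?_) b x
  · rw [lnorm_sq]
    simp only [ractₗ_apply]
    rw [linner_ract, ← ract_mul]
    exact norm_linner_le _ _
  · exact lnorm_le_of_forall (mul_nonneg (ConvAlg.l1Norm_nonneg a) (apply_nonneg _ _))
      (norm_linner_ract_le a x _)

/-- Let `l` and `r` be the left and right inner products of `x` with itself. By the imprimitivity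
relation, `l l* = l l` is the left inner product of `l · x = x · r` with `x`. Hence `‖l‖²` is at
most `lnorm (x · r) * lnorm x`, and so at most `‖r‖ ‖l‖`. Only this inequality is needed to bound
the left inner product by the right seminorm. -/
lemma lnorm_le_rnorm (x : C_c(Q, D)) : lnorm β μ ν x ≤ rnorm β μ ν x := by
  rw [lnorm_apply, rnorm_apply]
  refine Real.sqrt_le_sqrt ?_
  rcases (norm_nonneg (linner ν x x : ConvAlg (leftAction β S) μ)).eq_or_lt with h0 | hpos
  · rw [← h0]; exact norm_nonneg _
  have h1 : ‖(linner ν x x : ConvAlg (leftAction β S) μ)‖ *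
      ‖(linner ν x x : ConvAlg (leftAction β S) μ)‖ ≤
        ‖(rinner μ x x : ConvAlg (β.restrict S) ν)‖ *
          ‖(linner ν x x : ConvAlg (leftAction β S) μ)‖ := by
    have h2 := PreCStarAlgebra.norm_mul_self_le (linner ν x x : ConvAlg (leftAction β S) μ)
    rw [star_linner, ← linner_lact, lact_linner] at h2
    refine h2.trans ((norm_linner_le _ _).trans ?_)
    rw [← lnorm_sq, sq, ← mul_assoc]
    exact mul_le_mul_of_nonneg_right (lnorm_ract_le x _) (apply_nonneg _ _)
  exact le_of_mul_le_mul_right h1 hpos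

theorem innerSeminorm_bimodule (β : CStarAction Q D) (μ : HaarMeasure Q) (ν : HaarMeasure S) :
    (bimodule β S μ ν).innerSeminorm = rnorm β μ ν :=
  PreBimodule.innerSeminorm_eq _ rnorm_apply

/-- The Green bimodule is a pre-imprimitivity bimodule: its seminorm is that of the right inner
product, and all the operations are bounded. -/
theorem isBounded_bimodule (β : CStarAction Q D) (μ : HaarMeasure Q) (ν : HaarMeasure S) :
    (bimodule β S μ ν).IsBounded where
  norm_eq x := by rw [innerSeminorm_bimodule]; exact rnorm_apply x
  lact_add_left a b x := LinearMap.map_add₂ (lactₗ β S μ) a b x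
  lact_add_right a x y := map_add (lactₗ β S μ a) x y
  ract_add_left x y b := map_add (ractₗ β S ν b) x y
  ract_add_right x b c := LinearMap.map_add₂ (ractₗ β S ν) b c x
  linner_add_left := linner_add_left
  linner_add_right := linner_add_right
  rinner_add_left := rinner_add_left
  rinner_add_right := rinner_add_right
  lact_le a x := by rw [innerSeminorm_bimodule]; exact rnorm_lact_le a x
  ract_le x b := by rw [innerSeminorm_bimodule]; exact rnorm_ract_le x b
  linner_le x y := by
    rw [innerSeminorm_bimodule]
    exact (norm_linner_le x y).trans (mul_le_mul (lnorm_le_rnorm x) (lnorm_le_rnorm y)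
      (apply_nonneg _ _) (apply_nonneg _ _))
  rinner_le x y := by rw [innerSeminorm_bimodule]; exact norm_rinner_le x y

end Green
end CrossedProd
end

noncomputable section

namespace CrossedProd

/-! ### Crossed products by product groups -/

namespace ConvAlg

section Basic

variable {G A : Type*} [Group G] [TopologicalSpace G] [IsTopologicalGroup G]
  [LocallyCompactSpace G] [T2Space G] [NonUnitalCStarAlgebra A]
  {α : CStarAction G A} {μ : HaarMeasure G}

/-- Inversion of the integration variable absorbs the modular factor of the involution. In this form
translations and convolution operators in one variable are visibly adjointable. -/
lemma star_mul_apply (y z : ConvAlg α μ) (p : G) :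
    (star y * z) p = μ.int fun l => α l⁻¹ (star (y l) * z (l * p)) := by
  have h := μ.int_inv (f := fun l => α l (star (y l⁻¹) * z (l⁻¹ * p))) (by fun_prop)
    (HasCompactSupport.intro y.isCompact_tsupport.inv fun l hl => by
      rw [y.eq_zero fun h => hl (by simpa using h), star_zero, zero_mul, map_zero])
  simp only [inv_inv] at h
  rw [h, mul_apply]
  refine μ.int_congr fun l => ?_
  rw [star_apply, smul_mul_assoc, ← α.act_mul]

lemma norm_star_mul_self (y : ConvAlg α μ) : ‖star y * y‖ = ‖y‖ ^ 2 := by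
  rw [← CrossedProduct.norm_of, ← CrossedProduct.norm_of, CrossedProduct.of_mul,
    CrossedProduct.of_star, CStarRing.norm_star_mul_self, sq]

lemma norm_mul_star_self (y : ConvAlg α μ) : ‖y * star y‖ = ‖y‖ ^ 2 := by
  rw [← CrossedProduct.norm_of, ← CrossedProduct.norm_of, CrossedProduct.of_mul,
    CrossedProduct.of_star, CStarRing.norm_self_mul_star, sq]

/-- The translate `s ↦ α_g(y(g⁻¹ s))`. -/
def translate (g : G) (y : ConvAlg α μ) : ConvAlg α μ :=
  mk (fun s => α g (y (g⁻¹ * s))) (by fun_prop)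
    ((y.hasCompactSupport.comp_homeomorph (Homeomorph.mulLeft g⁻¹)).comp_left (g := α g)
      (map_zero _))

lemma translate_apply (g : G) (y : ConvAlg α μ) (s : G) :
    translate g y s = α g (y (g⁻¹ * s)) := rfl

/-- Left translation acts as a unitary multiplier. -/
lemma star_translate_mul_translate (g : G) (y z : ConvAlg α μ) :
    star (translate g y) * translate g z = star y * z := by
  ext p
  rw [star_mul_apply, star_mul_apply, μ.int_translate g]
  refine μ.int_congr fun l => ?_
  rw [translate_apply, translate_apply, ← α.act_star, ← α.act_mul, ← α.mul_apply]
  simp only [mul_assoc, mul_inv_rev, inv_mul_cancel_left, inv_mul_cancel, mul_one]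

lemma norm_translate (g : G) (y : ConvAlg α μ) : ‖translate g y‖ = ‖y‖ := by
  have h := norm_star_mul_self (translate g y)
  rw [star_translate_mul_translate, norm_star_mul_self] at h
  exact (sq_eq_sq₀ (norm_nonneg _) (norm_nonneg _)).1 h.symm

end Basic

section Product

variable {K G D : Type*} [Group K] [TopologicalSpace K] [IsTopologicalGroup K]
  [LocallyCompactSpace K] [T2Space K] [Group G] [TopologicalSpace G] [IsTopologicalGroup G]
  [LocallyCompactSpace G] [T2Space G] [NonUnitalCStarAlgebra D]
  {ω : CStarAction (K × G) D} {α : CStarAction G D} {μ : HaarMeasure K} {ν : HaarMeasure G}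

/-- The function `f(k, ·)`. -/
def slice (f : ConvAlg ω (μ.prod ν)) (k : K) : ConvAlg α ν :=
  mk (fun s => f (k, s)) (by fun_prop) (hasCompactSupport_slice f.hasCompactSupport k)

lemma slice_apply (f : ConvAlg ω (μ.prod ν)) (k : K) (s : G) :
    (slice f k : ConvAlg α ν) s = f (k, s) := rfl

lemma slice_ne_zero {f : ConvAlg ω (μ.prod ν)} {k : K} {s : G} (h : f (k, s) ≠ 0) :
    k ∈ Prod.fst '' tsupport f ∧ s ∈ Prod.snd '' tsupport f :=
  ⟨⟨_, mem_tsupport_of_ne h, rfl⟩, ⟨_, mem_tsupport_of_ne h, rfl⟩⟩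

lemma isCompact_fst (f : ConvAlg ω (μ.prod ν)) : IsCompact (Prod.fst '' tsupport f) :=
  f.isCompact_tsupport.image continuous_fst

lemma isCompact_snd (f : ConvAlg ω (μ.prod ν)) : IsCompact (Prod.snd '' tsupport f) :=
  f.isCompact_tsupport.image continuous_snd

lemma continuous_of_slice (f : ConvAlg ω (μ.prod ν)) :
    Continuous fun k => CrossedProduct.of (slice f k : ConvAlg α ν) :=
  continuous_of_family (F := fun k => (slice f k : ConvAlg α ν))
    (by change Continuous fun q : K × G => f q; exact f.continuous) f.isCompact_snd
    fun _ _ h => (slice_ne_zero h).2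

lemma hasCompactSupport_of_slice (f : ConvAlg ω (μ.prod ν)) :
    HasCompactSupport fun k => CrossedProduct.of (slice f k : ConvAlg α ν) :=
  hasCompactSupport_of_family f.isCompact_fst fun _ _ h => (slice_ne_zero h).1

lemma l1Norm_eq_int_slice (f : ConvAlg ω (μ.prod ν)) :
    l1Norm f = μ.int fun k => l1Norm (slice f k : ConvAlg α ν) :=
  HaarMeasure.int_prod μ ν f.continuous_norm f.hasCompactSupport_norm

/-- Convolution in the second variable. -/
def sndMul (F : ConvAlg α ν) (y : ConvAlg ω (μ.prod ν)) : ConvAlg ω (μ.prod ν) :=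
  mk (fun p => (F * slice y p.1 : ConvAlg α ν) p.2)
    (by
      change Continuous fun p : K × G => ν.int fun t => F t * α t (y (p.1, t⁻¹ * p.2))
      refine ν.continuous_int (f := fun (p : K × G) t => F t * α t (y (p.1, t⁻¹ * p.2)))
        (by fun_prop) fun p₀ => ⟨univ, univ_mem, tsupport F, F.isCompact_tsupport,
          fun p _ t ht => by rw [F.eq_zero ht, zero_mul]⟩)
    (by
      refine HasCompactSupport.intro
        (y.isCompact_fst.prod (F.isCompact_tsupport.mul y.isCompact_snd)) fun p hp => ?_
      by_contra hne
      rw [mul_apply] at hne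
      obtain ⟨t, ht⟩ := ν.exists_ne_zero hne
      have h1 := slice_ne_zero (ne_zero_of_act_ne (right_ne_zero_of_mul ht))
      exact hp ⟨h1.1, t, mem_tsupport_of_ne (left_ne_zero_of_mul ht), _, h1.2, by simp⟩)

lemma slice_sndMul (F : ConvAlg α ν) (y : ConvAlg ω (μ.prod ν)) (k : K) :
    (slice (sndMul F y) k : ConvAlg α ν) = F * slice y k := rfl

lemma sndMul_apply (F : ConvAlg α ν) (y : ConvAlg ω (μ.prod ν)) (p : K × G) :
    sndMul F y p = (F * slice y p.1 : ConvAlg α ν) p.2 := rfl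

/-- Convolution in the second variable as a bilinear map. -/
def sndMulₗ : ConvAlg α ν →ₗ[ℂ] ConvAlg ω (μ.prod ν) →ₗ[ℂ] ConvAlg ω (μ.prod ν) :=
  LinearMap.mk₂ ℂ sndMul
    (fun F F' y => by ext p; simp only [sndMul_apply, add_apply, add_mul])
    (fun c F y => by ext p; simp only [sndMul_apply, smul_apply, smul_mul_assoc])
    (fun F y y' => by
      ext p
      have : (slice (y + y') p.1 : ConvAlg α ν) = slice y p.1 + slice y' p.1 := rfl
      simp only [sndMul_apply, this, add_apply, mul_add])
    (fun c F y => by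
      ext p
      have : (slice (c • y) p.1 : ConvAlg α ν) = c • slice y p.1 := rfl
      simp only [sndMul_apply, this, smul_apply, mul_smul_comm])

lemma sndMul_mul (F F' : ConvAlg α ν) (y : ConvAlg ω (μ.prod ν)) :
    sndMul (F * F') y = sndMul F (sndMul F' y) := by
  ext p
  rw [sndMul_apply, sndMul_apply, slice_sndMul, mul_assoc]

lemma l1Norm_sndMul_le (F : ConvAlg α ν) (y : ConvAlg ω (μ.prod ν)) :
    l1Norm (sndMul F y) ≤ l1Norm F * l1Norm y := by
  have hc : ∀ z : ConvAlg ω (μ.prod ν), Continuous (fun k => l1Norm (slice z k : ConvAlg α ν)) ∧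
      HasCompactSupport (fun k => l1Norm (slice z k : ConvAlg α ν)) := fun z =>
    ⟨continuous_slice_int (f := fun q : K × G => ‖z q‖) ν z.continuous_norm z.hasCompactSupport_norm,
      hasCompactSupport_slice_int (f := fun q : K × G => ‖z q‖) ν z.hasCompactSupport_norm⟩
  rw [l1Norm_eq_int_slice (α := α), l1Norm_eq_int_slice (α := α) y, ← smul_eq_mul, ← μ.int_smul]
  refine μ.int_mono (hc _).1 (hc _).2 (continuous_const.mul (hc y).1) (hc y).2.mul_left
    fun k => ?_
  rw [slice_sndMul]
  exact l1Norm_mul_le _ _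

variable (hα : ∀ s d, ω (1, s) d = α s d)
include hα

lemma star_mul_apply_prod (y z : ConvAlg ω (μ.prod ν)) (p : K × G) :
    (star y * z) p = μ.int fun k =>
      ω (k⁻¹, 1) ((star (slice y k) * slice z (k * p.1) : ConvAlg α ν) p.2) := by
  rw [star_mul_apply, HaarMeasure.int_prod μ ν (by fun_prop)
    (HasCompactSupport.intro y.isCompact_tsupport fun l hl => by
      rw [y.eq_zero hl, star_zero, zero_mul, map_zero])]
  refine μ.int_congr fun k => ?_
  rw [star_mul_apply, ν.act_int']
  refine ν.int_congr fun s => ?_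
  have e : ((k⁻¹, 1) * (1, s⁻¹) : K × G) = (k, s)⁻¹ := by simp
  rw [← hα, ← ω.mul_apply, e]
  rfl

/-- The hypothesis `hα` identifies `ω` on `{1} × G` with `α`, so elements of `C_c(G, D)` act as
multipliers of the algebra of the product group, with the expected adjoints. -/
lemma star_sndMul_mul (F : ConvAlg α ν) (y z : ConvAlg ω (μ.prod ν)) :
    star (sndMul F y) * z = star y * sndMul (star F) z := by
  ext p
  rw [star_mul_apply_prod hα, star_mul_apply_prod hα]
  refine μ.int_congr fun k => ?_
  rw [slice_sndMul, slice_sndMul, star_mul, mul_assoc]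

lemma norm_sndMul_sq_le (F : ConvAlg α ν) (y : ConvAlg ω (μ.prod ν)) :
    ‖sndMul F y‖ ^ 2 ≤ ‖y‖ * ‖sndMul (star F * F) y‖ := by
  rw [← norm_star_mul_self, star_sndMul_mul hα, ← sndMul_mul]
  exact (norm_mul_le _ _).trans_eq (by rw [norm_star])

/-- The `L¹`-estimate in both variables gives only orbit bounds. `action_le_of_orbit_bound` turns
them into a bound by the `L¹`-norm of `F`, and `action_le_norm` into one by its universal norm. -/
lemma norm_sndMul_le (F : ConvAlg α ν) (y : ConvAlg ω (μ.prod ν)) :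
    ‖sndMul F y‖ ≤ ‖F‖ * ‖y‖ := by
  have h1 : ∀ (F : ConvAlg α ν) (y : ConvAlg ω (μ.prod ν)), ‖sndMul F y‖ ≤ l1Norm F * ‖y‖ :=
    action_le_of_orbit_bound (N := l1Norm) (nV := fun y : ConvAlg ω (μ.prod ν) => ‖y‖)
      l1Norm_nonneg l1Norm_mul_le l1Norm_star (fun _ => norm_nonneg _)
      (fun F y => norm_sndMul_sq_le hα F y) fun y => ⟨l1Norm y, fun F =>
        (norm_le_l1Norm _).trans ((l1Norm_sndMul_le F y).trans_eq (mul_comm _ _))⟩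
  exact action_le_norm (sndMulₗ (ω := ω) (α := α) (μ := μ) (ν := ν)) (fun F F' y => sndMul_mul F F' y)
    (fun F y => norm_sndMul_sq_le hα F y) h1 F y

/-- Left convolution by `f` is the integral over `K` of a unitary translation followed by the
multiplier of the slice `f(k, ·)`. The bound on the norm by the integral of the slice norms follows
from this. -/
lemma mul_apply_prod (f y : ConvAlg ω (μ.prod ν)) (p : K × G) :
    (f * y) p = μ.int fun k => sndMul (slice f k : ConvAlg α ν) (translate (k, 1) y) p := by
  rw [mul_apply, HaarMeasure.int_prod μ ν (by fun_prop)
    (HasCompactSupport.intro f.isCompact_tsupport fun l hl => by rw [f.eq_zero hl, zero_mul])]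
  refine μ.int_congr fun k => ?_
  rw [sndMul_apply, mul_apply]
  refine ν.int_congr fun s => ?_
  have e : ((1, s) * (k, 1) : K × G) = (k, s) := by simp
  have e' : ((k, 1)⁻¹ * (p.1, s⁻¹ * p.2) : K × G) = (k, s)⁻¹ * p := by ext <;> simp
  rw [slice_apply, slice_apply, translate_apply, ← hα, ← ω.mul_apply, e, e']

/-- The universal norm for a product group is bounded by the integral of the universal norms for
one factor. -/
theorem norm_le_int_norm_slice (f : ConvAlg ω (μ.prod ν)) :
    ‖f‖ ≤ μ.int fun k => ‖(slice f k : ConvAlg α ν)‖ := by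
  have hn : ∀ k, ‖(slice f k : ConvAlg α ν)‖ =
      ‖CrossedProduct.of (slice f k : ConvAlg α ν)‖ := fun k => (CrossedProduct.norm_of _).symm
  have hmul : ∀ y : ConvAlg ω (μ.prod ν),
      ‖f * y‖ ≤ (μ.int fun k => ‖(slice f k : ConvAlg α ν)‖) * ‖y‖ := by
    intro y
    rw [← CrossedProduct.norm_of, int_of_family μ
      (F := fun k => sndMul (slice f k : ConvAlg α ν) (translate (k, 1) y))
      (K := (Prod.fst '' tsupport f * Prod.fst '' tsupport y) ×ˢ
        (Prod.snd '' tsupport f * Prod.snd '' tsupport y))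
      (C := Prod.fst '' tsupport f) ?_ ?_ f.isCompact_fst ?_ (mul_apply_prod hα f y)]
    · rw [mul_comm, ← smul_eq_mul, ← μ.int_smul]
      refine μ.norm_int_le_of_le ?_ ?_ fun k => ?_
      · simp only [hn]
        exact continuous_const.mul (continuous_of_slice (α := α) f).norm
      · simp only [hn]
        exact (hasCompactSupport_of_slice (α := α) f).norm.mul_left
      · rw [CrossedProduct.norm_of, smul_eq_mul, mul_comm ‖y‖, ← norm_translate (k, 1) y]
        exact norm_sndMul_le hα _ _
    · change Continuous fun q : K × (K × G) => ν.int fun t =>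
        f (q.1, t) * α t (ω (q.1, 1) (y ((q.1, 1)⁻¹ * (q.2.1, t⁻¹ * q.2.2))))
      refine ν.continuous_int (f := fun (q : K × (K × G)) t =>
        f (q.1, t) * α t (ω (q.1, 1) (y ((q.1, 1)⁻¹ * (q.2.1, t⁻¹ * q.2.2))))) (by fun_prop)
        fun q₀ => ⟨univ, univ_mem, _, f.isCompact_snd, fun q _ t ht => ?_⟩
      by_contra hne
      exact ht (slice_ne_zero (left_ne_zero_of_mul hne)).2
    · exact (f.isCompact_fst.mul y.isCompact_fst).prod (f.isCompact_snd.mul y.isCompact_snd)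
    · intro k p hne
      rw [sndMul_apply, mul_apply] at hne
      obtain ⟨t, ht⟩ := ν.exists_ne_zero hne
      have h1 := slice_ne_zero (left_ne_zero_of_mul ht)
      have h2 := slice_ne_zero (f := y) (ne_zero_of_act_ne (ne_zero_of_act_ne
        (right_ne_zero_of_mul ht)))
      exact ⟨h1.1, ⟨k, h1.1, _, h2.1, by simp⟩, ⟨t, h1.2, _, h2.2, by simp⟩⟩
  -- `‖f‖² = ‖f f*‖`, so a bound for the multiplication operator by `f` is a bound for `‖f‖` itself.
  have h := hmul (star f)
  rw [norm_mul_star_self, norm_star] at h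
  rcases (norm_nonneg f).eq_or_lt with h0 | h0
  · rw [← h0]
    exact μ.int_nonneg fun _ => norm_nonneg _
  · nlinarith

end Product

end ConvAlg

end CrossedProd

end

noncomputable section

/-! ### Approximation by elementary functions and extension of isometries. -/

namespace CrossedProd

/-- A compactly supported continuous function is uniformly approximated, within a compact set, by
sums of elementary functions with values in a dense set. -/
lemma exists_sum_smul_approx {T B V : Type*} [TopologicalSpace T] [T2Space T]
    [LocallyCompactSpace T] [NormedAddCommGroup B] [NormedSpace ℝ B] {j : V → B}
    (hj : DenseRange j) {g : T → B} (hg : Continuous g) (hc : HasCompactSupport g) :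
    ∃ χ : T → ℝ, Continuous χ ∧ HasCompactSupport χ ∧ (∀ t, 0 ≤ χ t) ∧ (∀ t, χ t ≤ 1) ∧
      ∀ e : ℝ, 0 < e →
        ∃ (n : ℕ) (φ : Fin n → C(T, ℝ)) (b : Fin n → V), (∀ i, HasCompactSupport (φ i)) ∧
          ∀ t, ‖g t - ∑ i, φ i t • j (b i)‖ ≤ e * χ t := by
  obtain ⟨χ, hχ1, -, hχc, hχ⟩ := exists_continuous_one_zero_of_isCompact (X := T) hc isClosed_empty
    (disjoint_empty _)
  refine ⟨χ, χ.continuous, hχc, fun t => (hχ t).1, fun t => (hχ t).2, fun e he => ?_⟩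
  choose b hb using fun t => hj.exists_dist_lt (g t) he
  have hU : ∀ t, IsOpen {t' | ‖g t' - j (b t)‖ < e} := fun t =>
    isOpen_lt (hg.sub continuous_const).norm continuous_const
  obtain ⟨I, hI⟩ := (show IsCompact (tsupport χ) from hχc).elim_finite_subcover
    (fun t => {t' | ‖g t' - j (b t)‖ < e}) hU fun t _ => mem_iUnion.2 ⟨t, by
      rw [mem_ofPred_eq, ← dist_eq_norm]
      exact hb t⟩
  let E := I.equivFin
  obtain ⟨φ, hφs, hφ1, hφ, hφc⟩ := exists_continuous_sum_one_of_isOpen_isCompact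
    (s := fun i => {t' | ‖g t' - j (b (E.symm i).1)‖ < e}) (fun i => hU _) hχc (by
      intro t ht
      obtain ⟨u, hu, htu⟩ := mem_iUnion₂.1 (hI ht)
      exact mem_iUnion.2 ⟨E ⟨u, hu⟩, by simpa using htu⟩)
  -- The `φ i` form a partition of unity on the support of `χ`, each concentrated where `g` is
  -- within `e` of the chosen value `j (b i)`. Multiplying by `χ`, which is 1 where `g ≠ 0`, leaves
  -- `g` unchanged and makes the error at most `e χ` everywhere, with `χ` independent of `e`.
  refine ⟨_, fun i => χ * φ i, fun i => b (E.symm i).1, fun i => hχc.mul_right, fun t => ?_⟩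
  by_cases ht : t ∈ tsupport χ
  · have h1 : ∑ i, φ i t = 1 := by simpa using hφ1 ht
    have h2 : χ t • g t = g t := by
      by_cases h0 : g t = 0
      · rw [h0, smul_zero]
      · rw [hχ1 (mem_tsupport_of_ne h0), Pi.one_apply, one_smul]
    have h3 : g t - ∑ i, (χ * φ i) t • j (b (E.symm i).1) =
        χ t • ∑ i, φ i t • (g t - j (b (E.symm i).1)) := by
      simp only [smul_sub, Finset.sum_sub_distrib, ← Finset.sum_smul, h1, one_smul]
      rw [h2, Finset.smul_sum]
      simp [smul_smul]
    rw [h3, norm_smul, Real.norm_of_nonneg (hχ t).1, mul_comm]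
    refine mul_le_mul_of_nonneg_right ?_ (hχ t).1
    refine (norm_sum_le _ _).trans ((Finset.sum_le_sum (g := fun i => φ i t * e) fun i _ => ?_).trans_eq
      (by rw [← Finset.sum_mul, h1, one_mul]))
    rw [norm_smul, Real.norm_of_nonneg (hφ i t).1]
    by_cases h0 : φ i t = 0
    · rw [h0, zero_mul, zero_mul]
    · exact mul_le_mul_of_nonneg_left (le_of_lt (hφs i (mem_tsupport_of_ne h0))) (hφ i t).1
  · have h0 : χ t = 0 := image_eq_zero_of_notMem_tsupport ht
    have h1 : g t = 0 := by
      by_contra h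
      have := hχ1 (mem_tsupport_of_ne h)
      rw [h0] at this
      exact zero_ne_one this
    simp [h0, h1]

section Extension

variable {G A C : Type*} [Group G] [TopologicalSpace G] [IsTopologicalGroup G]
  [LocallyCompactSpace G] [T2Space G] [NonUnitalCStarAlgebra A] [NonUnitalCStarAlgebra C]
  {α : CStarAction G A} {μ : HaarMeasure G}

lemma CrossedProduct.real_smul_of (c : ℝ) (f : ConvAlg α μ) : c • of f = of ((c : ℂ) • f) := by
  rw [of_smul, Complex.coe_smul]

/-- An isometric *-homomorphism of the convolution algebra with dense range extends to an
isomorphism. -/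
theorem CrossedProduct.exists_starAlgEquiv (j : ConvAlg α μ →ₗ[ℂ] C)
    (hmul : ∀ f g, j (f * g) = j f * j g) (hstar : ∀ f, j (star f) = star (j f))
    (hnorm : ∀ f, ‖j f‖ = ‖f‖) (hd : DenseRange j) :
    ∃ e : CrossedProduct α μ ≃⋆ₐ[ℂ] C, ∀ f, e (of f) = j f := by
  let i : ConvAlg α μ →ₗᵢ[ℂ] CrossedProduct α μ := Completion.toComplₗᵢ
  let j' : ConvAlg α μ →ₗᵢ[ℂ] C := ⟨j, hnorm⟩
  let e₀ : CrossedProduct α μ →L[ℂ] C := j'.toContinuousLinearMap.extend i.toContinuousLinearMap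
  have he₀ : ∀ f, e₀ (of f) = j f := fun f =>
    ContinuousLinearMap.extend_eq _ denseRange_of i.isometry.isUniformInducing f
  have hnorm₀ : ∀ y, ‖e₀ y‖ = ‖y‖ := fun y => denseRange_of.induction_on y
    (isClosed_eq e₀.continuous.norm continuous_norm) fun f => by rw [he₀, norm_of, hnorm]
  let e₁ : CrossedProduct α μ →ₗᵢ[ℂ] C := ⟨e₀.toLinearMap, hnorm₀⟩
  have hsurj : Function.Surjective e₀ := by
    intro x
    have hcl : IsClosed (range e₁) := e₁.isometry.isClosedEmbedding.isClosed_range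
    have hdense : DenseRange e₁ := hd.mono (by
      rintro _ ⟨f, rfl⟩
      exact ⟨of f, he₀ f⟩)
    have := hdense.closure_range ▸ mem_univ x
    rwa [hcl.closure_eq] at this
  let e₂ : CrossedProduct α μ →⋆ₙₐ[ℂ] C :=
    { toFun := e₀
      map_smul' := map_smul e₀
      map_zero' := map_zero e₀
      map_add' := map_add e₀
      map_mul' := fun x y => denseRange_of.induction_on₂
        (isClosed_eq (e₀.continuous.comp continuous_mul) (by fun_prop))
        (fun f g => by rw [← of_mul, he₀, he₀, he₀, hmul]) x y
      map_star' := fun x => denseRange_of.induction_on x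
        (isClosed_eq (e₀.continuous.comp continuous_star) e₀.continuous.star)
        fun f => by rw [← of_star, he₀, he₀, hstar] }
  exact ⟨StarAlgEquiv.ofBijective e₂ ⟨e₁.injective, hsurj⟩, he₀⟩

end Extension

/-! ### Crossed products by `K × G` as iterated crossed products. -/

namespace ConvAlg

variable {K G D : Type*} [Group K] [TopologicalSpace K] [IsTopologicalGroup K]
  [LocallyCompactSpace K] [T2Space K] [Group G] [TopologicalSpace G] [IsTopologicalGroup G]
  [LocallyCompactSpace G] [T2Space G] [NonUnitalCStarAlgebra D]
  {ω : CStarAction (K × G) D} {α : CStarAction G D} {μ : HaarMeasure K} {ν : HaarMeasure G}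
  {β : CStarAction K (CrossedProduct α ν)}

/-- A function of two variables as a function with values in a crossed product. -/
def curry : ConvAlg ω (μ.prod ν) →ₗ[ℂ] ConvAlg β μ where
  toFun f := mk (fun k => CrossedProduct.of (slice f k)) (continuous_of_slice f)
    (hasCompactSupport_of_slice f)
  map_add' f g := by
    ext k
    exact CrossedProduct.of_add (slice f k : ConvAlg α ν) (slice g k)
  map_smul' c f := by
    ext k
    exact CrossedProduct.of_smul c (slice f k : ConvAlg α ν)

lemma curry_apply (f : ConvAlg ω (μ.prod ν)) (k : K) :
    (curry f : ConvAlg β μ) k = CrossedProduct.of (slice f k : ConvAlg α ν) := rfl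

/-- By `mul_apply_prod`, convolution over `K × G` is an integral over `K` of convolutions over `G`.
The hypothesis `hβ` says that `β k` is induced by `ω (k, 1)`, which is the translation occurring
there. -/
lemma curry_mul (hα : ∀ s d, ω (1, s) d = α s d)
    (hβ : ∀ k (F F' : ConvAlg α ν), (∀ s, F' s = ω (k, 1) (F s)) →
      β k (CrossedProduct.of F) = CrossedProduct.of F') (f g : ConvAlg ω (μ.prod ν)) :
    (curry (f * g) : ConvAlg β μ) = curry f * curry g := by
  ext k
  rw [curry_apply, mul_apply]
  refine (int_of_family μ (F := fun κ => slice f κ * slice (translate (κ, 1) g) k)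
    (K := Prod.snd '' tsupport f * Prod.snd '' tsupport g) (C := Prod.fst '' tsupport f) ?_
    (f.isCompact_snd.mul g.isCompact_snd) f.isCompact_fst ?_
    fun s => mul_apply_prod hα f g (k, s)).trans (μ.int_congr fun κ => ?_)
  · change Continuous fun q : K × G => ν.int fun t =>
      f (q.1, t) * α t (ω (q.1, 1) (g ((q.1, 1)⁻¹ * (k, t⁻¹ * q.2))))
    refine ν.continuous_int (f := fun (q : K × G) t =>
      f (q.1, t) * α t (ω (q.1, 1) (g ((q.1, 1)⁻¹ * (k, t⁻¹ * q.2))))) (by fun_prop)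
      fun q₀ => ⟨univ, univ_mem, _, f.isCompact_snd, fun q _ t ht => ?_⟩
    by_contra hne
    exact ht (slice_ne_zero (left_ne_zero_of_mul hne)).2
  · intro κ s hne
    rw [mul_apply] at hne
    obtain ⟨t, ht⟩ := ν.exists_ne_zero hne
    have h1 := slice_ne_zero (left_ne_zero_of_mul ht)
    have h2 := slice_ne_zero (f := g) (ne_zero_of_act_ne (ne_zero_of_act_ne
      (right_ne_zero_of_mul ht)))
    exact ⟨h1.1, ⟨t, h1.2, _, h2.2, by simp⟩⟩
  · rw [CrossedProduct.of_mul, curry_apply, curry_apply,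
      hβ κ _ (slice (translate (κ, 1) g) k) fun s => ?_]
    rw [slice_apply, translate_apply, slice_apply]
    congr 2
    simp

lemma curry_star (hα : ∀ s d, ω (1, s) d = α s d)
    (hβ : ∀ k (F F' : ConvAlg α ν), (∀ s, F' s = ω (k, 1) (F s)) →
      β k (CrossedProduct.of F) = CrossedProduct.of F') (f : ConvAlg ω (μ.prod ν)) :
    (curry (star f) : ConvAlg β μ) = star (curry f) := by
  ext k
  rw [curry_apply, star_apply, curry_apply, ← CrossedProduct.of_star, ← act_smul,
    CrossedProduct.real_smul_of, hβ]
  intro s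
  have e : ((k, 1) * (1, s) : K × G) = (k, s) := by simp
  rw [slice_apply, star_apply, smul_apply, star_apply, ← hα, map_smul, Complex.coe_smul, act_smul,
    ← ω.mul_apply, e, modular_prod μ ν, mul_inv, mul_smul]
  rfl

lemma l1Norm_curry (f : ConvAlg ω (μ.prod ν)) :
    l1Norm (curry f : ConvAlg β μ) = μ.int fun k => ‖(slice f k : ConvAlg α ν)‖ :=
  μ.int_congr fun _ => CrossedProduct.norm_of _

lemma l1Norm_curry_le (f : ConvAlg ω (μ.prod ν)) : l1Norm (curry f : ConvAlg β μ) ≤ l1Norm f := by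
  rw [l1Norm_eq_int_slice (α := α) f]
  refine μ.int_mono (curry f : ConvAlg β μ).continuous_norm
    (curry f : ConvAlg β μ).hasCompactSupport_norm
    (continuous_slice_int (f := fun q : K × G => ‖f q‖) ν f.continuous_norm f.hasCompactSupport_norm)
    (hasCompactSupport_slice_int (f := fun q : K × G => ‖f q‖) ν f.hasCompactSupport_norm) fun k => ?_
  rw [curry_apply, CrossedProduct.norm_of]
  exact norm_le_l1Norm _

/-- The function `(k, s) ↦ φ(k) F(s)`. -/
def tensor (φ : C(K, ℝ)) (hφ : HasCompactSupport φ) (F : ConvAlg α ν) : ConvAlg ω (μ.prod ν) :=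
  mk (fun p => φ p.1 • F p.2) (by fun_prop)
    (HasCompactSupport.intro (hφ.isCompact.prod F.isCompact_tsupport) fun p hp => by
      by_contra hne
      exact hp ⟨mem_tsupport_of_ne (left_ne_zero_of_smul hne),
        mem_tsupport_of_ne (right_ne_zero_of_smul hne)⟩)

lemma curry_tensor (φ : C(K, ℝ)) (hφ : HasCompactSupport φ) (F : ConvAlg α ν) (k : K) :
    (curry (tensor φ hφ F : ConvAlg ω (μ.prod ν)) : ConvAlg β μ) k =
      φ k • CrossedProduct.of F := by
  rw [curry_apply, CrossedProduct.real_smul_of]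
  congr 1

/-- Sums of elementary tensors with coefficients in `C_c(G, D)` are curried functions, and they
approximate `g` uniformly below a fixed cutoff function. -/
lemma exists_l1Norm_sub_curry_lt (g : ConvAlg β μ) {e : ℝ} (he : 0 < e) :
    ∃ f : ConvAlg ω (μ.prod ν), l1Norm (g - curry f) < e := by
  obtain ⟨χ, hχ, hχc, hχ0, hχ1, h⟩ := exists_sum_smul_approx
    (CrossedProduct.denseRange_of (α := α) (μ := ν)) g.continuous g.hasCompactSupport
  have hI : 0 ≤ μ.int χ := μ.int_nonneg hχ0
  obtain ⟨n, φ, b, hφ, hb⟩ := h (e / (μ.int χ + 1)) (by positivity)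
  refine ⟨∑ i, tensor (φ i) (hφ i) (b i), lt_of_le_of_lt (b := μ.int fun t =>
    e / (μ.int χ + 1) * χ t) ?_ ?_⟩
  · refine μ.int_mono (continuous_norm _) (hasCompactSupport_norm _) (by fun_prop) hχc.mul_left
      fun t => ?_
    rw [map_sum, sub_apply, sum_apply]
    simp only [curry_tensor]
    exact hb t
  · rw [show (μ.int fun t => e / (μ.int χ + 1) * χ t) = e / (μ.int χ + 1) * μ.int χ from
      μ.int_smul (e / (μ.int χ + 1)) χ, div_mul_eq_mul_div, div_lt_iff₀ (by positivity)]
    nlinarith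

/-- The pullback of the norm along `curry` is a C*-seminorm below the `L¹`-norm of `K × G`, which
gives `≤`. Conversely, the norm of `f` is at most the `L¹`-norm of `curry f` by
`norm_le_int_norm_slice`, so it is a C*-norm on an `L¹`-dense subalgebra to which
`le_norm_of_l1_dense` applies. -/
lemma norm_curry (hα : ∀ s d, ω (1, s) d = α s d)
    (hβ : ∀ k (F F' : ConvAlg α ν), (∀ s, F' s = ω (k, 1) (F s)) →
      β k (CrossedProduct.of F) = CrossedProduct.of F') (f : ConvAlg ω (μ.prod ν)) :
    ‖(curry f : ConvAlg β μ)‖ = ‖f‖ := by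
  have h1 : ∀ f : ConvAlg ω (μ.prod ν), ‖(curry f : ConvAlg β μ)‖ ≤ l1Norm f := fun f =>
    (norm_le_l1Norm _).trans (l1Norm_curry_le f)
  have h2 : ∀ f g : ConvAlg ω (μ.prod ν), ‖(curry (f * g) : ConvAlg β μ)‖ ≤
      ‖(curry f : ConvAlg β μ)‖ * ‖(curry g : ConvAlg β μ)‖ := fun f g => by
    rw [curry_mul hα hβ f g]
    exact norm_mul_le (curry f : ConvAlg β μ) (curry g)
  have h3 : ∀ f : ConvAlg ω (μ.prod ν), ‖(curry f : ConvAlg β μ)‖ ^ 2 ≤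
      ‖(curry (star f * f) : ConvAlg β μ)‖ := fun f => by
    rw [curry_mul hα hβ, curry_star hα hβ]
    exact (norm_star_mul_self _).ge
  refine le_antisymm ?_ ?_
  · exact le_norm_of_sq_le ((normSeminorm ℂ (ConvAlg β μ)).comp curry) h1 h2 h3 f
  · have h4 : ∀ f : ConvAlg ω (μ.prod ν), ‖f‖ ≤ l1Norm (curry f : ConvAlg β μ) := fun f =>
      (norm_le_int_norm_slice hα f).trans_eq (l1Norm_curry f).symm
    have h5 : ∀ f : ConvAlg ω (μ.prod ν), ‖f‖ ^ 2 ≤ ‖star f * f‖ := fun f =>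
      (norm_star_mul_self f).ge
    have h6 : ∀ (g : ConvAlg β μ) (e : ℝ), 0 < e →
        ∃ f : ConvAlg ω (μ.prod ν), l1Norm (g - curry f) < e := fun g e he =>
      exists_l1Norm_sub_curry_lt g he
    exact le_norm_of_l1_dense (curry : ConvAlg ω (μ.prod ν) →ₗ[ℂ] ConvAlg β μ) (curry_mul hα hβ)
      (curry_star hα hβ) h6 (normSeminorm ℂ (ConvAlg ω (μ.prod ν))) h4 norm_mul_le h5 f

/-- The crossed product by a product group is an iterated crossed product. -/
theorem _root_.CrossedProd.CrossedProduct.exists_iterated_equiv (hα : ∀ s d, ω (1, s) d = α s d)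
    (hβ : ∀ k (F F' : ConvAlg α ν), (∀ s, F' s = ω (k, 1) (F s)) →
      β k (CrossedProduct.of F) = CrossedProduct.of F') :
    ∃ e : CrossedProduct β μ ≃⋆ₐ[ℂ] CrossedProduct ω (μ.prod ν),
      ∀ f, e (CrossedProduct.of (curry f)) = CrossedProduct.of f := by
  let ofₗ : ConvAlg β μ →ₗ[ℂ] CrossedProduct β μ :=
    { toFun := CrossedProduct.of
      map_add' := CrossedProduct.of_add
      map_smul' := CrossedProduct.of_smul }
  obtain ⟨e, he⟩ := CrossedProduct.exists_starAlgEquiv (α := ω) (μ := μ.prod ν) (ofₗ.comp curry)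
    (fun f g => by
      change CrossedProduct.of _ = CrossedProduct.of _ * CrossedProduct.of _
      rw [curry_mul hα hβ, CrossedProduct.of_mul])
    (fun f => by
      change CrossedProduct.of _ = star (CrossedProduct.of _)
      rw [curry_star hα hβ, CrossedProduct.of_star])
    (fun f => (CrossedProduct.norm_of _).trans (norm_curry hα hβ f)) (by
      refine Metric.denseRange_iff.2 fun x r hr => ?_
      obtain ⟨g, hg⟩ := CrossedProduct.denseRange_of.exists_dist_lt x (half_pos hr)
      obtain ⟨f, hf⟩ := exists_l1Norm_sub_curry_lt (ω := ω) g (half_pos hr)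
      refine ⟨f, (dist_triangle _ (CrossedProduct.of g) _).trans_lt ?_⟩
      have h1 : dist (CrossedProduct.of g) (CrossedProduct.of (curry f)) < r / 2 := by
        rw [dist_eq_norm, ← CrossedProduct.of_sub, CrossedProduct.norm_of]
        exact (norm_le_l1Norm _).trans_lt hf
      change dist x _ + dist (CrossedProduct.of g) (CrossedProduct.of (curry f)) < r
      linarith)
  refine ⟨e.symm, fun f => ?_⟩
  rw [← e.symm_apply_apply (CrossedProduct.of f), he]
  rfl

end ConvAlg

end CrossedProd

end

noncomputable section

namespace CrossedProd

/-! ### Norms in `C₀(X, A) ⋊ G` for an action which is trivial on `X`. -/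

section Order

attribute [local instance] CStarAlgebra.spectralOrder CStarAlgebra.spectralOrderedRing

/-- Conjugation gives `b* (r* r) b ≤ m b* b`, and summing, `0 ≤ a³ ≤ m a²`. Hence `‖a³‖ ≤ m ‖a‖²`,
and `‖a‖⁴ = ‖a⁴‖ ≤ ‖a³‖ ‖a‖` gives the claim. It allows local norm estimates to be glued by a
partition of unity with no loss from the number of pieces. -/
lemma norm_le_of_sum_conjugate {C : Type*} [NonUnitalCStarAlgebra C] {n : ℕ} {a : C}
    (ha : star a = a) {b r : Fin n → C} {m : ℝ} (hm : 0 ≤ m)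
    (hr : ∀ i, ‖star (r i) * r i‖ ≤ m)
    (h1 : ∑ i, star (b i) * (star (r i) * r i) * b i = a * a * a)
    (h2 : ∑ i, star (b i) * b i = a * a) : ‖a‖ ≤ m := by
  have h3 : a * a * a ≤ m • (a * a) := by
    rw [← h1, ← h2, Finset.smul_sum]
    refine Finset.sum_le_sum fun i _ => ?_
    refine (CStarAlgebra.star_left_conjugate_le_norm_smul (IsSelfAdjoint.star_mul_self _)).trans ?_
    exact smul_le_smul_of_nonneg_right (hr i) (star_mul_self_nonneg _)
  have h4 : 0 ≤ a * a * a := by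
    rw [← h1]
    exact Finset.sum_nonneg fun i _ => star_left_conjugate_nonneg (star_mul_self_nonneg _) _
  have h5 : ‖a * a‖ = ‖a‖ ^ 2 := by
    conv_lhs => rw [← ha]
    rw [ha, sq, ← CStarRing.norm_star_mul_self, ha]
  have h6 : ‖a * a * (a * a)‖ = ‖a‖ ^ 4 := by
    have : star (a * a) = a * a := by rw [star_mul, ha]
    have h := CStarRing.norm_star_mul_self (x := a * a)
    rw [this, h5] at h
    rw [h]
    ring
  have h7 : ‖a * a * a‖ ≤ m * ‖a‖ ^ 2 := by
    refine (CStarAlgebra.norm_le_norm_of_nonneg_of_le h4 h3).trans_eq ?_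
    rw [norm_smul, h5, Real.norm_of_nonneg hm]
  have h8 : ‖a‖ ^ 4 ≤ m * ‖a‖ ^ 2 * ‖a‖ := by
    rw [← h6, ← mul_assoc]
    exact (norm_mul_le _ _).trans (mul_le_mul_of_nonneg_right h7 (norm_nonneg _))
  rcases (norm_nonneg a).eq_or_lt with h0 | h0
  · rwa [← h0]
  · have : ‖a‖ ^ 3 * ‖a‖ ≤ ‖a‖ ^ 3 * m := by nlinarith
    exact le_of_mul_le_mul_left this (by positivity)

end Order

/-- A compact set in `C₀(X, A)` vanishes at infinity uniformly: cover it by finitely many small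
balls. -/
lemma exists_isCompact_c0_norm_le {T X A : Type*} [TopologicalSpace T] [TopologicalSpace X]
    [NonUnitalCStarAlgebra A] {F : T → C₀(X, A)} (hF : Continuous F) {K : Set T}
    (hK : IsCompact K) {e : ℝ} (he : 0 < e) :
    ∃ C : Set X, IsCompact C ∧ ∀ s ∈ K, ∀ x ∉ C, ‖F s x‖ ≤ e := by
  have h1 : ∀ s, ∃ C : Set X, IsCompact C ∧ ∀ x ∉ C, ‖F s x‖ ≤ e / 2 := fun s => by
    have := (tendsto_zero_iff_norm_tendsto_zero.1 (F s).zero_at_infty').eventually_le_const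
      (show 0 < e / 2 by linarith)
    obtain ⟨C, hC, h⟩ := mem_cocompact.1 this
    exact ⟨C, hC, fun x hx => h hx⟩
  choose C hC hCe using h1
  obtain ⟨I, hI⟩ := hK.elim_finite_subcover
    (fun s => {s' | ‖F s' - F s‖ < e / 2})
    (fun s => isOpen_lt (hF.sub continuous_const).norm continuous_const)
    fun s _ => mem_iUnion.2 ⟨s, by simpa using he⟩
  refine ⟨⋃ s ∈ I, C s, I.isCompact_biUnion fun s _ => hC s, fun s hs x hx => ?_⟩
  obtain ⟨s', hs', h⟩ := mem_iUnion₂.1 (hI hs)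
  have h2 := hCe s' x fun h => hx (mem_iUnion₂.2 ⟨s', hs', h⟩)
  have h3 := (c0_norm_apply_le (F s - F s') x).trans (le_of_lt h)
  rw [ZeroAtInftyContinuousMap.sub_apply] at h3
  have h4 := norm_le_norm_add_norm_sub' (F s x) (F s' x)
  linarith

/-- The trivial action on a space. -/
def SpaceAction.trivial (G X : Type*) [Group G] [TopologicalSpace G] [TopologicalSpace X] :
    SpaceAction G X where
  toFun _ x := x
  one_apply _ := rfl
  mul_apply _ _ _ := rfl
  continuous_uncurry := continuous_snd

/-- The action on `C₀(X, A)` given by an action on `A`. -/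
abbrev pointwiseAction {G A : Type*} [Group G] [TopologicalSpace G] [IsTopologicalGroup G]
    [LocallyCompactSpace G] [NonUnitalCStarAlgebra A] (α : CStarAction G A) (X : Type*)
    [TopologicalSpace X] : CStarAction G C₀(X, A) := c0Action α (SpaceAction.trivial G X)

/-- The compactly supported continuous functions with values in the unit interval. -/
abbrev Cutoff (X : Type*) [TopologicalSpace X] : Type _ :=
  {ψ : C(X, ℝ) // HasCompactSupport ψ ∧ ∀ x, ψ x ∈ Icc (0 : ℝ) 1}

namespace Cutoff

variable {X : Type*} [TopologicalSpace X]

/-- The square root of a cutoff function. -/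
def sqrt (ψ : Cutoff X) : Cutoff X :=
  ⟨⟨fun x => √(ψ.1 x), by fun_prop⟩, ψ.2.1.comp_left (g := Real.sqrt) Real.sqrt_zero,
    fun x => ⟨Real.sqrt_nonneg _, Real.sqrt_le_one.2 (ψ.2.2 x).2⟩⟩

lemma sqrt_mul_sqrt (ψ : Cutoff X) (x : X) : ψ.sqrt.1 x * ψ.sqrt.1 x = ψ.1 x :=
  Real.mul_self_sqrt (ψ.2.2 x).1

/-- The square of a cutoff function. -/
def square (ψ : Cutoff X) : Cutoff X :=
  ⟨ψ.1 * ψ.1, ψ.2.1.mul_left, fun x => ⟨mul_self_nonneg _,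
    mul_le_one₀ (ψ.2.2 x).2 (ψ.2.2 x).1 (ψ.2.2 x).2⟩⟩

lemma square_apply (ψ : Cutoff X) (x : X) : ψ.square.1 x = ψ.1 x * ψ.1 x := rfl

end Cutoff

namespace ConvAlg

variable {G X A : Type*} [Group G] [TopologicalSpace G] [IsTopologicalGroup G]
  [LocallyCompactSpace G] [T2Space G] [NonUnitalCStarAlgebra A] [TopologicalSpace X]
  {α : CStarAction G A} {μ : HaarMeasure G}

/-- Evaluation at a point of `X`. -/
def fiber (x : X) : ConvAlg (pointwiseAction α X) μ →ₗ[ℂ] ConvAlg α μ where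
  toFun F := mk (fun s => F s x) (by fun_prop)
    (F.hasCompactSupport.comp_left (g := fun f : C₀(X, A) => f x) rfl)
  map_add' _ _ := rfl
  map_smul' _ _ := rfl

lemma fiber_apply (x : X) (F : ConvAlg (pointwiseAction α X) μ) (s : G) :
    fiber x F s = F s x := rfl

lemma fiber_ext {F F' : ConvAlg (pointwiseAction α X) μ} (h : ∀ x, fiber x F = fiber x F') :
    F = F' := by
  ext s x
  exact DFunLike.congr_fun (h x) s

lemma fiber_mul (x : X) (F F' : ConvAlg (pointwiseAction α X) μ) :
    fiber x (F * F') = fiber x F * fiber x F' := by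
  ext s
  exact mul_apply_apply F F' s x

lemma fiber_star (x : X) (F : ConvAlg (pointwiseAction α X) μ) :
    fiber x (star F) = star (fiber x F) := rfl

lemma l1Norm_fiber_le (x : X) (F : ConvAlg (pointwiseAction α X) μ) :
    l1Norm (fiber x F) ≤ l1Norm F :=
  μ.int_mono (continuous_norm _) (hasCompactSupport_norm _) (continuous_norm _)
    (hasCompactSupport_norm _) fun s => c0_norm_apply_le (F s) x

lemma norm_fiber_le (x : X) (F : ConvAlg (pointwiseAction α X) μ) : ‖fiber x F‖ ≤ ‖F‖ := by
  have h1 : ∀ F : ConvAlg (pointwiseAction α X) μ, ‖fiber x F‖ ≤ l1Norm F := fun F =>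
    (norm_le_l1Norm _).trans (l1Norm_fiber_le x F)
  have h2 : ∀ F F' : ConvAlg (pointwiseAction α X) μ,
      ‖fiber x (F * F')‖ ≤ ‖fiber x F‖ * ‖fiber x F'‖ := fun F F' => by
    rw [fiber_mul]
    exact norm_mul_le _ _
  have h3 : ∀ F : ConvAlg (pointwiseAction α X) μ,
      ‖fiber x F‖ ^ 2 ≤ ‖fiber x (star F * F)‖ := fun F => by
    rw [fiber_mul, fiber_star]
    exact (norm_star_mul_self _).ge
  exact le_norm_of_sq_le ((normSeminorm ℂ (ConvAlg α μ)).comp (fiber x)) h1 h2 h3 F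

lemma exists_compact_norm_le (F : ConvAlg (pointwiseAction α X) μ) {e : ℝ} (he : 0 < e) :
    ∃ C : Set X, IsCompact C ∧ ∀ s, ∀ x ∉ C, ‖F s x‖ ≤ e := by
  obtain ⟨C, hC, h⟩ := exists_isCompact_c0_norm_le F.continuous F.isCompact_tsupport he
  refine ⟨C, hC, fun s x hx => ?_⟩
  by_cases hs : s ∈ tsupport F
  · exact h s hs x hx
  · rw [F.eq_zero hs, ZeroAtInftyContinuousMap.zero_apply, norm_zero]
    exact he.le

/-- The product of a cutoff function with an element of the convolution algebra. -/
def scale (ψ : Cutoff X) (F : ConvAlg (pointwiseAction α X) μ) :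
    ConvAlg (pointwiseAction α X) μ :=
  c0Cc (fun s x => ψ.1 x • F s x)
    (by
      change Continuous fun q : G × X => ψ.1 q.2 • F q.1 q.2
      fun_prop)
    (tsupport F) F.isCompact_tsupport (tsupport ψ.1) ψ.2.1 fun s x h =>
      ⟨by
        by_contra hs
        rw [F.eq_zero hs] at h
        exact h (smul_zero _), mem_tsupport_of_ne (left_ne_zero_of_smul h)⟩

lemma scale_apply (ψ : Cutoff X) (F : ConvAlg (pointwiseAction α X) μ) (s : G) (x : X) :
    scale ψ F s x = ψ.1 x • F s x := rfl

lemma fiber_scale (ψ : Cutoff X) (F : ConvAlg (pointwiseAction α X) μ) (x : X) :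
    fiber x (scale ψ F) = (ψ.1 x : ℂ) • fiber x F := by
  ext s
  rw [smul_apply, Complex.coe_smul]
  rfl

/-- The function `(s, x) ↦ ψ(x) c(s)`. -/
def cutoffTensor (ψ : Cutoff X) : ConvAlg α μ →ₗ[ℂ] ConvAlg (pointwiseAction α X) μ where
  toFun c := c0Cc (fun s x => ψ.1 x • c s)
    (by
      change Continuous fun q : G × X => ψ.1 q.2 • c q.1
      fun_prop)
    (tsupport c) c.isCompact_tsupport (tsupport ψ.1) ψ.2.1 fun s x h =>
      ⟨mem_tsupport_of_ne (right_ne_zero_of_smul h), mem_tsupport_of_ne (left_ne_zero_of_smul h)⟩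
  map_add' c c' := by
    ext s x
    exact smul_add _ _ _
  map_smul' z c := by
    ext s x
    exact smul_comm (ψ.1 x) z (c s)

lemma cutoffTensor_apply (ψ : Cutoff X) (c : ConvAlg α μ) (s : G) (x : X) :
    cutoffTensor ψ c s x = ψ.1 x • c s := rfl

lemma fiber_cutoffTensor (ψ : Cutoff X) (c : ConvAlg α μ) (x : X) :
    fiber x (cutoffTensor ψ c) = (ψ.1 x : ℂ) • c := by
  ext s
  rw [smul_apply, Complex.coe_smul]
  rfl

lemma cutoffTensor_mul (ψ : Cutoff X) (c d : ConvAlg α μ) :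
    cutoffTensor ψ (c * d) = cutoffTensor ψ.sqrt c * cutoffTensor ψ.sqrt d := by
  refine fiber_ext fun x => ?_
  rw [fiber_mul, fiber_cutoffTensor, fiber_cutoffTensor, fiber_cutoffTensor, smul_mul_smul_comm,
    ← Complex.ofReal_mul, ψ.sqrt_mul_sqrt]

lemma star_cutoffTensor_mul (ψ : Cutoff X) (c : ConvAlg α μ) :
    star (cutoffTensor ψ c) * cutoffTensor ψ c = cutoffTensor ψ.square (star c * c) := by
  refine fiber_ext fun x => ?_
  rw [fiber_mul, fiber_star, fiber_cutoffTensor, fiber_cutoffTensor, star_smul, smul_mul_smul_comm,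
    ψ.square_apply, Complex.ofReal_mul, Complex.star_def, Complex.conj_ofReal]

lemma l1Norm_cutoffTensor_le (ψ : Cutoff X) (c : ConvAlg α μ) :
    l1Norm (cutoffTensor ψ c) ≤ l1Norm c := by
  refine μ.int_mono (continuous_norm _) (hasCompactSupport_norm _) (continuous_norm _)
    (hasCompactSupport_norm _) fun s => c0_norm_le (norm_nonneg _) fun x => ?_
  rw [cutoffTensor_apply, norm_smul, Real.norm_of_nonneg (ψ.2.2 x).1]
  exact mul_le_of_le_one_left (norm_nonneg _) (ψ.2.2 x).2

/-- For a single `ψ` the seminorm `‖ψ ⊗ c‖` need not be submultiplicative. The supremum over all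
cutoff functions is: it uses `ψ = √ψ √ψ` for products and `ψ²` for the C*-inequality, both of which
stay in the family. The universal norm therefore dominates it. -/
lemma norm_cutoffTensor_le (ψ : Cutoff X) (c : ConvAlg α μ) : ‖cutoffTensor ψ c‖ ≤ ‖c‖ := by
  let p : Cutoff X → Seminorm ℂ (ConvAlg α μ) := fun ψ =>
    (normSeminorm ℂ (ConvAlg (pointwiseAction α X) μ)).comp (cutoffTensor ψ)
  have hp : ∀ ψ c, p ψ c = ‖cutoffTensor ψ c‖ := fun _ _ => rfl
  have hl : ∀ ψ c, p ψ c ≤ l1Norm c := fun ψ c =>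
    (norm_le_l1Norm _).trans (l1Norm_cutoffTensor_le ψ c)
  have hbdd : BddAbove (range p) := by
    rw [Seminorm.bddAbove_iff]
    refine ⟨fun c => l1Norm c, ?_⟩
    rintro _ ⟨_, ⟨ψ, rfl⟩, rfl⟩
    exact hl ψ
  have hle : ∀ ψ c, p ψ c ≤ (⨆ ψ, p ψ) c := fun ψ c => le_ciSup hbdd ψ c
  have hne : Nonempty (Cutoff X) := ⟨ψ⟩
  have hsup : ∀ (c : ConvAlg α μ) (M : ℝ), (∀ ψ, p ψ c ≤ M) → (⨆ ψ, p ψ) c ≤ M := fun c M h => by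
    rw [Seminorm.iSup_apply hbdd]
    exact ciSup_le h
  refine (hle ψ c).trans (le_norm_of_sq_le (⨆ ψ, p ψ) (fun c => hsup c _ fun ψ => hl ψ c)
    (fun c d => hsup _ _ fun ψ => ?_) (fun c => ?_) c)
  · rw [hp, cutoffTensor_mul]
    exact (norm_mul_le _ _).trans (mul_le_mul (hle _ c) (hle _ d) (norm_nonneg _) (apply_nonneg _ _))
  · refine (Real.le_sqrt (apply_nonneg _ _) (apply_nonneg _ _)).1
      (hsup _ _ fun ψ => Real.le_sqrt_of_sq_le ?_)
    rw [hp, ← norm_star_mul_self, star_cutoffTensor_mul]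
    exact hle ψ.square _

/-- Near `x` the function `a` is uniformly close to its fibre at `x`, so `ψ a` is `L¹`-close to `ψ ⊗
a(x)`, whose norm is at most that of `a(x)`. -/
lemma exists_open_norm_scale_le (a : ConvAlg (pointwiseAction α X) μ) (x : X) {e : ℝ}
    (he : 0 < e) : ∃ U : Set X, IsOpen U ∧ x ∈ U ∧ ∀ ψ : Cutoff X, (∀ y, ψ.1 y ≠ 0 → y ∈ U) →
      ‖scale ψ a‖ ≤ ‖fiber x a‖ + e := by
  obtain ⟨c, hc0, hc⟩ := exists_l1Norm_le_mul (pointwiseAction α X) μ a.isCompact_tsupport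
  have hδ : 0 < e / (c + 1) := by positivity
  have h1 : ∀ᶠ y in 𝓝 x, ∀ s ∈ tsupport a, ‖a s y - a s x‖ < e / (c + 1) := by
    refine a.isCompact_tsupport.eventually_forall_of_forall_eventually fun s _ => ?_
    have hcont : Continuous fun q : X × G => ‖a q.2 q.1 - a q.2 x‖ := by fun_prop
    exact (hcont.tendsto (x, s)).eventually_lt_const (by simpa using hδ)
  obtain ⟨U, hU, hUo, hxU⟩ := mem_nhds_iff.1 h1
  refine ⟨U, hUo, hxU, fun ψ hψ => ?_⟩
  have h2 : ‖scale ψ a - cutoffTensor ψ (fiber x a)‖ ≤ c * (e / (c + 1)) := by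
    have hv : ∀ s y, (scale ψ a - cutoffTensor ψ (fiber x a) :
        ConvAlg (pointwiseAction α X) μ) s y = ψ.1 y • (a s y - a s x) := fun s y => by
      rw [smul_sub]
      rfl
    have hv0 : ∀ s ∉ tsupport a, ∀ y, (scale ψ a - cutoffTensor ψ (fiber x a) :
        ConvAlg (pointwiseAction α X) μ) s y = 0 := fun s hs y => by
      rw [hv, a.eq_zero hs]
      simp
    refine (norm_le_l1Norm _).trans (hc _ _ (fun s hs => ?_) (fun s => c0_norm_le hδ.le fun y => ?_)
      hδ.le)
    · by_contra hs'
      exact hs (ZeroAtInftyContinuousMap.ext (hv0 s hs'))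
    · by_cases hs : s ∈ tsupport a
      · rw [hv, norm_smul, Real.norm_of_nonneg (ψ.2.2 y).1]
        by_cases hy : ψ.1 y = 0
        · rw [hy, zero_mul]
          exact hδ.le
        · exact (mul_le_of_le_one_left (norm_nonneg _) (ψ.2.2 y).2).trans (hU (hψ y hy) s hs).le
      · rw [hv0 s hs, norm_zero]
        exact hδ.le
  have h3 : c * (e / (c + 1)) ≤ e := by
    rw [← mul_div_assoc, div_le_iff₀ (by positivity)]
    nlinarith
  calc ‖scale ψ a‖ = ‖cutoffTensor ψ (fiber x a) + (scale ψ a - cutoffTensor ψ (fiber x a))‖ := by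
        rw [add_sub_cancel]
    _ ≤ _ := (norm_add_le _ _).trans (add_le_add (norm_cutoffTensor_le ψ _) (h2.trans h3))

variable [T2Space X] [LocallyCompactSpace X]

/-- For `a = F* F`, cover `C` by open sets `U_i` on which cutoffs of `a` have norm at most `M² + e`.
Apply `norm_le_of_sum_conjugate` to `b_i = √φ_i a` and `r_i = √χ_i F`, where the `φ_i` form a
partition of unity on `C`. -/
lemma norm_le_of_norm_fiber_le_of_isCompact {F : ConvAlg (pointwiseAction α X) μ} {C : Set X}
    (hC : IsCompact C) (hF : ∀ s, ∀ x ∉ C, F s x = 0) {M : ℝ} (hM : 0 ≤ M)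
    (h : ∀ x, ‖fiber x F‖ ≤ M) : ‖F‖ ≤ M := by
  obtain ⟨a, ha⟩ : ∃ a, a = star F * F := ⟨_, rfl⟩
  have hfa : ∀ x, fiber x a = star (fiber x F) * fiber x F := fun x => by
    rw [ha, fiber_mul, fiber_star]
  have hax : ∀ x, ‖fiber x a‖ ≤ M ^ 2 := fun x => by
    rw [hfa, norm_star_mul_self]
    exact pow_le_pow_left₀ (norm_nonneg _) (h x) 2
  have hF0 : ∀ x ∉ C, fiber x a = 0 := fun x hx => by
    have : fiber x F = 0 := by
      ext s
      exact hF s x hx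
    rw [hfa, this, mul_zero]
  have has : star a = a := by rw [ha, star_mul, star_star]
  have key : ∀ e, 0 < e → ‖a‖ ≤ M ^ 2 + e := by
    intro e he
    choose U hUo hxU hU using fun x => exists_open_norm_scale_le a x he
    obtain ⟨I, hI⟩ := hC.elim_finite_subcover U hUo fun x _ => mem_iUnion.2 ⟨x, hxU x⟩
    let E := I.equivFin
    obtain ⟨φ, hφs, hφ1, hφ, hφc⟩ := exists_continuous_sum_one_of_isOpen_isCompact
      (s := fun i => U (E.symm i).1) (fun i => hUo _) hC (by
        intro t ht
        obtain ⟨u, hu, htu⟩ := mem_iUnion₂.1 (hI ht)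
        exact mem_iUnion.2 ⟨E ⟨u, hu⟩, by simpa using htu⟩)
    -- `χ i` is 1 on the support of `φ i` and vanishes off the `i`-th open set. Hence `r_i* r_i =
    -- χ_i a` has small norm, while `φ_i χ_i = φ_i` keeps the sum of the conjugates equal to `a³`.
    choose χ hχ1 hχ0 hχc hχ using fun i => exists_continuous_one_zero_of_isCompact (X := X) (hφc i)
      (hUo (E.symm i).1).isClosed_compl (disjoint_compl_right_iff_subset.2 (hφs i))
    let f : Fin I.card → Cutoff X := fun i => ⟨φ i, hφc i, hφ i⟩
    let g : Fin I.card → Cutoff X := fun i => ⟨χ i, hχc i, hχ i⟩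
    have hfg : ∀ i x, (g i).1 x * (f i).1 x = (f i).1 x := fun i x => by
      by_cases h0 : φ i x = 0
      · change χ i x * φ i x = φ i x
        rw [h0, mul_zero]
      · change χ i x * φ i x = φ i x
        rw [hχ1 i (mem_tsupport_of_ne h0), Pi.one_apply, one_mul]
    have hsum : ∀ (x : X) (y : ConvAlg α μ), x ∈ C → ∑ i, ((f i).1 x : ℂ) • y = y := fun x y hx => by
      have h1 : ∑ i, φ i x = 1 := by simpa using hφ1 hx
      rw [← Finset.sum_smul, ← Complex.ofReal_sum]
      change ((∑ i, φ i x : ℝ) : ℂ) • y = y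
      rw [h1, Complex.ofReal_one, one_smul]
    have hscale : ∀ i, star (scale (g i).sqrt F) * scale (g i).sqrt F = scale (g i) a := fun i => by
      refine fiber_ext fun x => ?_
      rw [fiber_mul, fiber_star, fiber_scale, fiber_scale, star_smul, smul_mul_smul_comm,
        Complex.star_def, Complex.conj_ofReal, ← Complex.ofReal_mul, Cutoff.sqrt_mul_sqrt, hfa]
    have hsqrt : ∀ i (x : X), fiber x (star (scale (f i).sqrt a) * scale (f i).sqrt a) =
        ((f i).1 x : ℂ) • (fiber x a * fiber x a) := fun i x => by
      rw [fiber_mul, fiber_star, fiber_scale, star_smul, smul_mul_smul_comm,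
        Complex.star_def, Complex.conj_ofReal, ← Complex.ofReal_mul, Cutoff.sqrt_mul_sqrt,
        ← fiber_star, has]
    have hcubic : ∀ i (x : X), fiber x (star (scale (f i).sqrt a) * scale (g i) a *
        scale (f i).sqrt a) = ((f i).1 x : ℂ) • (fiber x a * fiber x a * fiber x a) := fun i x => by
      rw [fiber_mul, fiber_mul, fiber_star, fiber_scale, fiber_scale, star_smul, smul_mul_smul_comm,
        smul_mul_smul_comm, Complex.star_def, Complex.conj_ofReal, ← fiber_star, has,
        ← Complex.ofReal_mul, ← Complex.ofReal_mul, mul_right_comm, Cutoff.sqrt_mul_sqrt, mul_comm,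
        hfg]
    rw [← CrossedProduct.norm_of]
    refine norm_le_of_sum_conjugate (n := I.card) (b := fun i => CrossedProduct.of (scale (f i).sqrt a))
      (r := fun i => CrossedProduct.of (scale (g i).sqrt F)) ?_ (by positivity) (fun i => ?_) ?_ ?_
    · rw [← CrossedProduct.of_star, has]
    · rw [← CrossedProduct.of_star, ← CrossedProduct.of_mul, CrossedProduct.norm_of, hscale]
      refine (hU (E.symm i).1 (g i) fun y hy => ?_).trans (add_le_add_left (hax _) _)
      by_contra hyU
      exact hy (hχ0 i hyU)
    · simp only [← CrossedProduct.of_star, ← CrossedProduct.of_mul, hscale]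
      refine (map_sum (CrossedProduct.ofAddHom (pointwiseAction α X) μ) _ _).symm.trans ?_
      refine congrArg CrossedProduct.of (fiber_ext fun x => ?_)
      rw [map_sum, fiber_mul, fiber_mul]
      simp only [hcubic]
      by_cases hx : x ∈ C
      · exact hsum x _ hx
      · simp [hF0 x hx]
    · simp only [← CrossedProduct.of_star, ← CrossedProduct.of_mul]
      refine (map_sum (CrossedProduct.ofAddHom (pointwiseAction α X) μ) _ _).symm.trans ?_
      refine congrArg CrossedProduct.of (fiber_ext fun x => ?_)
      rw [map_sum, fiber_mul]
      simp only [hsqrt]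
      by_cases hx : x ∈ C
      · exact hsum x _ hx
      · simp [hF0 x hx]
  have h2 : ‖F‖ ^ 2 ≤ M ^ 2 := by
    rw [← norm_star_mul_self, ← ha]
    exact le_of_forall_pos_le_add key
  exact (sq_le_sq₀ (norm_nonneg _) hM).1 h2

/-- Cut `F` off outside a compact set on which it is not yet small; the discarded part is small in
the `L¹`-norm. -/
lemma norm_le_of_norm_fiber_le (F : ConvAlg (pointwiseAction α X) μ) {M : ℝ} (hM : 0 ≤ M)
    (h : ∀ x, ‖fiber x F‖ ≤ M) : ‖F‖ ≤ M := by
  refine le_of_forall_pos_le_add fun e he => ?_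
  obtain ⟨c, hc0, hc⟩ := exists_l1Norm_le_mul (pointwiseAction α X) μ F.isCompact_tsupport
  have hδ : 0 < e / (c + 1) := by positivity
  obtain ⟨C, hC, hCF⟩ := F.exists_compact_norm_le hδ
  obtain ⟨χ, hχ1, -, hχc, hχ⟩ := exists_continuous_one_zero_of_isCompact (X := X) hC isClosed_empty
    (disjoint_empty _)
  let ψ : Cutoff X := ⟨χ, hχc, hχ⟩
  have hψ : ∀ x, ψ.1 x = χ x := fun _ => rfl
  have h1 : ‖scale ψ F‖ ≤ M := by
    refine norm_le_of_norm_fiber_le_of_isCompact hχc (fun s x hx => ?_) hM fun x => ?_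
    · rw [scale_apply, hψ, image_eq_zero_of_notMem_tsupport hx, zero_smul]
    · rw [fiber_scale, norm_smul, Complex.norm_real, Real.norm_of_nonneg (ψ.2.2 x).1]
      exact (mul_le_of_le_one_left (norm_nonneg _) (ψ.2.2 x).2).trans (h x)
  have hv : ∀ s x, (F - scale ψ F : ConvAlg (pointwiseAction α X) μ) s x =
      (1 - ψ.1 x) • F s x := fun s x => by
    rw [sub_smul, one_smul]
    rfl
  have h2 : ‖F - scale ψ F‖ ≤ c * (e / (c + 1)) := by
    refine (norm_le_l1Norm _).trans (hc _ _ (fun s hs => ?_) (fun s => c0_norm_le hδ.le fun x => ?_)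
      hδ.le)
    · by_contra hs'
      refine hs (ZeroAtInftyContinuousMap.ext fun x => ?_)
      rw [hv, F.eq_zero hs', ZeroAtInftyContinuousMap.zero_apply, smul_zero]
    · rw [hv, norm_smul, Real.norm_of_nonneg (sub_nonneg.2 (ψ.2.2 x).2)]
      by_cases hx : x ∈ C
      · rw [hψ, hχ1 hx, Pi.one_apply, sub_self, zero_mul]
        exact hδ.le
      · refine (mul_le_of_le_one_left (norm_nonneg _) ?_).trans (hCF s x hx)
        linarith [(ψ.2.2 x).1]
  have h3 : c * (e / (c + 1)) ≤ e := by
    rw [← mul_div_assoc, div_le_iff₀ (by positivity)]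
    nlinarith
  calc ‖F‖ = ‖scale ψ F + (F - scale ψ F)‖ := by rw [add_sub_cancel]
    _ ≤ _ := (norm_add_le _ _).trans (add_le_add h1 (h2.trans h3))

end ConvAlg

end CrossedProd

end

noncomputable section

namespace CrossedProd

/-! ### The isomorphism of `C₀(X, A) ⋊ G` with `C₀(X, A ⋊ G)`. -/

namespace ConvAlg

variable {G X A : Type*} [Group G] [TopologicalSpace G] [IsTopologicalGroup G]
  [LocallyCompactSpace G] [T2Space G] [NonUnitalCStarAlgebra A] [TopologicalSpace X]
  {α : CStarAction G A} {μ : HaarMeasure G}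

/-- An element of `C_c(G, C₀(X, A))` as a function on `X` with values in `A ⋊ G`. -/
def fibers : ConvAlg (pointwiseAction α X) μ →ₗ[ℂ] C₀(X, CrossedProduct α μ) where
  toFun F :=
    { toFun := fun x => CrossedProduct.of (fiber x F)
      continuous_toFun := continuous_of_family (F := fun x => fiber x F)
        (by
          change Continuous fun q : X × G => F q.2 q.1
          fun_prop) F.isCompact_tsupport fun x s h => by
          by_contra hs
          rw [fiber_apply, F.eq_zero hs] at h
          exact h rfl
      zero_at_infty' := by
        obtain ⟨c, hc0, hc⟩ := exists_l1Norm_le_mul α μ F.isCompact_tsupport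
        rw [tendsto_zero_iff_norm_tendsto_zero]
        refine Metric.tendsto_nhds.2 fun e he => ?_
        have hδ : 0 < e / (c + 1) := by positivity
        obtain ⟨C, hC, hCF⟩ := F.exists_compact_norm_le hδ
        refine mem_cocompact.2 ⟨C, hC, fun x hx => ?_⟩
        have h1 : ‖fiber x F‖ ≤ c * (e / (c + 1)) :=
          (norm_le_l1Norm _).trans (hc _ _ (fun s hs => by
            by_contra hs'
            rw [fiber_apply, F.eq_zero hs'] at hs
            exact hs rfl) (fun s => hCF s x hx) hδ.le)
        have h2 : c * (e / (c + 1)) < e := by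
          rw [← mul_div_assoc, div_lt_iff₀ (by positivity)]
          nlinarith
        rw [mem_ofPred_eq, dist_zero_right, norm_norm, CrossedProduct.norm_of]
        exact h1.trans_lt h2 }
  map_add' F F' := by
    ext x
    exact (congrArg CrossedProduct.of (map_add (fiber x) F F')).trans (CrossedProduct.of_add _ _)
  map_smul' c F := by
    ext x
    exact (congrArg CrossedProduct.of (map_smul (fiber x) c F)).trans (CrossedProduct.of_smul _ _)

lemma fibers_apply (F : ConvAlg (pointwiseAction α X) μ) (x : X) :
    fibers F x = CrossedProduct.of (fiber x F) := rfl

variable [T2Space X] [LocallyCompactSpace X]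

lemma norm_fibers (F : ConvAlg (pointwiseAction α X) μ) : ‖fibers F‖ = ‖F‖ := by
  refine le_antisymm (c0_norm_le (norm_nonneg _) fun x => ?_)
    (norm_le_of_norm_fiber_le F (norm_nonneg _) fun x => ?_)
  · rw [fibers_apply, CrossedProduct.norm_of]
    exact norm_fiber_le x F
  · rw [← CrossedProduct.norm_of]
    exact c0_norm_apply_le (fibers F) x

lemma fibers_tensor (φ : C(X, ℝ)) (hφ : HasCompactSupport φ) (c : ConvAlg α μ) :
    ∃ F : ConvAlg (pointwiseAction α X) μ, ∀ x, fibers F x = φ x • CrossedProduct.of c := by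
  refine ⟨c0Cc (fun s x => φ x • c s) (by
      change Continuous fun q : G × X => φ q.2 • c q.1
      fun_prop)
    (tsupport c) c.isCompact_tsupport (tsupport φ) hφ fun s x h =>
      ⟨mem_tsupport_of_ne (right_ne_zero_of_smul h), mem_tsupport_of_ne (left_ne_zero_of_smul h)⟩,
    fun x => ?_⟩
  rw [CrossedProduct.real_smul_of]
  exact congrArg CrossedProduct.of rfl

lemma _root_.CrossedProd.exists_cutoff_norm_sub_le {B : Type*} [NonUnitalCStarAlgebra B]
    (g : C₀(X, B)) {e : ℝ} (he : 0 < e) :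
    ∃ ψ : Cutoff X, ∀ x, ‖g x - ψ.1 x • g x‖ ≤ e := by
  have := (tendsto_zero_iff_norm_tendsto_zero.1 g.zero_at_infty').eventually_le_const he
  obtain ⟨C, hC, h⟩ := mem_cocompact.1 this
  obtain ⟨χ, hχ1, -, hχc, hχ⟩ := exists_continuous_one_zero_of_isCompact (X := X) hC isClosed_empty
    (disjoint_empty _)
  refine ⟨⟨χ, hχc, hχ⟩, fun x => ?_⟩
  change ‖g x - χ x • g x‖ ≤ e
  have h1 : g x - χ x • g x = (1 - χ x) • g x := by rw [sub_smul, one_smul]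
  rw [h1, norm_smul, Real.norm_of_nonneg (sub_nonneg.2 (hχ x).2)]
  by_cases hx : x ∈ C
  · rw [hχ1 hx, Pi.one_apply, sub_self, zero_mul]
    exact he.le
  · refine (mul_le_of_le_one_left (norm_nonneg _) ?_).trans (h hx)
    linarith [(hχ x).1]

/-- Cut `g` off to compact support, then approximate by sums of elementary tensors, which come from
`C_c(G, C₀(X, A))`. -/
lemma denseRange_fibers :
    DenseRange (fibers : ConvAlg (pointwiseAction α X) μ →ₗ[ℂ] C₀(X, CrossedProduct α μ)) := by
  refine Metric.denseRange_iff.2 fun g r hr => ?_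
  obtain ⟨ψ, hψ⟩ := exists_cutoff_norm_sub_le g (show 0 < r / 3 by linarith)
  obtain ⟨χ, -, -, hχ0, hχ1, h⟩ := exists_sum_smul_approx
    (CrossedProduct.denseRange_of (α := α) (μ := μ)) (g := fun x => ψ.1 x • g x) (by fun_prop)
    ψ.2.1.smul_right
  obtain ⟨n, φ, b, hφ, hb⟩ := h (r / 3) (by linarith)
  choose F hF using fun i => fibers_tensor (φ i) (hφ i) (b i)
  refine ⟨∑ i, F i, ?_⟩
  rw [dist_eq_norm, map_sum]
  refine (c0_norm_le (M := r / 3 + r / 3) (by linarith) fun x => ?_).trans_lt (by linarith)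
  have h1 : (∑ i, fibers (F i)) x = ∑ i, φ i x • CrossedProduct.of (b i) := by
    rw [← Finset.sum_congr rfl fun i _ => hF i x]
    exact map_sum (⟨⟨fun f => f x, rfl⟩, fun _ _ => rfl⟩ : C₀(X, CrossedProduct α μ) →+ _) _ _
  rw [ZeroAtInftyContinuousMap.sub_apply, h1, ← sub_add_sub_cancel _ (ψ.1 x • g x)]
  refine (norm_add_le _ _).trans (add_le_add (hψ x) ((hb x).trans ?_))
  exact mul_le_of_le_one_right (by linarith) (hχ1 x)

/-- `(A ⊗ C₀(X)) ⋊ G` is isomorphic to `(A ⋊ G) ⊗ C₀(X)` for an action which is trivial on `X`. -/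
theorem _root_.CrossedProd.CrossedProduct.exists_c0_equiv (α : CStarAction G A) (μ : HaarMeasure G)
    (X : Type*) [TopologicalSpace X] [T2Space X] [LocallyCompactSpace X] :
    ∃ e : CrossedProduct (pointwiseAction α X) μ ≃⋆ₐ[ℂ] C₀(X, CrossedProduct α μ),
      ∀ F x, e (CrossedProduct.of F) x = CrossedProduct.of (fiber x F) := by
  obtain ⟨e, he⟩ := CrossedProduct.exists_starAlgEquiv
    (fibers : ConvAlg (pointwiseAction α X) μ →ₗ[ℂ] C₀(X, CrossedProduct α μ))
    (fun F F' => by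
      ext x
      rw [fibers_apply, fiber_mul, CrossedProduct.of_mul]
      rfl)
    (fun F => by
      ext x
      rw [fibers_apply, fiber_star, CrossedProduct.of_star]
      rfl) norm_fibers denseRange_fibers
  refine ⟨e, fun F x => ?_⟩
  rw [he]
  rfl

end ConvAlg

end CrossedProd

end

noncomputable section

namespace CrossedProd

/-! ### Functions of two variables vanishing at infinity. -/

section Currying

variable {X Y Z A : Type*} [TopologicalSpace X] [TopologicalSpace Y] [TopologicalSpace Z]
  [NonUnitalCStarAlgebra A]

lemma exists_isCompact_norm_le (f : C₀(X, A)) {e : ℝ} (he : 0 < e) :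
    ∃ C : Set X, IsCompact C ∧ ∀ x ∉ C, ‖f x‖ ≤ e := by
  obtain ⟨C, hC, h⟩ := exists_isCompact_c0_norm_le (F := fun _ : Unit => f) continuous_const
    (isCompact_singleton (x := ())) he
  exact ⟨C, hC, h () rfl⟩

lemma tendsto_zero_of_forall_isCompact {B : Type*} [NormedAddCommGroup B] {f : X → B}
    (h : ∀ e : ℝ, 0 < e → ∃ C : Set X, IsCompact C ∧ ∀ x ∉ C, ‖f x‖ ≤ e) :
    Tendsto f (cocompact X) (𝓝 0) := by
  rw [tendsto_zero_iff_norm_tendsto_zero]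
  refine Metric.tendsto_nhds.2 fun e he => ?_
  obtain ⟨C, hC, hCe⟩ := h (e / 2) (by linarith)
  refine mem_cocompact.2 ⟨C, hC, fun x hx => ?_⟩
  rw [mem_ofPred_eq, dist_zero_right, norm_norm]
  linarith [hCe x hx]

/-- The function `r ↦ f(r, z)`. -/
def c0Slice (f : C₀(Y × Z, A)) (z : Z) : C₀(Y, A) where
  toFun r := f (r, z)
  continuous_toFun := f.continuous.comp (by fun_prop)
  zero_at_infty' := tendsto_zero_of_forall_isCompact fun e he => by
    obtain ⟨C, hC, h⟩ := exists_isCompact_norm_le f he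
    exact ⟨Prod.fst '' C, hC.image continuous_fst, fun r hr => h _ fun hm => hr ⟨_, hm, rfl⟩⟩

lemma continuous_c0Slice (f : C₀(Y × Z, A)) : Continuous (c0Slice f) := by
  rw [continuous_iff_continuousAt]
  intro z₀
  refine Metric.tendsto_nhds.2 fun e he => ?_
  obtain ⟨C, hC, h⟩ := exists_isCompact_norm_le f (show 0 < e / 4 by linarith)
  have hC' : ∀ z, ∀ r ∉ Prod.fst '' C, ‖f (r, z)‖ ≤ e / 2 / 2 := fun z r hr =>
    (h _ fun hm => hr ⟨_, hm, rfl⟩).trans (by linarith)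
  have key := eventually_norm_sub_le (F := fun z r => f (r, z)) (s₀ := z₀) (e := e / 2)
    (f.continuous.comp (by fun_prop : Continuous fun q : Z × Y => (q.2, q.1))) (by linarith)
    univ_mem (hC.image continuous_fst) (fun z _ r => by
      by_cases hr : r ∈ Prod.fst '' C
      · exact Or.inl ⟨r, hr, rfl⟩
      · exact Or.inr ⟨hC' z r hr, hC' z₀ r hr⟩)
  filter_upwards [key] with z hz
  rw [dist_eq_norm]
  exact (c0_norm_le (f := c0Slice f z - c0Slice f z₀) (by linarith) hz).trans_lt (by linarith)

/-- The isomorphism of `C₀(Y × Z, A)` with `C₀(X, C₀(Y, A))`, for `X` homeomorphic to `Z`. -/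
def c0Curry (h : X ≃ₜ Z) : C₀(Y × Z, A) ≃⋆ₐ[ℂ] C₀(X, C₀(Y, A)) where
  toFun f :=
    { toFun := fun x => c0Slice f (h x)
      continuous_toFun := (continuous_c0Slice f).comp h.continuous
      zero_at_infty' := tendsto_zero_of_forall_isCompact fun e he => by
        obtain ⟨C, hC, hCe⟩ := exists_isCompact_norm_le f he
        refine ⟨h ⁻¹' (Prod.snd '' C), h.isCompact_preimage.2 (hC.image continuous_snd),
          fun x hx => c0_norm_le he.le fun r => hCe _ fun hm => hx ⟨_, hm, rfl⟩⟩ }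
  invFun g :=
    { toFun := fun p => g (h.symm p.2) p.1
      continuous_toFun := by
        have := h.symm.continuous
        fun_prop
      zero_at_infty' := tendsto_zero_of_forall_isCompact fun e he => by
        obtain ⟨C, hC, hCe⟩ := exists_isCompact_norm_le g he
        obtain ⟨C', hC', hCe'⟩ := exists_isCompact_c0_norm_le g.continuous hC he
        refine ⟨C' ×ˢ (h '' C), hC'.prod (hC.image h.continuous), fun p hp => ?_⟩
        by_cases hx : h.symm p.2 ∈ C
        · exact hCe' _ hx _ fun hm => hp ⟨hm, _, hx, by simp⟩
        · exact (c0_norm_apply_le _ _).trans (hCe _ hx) }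
  left_inv f := ZeroAtInftyContinuousMap.ext fun p => congrArg f (by simp)
  right_inv g := ZeroAtInftyContinuousMap.ext fun x => ZeroAtInftyContinuousMap.ext fun r =>
    congrArg (fun x => g x r) (by simp)
  map_mul' _ _ := rfl
  map_add' _ _ := rfl
  map_star' _ := rfl
  map_smul' _ _ := rfl

lemma c0Curry_apply (h : X ≃ₜ Z) (f : C₀(Y × Z, A)) (x : X) (r : Y) :
    c0Curry h f x r = f (r, h x) := rfl

end Currying

/-- The action transported by an isomorphism. -/
def CStarAction.conj {G A B : Type*} [Group G] [TopologicalSpace G] [NonUnitalCStarAlgebra A]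
    [NonUnitalCStarAlgebra B] (α : CStarAction G A) (φ : A ≃⋆ₐ[ℂ] B) : CStarAction G B where
  aut :=
    { toFun := fun s => φ.symm.trans ((α s).trans φ)
      map_one' := StarAlgEquiv.ext fun b => by simp
      map_mul' := fun s t => StarAlgEquiv.ext fun b => by simp }
  continuous_orbit b := (StarAlgEquiv.isometry φ).continuous.comp (α.continuous_orbit (φ.symm b))

lemma CStarAction.equivariant_conj {G A B : Type*} [Group G] [TopologicalSpace G]
    [NonUnitalCStarAlgebra A] [NonUnitalCStarAlgebra B] (α : CStarAction G A) (φ : A ≃⋆ₐ[ℂ] B) :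
    ∀ s a, φ (α s a) = α.conj φ s (φ a) := fun s a =>
  congrArg (fun b => φ (α s b)) (φ.symm_apply_apply a).symm

/-! ### The canonical isomorphisms `i` and `ι`. -/

section Setup

variable {G A : Type*} [Group G] [TopologicalSpace G] [IsTopologicalGroup G]
  [LocallyCompactSpace G] [T2Space G] [NonUnitalCStarAlgebra A]
  (α : CStarAction G A) (N H : Subgroup G) [N.Normal]
  [IsClosed (N : Set G)] [IsClosed (H : Set G)] [Fact (N ≤ H)]
  (μG : HaarMeasure G) (μGN : HaarMeasure (G ⧸ N)) (μHN : HaarMeasure (quotSubgroup N H))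

lemma gammaAction_apply (l : quotSubgroup N H × G) (f : C₀(G ⧸ N, A)) (r : G ⧸ N) :
    gammaAction α N H l f r = α l.2 (f ((l.2 : G ⧸ N)⁻¹ * r * (l.1 : G ⧸ N))) :=
  congrArg (fun q => α l.2 (f ((l.2 : G ⧸ N)⁻¹ * r * q))) (inv_inv (l.1 : G ⧸ N))

lemma etaAction_apply (k : (G ⧸ N) × G) (f : C₀((G ⧸ N) × (G ⧸ H), A)) (r : G ⧸ N) (x : G ⧸ H) :
    etaAction α N H k f (r, x) =
      α k.2 (f ((k.2 : G ⧸ N)⁻¹ * r * k.1, quotCosetAction N H k.1⁻¹ x)) :=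
  congrArg (fun q => α k.2 (f ((k.2 : G ⧸ N)⁻¹ * r * q, quotCosetAction N H k.1⁻¹ x)))
    (inv_inv k.1)

lemma ltAction_apply' (s : G) (f : C₀(G ⧸ N, A)) (r : G ⧸ N) :
    ltAction α N s f r = α s (f ((s : G ⧸ N)⁻¹ * r)) := ltAction_apply α N s f r

lemma betaAction_of (t : G ⧸ N) {F F' : ConvAlg (ltAction α N) μG}
    (h : ∀ s r, F' s r = F s (r * t)) :
    betaAction α N μG t (CrossedProduct.of F) = CrossedProduct.of F' := by
  refine (CrossedProduct.mapEquiv_of _ (rtAction_equivariant α N t) F).trans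
    (congrArg CrossedProduct.of ?_)
  ext s r
  rw [ConvAlg.map_apply, rtAction_apply, h]

/-- The isomorphism `(B ⋊_β H/N) ≅ (A ⊗ C₀(G/N)) ⋊_γ (H/N × G)`. -/
lemma exists_right_equiv :
    ∃ i : CrossedProduct ((betaAction α N μG).restrict (quotSubgroup N H)) μHN ≃⋆ₐ[ℂ]
        CrossedProduct (gammaAction α N H) (μHN.prod μG),
      ∀ f, i (CrossedProduct.of (ConvAlg.curry f)) = CrossedProduct.of f := by
  refine CrossedProduct.exists_iterated_equiv (fun s d => ?_) fun k F F' h => ?_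
  · ext r
    rw [gammaAction_apply, ltAction_apply', Subgroup.coe_one, mul_one]
  · rw [Green.restrict_apply]
    refine betaAction_of α N μG _ fun s r => ?_
    rw [h, gammaAction_apply, α.one_apply, QuotientGroup.mk_one, inv_one, one_mul]

lemma isCanonicalRight_of {i : CrossedProduct ((betaAction α N μG).restrict (quotSubgroup N H)) μHN
      ≃⋆ₐ[ℂ] CrossedProduct (gammaAction α N H) (μHN.prod μG)}
    (hi : ∀ f, i (CrossedProduct.of (ConvAlg.curry f)) = CrossedProduct.of f) :
    IsCanonicalRight i := fun f =>
  ⟨ConvAlg.curry f, ConvAlg.slice f, fun _ _ => rfl, fun _ => rfl, hi f⟩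

/-- The identification of `(G/N)/(H/N)` with `G/H`. -/
def quotQuotHomeo : (G ⧸ N) ⧸ quotSubgroup N H ≃ₜ G ⧸ H where
  toFun := Quotient.lift (fun q : G ⧸ N => quotCosetAction N H q ((1 : G) : G ⧸ H)) (by
    intro q q' h
    obtain ⟨v, hv, e⟩ : q⁻¹ * q' ∈ quotSubgroup N H := QuotientGroup.leftRel_apply.1 h
    have h1 : q' = q * (v : G ⧸ N) := by
      rw [show (v : G ⧸ N) = q⁻¹ * q' from e, mul_inv_cancel_left]
    have h2 : ((v * 1 : G) : G ⧸ H) = ((1 : G) : G ⧸ H) := by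
      rw [mul_one]
      exact QuotientGroup.eq.2 (by simpa using hv)
    change quotCosetAction N H q _ = quotCosetAction N H q' _
    rw [h1, (quotCosetAction N H).mul_apply, quotCosetAction_mk, h2])
  invFun := Quotient.lift (fun u : G => (((u : G ⧸ N)) : (G ⧸ N) ⧸ quotSubgroup N H)) (by
    intro u u' h
    have h1 : u⁻¹ * u' ∈ H := QuotientGroup.leftRel_apply.1 h
    exact QuotientGroup.eq.2 ⟨_, h1, rfl⟩)
  left_inv x := by
    induction x using QuotientGroup.induction_on with
    | H q =>
    induction q using QuotientGroup.induction_on with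
    | H u => exact congrArg (fun u : G => (((u : G ⧸ N)) : (G ⧸ N) ⧸ quotSubgroup N H)) (mul_one u)
  right_inv x := by
    induction x using QuotientGroup.induction_on with
    | H u => exact congrArg ((↑) : G → G ⧸ H) (mul_one u)
  continuous_toFun := Continuous.quotient_lift
    (continuous_id.spaceAction (quotCosetAction N H) continuous_const) _
  continuous_invFun := Continuous.quotient_lift
    (QuotientGroup.continuous_mk.comp QuotientGroup.continuous_mk) _

lemma quotQuotHomeo_mk (u : G) :
    quotQuotHomeo N H (((u : G ⧸ N)) : (G ⧸ N) ⧸ quotSubgroup N H) = (u : G ⧸ H) :=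
  congrArg ((↑) : G → G ⧸ H) (mul_one u)

lemma quotQuotHomeo_cosetAction (t : G ⧸ N) (x : (G ⧸ N) ⧸ quotSubgroup N H) :
    quotQuotHomeo N H (cosetAction (quotSubgroup N H) t x) =
      quotCosetAction N H t (quotQuotHomeo N H x) := by
  induction x using QuotientGroup.induction_on with
  | H q => exact (quotCosetAction N H).mul_apply t q _

/-- The action of `G/N × G` on `C₀((G/N)/(H/N), C₀(G/N, A))`. -/
def curriedAction : CStarAction ((G ⧸ N) × G) C₀((G ⧸ N) ⧸ quotSubgroup N H, C₀(G ⧸ N, A)) :=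
  (etaAction α N H).conj (c0Curry (quotQuotHomeo N H))

lemma curriedAction_apply (k : (G ⧸ N) × G)
    (d : C₀((G ⧸ N) ⧸ quotSubgroup N H, C₀(G ⧸ N, A))) (x : (G ⧸ N) ⧸ quotSubgroup N H)
    (r : G ⧸ N) : curriedAction α N H k d x r =
      α k.2 (d (cosetAction (quotSubgroup N H) k.1⁻¹ x) ((k.2 : G ⧸ N)⁻¹ * r * k.1)) := by
  obtain ⟨f, rfl⟩ : ∃ f, c0Curry (quotQuotHomeo N H) f = d :=
    ⟨_, (c0Curry (quotQuotHomeo N H)).apply_symm_apply d⟩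
  rw [curriedAction, ← CStarAction.equivariant_conj, c0Curry_apply, etaAction_apply, c0Curry_apply,
    quotQuotHomeo_cosetAction]

/-- The isomorphism `(B ⊗ C₀(G/H)) ⋊ G/N ≅ (A ⊗ C₀(G/N) ⊗ C₀(G/H)) ⋊ (G/N × G)`. -/
lemma exists_left_equiv :
    ∃ ι : CrossedProduct (Green.leftAction (betaAction α N μG) (quotSubgroup N H)) μGN ≃⋆ₐ[ℂ]
        CrossedProduct (etaAction α N H) (μGN.prod μG),
      ∀ f : ConvAlg (etaAction α N H) (μGN.prod μG),
      ∃ f₁ : ConvAlg (Green.leftAction (betaAction α N μG) (quotSubgroup N H)) μGN,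
        ι (CrossedProduct.of f₁) = CrossedProduct.of f ∧
        ∀ (t : G ⧸ N) (x : (G ⧸ N) ⧸ quotSubgroup N H), ∃ g : ConvAlg (ltAction α N) μG,
          f₁ t x = CrossedProduct.of g ∧ ∀ s r, g s r = f (t, s) (r, quotQuotHomeo N H x) := by
  obtain ⟨e, he⟩ := CrossedProduct.exists_c0_equiv (ltAction α N) μG ((G ⧸ N) ⧸ quotSubgroup N H)
  -- The Green left algebra has coefficients `C₀(Q/S, B)`. Its action is carried to `(C₀(Q/S) ⊗ A ⊗
  -- C₀(G/N)) ⋊ G` by the isomorphism `e`, where it is induced by an action on the coefficients;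
  -- only then does the iterated crossed product theorem apply.
  let β' := (Green.leftAction (betaAction α N μG) (quotSubgroup N H)).conj e.symm
  have hβ' : Equivariant e.symm (Green.leftAction (betaAction α N μG) (quotSubgroup N H)) β' :=
    CStarAction.equivariant_conj _ _
  have hκ : Equivariant (c0Curry (quotQuotHomeo N H)) (etaAction α N H) (curriedAction α N H) :=
    CStarAction.equivariant_conj _ _
  obtain ⟨j, hj⟩ := CrossedProduct.exists_iterated_equiv (ω := curriedAction α N H)
    (α := pointwiseAction (ltAction α N) ((G ⧸ N) ⧸ quotSubgroup N H)) (μ := μGN) (ν := μG)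
    (β := β') (fun s d => by
      ext x r
      rw [curriedAction_apply, c0Action_apply, ltAction_apply', mul_one, inv_one,
        (cosetAction (quotSubgroup N H)).one_apply]
      rfl) (fun t F F' h => by
      have h1 : β' t (CrossedProduct.of F) =
          e.symm (Green.leftAction (betaAction α N μG) (quotSubgroup N H) t
            (e (CrossedProduct.of F))) := rfl
      rw [h1]
      refine (congrArg e.symm ?_).trans (e.symm_apply_apply _)
      ext x
      rw [c0Action_apply, he, he]
      refine betaAction_of α N μG t fun s r => ?_
      rw [ConvAlg.fiber_apply, h, curriedAction_apply, α.one_apply, QuotientGroup.mk_one, inv_one,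
        one_mul]
      rfl)
  -- `ι` pulls `B` apart fibrewise over `Q/S`, merges the groups `G/N` and `G`, and finally replaces
  -- iterated `C₀`-functions on `Q/S` and `G/N` by functions on `G/N × G/H`.
  refine ⟨((CrossedProduct.mapEquiv e.symm hβ').trans j).trans
    (CrossedProduct.mapEquiv _ hκ.symm), fun f => ?_⟩
  obtain ⟨f', hf'⟩ : ∃ f' : ConvAlg (curriedAction α N H) (μGN.prod μG),
    f' = ConvAlg.map (c0Curry (quotQuotHomeo N H)) f := ⟨_, rfl⟩
  refine ⟨ConvAlg.map e (ConvAlg.curry f' : ConvAlg β' μGN), ?_, fun t x => ?_⟩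
  · have h1 : (ConvAlg.map e.symm (ConvAlg.map e (ConvAlg.curry f' : ConvAlg β' μGN) :
        ConvAlg (Green.leftAction (betaAction α N μG) (quotSubgroup N H)) μGN) :
        ConvAlg β' μGN) = ConvAlg.curry f' := by
      ext t
      rw [ConvAlg.map_apply, ConvAlg.map_apply, e.symm_apply_apply]
    have h2 : (ConvAlg.map (c0Curry (quotQuotHomeo N H)).symm f' :
        ConvAlg (etaAction α N H) (μGN.prod μG)) = f := by
      ext t
      rw [ConvAlg.map_apply, hf', ConvAlg.map_apply, StarAlgEquiv.symm_apply_apply]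
    rw [StarAlgEquiv.trans_apply, StarAlgEquiv.trans_apply, CrossedProduct.mapEquiv_of, h1, hj,
      CrossedProduct.mapEquiv_of, h2]
  · refine ⟨ConvAlg.fiber x (ConvAlg.slice f' t), ?_, fun s r => ?_⟩
    · rw [ConvAlg.map_apply, ConvAlg.curry_apply, he]
    · rw [ConvAlg.fiber_apply, ConvAlg.slice_apply, hf', ConvAlg.map_apply, c0Curry_apply]

lemma isCanonicalLeft_of {ι : CrossedProduct (Green.leftAction (betaAction α N μG)
      (quotSubgroup N H)) μGN ≃⋆ₐ[ℂ] CrossedProduct (etaAction α N H) (μGN.prod μG)}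
    (hι : ∀ f : ConvAlg (etaAction α N H) (μGN.prod μG),
      ∃ f₁ : ConvAlg (Green.leftAction (betaAction α N μG) (quotSubgroup N H)) μGN,
        ι (CrossedProduct.of f₁) = CrossedProduct.of f ∧
        ∀ (t : G ⧸ N) (x : (G ⧸ N) ⧸ quotSubgroup N H), ∃ g : ConvAlg (ltAction α N) μG,
          f₁ t x = CrossedProduct.of g ∧ ∀ s r, g s r = f (t, s) (r, quotQuotHomeo N H x)) :
    IsCanonicalLeft ι := fun f => by
  obtain ⟨f₁, h1, h2⟩ := hι f
  choose g hg1 hg2 using h2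
  refine ⟨f₁, fun t u => g t (((u : G ⧸ N)) : (G ⧸ N) ⧸ quotSubgroup N H), fun t u s r => ?_,
    fun t u => hg1 t _, h1⟩
  rw [hg2, quotQuotHomeo_mk]

end Setup

end CrossedProd

end

noncomputable section

namespace CrossedProd

/-! ### Induced algebras as functions on the orbit space. -/

section Ind

variable {G L P Z A : Type*} [Group G] [TopologicalSpace G] [Group L] [TopologicalSpace L]
  [IsTopologicalGroup L] [TopologicalSpace P] [LocallyCompactSpace P] [TopologicalSpace Z]
  [NonUnitalCStarAlgebra A] {ρ : SpaceAction L P} {η : CStarAction L A}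

lemma exists_isCompact_subset_image {m : P → Z} (hm : IsOpenQuotientMap m) {C : Set Z}
    (hC : IsCompact C) : ∃ C' : Set P, IsCompact C' ∧ C ⊆ m '' C' := by
  choose k hk hkx using fun x : P => exists_compact_mem_nhds x
  obtain ⟨t, ht⟩ := hC.elim_finite_subcover (fun x : P => m '' interior (k x))
    (fun x => hm.isOpenMap _ isOpen_interior) (by
      intro q _
      obtain ⟨x, rfl⟩ := hm.surjective q
      exact mem_iUnion.2 ⟨x, x, mem_interior_iff_mem_nhds.2 (hkx x), rfl⟩)
  refine ⟨⋃ x ∈ t, k x, t.isCompact_biUnion fun x _ => hk x, ht.trans ?_⟩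
  rw [image_iUnion₂]
  exact iUnion₂_mono fun x _ => image_mono interior_subset

/-- The element `p ↦ α_{w(p)}(f(m(p)))` of an induced algebra. -/
def toInd (α : CStarAction G A) {m : P → Z} (hm : IsOpenQuotientMap m) {w : P → G}
    (hw : Continuous w) (hinv : ∀ t p, m (ρ t p) = m p)
    (htrans : ∀ p p', m p = m p' → ∃ t, ρ t p = p')
    (hη : ∀ t p a, α (w (ρ t p)) a = η t (α (w p) a)) (f : C₀(Z, A)) : Ind ρ η :=
  ⟨BoundedContinuousFunction.ofNormedAddCommGroup (fun p => α (w p) (f (m p)))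
      (hw.cstarAction α (f.continuous.comp hm.continuous)) ‖f‖
      fun p => by
        rw [α.norm_apply]
        exact c0_norm_apply_le f _,
    fun t p => by
      change α (w (ρ t p)) (f (m (ρ t p))) = η t (α (w p) (f (m p)))
      rw [hinv, hη], by
    refine (ind_vanish_iff _).2 fun e he => ?_
    obtain ⟨C, hC, hCe⟩ := exists_isCompact_norm_le f (half_pos he)
    obtain ⟨C', hC', hCC⟩ := exists_isCompact_subset_image hm hC
    refine ⟨C', hC', fun p hp => ?_⟩
    have hp' : e ≤ ‖α (w p) (f (m p))‖ := hp
    rw [α.norm_apply] at hp'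
    have hpC : m p ∈ C := by
      by_contra h
      linarith [hCe _ h]
    obtain ⟨p', hp', h⟩ := hCC hpC
    obtain ⟨t, rfl⟩ := htrans p p' h.symm
    exact ⟨t, hp'⟩⟩

/-- An induced algebra is a function algebra on the orbit space if the coefficient action is
untwisted by a continuous cocycle. -/
theorem exists_ind_equiv (α : CStarAction G A) {m : P → Z} (hm : IsOpenQuotientMap m) {w : P → G}
    (hw : Continuous w) (hw' : Continuous fun p => (w p)⁻¹) (hinv : ∀ t p, m (ρ t p) = m p)
    (htrans : ∀ p p', m p = m p' → ∃ t, ρ t p = p')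
    (hη : ∀ t p a, α (w (ρ t p)) a = η t (α (w p) a)) :
    ∃ Φ : C₀(Z, A) ≃⋆ₐ[ℂ] Ind ρ η, ∀ f p, Φ f p = α (w p) (f (m p)) := by
  let Φ : C₀(Z, A) →⋆ₙₐ[ℂ] Ind ρ η :=
    { toFun := toInd α hm hw hinv htrans hη
      map_smul' := fun c f => Ind.ext' fun p => map_smul (α (w p)) c (f (m p))
      map_zero' := Ind.ext' fun p => map_zero (α (w p))
      map_add' := fun f g => Ind.ext' fun p => map_add (α (w p)) (f (m p)) (g (m p))
      map_mul' := fun f g => Ind.ext' fun p => map_mul (α (w p)) (f (m p)) (g (m p))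
      map_star' := fun f => Ind.ext' fun p => map_star (α (w p)) (f (m p)) }
  have hΦ : ∀ f p, Φ f p = α (w p) (f (m p)) := fun _ _ => rfl
  refine ⟨StarAlgEquiv.ofBijective Φ ⟨fun f g h => ?_, fun F => ?_⟩, hΦ⟩
  · ext z
    obtain ⟨p, rfl⟩ := hm.surjective z
    have := DFunLike.congr_fun h p
    rw [hΦ, hΦ] at this
    exact (α.isometry_apply (w p)).injective this
  · have hconst : ∀ p p', m p = m p' → α (w p)⁻¹ (F p) = α (w p')⁻¹ (F p') := fun p p' h => by
      obtain ⟨t, rfl⟩ := htrans p p' h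
      refine (α.isometry_apply (w (ρ t p))).injective ?_
      rw [α.self_apply_inv, hη, α.self_apply_inv, Ind.equivariant F]
    choose s hs using hm.surjective
    have hf : ∀ p, α (w (s (m p)))⁻¹ (F (s (m p))) = α (w p)⁻¹ (F p) := fun p =>
      hconst _ _ (hs (m p))
    have hcont : Continuous fun z => α (w (s z))⁻¹ (F (s z)) := by
      rw [← hm.continuous_comp_iff]
      refine (hw'.cstarAction α (Ind.continuous F)).congr fun p => (hf p).symm
    refine ⟨⟨⟨fun z => α (w (s z))⁻¹ (F (s z)), hcont⟩,
      tendsto_zero_of_forall_isCompact fun e he => ?_⟩, ?_⟩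
    · obtain ⟨C, hC, hCe⟩ := (ind_vanish_iff F).1 F.2.2 e he
      refine ⟨m '' C, hC.image hm.continuous, fun z hz => ?_⟩
      by_contra h
      change ¬ ‖α (w (s z))⁻¹ (F (s z))‖ ≤ e at h
      rw [α.norm_apply] at h
      obtain ⟨t, ht⟩ := hCe (s z) (not_le.1 h).le
      exact hz ⟨_, ht, by rw [hinv, hs]⟩
    · refine Ind.ext' fun p => ?_
      rw [hΦ]
      change α (w p) (α (w (s (m p)))⁻¹ (F (s (m p)))) = F p
      rw [hf, α.self_apply_inv]

end Ind

/-! ### The isomorphisms `Γ` and `Υ`. -/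

section Setup

variable {G A : Type*} [Group G] [TopologicalSpace G] [IsTopologicalGroup G]
  [LocallyCompactSpace G] [T2Space G] [NonUnitalCStarAlgebra A]
  (α : CStarAction G A) (N H : Subgroup G) [N.Normal]
  [IsClosed (N : Set G)] [IsClosed (H : Set G)] [Fact (N ≤ H)]

/-- The map `vN ↦ vH`. -/
def quotProj (v : G ⧸ N) : G ⧸ H := quotQuotHomeo N H (v : (G ⧸ N) ⧸ quotSubgroup N H)

lemma quotProj_mk (v : G) : quotProj N H (v : G ⧸ N) = (v : G ⧸ H) := quotQuotHomeo_mk N H v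

lemma quotProj_mul (t v : G ⧸ N) :
    quotProj N H (t * v) = quotCosetAction N H t (quotProj N H v) :=
  quotQuotHomeo_cosetAction N H t (v : (G ⧸ N) ⧸ quotSubgroup N H)

lemma quotProj_mul_coe (v : G ⧸ N) (h : quotSubgroup N H) :
    quotProj N H (v * (h : G ⧸ N)) = quotProj N H v :=
  congrArg (quotQuotHomeo N H) (QuotientGroup.mk_mul_of_mem v h.2)

lemma isOpenQuotientMap_quotProj : IsOpenQuotientMap (quotProj N H) :=
  (quotQuotHomeo N H).isOpenQuotientMap.comp QuotientGroup.isOpenQuotientMap_mk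

lemma inv_mul_mem_of_quotProj_eq {v v' : G ⧸ N} (h : quotProj N H v = quotProj N H v') :
    v⁻¹ * v' ∈ quotSubgroup N H :=
  QuotientGroup.eq.1 ((quotQuotHomeo N H).injective h)

/-- A shear of `P` turns the map into a product of the identity and open quotient maps. -/
lemma isOpenQuotientMap_orbitL :
    IsOpenQuotientMap fun p : (G ⧸ N) × G × (G ⧸ N) =>
      ((p.2.1 : G ⧸ N) * p.1⁻¹, quotProj N H p.2.2) := by
  have hc : Continuous fun p : (G ⧸ N) × G × (G ⧸ N) => (p.2.1 : G ⧸ N) :=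
    QuotientGroup.continuous_mk.comp (by fun_prop)
  let e : (G ⧸ N) × G × (G ⧸ N) ≃ₜ (G ⧸ N) × G × (G ⧸ N) :=
    { toFun := fun p => ((p.2.1 : G ⧸ N) * p.1⁻¹, p.2)
      invFun := fun p => (p.1⁻¹ * (p.2.1 : G ⧸ N), p.2)
      left_inv := fun p => by simp
      right_inv := fun p => by simp
      continuous_toFun := by fun_prop
      continuous_invFun := by fun_prop }
  have h1 : IsOpenQuotientMap (Prod.snd : G × (G ⧸ N) → G ⧸ N) :=
    ⟨Prod.snd_surjective, continuous_snd, isOpenMap_snd⟩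
  exact (IsOpenQuotientMap.id.prodMap ((isOpenQuotientMap_quotProj N H).comp h1)).comp
    e.isOpenQuotientMap

lemma isOpenQuotientMap_orbitK :
    IsOpenQuotientMap fun p : (G ⧸ N) × G × (G ⧸ N) => p.1⁻¹ * p.2.2 := by
  let e : (G ⧸ N) × G × (G ⧸ N) ≃ₜ (G ⧸ N) × G × (G ⧸ N) :=
    { toFun := fun p => (p.1, p.2.1, p.1⁻¹ * p.2.2)
      invFun := fun p => (p.1, p.2.1, p.1 * p.2.2)
      left_inv := fun p => by simp
      right_inv := fun p => by simp
      continuous_toFun := by fun_prop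
      continuous_invFun := by fun_prop }
  have h1 : IsOpenQuotientMap (fun p : (G ⧸ N) × G × (G ⧸ N) => p.2.2) :=
    ⟨Prod.snd_surjective.comp Prod.snd_surjective, by fun_prop,
      isOpenMap_snd.comp isOpenMap_snd⟩
  exact h1.comp e.isOpenQuotientMap

lemma greenData_left (k : (G ⧸ N) × G) (p : (G ⧸ N) × G × (G ⧸ N)) :
    (greenData α N H).left k p = (k.1 * p.1, k.2 * p.2.1, k.1 * p.2.2) := rfl

lemma greenData_right (l : quotSubgroup N H × G) (p : (G ⧸ N) × G × (G ⧸ N)) :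
    (greenData α N H).right l p =
      (p.1 * (l.2 : G ⧸ N)⁻¹, p.2.1 * l.2⁻¹, p.2.2 * (l.1 : G ⧸ N)⁻¹) := rfl

lemma greenData_rmul (p : (G ⧸ N) × G × (G ⧸ N)) (l : quotSubgroup N H × G) :
    (greenData α N H).rmul p l =
      (p.1 * (l.2 : G ⧸ N), p.2.1 * l.2, p.2.2 * (l.1 : G ⧸ N)) := by
  change (greenData α N H).right l⁻¹ p = _
  rw [greenData_right]
  simp

lemma greenData_σ (k : (G ⧸ N) × G) (a : A) : (greenData α N H).σ k a = α k.2 a := rfl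

lemma greenData_η (l : quotSubgroup N H × G) (a : A) : (greenData α N H).η l a = a := rfl

/-- The action `η` is trivial, so the cocycle is constant. Two points with the same image are
related by the element `(v'⁻¹v, u'⁻¹u)` of `L`, whose first entry lies in `H/N` because `vH = v'H`.
-/
lemma exists_indL_equiv :
    ∃ Γ : C₀((G ⧸ N) × (G ⧸ H), A) ≃⋆ₐ[ℂ] (greenData α N H).IndL,
      ∀ f (r : G ⧸ N) (u : G) (v : G ⧸ N),
        Γ f (r, u, v) = f ((u : G ⧸ N) * r⁻¹, quotProj N H v) := by
  obtain ⟨Γ, hΓ⟩ := exists_ind_equiv (ρ := (greenData α N H).right) (η := (greenData α N H).η)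
    α (isOpenQuotientMap_orbitL N H) (w := fun _ => 1) continuous_const
    continuous_const (fun l p => by
      simp only [greenData_right]
      refine Prod.ext ?_ (quotProj_mul_coe N H p.2.2 l.1⁻¹)
      simp) (fun p p' h => by
      obtain ⟨r, u, v⟩ := p
      obtain ⟨r', u', v'⟩ := p'
      have h1 : (u : G ⧸ N) * r⁻¹ = u' * r'⁻¹ := congrArg Prod.fst h
      have h2 := inv_mul_mem_of_quotProj_eq N H (congrArg Prod.snd h).symm
      refine ⟨(⟨_, h2⟩, u'⁻¹ * u), ?_⟩
      rw [greenData_right]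
      refine Prod.ext ?_ (Prod.ext (by simp) (by simp))
      change r * ((u' : G ⧸ N)⁻¹ * (u : G ⧸ N))⁻¹ = r'
      have h3 := congrArg Inv.inv h1
      simp only [mul_inv_rev, inv_inv] at h3
      rw [mul_inv_rev, inv_inv, ← mul_assoc, h3, inv_mul_cancel_right]) (fun l p a => rfl)
  refine ⟨Γ, fun f r u v => ?_⟩
  rw [hΓ, α.one_apply]

/-- The cocycle is the middle coordinate `u`, on which `(tN, s)` acts by left multiplication by `s`,
as `σ` does through `α`. -/
lemma exists_indK_equiv :
    ∃ Υ : C₀(G ⧸ N, A) ≃⋆ₐ[ℂ] (greenData α N H).IndK,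
      ∀ f (r : G ⧸ N) (u : G) (v : G ⧸ N), Υ f (r, u, v) = α u (f (r⁻¹ * v)) := by
  obtain ⟨Υ, hΥ⟩ := exists_ind_equiv (ρ := (greenData α N H).left) (η := (greenData α N H).σ)
    α (isOpenQuotientMap_orbitK N) (w := fun p => p.2.1) (by fun_prop) (by fun_prop) (fun k p => by
      simp only [greenData_left]
      simp only [mul_inv_rev, mul_assoc, inv_mul_cancel_left]) (fun p p' h => by
      obtain ⟨r, u, v⟩ := p
      obtain ⟨r', u', v'⟩ := p'
      have h1 : r⁻¹ * v = r'⁻¹ * v' := h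
      refine ⟨(r' * r⁻¹, u' * u⁻¹), ?_⟩
      rw [greenData_left]
      refine Prod.ext (by simp) (Prod.ext (by simp) ?_)
      change r' * r⁻¹ * v = v'
      rw [mul_assoc, h1, mul_inv_cancel_left]) (fun k p a => by
      rw [greenData_σ, greenData_left, α.mul_apply])
  exact ⟨Υ, fun f r u v => hΥ f (r, u, v)⟩

lemma equivariant_indL {Γ : C₀((G ⧸ N) × (G ⧸ H), A) ≃⋆ₐ[ℂ] (greenData α N H).IndL}
    (hΓ : ∀ f (r : G ⧸ N) (u : G) (v : G ⧸ N),
      Γ f (r, u, v) = f ((u : G ⧸ N) * r⁻¹, quotProj N H v)) :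
    Equivariant Γ (etaAction α N H) (greenData α N H).actL := fun k f => by
  refine Ind.ext' fun p => ?_
  obtain ⟨r, u, v⟩ := p
  rw [SymmetricData.actL_apply, greenData_left, hΓ, hΓ, greenData_σ, etaAction_apply, quotProj_mul]
  simp only [Prod.fst_inv, Prod.snd_inv, QuotientGroup.mk_mul, QuotientGroup.mk_inv, mul_inv_rev,
    inv_inv, mul_assoc]

lemma equivariant_indK {Υ : C₀(G ⧸ N, A) ≃⋆ₐ[ℂ] (greenData α N H).IndK}
    (hΥ : ∀ f (r : G ⧸ N) (u : G) (v : G ⧸ N), Υ f (r, u, v) = α u (f (r⁻¹ * v))) :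
    Equivariant Υ (gammaAction α N H) (greenData α N H).actK := fun l f => by
  refine Ind.ext' fun p => ?_
  obtain ⟨r, u, v⟩ := p
  rw [SymmetricData.actK_apply, greenData_rmul, hΥ, hΥ, greenData_η, gammaAction_apply, α.mul_apply]
  simp only [mul_inv_rev, mul_assoc]

end Setup

end CrossedProd

end

noncomputable section

namespace CrossedProd

/-! ### The dense embedding of `C_c(P, A)` in the Green bimodule. -/

section Kernel

variable {G T X A : Type*} [Group G] [TopologicalSpace G] [IsTopologicalGroup G]
  [LocallyCompactSpace G] [T2Space G] [Group T] [TopologicalSpace T] [IsTopologicalGroup T]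
  [LocallyCompactSpace T] [T2Space T] [TopologicalSpace X] [NonUnitalCStarAlgebra A]

/-- The integral of a family of elements of a crossed product by `C₀(X, A)` which are given by the
partial integrals of a kernel. -/
lemma CrossedProduct.of_eq_int_of_kernel {α : CStarAction G C₀(X, A)} {μ : HaarMeasure G}
    (ν : HaarMeasure T) (Φ : T × G × X × G → A) (hΦ : Continuous Φ) {C : Set (T × G × X × G)}
    (hC : IsCompact C) (hΦC : ∀ k, Φ k ≠ 0 → k ∈ C) {F : T → ConvAlg α μ}
    (hF : ∀ t s x, F t s x = μ.int fun w => Φ (t, s, x, w)) {g : ConvAlg α μ}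
    (hg : ∀ s x, g s x = (ν.prod μ).int fun k => Φ (k.1, s, x, k.2)) :
    of g = ν.int fun t => of (F t) := by
  have hmem : ∀ t s x, F t s x ≠ 0 →
      t ∈ Prod.fst '' C ∧ s ∈ (fun k => k.2.1) '' C ∧ x ∈ (fun k => k.2.2.1) '' C := by
    intro t s x hne
    rw [hF] at hne
    obtain ⟨w, hw⟩ := μ.exists_ne_zero hne
    exact ⟨⟨_, hΦC _ hw, rfl⟩, ⟨_, hΦC _ hw, rfl⟩, ⟨_, hΦC _ hw, rfl⟩⟩
  have hCT : IsCompact (Prod.fst '' C) := hC.image continuous_fst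
  have hCG : IsCompact ((fun k => k.2.1) '' C) := hC.image (by fun_prop)
  have hCX : IsCompact ((fun k => k.2.2.1) '' C) := hC.image (by fun_prop)
  have hcont : Continuous fun q : (T × G) × X => F q.1.1 q.1.2 q.2 := by
    simp only [hF]
    refine μ.continuous_int (f := fun (q : (T × G) × X) w => Φ (q.1.1, q.1.2, q.2, w)) (by fun_prop)
      fun q => ⟨univ, univ_mem, _, hC.image (by fun_prop : Continuous fun k => k.2.2.2),
        fun q _ w hw => ?_⟩
    by_contra hne
    exact hw ⟨_, hΦC _ hne, rfl⟩
  have hc0 : Continuous fun q : T × G => F q.1 q.2 :=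
    (map_continuous (c0Cc (fun (q : T × G) x => F q.1 q.2 x) hcont _ (hCT.prod hCG) _ hCX
      fun q x h => ⟨⟨(hmem _ _ _ h).1, (hmem _ _ _ h).2.1⟩, (hmem _ _ _ h).2.2⟩)).congr fun q => rfl
  have hne : ∀ t s, F t s ≠ 0 → ∃ x, F t s x ≠ 0 := fun t s h => by
    by_contra! h'
    exact h (ZeroAtInftyContinuousMap.ext h')
  refine int_of_family ν hc0 hCG hCT (fun t s h => ?_) fun s => ?_
  · obtain ⟨x, hx⟩ := hne t s h
    exact ⟨(hmem t s x hx).1, (hmem t s x hx).2.1⟩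
  · ext x
    rw [hg, ν.int_apply_c0 (f := fun t => F t s) hCT (hc0.comp (Continuous.prodMk_left s)) (fun t ht => by
      by_contra h
      obtain ⟨x, hx⟩ := hne t s h
      exact ht (hmem t s x hx).1), HaarMeasure.int_prod ν μ (by fun_prop)
      (HasCompactSupport.intro (hC.image (by fun_prop : Continuous fun k => (k.1, k.2.2.2)))
        fun k hk => by
          by_contra h
          exact hk ⟨_, hΦC _ h, rfl⟩)]
    exact ν.int_congr fun t => (hF t s x).symm

end Kernel

section Setup

@[fun_prop] lemma _root_.Continuous.quotientGroup_mk {G Y : Type*} [Group G] [TopologicalSpace G]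
    [TopologicalSpace Y] {N : Subgroup G} {f : Y → G} (hf : Continuous f) :
    Continuous fun y => (f y : G ⧸ N) := QuotientGroup.continuous_mk.comp hf

variable {G A : Type*} [Group G] [TopologicalSpace G] [IsTopologicalGroup G]
  [LocallyCompactSpace G] [T2Space G] [NonUnitalCStarAlgebra A]
  (α : CStarAction G A) (N H : Subgroup G) [N.Normal] [IsClosed (N : Set G)] (μG : HaarMeasure G)

/-- The element `(u, qN) ↦ Δ_G(u)^(-1/2) y(q⁻¹uN, u)` of the convolution algebra of
`α ⊗ lt`. -/
def convOfCc (y : C_c((G ⧸ N) × G, A)) : ConvAlg (ltAction α N) μG :=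
  c0Cc (fun u q => dmod (-1 / 2) u • y (q⁻¹ * (u : G ⧸ N), u)) (by fun_prop)
    _ ((isCompact_tsupport_cc y).image continuous_snd)
    _ ((isCompact_tsupport_cc y).image
      (by fun_prop : Continuous fun p : (G ⧸ N) × G => (p.2 : G ⧸ N) * p.1⁻¹))
    fun u q h => by
      have h1 := mem_tsupport_of_ne (ne_zero_of_smul_ne h)
      exact ⟨⟨_, h1, rfl⟩, _, h1, by simp⟩

lemma convOfCc_apply (y : C_c((G ⧸ N) × G, A)) (u : G) (q : G ⧸ N) :
    convOfCc α N μG y u q = dmod (-1 / 2) u • y (q⁻¹ * (u : G ⧸ N), u) := rfl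

/-- Elements of `C_c(G, C₀(G/N, A))` need not have compact support in `G/N`. A cutoff there costs
little in the `L¹`-norm, since they vanish at infinity uniformly over their compact support in `G`.
-/
lemma denseRange_of_convOfCc :
    DenseRange fun y : C_c((G ⧸ N) × G, A) => CrossedProduct.of (convOfCc α N μG y) := by
  refine Metric.denseRange_iff.2 fun b r hr => ?_
  obtain ⟨F, hF⟩ := CrossedProduct.denseRange_of.exists_dist_lt b (half_pos hr)
  obtain ⟨c, hc0, hc⟩ := ConvAlg.exists_l1Norm_le_mul (ltAction α N) μG F.isCompact_tsupport
  have hδ : 0 < r / 2 / (c + 1) := by positivity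
  obtain ⟨C, hC, hCF⟩ := exists_isCompact_c0_norm_le F.continuous F.isCompact_tsupport hδ
  obtain ⟨χ, hχ1, -, hχc, hχ⟩ := exists_continuous_one_zero_of_isCompact (X := G ⧸ N) hC
    isClosed_empty (disjoint_empty _)
  -- Inverts the substitution `r = q⁻¹u` and the factor `Δ(u)^(-1/2)` of `convOfCc`, so that the
  -- image of `y` is exactly `χ F`.
  let y : C_c((G ⧸ N) × G, A) :=
    { toFun := fun p => dmod (1 / 2) p.2 •
        (χ ((p.2 : G ⧸ N) * p.1⁻¹) • F p.2 ((p.2 : G ⧸ N) * p.1⁻¹))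
      continuous_toFun := by fun_prop
      hasCompactSupport' := by
        refine HasCompactSupport.intro ((hχc.isCompact.prod F.isCompact_tsupport).image
          (by fun_prop : Continuous fun k : (G ⧸ N) × G => (k.1⁻¹ * (k.2 : G ⧸ N), k.2)))
          fun p hp => ?_
        by_contra hne
        have h1 := ne_zero_of_smul_ne hne
        refine hp ⟨((p.2 : G ⧸ N) * p.1⁻¹, p.2), ⟨?_, ?_⟩, by simp⟩
        · exact mem_tsupport_of_ne fun h0 => h1 (by rw [h0, zero_smul])
        · exact mem_tsupport_of_ne fun h0 => h1 (by rw [h0]; exact smul_zero _) }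
  have hy : ∀ u q, convOfCc α N μG y u q = χ q • F u q := fun u q => by
    rw [convOfCc_apply]
    change _ • dmod (1 / 2) u • (χ ((u : G ⧸ N) * (q⁻¹ * (u : G ⧸ N))⁻¹) •
      F u ((u : G ⧸ N) * (q⁻¹ * (u : G ⧸ N))⁻¹)) = _
    rw [mul_inv_rev, inv_inv, mul_inv_cancel_left, smul_smul, dmod_add]
    norm_num
  refine ⟨y, (dist_triangle _ (CrossedProduct.of F) _).trans_lt ?_⟩
  have h1 : dist (CrossedProduct.of F) (CrossedProduct.of (convOfCc α N μG y)) ≤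
      c * (r / 2 / (c + 1)) := by
    rw [dist_eq_norm, ← CrossedProduct.of_sub, CrossedProduct.norm_of]
    refine (ConvAlg.norm_le_l1Norm _).trans (hc _ _ (fun u hu => ?_) (fun u => ?_) hδ.le)
    · by_contra h
      refine hu (ZeroAtInftyContinuousMap.ext fun q => ?_)
      rw [ConvAlg.sub_apply, ZeroAtInftyContinuousMap.sub_apply, hy, F.eq_zero h]
      simp
    · refine c0_norm_le hδ.le fun q => ?_
      rw [ConvAlg.sub_apply, ZeroAtInftyContinuousMap.sub_apply, hy]
      have h2 : F u q - χ q • F u q = (1 - χ q) • F u q := by rw [sub_smul, one_smul]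
      rw [h2, norm_smul]
      by_cases hu : u ∈ tsupport F
      · by_cases hq : q ∈ C
        · rw [hχ1 hq]
          simpa using hδ.le
        · refine (mul_le_of_le_one_left (norm_nonneg _) ?_).trans (hCF u hu q hq)
          rw [Real.norm_eq_abs, abs_le]
          constructor <;> linarith [(hχ q).1, (hχ q).2]
      · rw [F.eq_zero hu]
        simpa using hδ.le
  have h2 : c * (r / 2 / (c + 1)) < r / 2 := by
    rw [mul_div_assoc', div_lt_iff₀ (by positivity)]
    nlinarith
  linarith

variable {N}

/-- The function `(r, u) ↦ z(r, u, v)`. -/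
def sliceCc (z : C_c((G ⧸ N) × G × (G ⧸ N), A)) (v : G ⧸ N) : C_c((G ⧸ N) × G, A) where
  toFun p := z (p.1, p.2, v)
  continuous_toFun := by fun_prop
  hasCompactSupport' := by
    refine HasCompactSupport.intro ((isCompact_tsupport_cc z).image
      (by fun_prop : Continuous fun p => (p.1, p.2.1))) fun p hp => ?_
    by_contra h
    exact hp ⟨_, mem_tsupport_of_ne h, rfl⟩

/-- The embedding of `C_c(P, A)` in the Green bimodule. -/
def greenEmb : C_c((G ⧸ N) × G × (G ⧸ N), A) →ₗ[ℂ]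
    C_c(G ⧸ N, CrossedProduct (ltAction α N) μG) where
  toFun z :=
    { toFun := fun v => CrossedProduct.of (convOfCc α N μG (sliceCc z v))
      continuous_toFun := by
        have hz : ∀ (v : G ⧸ N) (u : G) (q : G ⧸ N), dmod (-1 / 2) u • z (q⁻¹ * (u : G ⧸ N), u, v) ≠ 0 →
            (q⁻¹ * (u : G ⧸ N), u, v) ∈ tsupport z := fun v u q h =>
          mem_tsupport_of_ne (ne_zero_of_smul_ne h)
        refine continuous_of_family ((map_continuous (c0Cc (fun (p : (G ⧸ N) × G) (q : G ⧸ N) =>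
          dmod (-1 / 2) p.2 • z (q⁻¹ * (p.2 : G ⧸ N), p.2, p.1)) (by fun_prop) _
            ((isCompact_tsupport_cc z).image (by fun_prop : Continuous fun p => (p.2.2, p.2.1))) _
            ((isCompact_tsupport_cc z).image
              (by fun_prop : Continuous fun p => (p.2.1 : G ⧸ N) * p.1⁻¹))
            fun p q h => ⟨⟨_, hz _ _ _ h, rfl⟩, _, hz _ _ _ h, by simp⟩)).congr fun p => rfl)
          ((isCompact_tsupport_cc z).image (by fun_prop : Continuous fun p => p.2.1))
          fun v u h => ?_
        by_contra hu
        refine h (ZeroAtInftyContinuousMap.ext fun q => ?_)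
        by_contra hne
        exact hu ⟨_, hz v u q hne, rfl⟩
      hasCompactSupport' := by
        refine hasCompactSupport_of_family ((isCompact_tsupport_cc z).image
          (by fun_prop : Continuous fun p => p.2.2)) fun v u h => ?_
        by_contra hv
        refine h (ZeroAtInftyContinuousMap.ext fun q => ?_)
        by_contra hne
        exact hv ⟨_, mem_tsupport_of_ne (ne_zero_of_smul_ne hne), rfl⟩ }
  map_add' z z' := by
    ext v
    refine Eq.trans ?_ (CrossedProduct.of_add _ _)
    refine congrArg CrossedProduct.of ?_
    ext u q
    exact smul_add _ _ _
  map_smul' c z := by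
    ext v
    refine Eq.trans ?_ (CrossedProduct.of_smul _ _)
    refine congrArg CrossedProduct.of ?_
    ext u q
    exact smul_comm _ _ _

lemma greenEmb_apply (z : C_c((G ⧸ N) × G × (G ⧸ N), A)) (v : G ⧸ N) :
    greenEmb α μG z v = CrossedProduct.of (convOfCc α N μG (sliceCc z v)) := rfl

/-- The function `(r, u, v) ↦ φ(v) y(r, u)`. -/
def tensorCc (φ : C(G ⧸ N, ℝ)) (hφ : HasCompactSupport φ) (y : C_c((G ⧸ N) × G, A)) :
    C_c((G ⧸ N) × G × (G ⧸ N), A) where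
  toFun p := φ p.2.2 • y (p.1, p.2.1)
  continuous_toFun := by fun_prop
  hasCompactSupport' := by
    refine HasCompactSupport.intro (((isCompact_tsupport_cc y).prod hφ.isCompact).image
      (by fun_prop : Continuous fun p : ((G ⧸ N) × G) × (G ⧸ N) => (p.1.1, p.1.2, p.2)))
      fun p hp => ?_
    by_contra hne
    exact hp ⟨((p.1, p.2.1), p.2.2), ⟨mem_tsupport_of_ne (ne_zero_of_smul_ne hne),
      mem_tsupport_of_ne fun h0 => hne (by rw [h0, zero_smul])⟩, rfl⟩

lemma greenEmb_tensorCc (φ : C(G ⧸ N, ℝ)) (hφ : HasCompactSupport φ) (y : C_c((G ⧸ N) × G, A))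
    (v : G ⧸ N) : greenEmb α μG (tensorCc φ hφ y) v =
      φ v • CrossedProduct.of (convOfCc α N μG y) := by
  rw [CrossedProduct.real_smul_of, greenEmb_apply]
  congr 1
  ext u q
  exact smul_comm (dmod (-1 / 2) u) (φ v) (y (q⁻¹ * (u : G ⧸ N), u))

variable (N)

/-- Elementary tensors approximate `x` uniformly below one fixed compactly supported function `χ`,
and `Green.exists_rnorm_le` turns this into approximation for the seminorm of the right inner
product. -/
lemma exists_innerSeminorm_sub_greenEmb_lt [IsClosed (H : Set G)] [Fact (N ≤ H)]
    (μGN : HaarMeasure (G ⧸ N)) (μHN : HaarMeasure (quotSubgroup N H))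
    (x : C_c(G ⧸ N, CrossedProduct (ltAction α N) μG)) (e : ℝ) (he : 0 < e) :
    ∃ z, (Green.bimodule (betaAction α N μG) (quotSubgroup N H) μGN μHN).innerSeminorm
      (x - greenEmb α μG z) < e := by
  rw [Green.innerSeminorm_bimodule]
  obtain ⟨χ, hχ, hχc, hχ0, -, h⟩ := exists_sum_smul_approx (denseRange_of_convOfCc α N μG)
    (map_continuous x) x.hasCompactSupport
  obtain ⟨C, hC⟩ := Green.exists_rnorm_le (betaAction α N μG) μGN μHN hχ hχc hχ0
  have hδ : 0 < e / (|C| + 1) := by positivity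
  obtain ⟨n, φ, b, hφ, hb⟩ := h _ hδ
  refine ⟨∑ i, tensorCc (φ i) (hφ i) (b i), (hC _ _ hδ.le fun v => ?_).trans_lt ?_⟩
  · rw [map_sum]
    change ‖x v - (∑ i, greenEmb α μG (tensorCc (φ i) (hφ i) (b i))) v‖ ≤ _
    rw [CompactlySupportedContinuousMap.sum_apply]
    simp only [greenEmb_tensorCc]
    exact hb v
  · refine (mul_le_mul_of_nonneg_right (le_abs_self C) hδ.le).trans_lt ?_
    rw [mul_div_assoc', div_lt_iff₀ (by positivity)]
    nlinarith [abs_nonneg C]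

end Setup

end CrossedProd

end

noncomputable section

namespace CrossedProd

lemma dmod_prod {G H : Type*} [Group G] [TopologicalSpace G] [IsTopologicalGroup G]
    [LocallyCompactSpace G] [T2Space G] [Group H] [TopologicalSpace H] [IsTopologicalGroup H]
    [LocallyCompactSpace H] [T2Space H] (μ : HaarMeasure G) (ν : HaarMeasure H) (c : ℝ)
    (k : G × H) : dmod c k = dmod c k.1 * dmod c k.2 := by
  rw [dmod, modular_prod μ ν k.1 k.2, Real.mul_rpow (modular_pos _).le (modular_pos _).le]
  rfl

attribute [fun_prop] SymmetricData.continuous_eval_ind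

/-! ### The embedding intertwines the four operations. -/

section Setup

variable {G A : Type*} [Group G] [TopologicalSpace G] [IsTopologicalGroup G]
  [LocallyCompactSpace G] [T2Space G] [NonUnitalCStarAlgebra A]
  {α : CStarAction G A} {N H : Subgroup G} [N.Normal] {μG : HaarMeasure G}

lemma cosetAction_eq_mul (s : G) (q : G ⧸ N) : cosetAction N s q = (s : G ⧸ N) * q := by
  induction q using QuotientGroup.induction_on with
  | H q => rfl

lemma ltConv_mul_apply (a b : ConvAlg (ltAction α N) μG) (u : G) (q : G ⧸ N) :
    (a * b) u q = μG.int fun w => a w q * α w (b (w⁻¹ * u) ((w : G ⧸ N)⁻¹ * q)) := by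
  rw [ConvAlg.mul_apply_apply]
  refine μG.int_congr fun w => ?_
  rw [cosetAction_eq_mul, QuotientGroup.mk_inv]

lemma ltConv_star_apply (a : ConvAlg (ltAction α N) μG) (u : G) (q : G ⧸ N) :
    (star a) u q = dmod (-1) u • α u (star (a u⁻¹ ((u : G ⧸ N)⁻¹ * q))) := by
  rw [ConvAlg.star_apply_apply, cosetAction_eq_mul, QuotientGroup.mk_inv]

lemma ltConv_smul_apply (c : ℝ) (a : ConvAlg (ltAction α N) μG) (u : G) (q : G ⧸ N) :
    ((c : ℂ) • a) u q = c • a u q := rfl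

/-- The action `id ⊗ rt` on the convolution algebra of `α ⊗ lt`. -/
def rtConv (t : G ⧸ N) (f : ConvAlg (ltAction α N) μG) : ConvAlg (ltAction α N) μG :=
  ConvAlg.map (rtAction N A t) f

lemma rtConv_apply (t : G ⧸ N) (f : ConvAlg (ltAction α N) μG) (u : G) (q : G ⧸ N) :
    rtConv t f u q = f u (q * t) := rtAction_apply N t (f u) q

variable [IsClosed (N : Set G)]

lemma betaAction_of_eq (t : G ⧸ N) (f : ConvAlg (ltAction α N) μG) :
    betaAction α N μG t (CrossedProduct.of f) = CrossedProduct.of (rtConv t f) :=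
  CrossedProduct.mapEquiv_of _ (rtAction_equivariant α N t) f

variable [IsClosed (H : Set G)] [Fact (N ≤ H)] {μGN : HaarMeasure (G ⧸ N)}
  {μHN : HaarMeasure (quotSubgroup N H)}

/-- Equivariance determines an element of `Ind_K^P σ` by its values at the points `(r, 1, 1)`, one
in each `K`-orbit. -/
lemma indK_apply (f : (greenData α N H).IndK) (r : G ⧸ N) (u : G) (v : G ⧸ N) :
    f (r, u, v) = α u (f (v⁻¹ * r, 1, 1)) := by
  have h := Ind.equivariant f (v, u) (v⁻¹ * r, 1, 1)
  rw [greenData_left, greenData_σ] at h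
  simpa using h

/-- The corresponding normal form for `L`, using only its factor `G`: the middle coordinate can be
moved to 1. -/
lemma indL_apply (f : (greenData α N H).IndL) (r : G ⧸ N) (u : G) (v : G ⧸ N) :
    f (r, u, v) = f (r * (u : G ⧸ N)⁻¹, 1, v) := by
  have h := Ind.equivariant f (1, u) (r, u, v)
  rw [greenData_right, greenData_η] at h
  simpa using h.symm

/-- The hypothesis on `b` says that it is the element corresponding to `c` under `i` and `Υ`, since
the inverse of `Υ` takes `f` to `r ↦ f(r⁻¹, 1, 1)`. Both sides are partial integrals of one kernel
on `H/N × G`, to which `CrossedProduct.of_eq_int_of_kernel` applies; the three lemmas after this one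
follow the same scheme. -/
lemma greenEmb_ract (z : C_c((G ⧸ N) × G × (G ⧸ N), A))
    (c : ConvAlg (greenData α N H).actK (μHN.prod μG))
    (b : ConvAlg ((betaAction α N μG).restrict (quotSubgroup N H)) μHN)
    (hb : ∀ h, ∃ g : ConvAlg (ltAction α N) μG, b h = CrossedProduct.of g ∧
      ∀ s (r : G ⧸ N), g s r = c (h, s) (r⁻¹, 1, 1)) :
    greenEmb α μG ((greenData α N H).ract (μHN.prod μG) z c) =
      Green.ract (greenEmb α μG z) b := by
  choose g hbg hg using hb
  ext v
  rw [greenEmb_apply, Green.ract_apply]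
  have hF : ∀ h : quotSubgroup N H, dmod (-1 / 2) h • (greenEmb α μG z (v * (h : G ⧸ N)) *
      betaAction α N μG (v * (h : G ⧸ N)) (b h⁻¹)) =
      CrossedProduct.of (((dmod (-1 / 2) h : ℝ) : ℂ) •
        (convOfCc α N μG (sliceCc z (v * (h : G ⧸ N))) *
          rtConv (v * (h : G ⧸ N)) (g h⁻¹) : ConvAlg (ltAction α N) μG)) := fun h => by
    rw [greenEmb_apply, hbg, betaAction_of_eq, ← CrossedProduct.of_mul,
      CrossedProduct.real_smul_of]
  rw [μHN.int_congr hF]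
  refine CrossedProduct.of_eq_int_of_kernel μHN
    (fun k : quotSubgroup N H × G × (G ⧸ N) × G => (dmod (-1 / 2) k.1 * dmod (-1 / 2) k.2.2.2) •
      (z (k.2.2.1⁻¹ * (k.2.2.2 : G ⧸ N), k.2.2.2, v * (k.1 : G ⧸ N)) *
        c (k.1⁻¹, k.2.2.2⁻¹ * k.2.1)
          (k.2.2.1⁻¹ * (k.2.2.2 : G ⧸ N), k.2.2.2, v * (k.1 : G ⧸ N)))) (by fun_prop)
    ((c.isCompact_tsupport.prod (isCompact_tsupport_cc z)).image
      (by fun_prop : Continuous fun y : (quotSubgroup N H × G) × (G ⧸ N) × G × (G ⧸ N) =>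
        (y.1.1⁻¹, y.2.2.1 * y.1.2, (y.2.2.1 : G ⧸ N) * y.2.1⁻¹, y.2.2.1)))
    (fun k hk => ?_) (fun h u q => ?_) fun u q => ?_
  · have h1 := ne_zero_of_smul_ne hk
    refine ⟨((k.1⁻¹, k.2.2.2⁻¹ * k.2.1), (k.2.2.1⁻¹ * (k.2.2.2 : G ⧸ N), k.2.2.2,
      v * (k.1 : G ⧸ N))), ⟨mem_tsupport_of_ne fun h0 => h1 ?_,
        mem_tsupport_of_ne (left_ne_zero_of_mul h1)⟩, by simp⟩
    rw [h0]
    exact mul_zero _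
  · rw [ltConv_smul_apply, ltConv_mul_apply, ← μG.int_smul]
    refine μG.int_congr fun w => ?_
    rw [rtConv_apply, convOfCc_apply, hg, smul_mul_assoc, smul_smul]
    dsimp only
    rw [indK_apply _ _ w]
    simp only [mul_inv_rev, inv_inv, mul_assoc]
    rfl
  · rw [convOfCc_apply]
    change dmod (-1 / 2) u • (μHN.prod μG).int (fun l => dmod (-1 / 2) l •
      (z ((greenData α N H).rmul (q⁻¹ * (u : G ⧸ N), u, v) l) *
        c l⁻¹ ((greenData α N H).rmul (q⁻¹ * (u : G ⧸ N), u, v) l))) = _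
    -- The convolution in `B` integrates over the middle coordinate `w = uy` of the point `p · (h,
    -- y)`, whereas the right action of `W(P)` integrates over `y`.
    rw [← HaarMeasure.int_smul, (μHN.prod μG).int_translate (1, u)
      (fun k => (dmod (-1 / 2) k.1 * dmod (-1 / 2) k.2) • _)]
    refine HaarMeasure.int_congr _ fun l => ?_
    rw [greenData_rmul, dmod_prod μHN μG, smul_smul]
    simp only [Prod.fst_mul, Prod.snd_mul, one_mul, dmod_mul, QuotientGroup.mk_mul, mul_assoc,
      mul_inv_rev, inv_mul_cancel, mul_one, mul_left_comm (dmod (-1 / 2) u)]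
    rfl

/-- Here `c` and `a` correspond under `Γ` and `ι`. The modular powers agree because `Δ(u)^(-1/2)
Δ(w)^(1/2) = Δ(w⁻¹u)^(-1/2)`, which is why the embedding carries the factor `Δ(u)^(-1/2)`. -/
lemma greenEmb_lact (c : ConvAlg (greenData α N H).actL (μGN.prod μG))
    (z : C_c((G ⧸ N) × G × (G ⧸ N), A))
    (a : ConvAlg (Green.leftAction (betaAction α N μG) (quotSubgroup N H)) μGN)
    (ha : ∀ t v : G ⧸ N, ∃ g : ConvAlg (ltAction α N) μG,
      a t (v : (G ⧸ N) ⧸ quotSubgroup N H) = CrossedProduct.of g ∧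
        ∀ s (r : G ⧸ N), g s r = c (t, s) (r⁻¹, 1, v)) :
    greenEmb α μG ((greenData α N H).lact (μGN.prod μG) c z) =
      Green.lact a (greenEmb α μG z) := by
  ext v
  choose g hag hg using fun t => ha t v
  rw [greenEmb_apply, Green.lact_apply]
  have hF : ∀ t : G ⧸ N, dmod (1 / 2) t • (a t (v : (G ⧸ N) ⧸ quotSubgroup N H) *
      betaAction α N μG t (greenEmb α μG z (t⁻¹ * v))) =
      CrossedProduct.of (((dmod (1 / 2) t : ℝ) : ℂ) •
        (g t * rtConv t (convOfCc α N μG (sliceCc z (t⁻¹ * v))) :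
          ConvAlg (ltAction α N) μG)) := fun t => by
    rw [greenEmb_apply, hag, betaAction_of_eq, ← CrossedProduct.of_mul,
      CrossedProduct.real_smul_of]
  rw [μGN.int_congr hF]
  refine CrossedProduct.of_eq_int_of_kernel μGN
    (fun k : (G ⧸ N) × G × (G ⧸ N) × G =>
      (dmod (1 / 2) k.1 * dmod (-1 / 2) (k.2.2.2⁻¹ * k.2.1)) •
      (c (k.1, k.2.2.2) (k.2.2.1⁻¹, 1, v) * α k.2.2.2
        (z (k.1⁻¹ * (k.2.2.1⁻¹ * (k.2.1 : G ⧸ N)), k.2.2.2⁻¹ * k.2.1, k.1⁻¹ * v)))) (by fun_prop)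
    ((c.isCompact_tsupport.prod (isCompact_tsupport_cc z)).image
      (by fun_prop : Continuous fun y : ((G ⧸ N) × G) × (G ⧸ N) × G × (G ⧸ N) =>
        (y.1.1, y.1.2 * y.2.2.1, ((y.1.2 * y.2.2.1 : G) : G ⧸ N) * (y.2.1⁻¹ * y.1.1⁻¹), y.1.2)))
    (fun k hk => ?_) (fun t u q => ?_) fun u q => ?_
  · have h1 := ne_zero_of_smul_ne hk
    refine ⟨((k.1, k.2.2.2), (k.1⁻¹ * (k.2.2.1⁻¹ * (k.2.1 : G ⧸ N)), k.2.2.2⁻¹ * k.2.1, k.1⁻¹ * v)),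
      ⟨mem_tsupport_of_ne fun h0 => h1 ?_,
        mem_tsupport_of_ne (ne_zero_of_act_ne (right_ne_zero_of_mul h1))⟩, by simp [mul_assoc]⟩
    rw [h0]
    exact zero_mul _
  · rw [ltConv_smul_apply, ltConv_mul_apply, ← μG.int_smul]
    refine μG.int_congr fun w => ?_
    rw [rtConv_apply, convOfCc_apply, hg, ConvAlg.act_smul, mul_smul_comm, smul_smul]
    simp only [mul_inv_rev, inv_inv, mul_assoc, QuotientGroup.mk_mul, QuotientGroup.mk_inv,
      mul_inv_cancel_left]
    rfl
  · rw [convOfCc_apply]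
    change dmod (-1 / 2) u • (μGN.prod μG).int (fun k => dmod (1 / 2) k •
      (c k (q⁻¹ * (u : G ⧸ N), u, v) * α k.2
        (z (k.1⁻¹ * (q⁻¹ * (u : G ⧸ N)), k.2⁻¹ * u, k.1⁻¹ * v)))) = _
    rw [← HaarMeasure.int_smul]
    refine HaarMeasure.int_congr _ fun k => ?_
    rw [indL_apply, mul_inv_cancel_right, dmod_prod μGN μG, smul_smul, dmod_mul, dmod_inv,
      mul_left_comm, mul_comm (dmod (-1 / 2) u)]
    norm_num

lemma linner_greenEmb (x y : C_c((G ⧸ N) × G × (G ⧸ N), A))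
    (a : ConvAlg (Green.leftAction (betaAction α N μG) (quotSubgroup N H)) μGN)
    (ha : ∀ t v : G ⧸ N, ∃ g : ConvAlg (ltAction α N) μG,
      a t (v : (G ⧸ N) ⧸ quotSubgroup N H) = CrossedProduct.of g ∧
        ∀ s (r : G ⧸ N), g s r =
          (greenData α N H).linner (μGN.prod μG) (μHN.prod μG) x y (t, s) (r⁻¹, 1, v)) :
    Green.linner μHN (greenEmb α μG x) (greenEmb α μG y) = a := by
  refine Green.conv_ext fun t v => ?_
  obtain ⟨g, hag, hg⟩ := ha t v
  rw [hag, Green.linner_apply, ← μHN.int_smul]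
  have hF : ∀ h : quotSubgroup N H, dmod (-1 / 2) t • (greenEmb α μG x (v * (h : G ⧸ N)) *
      betaAction α N μG t (star (greenEmb α μG y (t⁻¹ * (v * (h : G ⧸ N)))))) =
      CrossedProduct.of (((dmod (-1 / 2) t : ℝ) : ℂ) •
        (convOfCc α N μG (sliceCc x (v * (h : G ⧸ N))) *
          rtConv t (star (convOfCc α N μG (sliceCc y (t⁻¹ * (v * (h : G ⧸ N)))))) :
            ConvAlg (ltAction α N) μG)) := fun h => by
    rw [greenEmb_apply, greenEmb_apply, ← CrossedProduct.of_star, betaAction_of_eq,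
      ← CrossedProduct.of_mul, CrossedProduct.real_smul_of]
  rw [μHN.int_congr hF]
  refine (CrossedProduct.of_eq_int_of_kernel μHN
    (fun k : quotSubgroup N H × G × (G ⧸ N) × G => (dmod (-1 / 2) t * dmod (-1 / 2) k.2.1) •
      (x (k.2.2.1⁻¹ * (k.2.2.2 : G ⧸ N), k.2.2.2, v * (k.1 : G ⧸ N)) * α k.2.1
        (star (y (t⁻¹ * (k.2.2.1⁻¹ * (k.2.2.2 : G ⧸ N)), k.2.1⁻¹ * k.2.2.2,
          t⁻¹ * (v * (k.1 : G ⧸ N))))))) (by fun_prop)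
    (((Green.isCompact_cosetTransporter (quotSubgroup N H) (isCompact_singleton (x := v))
      ((isCompact_tsupport_cc x).image (by fun_prop : Continuous fun p => p.2.2))).prod
        ((isCompact_tsupport_cc x).prod (isCompact_tsupport_cc y))).image
      (by fun_prop : Continuous fun p : quotSubgroup N H × ((G ⧸ N) × G × (G ⧸ N)) ×
        ((G ⧸ N) × G × (G ⧸ N)) =>
        (p.1, p.2.1.2.1 * p.2.2.2.1⁻¹, (p.2.1.2.1 : G ⧸ N) * p.2.1.1⁻¹, p.2.1.2.1)))
    (fun k hk => ?_) (fun h s q => ?_) fun s q => ?_).symm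
  · have h1 := ne_zero_of_smul_ne hk
    have h2 := mem_tsupport_of_ne (left_ne_zero_of_mul h1)
    have h3 := ne_zero_of_act_ne (right_ne_zero_of_mul h1)
    exact ⟨(k.1, _, _), ⟨⟨v, rfl, _, h2, rfl⟩, h2,
      mem_tsupport_of_ne fun h0 => h3 (by rw [h0, star_zero])⟩, by simp⟩
  · rw [ltConv_smul_apply, ltConv_mul_apply, ← μG.int_smul]
    refine μG.int_congr fun w => ?_
    rw [rtConv_apply, convOfCc_apply, ltConv_star_apply, convOfCc_apply, star_smul, star_trivial,
      ConvAlg.act_smul, ConvAlg.act_smul, ConvAlg.act_smul, ← α.mul_apply, mul_inv_cancel_left,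
      smul_mul_assoc, mul_smul_comm, mul_smul_comm, smul_smul, smul_smul, smul_smul]
    congr 1
    -- The involution and the two embeddings contribute `Δ(w)^(-1/2) Δ(w⁻¹s)^(-1) Δ(s⁻¹w)^(-1/2) =
    -- Δ(s)^(-1/2)`, the `G`-part of the normalisation of the inner product of `W(P)`.
    · rw [mul_assoc, mul_assoc, dmod_inv, dmod_add, dmod_mul, ← mul_assoc (dmod (-1 / 2) w),
        dmod_inv, dmod_add]
      norm_num
    · simp only [mul_inv_rev, inv_inv, mul_assoc, QuotientGroup.mk_mul, QuotientGroup.mk_inv,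
        mul_inv_cancel_left]
      rfl
  · rw [hg]
    change dmod (-1 / 2) ((t, s) : (G ⧸ N) × G) • (μHN.prod μG).int (fun l =>
      x ((greenData α N H).rmul (q⁻¹, 1, v) l) * α s (star (y ((greenData α N H).left (t, s)⁻¹
        ((greenData α N H).rmul (q⁻¹, 1, v) l))))) = _
    rw [dmod_prod μGN μG, ← HaarMeasure.int_smul]
    refine HaarMeasure.int_congr _ fun l => ?_
    rw [greenData_rmul, greenData_left, one_mul]
    rfl

lemma rinner_greenEmb (x y : C_c((G ⧸ N) × G × (G ⧸ N), A))
    (b : ConvAlg ((betaAction α N μG).restrict (quotSubgroup N H)) μHN)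
    (hb : ∀ h, ∃ g : ConvAlg (ltAction α N) μG, b h = CrossedProduct.of g ∧
      ∀ s (r : G ⧸ N), g s r =
        (greenData α N H).rinner (μGN.prod μG) (μHN.prod μG) x y (h, s) (r⁻¹, 1, 1)) :
    Green.rinner μGN (greenEmb α μG x) (greenEmb α μG y) = b := by
  ext h
  obtain ⟨g, hbg, hg⟩ := hb h
  rw [hbg, Green.rinner_apply, ← μGN.int_smul]
  have hF : ∀ t : G ⧸ N, dmod (-1 / 2) h • betaAction α N μG t (star (greenEmb α μG x t⁻¹) *
      greenEmb α μG y (t⁻¹ * (h : G ⧸ N))) =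
      CrossedProduct.of (((dmod (-1 / 2) h : ℝ) : ℂ) •
        rtConv t (star (convOfCc α N μG (sliceCc x t⁻¹)) *
          convOfCc α N μG (sliceCc y (t⁻¹ * (h : G ⧸ N))) :
            ConvAlg (ltAction α N) μG)) := fun t => by
    rw [greenEmb_apply, greenEmb_apply, ← CrossedProduct.of_star, ← CrossedProduct.of_mul,
      betaAction_of_eq, CrossedProduct.real_smul_of]
  rw [μGN.int_congr hF]
  refine (CrossedProduct.of_eq_int_of_kernel μGN
    (fun k : (G ⧸ N) × G × (G ⧸ N) × G => (dmod (-1 / 2) h * dmod (-1 / 2) k.2.1) •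
      α k.2.2.2 (star (x (k.1⁻¹ * k.2.2.1⁻¹, k.2.2.2⁻¹, k.1⁻¹)) *
        y (k.1⁻¹ * (k.2.2.1⁻¹ * (k.2.1 : G ⧸ N)), k.2.2.2⁻¹ * k.2.1, k.1⁻¹ * (h : G ⧸ N))))
    (by fun_prop)
    (((isCompact_tsupport_cc x).prod (isCompact_tsupport_cc y)).image
      (by fun_prop : Continuous fun p : ((G ⧸ N) × G × (G ⧸ N)) × ((G ⧸ N) × G × (G ⧸ N)) =>
        (p.1.2.2⁻¹, p.1.2.1⁻¹ * p.2.2.1, p.1.1⁻¹ * p.1.2.2, p.1.2.1⁻¹)))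
    (fun k hk => ?_) (fun t s q => ?_) fun s q => ?_).symm
  · have h1 := ne_zero_of_act_ne (ne_zero_of_smul_ne hk)
    have h2 := left_ne_zero_of_mul h1
    exact ⟨(_, _), ⟨mem_tsupport_of_ne fun h0 => h2 (by rw [h0, star_zero]),
      mem_tsupport_of_ne (right_ne_zero_of_mul h1)⟩, by simp⟩
  · rw [ltConv_smul_apply, rtConv_apply, ltConv_mul_apply, ← μG.int_smul]
    refine μG.int_congr fun w => ?_
    rw [convOfCc_apply, ltConv_star_apply, convOfCc_apply, star_smul, star_trivial,
      ConvAlg.act_smul, ConvAlg.act_smul, smul_mul_assoc, smul_mul_assoc, mul_smul_comm,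
      ← α.act_mul, smul_smul, smul_smul, smul_smul]
    congr 1
    -- Here the exponents of `Δ(w)` are `-1`, `1/2` and `1/2`, and only `Δ(s)^(-1/2)` remains.
    · rw [mul_assoc, mul_assoc, dmod_inv, dmod_mul, ← mul_assoc (dmod (-(-1 / 2)) w), dmod_inv,
        dmod_add, ← mul_assoc (dmod (-1) w), dmod_add]
      norm_num
    · simp only [mul_inv_rev, inv_inv, mul_assoc, QuotientGroup.mk_mul, QuotientGroup.mk_inv,
        mul_inv_cancel_left, mul_inv_cancel, mul_one]
      rfl
  · rw [hg]
    change dmod (-1 / 2) ((h, s) : quotSubgroup N H × G) • (μGN.prod μG).int (fun k =>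
      α k.2 (star (x ((greenData α N H).left k⁻¹ (q⁻¹, 1, 1))) *
        y ((greenData α N H).rmul ((greenData α N H).left k⁻¹ (q⁻¹, 1, 1)) (h, s)))) = _
    rw [dmod_prod μHN μG, ← HaarMeasure.int_smul]
    refine HaarMeasure.int_congr _ fun k => ?_
    rw [greenData_rmul, greenData_left]
    simp only [mul_one, mul_assoc]
    rfl

end Setup

end CrossedProd

end

noncomputable section

namespace CrossedProd

/-! ### Commutativity of the diagram. -/

section Setup

variable {G A : Type*} [Group G] [TopologicalSpace G] [IsTopologicalGroup G]
  [LocallyCompactSpace G] [T2Space G] [NonUnitalCStarAlgebra A]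
  {α : CStarAction G A} {N H : Subgroup G} [N.Normal]
  [IsClosed (N : Set G)] [IsClosed (H : Set G)] [Fact (N ≤ H)]
  {μG : HaarMeasure G} {μGN : HaarMeasure (G ⧸ N)} {μHN : HaarMeasure (quotSubgroup N H)}

/-- The coefficient maps of the dense embedding run from the `W(P)` side to the Green side: `c` is
untwisted by the inverse of `Γ` or `Υ` and then lifted to the element of `C_c` that `ι` or `i` sends
to it. -/
theorem nonempty_bimoduleIso_green
    {Γ : C₀((G ⧸ N) × (G ⧸ H), A) ≃⋆ₐ[ℂ] (greenData α N H).IndL}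
    {Υ : C₀(G ⧸ N, A) ≃⋆ₐ[ℂ] (greenData α N H).IndK}
    (hΓ : ∀ f (r : G ⧸ N) (u : G) (v : G ⧸ N),
      Γ f (r, u, v) = f ((u : G ⧸ N) * r⁻¹, quotProj N H v))
    (hΥ : ∀ f (r : G ⧸ N) (u : G) (v : G ⧸ N), Υ f (r, u, v) = α u (f (r⁻¹ * v)))
    (hΓe : Equivariant Γ (etaAction α N H) (greenData α N H).actL)
    (hΥe : Equivariant Υ (gammaAction α N H) (greenData α N H).actK)
    {ι : CrossedProduct (Green.leftAction (betaAction α N μG) (quotSubgroup N H)) μGN ≃⋆ₐ[ℂ]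
      CrossedProduct (etaAction α N H) (μGN.prod μG)}
    (hι : ∀ f : ConvAlg (etaAction α N H) (μGN.prod μG),
      ∃ f₁ : ConvAlg (Green.leftAction (betaAction α N μG) (quotSubgroup N H)) μGN,
        ι (CrossedProduct.of f₁) = CrossedProduct.of f ∧
        ∀ (t : G ⧸ N) (x : (G ⧸ N) ⧸ quotSubgroup N H), ∃ g : ConvAlg (ltAction α N) μG,
          f₁ t x = CrossedProduct.of g ∧ ∀ s r, g s r = f (t, s) (r, quotQuotHomeo N H x))
    {i : CrossedProduct ((betaAction α N μG).restrict (quotSubgroup N H)) μHN ≃⋆ₐ[ℂ]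
      CrossedProduct (gammaAction α N H) (μHN.prod μG)}
    (hi : ∀ f, i (CrossedProduct.of (ConvAlg.curry f)) = CrossedProduct.of f) :
    Nonempty (BimoduleIso
      (Green.bimodule (betaAction α N μG) (quotSubgroup N H) μGN μHN)
      ((greenData α N H).bimodule (μGN.prod μG) (μHN.prod μG))
      (ι.trans (CrossedProduct.mapEquiv Γ hΓe)) (i.trans (CrossedProduct.mapEquiv Υ hΥe))) := by
  -- The inverses of `Γ` and `Υ` are read off at points of `P` with middle coordinate 1; these are
  -- the values that the intertwining lemmas require.
  have hΓs : ∀ (f : (greenData α N H).IndL) (r v : G ⧸ N),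
      Γ.symm f (r, quotProj N H v) = f (r⁻¹, 1, v) := fun f r v => by
    have h := hΓ (Γ.symm f) r⁻¹ 1 v
    rw [Γ.apply_symm_apply, QuotientGroup.mk_one, one_mul, inv_inv] at h
    exact h.symm
  have hΥs : ∀ (f : (greenData α N H).IndK) (r : G ⧸ N),
      Υ.symm f r = f (r⁻¹, 1, 1) := fun f r => by
    have h := hΥ (Υ.symm f) r⁻¹ 1 1
    rw [Υ.apply_symm_apply, α.one_apply, inv_inv, mul_one] at h
    exact h.symm
  choose a haι ha using fun c : ConvAlg (greenData α N H).actL (μGN.prod μG) =>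
    hι (ConvAlg.map Γ.symm c)
  have ha' : ∀ c (t v : G ⧸ N), ∃ g : ConvAlg (ltAction α N) μG,
      a c t (v : (G ⧸ N) ⧸ quotSubgroup N H) = CrossedProduct.of g ∧
        ∀ s (r : G ⧸ N), g s r = c (t, s) (r⁻¹, 1, v) := fun c t v => by
    obtain ⟨g, h1, h2⟩ := ha c t v
    exact ⟨g, h1, fun s r => (h2 s r).trans (hΓs (c (t, s)) r v)⟩
  have hb' : ∀ (c : ConvAlg (greenData α N H).actK (μHN.prod μG)) h,
      ∃ g : ConvAlg (ltAction α N) μG,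
        (ConvAlg.curry (ConvAlg.map Υ.symm c : ConvAlg (gammaAction α N H) (μHN.prod μG)) :
          ConvAlg ((betaAction α N μG).restrict (quotSubgroup N H)) μHN) h =
            CrossedProduct.of g ∧
        ∀ s (r : G ⧸ N), g s r = c (h, s) (r⁻¹, 1, 1) := fun c h =>
    ⟨_, rfl, fun s r => hΥs (c (h, s)) r⟩
  refine nonempty_bimoduleIso_of_dense (Green.isBounded_bimodule (betaAction α N μG) μGN μHN)
    (greenEmb α μG) (exists_innerSeminorm_sub_greenEmb_lt α N H μG μGN μHN) a (fun c => ?_)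
    (fun c => ConvAlg.curry (ConvAlg.map Υ.symm c : ConvAlg (gammaAction α N H) (μHN.prod μG)))
    (fun c => ?_) (fun c z => greenEmb_lact c z _ (ha' c)) (fun z c => greenEmb_ract z c _ (hb' c))
    (fun x y => linner_greenEmb x y _ (ha' _)) (fun x y => rinner_greenEmb x y _ (hb' _))
  · change CrossedProduct.mapEquiv Γ hΓe (ι _) = _
    rw [haι, CrossedProduct.mapEquiv_of]
    congr 1
    ext k : 1
    exact Γ.apply_symm_apply (c k)
  · change CrossedProduct.mapEquiv Υ hΥe (i _) = _
    rw [hi, CrossedProduct.mapEquiv_of]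
    congr 1
    ext l : 1
    exact Υ.apply_symm_apply (c l)

end Setup

end CrossedProd

end

theorem mainTheorem7 {G A : Type*} [Group G] [TopologicalSpace G] [IsTopologicalGroup G]
    [LocallyCompactSpace G] [T2Space G] [NonUnitalCStarAlgebra A]
    (α : CStarAction G A) (N H : Subgroup G) [N.Normal]
    [IsClosed (N : Set G)] [IsClosed (H : Set G)] [Fact (N ≤ H)]
    (μG : HaarMeasure G) (μGN : HaarMeasure (G ⧸ N)) (μHN : HaarMeasure (quotSubgroup N H)) :
    ∃ (Γ : C₀((G ⧸ N) × (G ⧸ H), A) ≃⋆ₐ[ℂ] (greenData α N H).IndL)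
      (Υ : C₀(G ⧸ N, A) ≃⋆ₐ[ℂ] (greenData α N H).IndK)
      (hΓ : Equivariant Γ (etaAction α N H) (greenData α N H).actL)
      (hΥ : Equivariant Υ (gammaAction α N H) (greenData α N H).actK)
      (ι : CrossedProduct (Green.leftAction (betaAction α N μG) (quotSubgroup N H)) μGN ≃⋆ₐ[ℂ]
        CrossedProduct (etaAction α N H) (μGN.prod μG))
      (i : CrossedProduct ((betaAction α N μG).restrict (quotSubgroup N H)) μHN ≃⋆ₐ[ℂ]
        CrossedProduct (gammaAction α N H) (μHN.prod μG)),
      (∀ f (r : G ⧸ N) (u v : G),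
        Γ f (r, u, (v : G ⧸ N)) = f ((u : G ⧸ N) * r⁻¹, (v : G ⧸ H))) ∧
      (∀ f (r : G ⧸ N) (u : G) (v : G ⧸ N), Υ f (r, u, v) = α u (f (r⁻¹ * v))) ∧
      IsCanonicalLeft ι ∧ IsCanonicalRight i ∧
      Nonempty (BimoduleIso
        (Green.bimodule (betaAction α N μG) (quotSubgroup N H) μGN μHN)
        ((greenData α N H).bimodule (μGN.prod μG) (μHN.prod μG))
        (ι.trans (CrossedProduct.mapEquiv Γ hΓ)) (i.trans (CrossedProduct.mapEquiv Υ hΥ))) := by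
  obtain ⟨Γ, hΓ⟩ := exists_indL_equiv α N H
  obtain ⟨Υ, hΥ⟩ := exists_indK_equiv α N H
  obtain ⟨ι, hι⟩ := exists_left_equiv α N H μG μGN
  obtain ⟨i, hi⟩ := exists_right_equiv α N H μG μHN
  refine ⟨Γ, Υ, equivariant_indL α N H hΓ, equivariant_indK α N H hΥ, ι, i,
    fun f r u v => by rw [hΓ, quotProj_mk], hΥ, isCanonicalLeft_of α N H μG μGN hι,
    isCanonicalRight_of α N H μG μHN hi,
    nonempty_bimoduleIso_green hΓ hΥ _ _ hι hi⟩
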